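/- **Setting.** Let $p\ge 2$, $k\ge 0$ be integers, $w_1,\dots,w_k\in\mathbb R$, $n_1,\dots,n_k\in\mathbb Z_{\ge0}$, $n=\sum_i n_i$, $P_k(X)=\prod_{i=1}^k(X-w_i)$. All statements are for both signs $\pm$. Let $\Gamma^\pm$ be a finite union of oriented $C^1$ curves (corners allowed) with straight ends, in directions $\zeta$ with $\mathrm{Re}(\pm\zeta^{p+1})>0$, where the curves of $\Gamma^-$ avoid every $w_i$ with $n_i>0$. With a choice of the square root put $$\Phi^\pm(u)=\sqrt{\tfrac{\pm p}{2\pi}}\int_{\Gamma^\pm}e^{\mp\frac{y^{p+1}}{p+1}\pm uy}\prod_{i=1}^k(y-w_i)^{\pm n_i}\,dy,\qquad \Psi^\pm(x,0;z)=z^{\mp n+\frac{p-1}{2}}\,e^{\mp\frac{p}{p+1}z^{p+1}}\,\Phi^\pm(x+z^p),$$ and suppose that the contours are chosen such that, in some open sector $\mathcal D^\pm$ with vertex $0$ and opening at most $2\pi$ (with a branch of $z^{1/2}$ on it), there is an asymptotic expansion $\Psi^\pm(0,0;z)\sim\varphi^\pm(z):=1+\sum_{j\ge1}a_j^\pm z^{-j}$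 as $z\to\infty$. (Asymptotic expansions are uniform on closed subsectors.) Let $$\mathcal A^\pm=z\pm\frac1{pz^p}\Big(z\frac{d}{dz}\pm n-\frac{p-1}2\Big).$$ **Formal notions.** A point of (the big cell of) Sato's Grassmannian is a subspace of $\mathbb C((z^{-1}))$ spanned by series $z^i+(\text{lower powers})$, $i=0,1,2,\dots$. It is $k$-vector $p$-reduced, via $\mathcal W'$, if $\mathcal W'\subseteq\mathcal W$ has codimension $k$ and $z^p\mathcal W'\subseteq\mathcal W$. Put $D=\partial/\partial x$. A KP solution is given by a wave operator $S=1+\sum_{j\ge1}s_j(x,t)D^{-j}$, $s_j\in\mathbb C[[x,t_1,t_2,\dots]]$, such that $\Psi^+=Se^{xz+\sum t_iz^i}$ and $\Psi^-=(S^{-1})^*e^{-xz-\sum t_iz^i}$ satisfy $\partial\Psi^\pm/\partial t_i=\pm((L^\pm)^i)_+\Psi^\pm$ for all $i\ge1$, where $L^+=SDS^{-1}$, $L^-=(S^{-1})^*(-D)S^*$, $^*$ is the formal adjoint and $(\cdot)_+$, $(\cdot)_-$ are the parts with powers $D^i$, $i\ge0$, resp. $i<0$. It corresponds to the subspaces $\mathrm{span}_{i\ge0}\{D^i\Psi^\pm(x,0;z)|_{x=0}\}$,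 where $\Psi^\pm(x,0;z)$ is the restriction to $t=0$. **Theorem.** 1. On $\mathcal D^\pm$ the functions $\Psi^\pm(0,0;z)$ satisfy the differential equation $$\Big[\big((\mathcal A^\pm)^p-z^p\big)P_k(\mathcal A^\pm)\mp P_k'(\mathcal A^\pm)-\sum_{i=1}^kn_i\prod_{j\ne i}(\mathcal A^\pm-w_j)\Big]f=0 .$$ Their expansions $\varphi^\pm$ are the unique formal solutions of this equation of the form $1+O(1/z)$, i.e. in $1+z^{-1}\mathbb C[[z^{-1}]]$. 2. The subspaces $\mathcal W^\pm=\mathrm{span}_{i\ge0}\{(\mathcal A^\pm)^i\varphi^\pm\}$ are points of the Grassmannian, $\mathcal A^\pm\mathcal W^\pm\subseteq\mathcal W^\pm$, and $\mathcal W^\pm$ is $k$-vector $p$-reduced via $\mathcal W'^\pm=P_k(\mathcal A^\pm)\mathcal W^\pm$. 3. There is a KP solution which corresponds to $\mathcal W^\pm$ and whose wave and adjoint wave functions at $t=0$ are the functions $\Psi^\pm(x,0;z)$ in the following sense: at $t=0$ its formal wave functions are $e^{\pm xz}\big(1+\sum_{j\ge1}v_j^\pm(x)z^{-j}\big)$ with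 polynomials $v^\pm_j$, and for every $x\in\mathbb C$ the function $e^{\mp xz}\Psi^\pm(x,0;z)$ has on $\mathcal D^\pm$ the asymptotic expansion $1+\sum_{j\ge1}v_j^\pm(x)z^{-j}$. 4. For this solution the operators $\mathcal L^\pm=(L^\pm)^p$ at $t=0$ are $$\mathcal L^\pm(x,0)=(\pm D)^p-x-\sum_{i=1}^kn_i\,e^{\pm xw_i}(\pm D)^{-1}e^{\mp xw_i},$$ and $\mathcal L^\pm(x,0)\Psi^\pm(x,0;z)=z^p\Psi^\pm(x,0;z)$, both for the formal wave functions and for the functions $\Psi^\pm(x,0;z)$, $z\in\mathcal D^\pm$; in the latter case $e^{\pm xw_i}(\pm D)^{-1}e^{\mp xw_i}\Psi^\pm$ is, for suitable constants of integration, a function $G_i$ with $\pm D(e^{\mp xw_i}G_i)=e^{\mp xw_i}\Psi^\pm$. 5. There are $q_i^\pm\in\mathbb C[[x,t_1,t_2,\dots]]$, $1\le i\le k$, with $q_i^\pm(x,0)=\mp\sqrt{n_i}\,e^{\pm xw_i}$, such that, for all times, $(\mathcal L^\pm)_-=\sum_{i=1}^kq_i^\pm(\pm D)^{-1}q_i^\mp$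 and $\partial q_i^\pm/\partial t_m=\pm\big((L^{\pm})^m\big)_+q_i^\pm$ for $m\ge1$. -/

import Mathlib

namespace KVec

open Filter Topology Asymptotics

noncomputable section

/-! ### Signs

A sign `σ : ℤˣ` (that is `1` or `-1`) encodes the superscript `±`. -/

/-- The sign `σ` as an element of a ring. -/
abbrev sgn (R : Type*) [Ring R] (σ : ℤˣ) : R := ((σ : ℤ) : R)

/-! ### Polynomials in a (not necessarily linear) operator -/

/-- `Q(A) f = ∑ cᵢ Aⁱ f`. -/
def applyPoly {M : Type*} [AddCommGroup M] [Module ℂ M] (A : M → M) (Q : Polynomial ℂ) (f : M) : M :=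
  Q.sum fun i c => c • A^[i] f

/-- `P_k = ∏ (X - wᵢ)`. -/
def polyP {k : ℕ} (w : Fin k → ℝ) : Polynomial ℂ :=
  ∏ i, (Polynomial.X - Polynomial.C (w i : ℂ))

/-- `∑ᵢ nᵢ ∏_{j ≠ i} (X - wⱼ)`. -/
def polyR {k : ℕ} (w : Fin k → ℝ) (n : Fin k → ℕ) : Polynomial ℂ :=
  ∑ i, Polynomial.C (n i : ℂ) *
    ∏ j ∈ Finset.univ.erase i, (Polynomial.X - Polynomial.C (w j : ℂ))

/-- `[(A^p - Z) P_k(A) - σ P_k'(A) - ∑ nᵢ ∏_{j ≠ i} (A - wⱼ)] f`, where `Z` is multiplication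
by `z ^ p`; used for functions of `z` as well as for formal Laurent series in `z⁻¹`. -/
def odeOp {M : Type*} [AddCommGroup M] [Module ℂ M] {k : ℕ} (p : ℕ) (w : Fin k → ℝ)
    (n : Fin k → ℕ) (σ : ℤˣ) (A Z : M → M) (f : M) : M :=
  A^[p] (applyPoly A (polyP w) f) - Z (applyPoly A (polyP w) f)
    - sgn ℂ σ • applyPoly A (polyP w).derivative f - applyPoly A (polyR w n) f

/-! ### Contours, integrals, sectors -/

/-- An infinite oriented curve, of class `C¹` in a parametrization (which may stop at corners, so
that e.g. broken lines are included), with two straight ends in directions `ζ` in which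
`exp (-σ y^(p+1) / (p+1))` decays, that is `Re (σ ζ^(p+1)) > 0`. -/
def IsDecayCurve (p : ℕ) (σ : ℤˣ) (γ : ℝ → ℂ) : Prop :=
  ContDiff ℝ 1 γ ∧
  (∃ b ζ : ℂ, 0 < (sgn ℂ σ * ζ ^ (p + 1)).re ∧ ∀ᶠ s : ℝ in atTop, γ s = b + s * ζ) ∧
  (∃ b ζ : ℂ, 0 < (sgn ℂ σ * ζ ^ (p + 1)).re ∧ ∀ᶠ s : ℝ in atBot, γ s = b - s * ζ)

/-- A contour is a finite union (with multiplicities) of oriented curves. It is admissible if its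
curves are decay curves which, in the case of the sign `-`, avoid the poles of the integrand. -/
def IsAdmissible {k : ℕ} (p : ℕ) (w : Fin k → ℝ) (n : Fin k → ℕ) (σ : ℤˣ)
    (Γ : List (ℝ → ℂ)) : Prop :=
  ∀ γ ∈ Γ, IsDecayCurve p σ γ ∧ (σ = -1 → ∀ i, n i ≠ 0 → ∀ s, γ s ≠ (w i : ℂ))

/-- `∫_Γ f(y) dy`. -/
def contourIntegral (Γ : List (ℝ → ℂ)) (f : ℂ → ℂ) : ℂ :=
  (Γ.map fun γ => ∫ s : ℝ, f (γ s) * deriv γ s).sum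

/-- `Φ^σ(u) = c ∫_Γ exp (-σ y^(p+1)/(p+1) + σ u y) ∏ (y - wᵢ)^(σ nᵢ) dy`; here `c` stands for a
square root of `σ p / (2 π)`. -/
def PhiFun {k : ℕ} (p : ℕ) (w : Fin k → ℝ) (n : Fin k → ℕ) (σ : ℤˣ)
    (Γ : List (ℝ → ℂ)) (c : ℂ) (u : ℂ) : ℂ :=
  c * contourIntegral Γ fun y =>
    Complex.exp (-sgn ℂ σ * y ^ (p + 1) / ((p : ℂ) + 1) + sgn ℂ σ * u * y) *
      ∏ i, (y - (w i : ℂ)) ^ ((σ : ℤ) * (n i : ℤ))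

/-- The open sector with vertex at the origin, bisecting ray of argument `θ` and half-opening
`δ` (for `0 < δ ≤ π`). -/
def sector (θ δ : ℝ) : Set ℂ :=
  {z | z ≠ 0 ∧ |(z * Complex.exp (-(θ * Complex.I))).arg| < δ}

/-- The branch of `√z` on `sector θ δ`, `δ ≤ π`, whose argument is `θ / 2` on the bisecting ray;
`θ` and `θ + 2 π` give the same sector and the two branches. -/
def sqrtBranch (θ : ℝ) (z : ℂ) : ℂ :=
  Complex.exp (θ / 2 * Complex.I) * (z * Complex.exp (-(θ * Complex.I))) ^ (1 / 2 : ℂ)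

/-- `Ψ^σ(x,0;z) = z^(-σ n + (p-1)/2) exp (-σ p/(p+1) z^(p+1)) Φ^σ(x + z^p)`, `n = ∑ nᵢ`. -/
def PsiFun {k : ℕ} (p : ℕ) (w : Fin k → ℝ) (n : Fin k → ℕ) (σ : ℤˣ)
    (Γ : List (ℝ → ℂ)) (c : ℂ) (θ : ℝ) (x z : ℂ) : ℂ :=
  z ^ (-(σ : ℤ) * ((∑ i, n i : ℕ) : ℤ)) * sqrtBranch θ z ^ ((p : ℤ) - 1) *
    Complex.exp (-sgn ℂ σ * ((p : ℂ) / ((p : ℂ) + 1)) * z ^ (p + 1)) *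
    PhiFun p w n σ Γ c (x + z ^ p)

/-- `f(z) ~ ∑ a_j z^(-j)` as `z → ∞` in the open sector: uniformly on closed subsectors. -/
def HasAsympExpansion (θ δ : ℝ) (f : ℂ → ℂ) (a : ℕ → ℂ) : Prop :=
  ∀ δ', 0 < δ' → δ' < δ → ∀ N : ℕ,
    (fun z => f z - ∑ j ∈ Finset.range N, a j * (z⁻¹) ^ j)
      =O[Bornology.cobounded ℂ ⊓ 𝓟 (sector θ δ')] fun z => (z⁻¹) ^ N

/-- `A^σ = z + σ/(p z^p) (z d/dz + σ n - (p-1)/2)` acting on functions of `z`. -/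
def funA (p N : ℕ) (σ : ℤˣ) (f : ℂ → ℂ) : ℂ → ℂ := fun z =>
  z * f z + sgn ℂ σ / ((p : ℂ) * z ^ p) *
    (z * deriv f z + (sgn ℂ σ * (N : ℂ) - ((p : ℂ) - 1) / 2) * f z)

/-! ### Formal Laurent series in `z⁻¹` -/

/-- Multiplication of the `e`-th coefficient by `c e`, for all `e`. -/
def coeffwise {R : Type*} [CommRing R] (c : ℤ → R) (f : LaurentSeries R) : LaurentSeries R where
  coeff := fun e => c e * f.coeff e
  isPWO_support' := f.isPWO_support.mono fun e he => by
    simp only [Function.mem_support, ne_eq, HahnSeries.mem_support] at he ⊢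
    exact fun h => he (by rw [h, mul_zero])

/-- Formal Laurent series over `ℂ` in the variable `z⁻¹`: the coefficient of index `e` is the one of
`z ^ (-e)`. -/
def FLS : Type := LaurentSeries ℂ

/-- A Laurent series in `z⁻¹`, as an element of `FLS`. -/
def FLS.of (f : LaurentSeries ℂ) : FLS := f

/-- The coefficient of `z ^ (-e)`. -/
def FLS.coeff (f : FLS) (e : ℤ) : ℂ := HahnSeries.coeff (id f : LaurentSeries ℂ) e

instance : CommRing FLS := inferInstanceAs (CommRing (HahnSeries ℤ ℂ))

instance : Algebra ℂ FLS :=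
  RingHom.toAlgebra (R := ℂ) (S := FLS) (HahnSeries.C : ℂ →+* HahnSeries ℤ ℂ)

theorem FLS.ext {f g : FLS} (h : ∀ e, f.coeff e = g.coeff e) : f = g :=
  HahnSeries.ext (Γ := ℤ) (R := ℂ) (funext h)

@[simp]
theorem FLS.coeff_add (f g : FLS) (e : ℤ) : (f + g).coeff e = f.coeff e + g.coeff e := rfl

@[simp]
theorem FLS.coeff_smul (c : ℂ) (f : FLS) (e : ℤ) : (c • f).coeff e = c * f.coeff e :=
  congrArg (fun h : HahnSeries ℤ ℂ => h.coeff e)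
    (HahnSeries.C_mul_eq_smul (Γ := ℤ) (R := ℂ) (r := c) (x := f))

/-- The monomial `c z ^ m`. -/
def monoF (m : ℤ) (c : ℂ) : FLS := FLS.of (HahnSeries.single (-m) c)

/-- The formal series `∑_{j ≥ 0} a_j z ^ (-j)`. -/
def seriesF (a : ℕ → ℂ) : FLS := FLS.of (HahnSeries.ofPowerSeries ℤ ℂ (PowerSeries.mk a))

/-- `z d/dz`. -/
def eulerF : Module.End ℂ FLS where
  toFun f := FLS.of (coeffwise (fun e => -(e : ℂ)) (id f : LaurentSeries ℂ))
  map_add' f g := FLS.ext fun e => mul_add (-(e : ℂ)) (f.coeff e) (g.coeff e)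
  map_smul' r f := FLS.ext fun e => by
    refine Eq.trans ?_ (FLS.coeff_smul r _ e).symm
    change -(e : ℂ) * (r • f).coeff e = r * (-(e : ℂ) * f.coeff e)
    rw [FLS.coeff_smul, mul_left_comm]

/-- `A^σ = z + σ/(p z^p) (z d/dz + σ n - (p-1)/2)` acting on formal Laurent series. -/
def formalA (p N : ℕ) (σ : ℤˣ) : Module.End ℂ FLS :=
  LinearMap.mulLeft ℂ (monoF 1 1) +
    LinearMap.mulLeft ℂ (monoF (-(p : ℤ)) (sgn ℂ σ / (p : ℂ))) ∘ₗ
      (eulerF + (sgn ℂ σ * (N : ℂ) - ((p : ℂ) - 1) / 2) • LinearMap.id)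

/-- `f = z ^ m + (lower powers of z)`. -/
def IsMonicOfDegree (m : ℤ) (f : FLS) : Prop :=
  f.coeff (-m) = 1 ∧ ∀ e < -m, f.coeff e = 0

/-- Points of (the big cell of) Sato's Grassmannian: subspaces spanned by series
`z ^ i + (lower powers of z)`, `i = 0, 1, 2, …`. -/
def IsGrPoint (W : Submodule ℂ FLS) : Prop :=
  ∃ φ : ℕ → FLS, (∀ i : ℕ, IsMonicOfDegree (i : ℤ) (φ i)) ∧
    W = Submodule.span ℂ (Set.range φ)

/-- `W' ⊆ W` has codimension `k` in `W`, and `z ^ p W' ⊆ W`: the subspace `W'` exhibits `W` as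
satisfying the `k`-vector `p`-reduced condition. -/
def IsVectorReducedVia (k p : ℕ) (W W' : Submodule ℂ FLS) : Prop :=
  W' ≤ W ∧ Module.rank ℂ (W ⧸ W'.submoduleOf W) = k ∧ ∀ f ∈ W', monoF (p : ℤ) 1 * f ∈ W

/-- `span {A^i φ : i ≥ 0}`. -/
def cyclicSpan (A : Module.End ℂ FLS) (φ : FLS) : Submodule ℂ FLS :=
  Submodule.span ℂ (Set.range fun i : ℕ => (A ^ i) φ)

/-! ### Formal pseudo-differential operators

A pseudo-differential operator `∑_{i ≤ N} hᵢ D^i` with coefficients in a commutative ring `R` with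
derivation `d` is represented by its symbol, the Laurent series in the variable `D⁻¹`: the
coefficient of index `e` is the one of `D ^ (-e)`. The (commutative) product of `LaurentSeries R`
is the product of symbols; the product of operators is `comp` below. -/

/-- Pseudo-differential operators over `R`. -/
abbrev PDO (R : Type*) [CommRing R] := LaurentSeries R

section PDO

variable {R : Type*} [CommRing R]

/-- `(1 / k!) (∂/∂ξ)^k` of a symbol: `h ξ^i ↦ (i choose k) h ξ^(i - k)`. -/
def hasse (k : ℕ) (P : PDO R) : PDO R :=
  coeffwise (fun e => ((Ring.choose ((k : ℤ) - e) k : ℤ) : R)) (HahnSeries.single (k : ℤ) 1 * P)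

theorem exists_bound (P : PDO R) : ∃ N : ℤ, ∀ e < N, P.coeff e = 0 := by
  by_cases h : P = 0
  · exact ⟨0, fun e _ => by simp [h]⟩
  · exact ⟨P.order, fun e he => HahnSeries.coeff_eq_zero_of_lt_order he⟩

theorem coeff_mul_zero {P Q : PDO R} {N M : ℤ} (hP : ∀ e < N, P.coeff e = 0)
    (hQ : ∀ e < M, Q.coeff e = 0) {e : ℤ} (he : e < N + M) : (P * Q).coeff e = 0 := by
  rw [HahnSeries.coeff_mul]
  refine Finset.sum_eq_zero fun ij hij => ?_
  have h := (Finset.mem_antidiagonal.1 hij).2.2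
  rcases lt_or_ge ij.1 N with h1 | h1
  · rw [hP _ h1, zero_mul]
  · rw [hQ _ (by omega), mul_zero]

theorem coeff_hasse_zero {P : PDO R} {N : ℤ} (hP : ∀ e < N, P.coeff e = 0) (k : ℕ) :
    ∀ e < N, (hasse k P).coeff e = 0 := by
  intro e he
  have h1 : ∀ i < (0 : ℤ), (HahnSeries.single (k : ℤ) (1 : R)).coeff i = 0 := fun i hi =>
    HahnSeries.coeff_single_of_ne (by omega)
  have h2 := coeff_mul_zero h1 hP (e := e) (by omega)
  change _ * (HahnSeries.single (k : ℤ) (1 : R) * P).coeff e = 0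
  rw [h2, mul_zero]

variable [Algebra ℂ R]

/-- `d ^ k` applied to all coefficients. -/
def mapD (d : Derivation ℂ R R) (k : ℕ) (P : PDO R) : PDO R :=
  P.map ((d : R →ₗ[ℂ] R) ^ k)

theorem coeff_mapD_zero (d : Derivation ℂ R R) {P : PDO R} {N : ℤ}
    (hP : ∀ e < N, P.coeff e = 0) (k : ℕ) : ∀ e < N, (mapD d k P).coeff e = 0 := by
  intro e he
  rw [mapD, HahnSeries.map_coeff, hP e he, map_zero]

/-- The product `P Q` of pseudo-differential operators:
`∑_k (1/k!) (∂_ξ^k P) (d^k Q)` on the level of symbols, that is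
`h D^i ∘ g D^j = ∑_k (i choose k) h (d^k g) D^(i+j-k)`. In every degree the sum is finite. -/
def comp (d : Derivation ℂ R R) (P Q : PDO R) : PDO R :=
  HahnSeries.ofSuppBddBelow (fun e => ∑ᶠ k : ℕ, (hasse k P * mapD d k Q).coeff e) (by
    obtain ⟨N, hN⟩ := exists_bound P
    obtain ⟨M, hM⟩ := exists_bound Q
    refine ⟨N + M, fun e hne => not_lt.1 fun he => hne ?_⟩
    have h : ∀ k : ℕ, (hasse k P * mapD d k Q).coeff e = 0 := fun k =>
      coeff_mul_zero (coeff_hasse_zero hN k) (coeff_mapD_zero d hM k) he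
    simp [h])

/-- The formal adjoint, `(h D^j)^* = (-D)^j h = ∑_k (-1)^j (j choose k) (d^k h) D^(j-k)`. -/
def adj (d : Derivation ℂ R R) (P : PDO R) : PDO R :=
  HahnSeries.ofSuppBddBelow (fun e => ∑ᶠ k : ℕ,
      (hasse k (mapD d k (coeffwise (fun e => (((-1 : ℤˣ) ^ e : ℤˣ) : R)) P))).coeff e) (by
    obtain ⟨N, hN⟩ := exists_bound P
    refine ⟨N, fun e hne => not_lt.1 fun he => hne ?_⟩
    have h : ∀ k : ℕ, (hasse k (mapD d k
        (coeffwise (fun e => (((-1 : ℤˣ) ^ e : ℤˣ) : R)) P))).coeff e = 0 := fun k =>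
      coeff_hasse_zero (coeff_mapD_zero d (fun i hi => by
        change _ * P.coeff i = 0
        rw [hN i hi, mul_zero]) k) k e he
    simp [h])

/-- `P^i` with respect to `comp`. -/
def compPow (d : Derivation ℂ R R) (P : PDO R) : ℕ → PDO R
  | 0 => 1
  | i + 1 => comp d P (compPow d P i)

/-- `(σ D)^m`, for any integer `m`. -/
def signedD (R : Type*) [CommRing R] (σ : ℤˣ) (m : ℤ) : PDO R :=
  HahnSeries.single (-m) (sgn R (σ ^ m))

/-- Multiplication by the function `h`, as an operator. -/
def multOp (h : R) : PDO R := HahnSeries.single 0 h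

/-- The differential part `P_+ = ∑_{i ≥ 0} hᵢ D^i`. -/
def posPart (P : PDO R) : PDO R := coeffwise (fun e => if e ≤ 0 then 1 else 0) P

/-- `P_- = ∑_{i < 0} hᵢ D^i`. -/
def negPart (P : PDO R) : PDO R := coeffwise (fun e => if e ≤ 0 then 0 else 1) P

/-- The function `P_+ q = ∑_{i ≥ 0} hᵢ d^i q` (a finite sum). -/
def applyPos (d : Derivation ℂ R R) (P : PDO R) (q : R) : R :=
  ∑ᶠ i : ℕ, P.coeff (-(i : ℤ)) * (d : R → R)^[i] q

/-! ### The KP hierarchy -/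

/-- The operator `K^σ` with `Ψ^σ = K^σ e^(σ x z + …)`: `S` for `σ = 1`, and `(S⁻¹)^*` for
`σ = -1`; here `T = S⁻¹`. -/
def dressing (d : Derivation ℂ R R) (σ : ℤˣ) (S T : PDO R) : PDO R :=
  if σ = 1 then S else adj d T

/-- The Lax operators `L^+ = S D S⁻¹` and `L^- = (S⁻¹)^* (-D) S^*`; here `T = S⁻¹`. -/
def lax (d : Derivation ℂ R R) (σ : ℤˣ) (S T : PDO R) : PDO R :=
  if σ = 1 then comp d (comp d S (signedD R σ 1)) T
  else comp d (comp d (adj d T) (signedD R σ 1)) (adj d S)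

end PDO

/-- Formal power series in `x` (the variable of index `0`) and the times `t_1, t_2, …` (the
variables of index `1, 2, …`). -/
abbrev XT : Type := MvPowerSeries ℕ ℂ

/-- `D = ∂/∂x`. -/
def dX : Derivation ℂ XT XT := MvPowerSeries.pderiv ℂ 0

/-- `d/dx` on formal power series in `x`. -/
def dX₀ : Derivation ℂ (PowerSeries ℂ) (PowerSeries ℂ) := PowerSeries.derivative ℂ

/-- `∂/∂t_i` (for `i ≥ 1`), applied to the coefficients of an operator. -/
def dT (i : ℕ) (P : PDO XT) : PDO XT := mapD (MvPowerSeries.pderiv ℂ i) 1 P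

/-- Restriction to `t = 0`. -/
def atZero : XT →ₗ[ℂ] PowerSeries ℂ where
  toFun f := PowerSeries.mk fun a => MvPowerSeries.coeff (Finsupp.single 0 a) f
  map_add' f g := by ext; simp
  map_smul' c f := by ext; simp

/-- Restriction of an operator to `t = 0`. -/
def opAtZero (P : PDO XT) : PDO (PowerSeries ℂ) := P.map atZero

/-- `S = 1 + ∑_{j ≥ 1} w_j(x,t) D^(-j)`, with inverse `T`, is the wave operator of a solution of the
KP hierarchy: the wave function `Ψ^+ = S e^(xz + ∑ t_i z^i)` and the adjoint wave function
`Ψ^- = (S⁻¹)^* e^(-xz - ∑ t_i z^i)` satisfy `∂Ψ^σ/∂t_i = σ ((L^σ)^i)_+ Ψ^σ` for all `i ≥ 1`. (For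
`Ψ^σ = K e^(σ x z + σ ∑ t_i z^i)` one has
`∂Ψ^σ/∂t_i = (∂K/∂t_i + σ K (σ D)^i) e^(σ x z + σ ∑ t_i z^i)`.) -/
def IsKPWaveOperator (S T : PDO XT) : Prop :=
  (S.coeff 0 = 1 ∧ ∀ e < 0, S.coeff e = 0) ∧ comp dX S T = 1 ∧ comp dX T S = 1 ∧
  ∀ σ : ℤˣ, ∀ i : ℕ, 1 ≤ i →
    dT i (dressing dX σ S T) +
        sgn (PDO XT) σ * comp dX (dressing dX σ S T) (signedD XT σ i) =
      sgn (PDO XT) σ *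
        comp dX (posPart (compPow dX (lax dX σ S T) i)) (dressing dX σ S T)

/-- The coefficient of `z^(-j)` in `e^(-σ x z) K e^(σ x z)`, where `D^(-j) e^(σ x z)` is
`(σ z)^(-j) e^(σ x z)`. -/
def waveCoeff (σ : ℤˣ) (K : PDO (PowerSeries ℂ)) (j : ℤ) : PowerSeries ℂ :=
  sgn (PowerSeries ℂ) (σ ^ j) * K.coeff j

/-- The formal function `K e^(σ x z)`, as a formal power series in `x` whose coefficients are
formal Laurent series in `z⁻¹`. -/
def formalWave (σ : ℤˣ) (K : PDO (PowerSeries ℂ)) : PowerSeries FLS :=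
  PowerSeries.mk (fun a => monoF a (sgn ℂ σ ^ a / (a.factorial : ℂ))) *
    PowerSeries.mk (fun a => FLS.of
      (coeffwise (fun e => sgn ℂ (σ ^ e)) (K.map (PowerSeries.coeff (R := ℂ) a))))

/-- The subspace `span {D^i Ψ(x;z)|_{x = 0} : i ≥ 0}`. -/
def waveSpace (Ψ : PowerSeries FLS) : Submodule ℂ FLS :=
  Submodule.span ℂ (Set.range fun i : ℕ =>
    PowerSeries.constantCoeff ((PowerSeries.derivative FLS)^[i] Ψ))

/-- `e^(a x)` as a formal power series. -/
def expX (a : ℂ) : PowerSeries ℂ := PowerSeries.rescale a (PowerSeries.exp ℂ)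

/-- `(σ D)^p - x - ∑ nᵢ e^(σ x wᵢ) (σ D)⁻¹ e^(-σ x wᵢ)`. -/
def laxPower {k : ℕ} (p : ℕ) (w : Fin k → ℝ) (n : Fin k → ℕ) (σ : ℤˣ) : PDO (PowerSeries ℂ) :=
  signedD (PowerSeries ℂ) σ p - multOp PowerSeries.X
    - ∑ i, multOp (PowerSeries.C (n i : ℂ)) *
        comp dX₀ (comp dX₀ (multOp (expX (sgn ℂ σ * (w i : ℂ)))) (signedD (PowerSeries ℂ) σ (-1)))
          (multOp (expX (-sgn ℂ σ * (w i : ℂ))))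

end

end KVec

open KVec

/-! Write σ for the sign, μ for the constant σn - (p-1)/2 and A for 𝒜^σ, so that A = z + σ/(p z^p)
(z d/dz + μ). Everything rests on the commutator [A, z^p] = σ and on one computation: on the
integrals, A inserts a factor y into the integrand (`funA_psiAmp`), just as σ ∂/∂x does.

The differential equation. Polynomials in A insert polynomials in y, so the equation says that the
integral of a total derivative vanishes, namely that of the phase times P_k(y) ∏ (y - wᵢ)^(σ nᵢ)
(`phaseIntegral_ode`). Expansions of holomorphic functions on sectors may be differentiated, by
Cauchy's estimate (`AsympF.euler`), and the zero function has the zero expansion; hence the formal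
series satisfies the same equation (`odeOp_seriesF`). On c z^m + … the operator of the equation has
the leading term σ m c z^(m+k-1) (`Lead.odeEnd`), which forces uniqueness of the normalised solution
φ (`formal_solution_unique`).

The Grassmannian. Q ↦ Q(A)φ identifies ℂ[X] with 𝒲 and the ideal of P_k with P_k(A)𝒲, which gives
the codimension; the commutator and the equation give z^p P_k(A)𝒲 ⊆ 𝒲
(`isVectorReducedVia_cyclicSpan`).

The KP solution. In the big cell, an element of 𝒲 without nonnegative powers of z is zero. So there
is one operator S = 1 + … with a 𝒲-valued wave function, and the defect of each KP equation, being
𝒲-valued and of negative order, vanishes (`exists_waveOperator`). By the same principle the wave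
function at t = 0 is e^(xA)φ. Conjugation by e^(σxA) turns A into σ d/dx and z^p into x + z^p, hence
the equation in z into one in x; the latter is P_k(σD) times the spectral equation of the nonlocal
Lax operator (`lax_mul_eq_iff`). The operator M that represents A on the x-side and the Lax operator
both go over into those of the opposite sign under the adjoint. Therefore the adjoint wave function
at t = 0 comes from a normalised solution of the equation for the opposite sign, and by uniqueness
from φ^- (`wave₀_adj_inverse`).

Eigenfunctions. A linear form on Laurent series, applied to the coefficients of the wave function,
gives a solution of the linear evolution equations. The A^j φ are linearly independent, so the
values ∓√nᵢ wᵢ^j may be prescribed, and the solution is then ∓√nᵢ e^(±x wᵢ) at t = 0. The negative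
part of ℒ and the bilinear sum in these functions solve the same linear equation ∂Y/∂t_m = [B_m,
Y]_- and agree at t = 0 (`negPart_lax_pow_one`).

All x. Along a path with x s + Z^p constant the contour integral does not change, so e^(-σxsZ) Ψ(xs;
Z) is an elementary function that solves a linear equation with bounded coefficient. The truncated
formal series solves it up to O(Z^(-K)), and Gronwall's inequality carries the expansion from x = 0
to x (`HasAsympExpansion.psiAmp`). -/

namespace KVec

set_option linter.unusedSimpArgs false
set_option linter.unusedSectionVars false

noncomputable section

/-! ### Symbols, filtration and composition of pseudo-differential operators -/

section PDORing

variable {R : Type*} [CommRing R]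

/-- All coefficients of index `< N` vanish. -/
def Vanish (N : ℤ) (P : PDO R) : Prop := ∀ e < N, P.coeff e = 0

theorem Vanish.mono {N M : ℤ} {P : PDO R} (h : Vanish N P) (hM : M ≤ N) : Vanish M P :=
  fun e he => h e (by omega)

theorem Vanish.add {N : ℤ} {P Q : PDO R} (hP : Vanish N P) (hQ : Vanish N Q) :
    Vanish N (P + Q) := fun e he => by simp [hP e he, hQ e he]

theorem Vanish.sub {N : ℤ} {P Q : PDO R} (hP : Vanish N P) (hQ : Vanish N Q) :
    Vanish N (P - Q) := fun e he => by simp [hP e he, hQ e he]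

theorem vanish_single {N e : ℤ} (h : R) (he : N ≤ e) : Vanish N (HahnSeries.single e h : PDO R) :=
  fun i hi => HahnSeries.coeff_single_of_ne (by omega)

theorem Vanish.mul {N M : ℤ} {P Q : PDO R} (hP : Vanish N P) (hQ : Vanish M Q) :
    Vanish (N + M) (P * Q) := fun _ he => coeff_mul_zero hP hQ he

theorem exists_vanish (P : PDO R) : ∃ N, Vanish N P := exists_bound P

theorem exists_vanish₂ (P Q : PDO R) : ∃ N, Vanish N P ∧ Vanish N Q := by
  obtain ⟨N, hN⟩ := exists_vanish P
  obtain ⟨M, hM⟩ := exists_vanish Q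
  exact ⟨min N M, hN.mono (min_le_left _ _), hM.mono (min_le_right _ _)⟩

theorem eq_zero_of_vanish {P : PDO R} (h : ∀ N, Vanish N P) : P = 0 := by
  ext e
  exact h (e + 1) e (by omega)

/-- The finite part of `P` of indices in `[N, K)`. -/
theorem exists_sum_single {N : ℤ} {P : PDO R} (h : Vanish N P) (K : ℤ) :
    Vanish K (P - ∑ e ∈ Finset.Ico N K, HahnSeries.single e (P.coeff e)) := by
  intro e he
  rw [HahnSeries.coeff_sub, HahnSeries.coeff_sum]
  by_cases hN : e < N
  · rw [h e hN, Finset.sum_eq_zero, sub_zero]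
    intro i hi
    rw [Finset.mem_Ico] at hi
    exact HahnSeries.coeff_single_of_ne (by omega)
  · rw [Finset.sum_eq_single e]
    · simp
    · intro i _ hi
      exact HahnSeries.coeff_single_of_ne (Ne.symm hi)
    · intro hi
      exact absurd (Finset.mem_Ico.2 ⟨by omega, he⟩) hi

/-- Additive maps of Laurent series which respect the filtrations agree if they agree on monomials. -/
theorem eq_of_eq_single {R' : Type*} [CommRing R'] (F G : PDO R → PDO R')
    (hF : ∀ P Q, F (P + Q) = F P + F Q) (hG : ∀ P Q, G (P + Q) = G P + G Q)
    (cF : ∃ c, ∀ N P, Vanish N P → Vanish (N + c) (F P))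
    (cG : ∃ c, ∀ N P, Vanish N P → Vanish (N + c) (G P))
    (h : ∀ e r, F (HahnSeries.single e r) = G (HahnSeries.single e r)) (P : PDO R) :
    F P = G P := by
  obtain ⟨c, hc⟩ := cF
  obtain ⟨c', hc'⟩ := cG
  let F' : PDO R →+ PDO R' := AddMonoidHom.mk' F hF
  let G' : PDO R →+ PDO R' := AddMonoidHom.mk' G hG
  rw [← sub_eq_zero]
  refine eq_zero_of_vanish fun K => ?_
  obtain ⟨N, hN⟩ := exists_vanish P
  -- The cut-off lies |c| + |c'| beyond `K`, so that the remainder still vanishes below `K` after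
  -- `F` and `G` have shifted the filtration.
  have hs := exists_sum_single hN (K + |c| + |c'|)
  set S := ∑ e ∈ Finset.Ico N (K + |c| + |c'|), HahnSeries.single e (P.coeff e) with hS
  have h1 : F' S = G' S := by
    rw [hS, map_sum, map_sum]
    exact Finset.sum_congr rfl fun e _ => h e _
  have h2 : F P - G P = F (P - S) - G (P - S) := by
    change F' P - G' P = F' (P - S) - G' (P - S)
    rw [map_sub, map_sub, h1]
    abel
  rw [h2]
  have e1 := neg_abs_le c
  have e2 := neg_abs_le c'
  have e3 := abs_nonneg c
  have e4 := abs_nonneg c'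
  exact ((hc _ _ hs).mono (by omega)).sub ((hc' _ _ hs).mono (by omega))

theorem hasse_coeff (k : ℕ) (P : PDO R) (e : ℤ) :
    (hasse k P).coeff e = ((Ring.choose ((k : ℤ) - e) k : ℤ) : R) * P.coeff (e - k) := by
  change _ * (HahnSeries.single (k : ℤ) (1 : R) * P).coeff e = _
  rw [HahnSeries.coeff_single_mul, one_mul]

theorem Vanish.hasse {N : ℤ} {P : PDO R} (h : Vanish N P) (k : ℕ) : Vanish (N + k) (hasse k P) :=
  fun e he => by rw [hasse_coeff, h _ (by omega), mul_zero]

theorem hasse_add (k : ℕ) (P Q : PDO R) : hasse k (P + Q) = hasse k P + hasse k Q := by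
  ext e
  simp [hasse_coeff, mul_add]

theorem hasse_zero (P : PDO R) : hasse 0 P = P := by
  ext e
  simp [hasse_coeff]

theorem hasse_single (k : ℕ) (e : ℤ) (h : R) :
    hasse k (HahnSeries.single e h) =
      HahnSeries.single (e + k) (((Ring.choose (-e) k : ℤ) : R) * h) := by
  ext l
  rw [hasse_coeff]
  by_cases hl : l = e + k
  · subst hl
    rw [HahnSeries.coeff_single_same, show e + k - k = e by ring, HahnSeries.coeff_single_same]
    congr 3
    ring
  · rw [HahnSeries.coeff_single_of_ne hl, HahnSeries.coeff_single_of_ne (by omega), mul_zero]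

theorem hasse_smul_mul (k : ℕ) (h : R) (P : PDO R) :
    hasse k (HahnSeries.single 0 h * P) = HahnSeries.single 0 h * hasse k P := by
  ext e
  rw [hasse_coeff, HahnSeries.coeff_single_zero_mul, HahnSeries.coeff_single_zero_mul, hasse_coeff]
  ring

variable [Algebra ℂ R] (d : Derivation ℂ R R)

theorem mapD_coeff (k : ℕ) (P : PDO R) (e : ℤ) :
    (mapD d k P).coeff e = ((d : R →ₗ[ℂ] R) ^ k) (P.coeff e) := by
  rw [mapD, HahnSeries.map_coeff]

theorem Vanish.mapD {N : ℤ} {P : PDO R} (h : Vanish N P) (k : ℕ) : Vanish N (mapD d k P) :=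
  coeff_mapD_zero d h k

theorem mapD_add (k : ℕ) (P Q : PDO R) : mapD d k (P + Q) = mapD d k P + mapD d k Q := by
  ext e
  simp [mapD_coeff]

theorem mapD_zero (P : PDO R) : mapD d 0 P = P := by
  ext e
  simp [mapD_coeff]

theorem mapD_single (k : ℕ) (e : ℤ) (h : R) :
    mapD d k (HahnSeries.single e h) = HahnSeries.single e (((d : R →ₗ[ℂ] R) ^ k) h) := by
  ext l
  rw [mapD_coeff]
  by_cases hl : l = e
  · subst hl
    simp
  · rw [HahnSeries.coeff_single_of_ne hl, HahnSeries.coeff_single_of_ne hl, map_zero]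

theorem comp_coeff (P Q : PDO R) (e : ℤ) :
    (comp d P Q).coeff e = ∑ᶠ k : ℕ, (hasse k P * mapD d k Q).coeff e := rfl

/-- The k-th term of the product has its order lowered by k, so in a fixed degree only finitely many
terms survive. The length `K` is left free so that one range can serve several products at once. -/
theorem comp_coeff_sum {P Q : PDO R} {N M : ℤ} (hP : Vanish N P) (hQ : Vanish M Q) {e : ℤ} {K : ℕ}
    (hK : e < N + M + K) :
    (comp d P Q).coeff e = ∑ k ∈ Finset.range K, (hasse k P * mapD d k Q).coeff e := by
  rw [comp_coeff]
  refine finsum_eq_sum_of_support_subset _ fun k hk => ?_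
  by_contra h
  refine hk ?_
  have h' : K ≤ k := by simpa using h
  exact (hP.hasse k).mul (hQ.mapD d k) e (by omega)

theorem Vanish.comp {P Q : PDO R} {N M : ℤ} (hP : Vanish N P) (hQ : Vanish M Q) :
    Vanish (N + M) (comp d P Q) := fun e he => by
  rw [comp_coeff_sum d hP hQ (K := 0) (by simpa using he), Finset.sum_range_zero]

theorem comp_add_left (P P' Q : PDO R) : comp d (P + P') Q = comp d P Q + comp d P' Q := by
  obtain ⟨N, hP, hP'⟩ := exists_vanish₂ P P'
  obtain ⟨M, hQ⟩ := exists_vanish Q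
  ext e
  have hK : e < N + M + (e - N - M + 1).toNat := by omega
  rw [HahnSeries.coeff_add, comp_coeff_sum d (hP.add hP') hQ hK, comp_coeff_sum d hP hQ hK,
    comp_coeff_sum d hP' hQ hK, ← Finset.sum_add_distrib]
  simp [hasse_add, add_mul]

theorem comp_add_right (P Q Q' : PDO R) : comp d P (Q + Q') = comp d P Q + comp d P Q' := by
  obtain ⟨N, hP, hP'⟩ := exists_vanish₂ Q Q'
  obtain ⟨M, hQ⟩ := exists_vanish P
  ext e
  have hK : e < M + N + (e - N - M + 1).toNat := by omega
  rw [HahnSeries.coeff_add, comp_coeff_sum d hQ (hP.add hP') hK, comp_coeff_sum d hQ hP hK,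
    comp_coeff_sum d hQ hP' hK, ← Finset.sum_add_distrib]
  simp [mapD_add, mul_add]

theorem comp_zero_left (Q : PDO R) : comp d 0 Q = 0 := by
  simpa using comp_add_left d 0 0 Q

theorem comp_zero_right (P : PDO R) : comp d P 0 = 0 := by
  simpa using comp_add_right d P 0 0

theorem comp_mult_mul (h : R) (P Q : PDO R) :
    comp d (HahnSeries.single 0 h * P) Q = HahnSeries.single 0 h * comp d P Q := by
  obtain ⟨N, hP⟩ := exists_vanish P
  obtain ⟨M, hQ⟩ := exists_vanish Q
  have hP' : Vanish N (HahnSeries.single 0 h * P) := by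
    have := (vanish_single h (le_refl (0 : ℤ))).mul hP
    rwa [zero_add] at this
  ext e
  have hK : e < N + M + (e - N - M + 1).toNat := by omega
  rw [HahnSeries.coeff_single_zero_mul, comp_coeff_sum d hP' hQ hK, comp_coeff_sum d hP hQ hK,
    Finset.mul_sum]
  refine Finset.sum_congr rfl fun k _ => ?_
  rw [hasse_smul_mul, mul_assoc, HahnSeries.coeff_single_zero_mul]

theorem comp_mul_single (P Q : PDO R) (m : ℤ) :
    comp d P (Q * HahnSeries.single m 1) = comp d P Q * HahnSeries.single m 1 := by
  obtain ⟨N, hP⟩ := exists_vanish P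
  obtain ⟨M, hQ⟩ := exists_vanish Q
  have hQ' : Vanish (M + m) (Q * HahnSeries.single m 1) := hQ.mul (vanish_single 1 le_rfl)
  ext e
  have hK : e - m < N + M + (e - N - M - m + 1).toNat := by omega
  rw [HahnSeries.coeff_mul_single, mul_one, comp_coeff_sum d hP hQ hK,
    comp_coeff_sum d hP hQ' (K := (e - N - M - m + 1).toNat) (by omega)]
  refine Finset.sum_congr rfl fun k _ => ?_
  have : mapD d k (Q * HahnSeries.single m 1) = mapD d k Q * HahnSeries.single m 1 := by
    ext l
    rw [mapD_coeff, HahnSeries.coeff_mul_single, HahnSeries.coeff_mul_single, mapD_coeff, mul_one,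
      mul_one]
  rw [this, ← mul_assoc, HahnSeries.coeff_mul_single, mul_one]

theorem comp_single_coeff {e : ℤ} (h : R) {Q : PDO R} {M : ℤ} (hQ : Vanish M Q) {l : ℤ} {K : ℕ}
    (hK : l < e + M + K) :
    (comp d (HahnSeries.single e h) Q).coeff l = ∑ k ∈ Finset.range K,
      ((Ring.choose (-e) k : ℤ) : R) * h * ((d : R →ₗ[ℂ] R) ^ k) (Q.coeff (l - e - k)) := by
  rw [comp_coeff_sum d (vanish_single h le_rfl) hQ hK]
  refine Finset.sum_congr rfl fun k _ => ?_
  rw [hasse_single, HahnSeries.coeff_single_mul, mapD_coeff]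
  congr 3
  ring

theorem comp_mult (h : R) (Q : PDO R) :
    comp d (HahnSeries.single 0 h) Q = HahnSeries.single 0 h * Q := by
  obtain ⟨M, hQ⟩ := exists_vanish Q
  ext l
  rw [comp_single_coeff d h hQ (K := (l - M + 1).toNat + 1) (by push_cast; omega),
    Finset.sum_range_succ', HahnSeries.coeff_single_zero_mul, Finset.sum_eq_zero]
  · simp
  · intro k _
    rw [neg_zero, Ring.choose_zero_succ, Int.cast_zero, zero_mul, zero_mul]

theorem one_comp (Q : PDO R) : comp d 1 Q = Q := by
  rw [← HahnSeries.single_zero_one, comp_mult, HahnSeries.single_zero_one, one_mul]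

theorem comp_one (P : PDO R) : comp d P 1 = P := by
  obtain ⟨N, hP⟩ := exists_vanish P
  ext l
  rw [← HahnSeries.single_zero_one, comp_coeff_sum d hP (vanish_single (1 : R) le_rfl)
    (K := (l - N + 1).toNat + 1) (by push_cast; omega), Finset.sum_range_succ', Finset.sum_eq_zero]
  · rw [zero_add, hasse_zero, mapD_zero, HahnSeries.single_zero_one, mul_one]
  · intro k _
    have : ((d : R →ₗ[ℂ] R) ^ (k + 1)) 1 = 0 := by
      rw [pow_succ, Module.End.mul_apply]
      simp
    rw [mapD_single, this, HahnSeries.single_eq_zero, mul_zero,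
      HahnSeries.coeff_zero]

theorem comp_single_eq (e : ℤ) (h : R) (Q : PDO R) :
    comp d (HahnSeries.single e h) Q =
      HahnSeries.single 0 h * comp d (HahnSeries.single e 1) Q := by
  rw [← comp_mult_mul, HahnSeries.single_mul_single, zero_add, mul_one]

theorem comp_D (Q : PDO R) :
    comp d (HahnSeries.single (-1) 1) Q = HahnSeries.single (-1) 1 * Q + mapD d 1 Q := by
  obtain ⟨M, hQ⟩ := exists_vanish Q
  ext l
  rw [comp_single_coeff d 1 hQ (K := (l - M + 1).toNat + 2) (by push_cast; omega),
    Finset.sum_range_succ', Finset.sum_range_succ', Finset.sum_eq_zero]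
  · simp only [HahnSeries.coeff_add, mapD_coeff, HahnSeries.coeff_single_mul]
    simp [add_comm]
  · intro k _
    have : Ring.choose (-(-1 : ℤ)) (k + 1 + 1) = 0 := by
      rw [neg_neg, show (1 : ℤ) = ((1 : ℕ) : ℤ) by rfl, Ring.choose_natCast,
        Nat.choose_eq_zero_of_lt (by omega)]
      rfl
    rw [this, Int.cast_zero, zero_mul, zero_mul]

theorem comp_D_coeff (Q : PDO R) (l : ℤ) :
    (comp d (HahnSeries.single (-1) 1) Q).coeff l = Q.coeff (l + 1) + d (Q.coeff l) := by
  rw [comp_D, HahnSeries.coeff_add, mapD_coeff, HahnSeries.coeff_single_mul]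
  simp

/-- The coefficients satisfy Q_(l+1) = -d Q_l, so they vanish one after the other, beginning with
the leading ones. This allows D to be cancelled on the left before associativity, and with it the
inverse D⁻¹, is available. -/
theorem comp_D_injective {Q : PDO R} (h : comp d (HahnSeries.single (-1) 1) Q = 0) : Q = 0 := by
  obtain ⟨M, hM⟩ := exists_vanish Q
  have key : ∀ n : ℕ, Vanish (M + n) Q := by
    intro n
    induction n with
    | zero => simpa using hM
    | succ n ih =>
      intro e he
      have := comp_D_coeff d Q (e - 1)
      rw [h, ih (e - 1) (by push_cast at he; omega), map_zero, add_zero, sub_add_cancel] at this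
      exact this.symm
  exact eq_zero_of_vanish fun N => (key (N - M).toNat).mono (by omega)

theorem comp_D_cancel {P Q : PDO R} (h : comp d (HahnSeries.single (-1) 1) P =
    comp d (HahnSeries.single (-1) 1) Q) : P = Q := by
  refine sub_eq_zero.1 (comp_D_injective d ?_)
  have := comp_add_right d (HahnSeries.single (-1) 1) (P - Q) Q
  rwa [sub_add_cancel, h, right_eq_add] at this

/-- Pascal's rule for binomial coefficients with an arbitrary integer upper entry. -/
theorem comp_D_Dpow (e : ℤ) (Q : PDO R) :
    comp d (HahnSeries.single (-1) 1) (comp d (HahnSeries.single e 1) Q) =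
      comp d (HahnSeries.single (e - 1) 1) Q := by
  obtain ⟨M, hQ⟩ := exists_vanish Q
  ext l
  obtain ⟨K, hK⟩ : ∃ K : ℕ, l + 1 < e + M + K := ⟨(l - e - M + 2).toNat, by omega⟩
  rw [comp_D_coeff, comp_single_coeff d 1 hQ (K := K + 1) (by push_cast; omega),
    comp_single_coeff d 1 hQ (K := K) (by omega),
    comp_single_coeff d 1 hQ (K := K + 1) (by push_cast; omega), map_sum, Finset.sum_range_succ',
    Finset.sum_range_succ' _ K, add_right_comm, ← Finset.sum_add_distrib]
  congr 1
  · refine Finset.sum_congr rfl fun k _ => ?_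
    rw [show -(e - 1) = -e + 1 by ring, Ring.choose_succ_succ]
    simp only [mul_one, Int.cast_add, add_mul]
    rw [Derivation.leibniz, Derivation.map_intCast, smul_zero, add_zero, smul_eq_mul, add_comm,
      pow_succ' (d : R →ₗ[ℂ] R), Module.End.mul_apply,
      show l + 1 - e - ((k + 1 : ℕ) : ℤ) = l - e - k by push_cast; ring,
      show l - (e - 1) - ((k + 1 : ℕ) : ℤ) = l - e - k by push_cast; ring]
    rfl
  · simp only [Ring.choose_zero_right, pow_zero, Int.cast_one, one_mul]
    congr 2
    push_cast; ring

end PDORing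

/-! ### Signs as elements of a ring -/

section Sgn

variable (R : Type*) [Ring R]

@[simp]
theorem sgn_one : sgn R 1 = 1 := by simp [sgn]

@[simp]
theorem sgn_neg (σ : ℤˣ) : sgn R (-σ) = - sgn R σ := by simp [sgn]

theorem sgn_mul (σ τ : ℤˣ) : sgn R (σ * τ) = sgn R σ * sgn R τ := by simp [sgn]

theorem sgn_mul_self (σ : ℤˣ) : sgn R σ * sgn R σ = 1 := by
  rw [← sgn_mul, Int.units_mul_self, sgn_one]

end Sgn

theorem coeffwise_coeff {R : Type*} [CommRing R] (c : ℤ → R) (f : LaurentSeries R) (e : ℤ) :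
    (coeffwise c f).coeff e = c e * f.coeff e := rfl

/-! ### The ring of pseudo-differential operators and the formal adjoint -/

section OpRing

variable {R : Type*} [CommRing R] [Algebra ℂ R] (d : Derivation ℂ R R)

/-- By additivity and continuity in `Q` it suffices to take `Q` = h D^m, where the Leibniz rule D h
= h D + h' reduces the claim to `comp_D_Dpow`. -/
theorem comp_D_assoc (Q F : PDO R) :
    comp d (comp d (HahnSeries.single (-1) 1) Q) F =
      comp d (HahnSeries.single (-1) 1) (comp d Q F) := by
  obtain ⟨M, hF⟩ := exists_vanish F
  have hD : Vanish (-1) (HahnSeries.single (-1) (1 : R)) := vanish_single 1 le_rfl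
  refine eq_of_eq_single (fun Q => comp d (comp d (HahnSeries.single (-1) 1) Q) F)
    (fun Q => comp d (HahnSeries.single (-1) 1) (comp d Q F)) (fun P Q => ?_) (fun P Q => ?_)
    ⟨-1 + M, fun N P h => ((hD.comp d h).comp d hF).mono (by omega)⟩
    ⟨-1 + M, fun N P h => (hD.comp d (h.comp d hF)).mono (by omega)⟩ (fun e h => ?_) Q
  · simp only [comp_add_left, comp_add_right]
  · simp only [comp_add_left, comp_add_right]
  · rw [comp_single_eq d e h F, comp_D d (HahnSeries.single e h), mapD_single, comp_add_left,
      HahnSeries.single_mul_single, one_mul, comp_single_eq d (-1 + e), comp_single_eq d e,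
      show (-1 + e) = e - 1 by ring, ← comp_D_Dpow]
    set G := comp d (HahnSeries.single e 1) F
    ext l
    simp only [HahnSeries.coeff_add, HahnSeries.coeff_single_zero_mul, comp_D_coeff, pow_one,
      Derivation.leibniz, Derivation.coeFn_coe, smul_eq_mul]
    ring

/-- Positive powers of D are built up with `comp_D_assoc`. For negative powers D is applied to both
sides, where it may be cancelled. -/
theorem comp_Dpow_assoc (e : ℤ) (Q F : PDO R) :
    comp d (comp d (HahnSeries.single e 1) Q) F =
      comp d (HahnSeries.single e 1) (comp d Q F) := by
  induction e using Int.induction_on generalizing Q with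
  | zero => rw [HahnSeries.single_zero_one, one_comp, one_comp]
  | succ i ih =>
    refine comp_D_cancel d ?_
    rw [← comp_D_assoc, comp_D_Dpow, comp_D_Dpow, show (i : ℤ) + 1 - 1 = i by ring, ih]
  | pred i ih =>
    rw [← comp_D_Dpow, ← comp_D_Dpow, comp_D_assoc, ih]

theorem comp_assoc (P Q F : PDO R) : comp d (comp d P Q) F = comp d P (comp d Q F) := by
  obtain ⟨M, hQ⟩ := exists_vanish Q
  obtain ⟨M', hF⟩ := exists_vanish F
  refine eq_of_eq_single (fun P => comp d (comp d P Q) F)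
    (fun P => comp d P (comp d Q F)) (fun P Q => ?_) (fun P Q => ?_)
    ⟨M + M', fun N P h => ((h.comp d hQ).comp d hF).mono (by omega)⟩
    ⟨M + M', fun N P h => (h.comp d (hQ.comp d hF)).mono (by omega)⟩ (fun e h => ?_) P
  · simp only [comp_add_left]
  · simp only [comp_add_left]
  · rw [comp_single_eq d e h, comp_single_eq d e h, comp_mult_mul, comp_Dpow_assoc]

/-- The ring of pseudo-differential operators. -/
def Op (_ : Derivation ℂ R R) : Type _ := PDO R

instance : AddCommGroup (Op d) := inferInstanceAs (AddCommGroup (PDO R))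

instance : Module ℂ (Op d) := inferInstanceAs (Module ℂ (PDO R))

/-- A symbol, as an element of the ring of operators. -/
def op : PDO R ≃ₗ[ℂ] Op d := LinearEquiv.refl ℂ (PDO R)

/-- The product carried by Laurent series is the commutative product of symbols, so composition
needs a type of its own; the ring structure makes powers, geometric sums and noncommutative
normalisation available. -/
instance : Ring (Op d) :=
  { (inferInstance : AddCommGroup (Op d)) with
    mul := fun P Q => op d (comp d ((op d).symm P) ((op d).symm Q))
    one := op d 1
    left_distrib := comp_add_right d
    right_distrib := comp_add_left d
    zero_mul := comp_zero_left d
    mul_zero := comp_zero_right d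
    mul_assoc := comp_assoc d
    one_mul := one_comp d
    mul_one := comp_one d }

theorem op_comp (P Q : PDO R) : op d (comp d P Q) = op d P * op d Q := rfl

theorem op_one : op d 1 = 1 := rfl

theorem smul_eq_single_mul (c : ℂ) (X : PDO R) :
    c • X = HahnSeries.single 0 (algebraMap ℂ R c) * X := by
  ext e
  rw [HahnSeries.coeff_single_zero_mul, HahnSeries.coeff_smul, Algebra.smul_def]

theorem smul_comp (c : ℂ) (P Q : PDO R) : comp d (c • P) Q = c • comp d P Q := by
  rw [smul_eq_single_mul, smul_eq_single_mul, comp_mult_mul]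

theorem comp_smul (c : ℂ) (P Q : PDO R) : comp d P (c • Q) = c • comp d P Q := by
  obtain ⟨N, hP⟩ := exists_vanish P
  obtain ⟨M, hQ⟩ := exists_vanish Q
  have hQ' : Vanish M (c • Q) := fun e he => by rw [HahnSeries.coeff_smul, hQ e he, smul_zero]
  ext e
  have hK : e < N + M + (e - N - M + 1).toNat := by omega
  rw [HahnSeries.coeff_smul, comp_coeff_sum d hP hQ' hK, comp_coeff_sum d hP hQ hK,
    Finset.smul_sum]
  refine Finset.sum_congr rfl fun k _ => ?_
  have : mapD d k (c • Q) = c • mapD d k Q := by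
    ext l
    simp [mapD_coeff]
  rw [this, smul_eq_single_mul, mul_left_comm, ← smul_eq_single_mul, HahnSeries.coeff_smul]

instance : Algebra ℂ (Op d) :=
  Algebra.ofModule (fun c P Q => smul_comp d c P Q) (fun c P Q => comp_smul d c P Q)

theorem op_compPow (P : PDO R) (i : ℕ) : op d (compPow d P i) = op d P ^ i := by
  induction i with
  | zero => rfl
  | succ i ih => rw [compPow, op_comp, ih, pow_succ']

theorem op_sgn_mul (σ : ℤˣ) (P : PDO R) : op d (sgn (PDO R) σ * P) = sgn ℂ σ • op d P := by
  have : sgn (PDO R) σ * P = sgn ℂ σ • P := by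
    rcases Int.units_eq_one_or σ with rfl | rfl
    · rw [sgn_one, sgn_one, one_mul, one_smul]
    · rw [sgn_neg, sgn_neg, sgn_one, sgn_one, neg_mul, one_mul, neg_smul, one_smul]
  rw [this, map_smul]

/-- Multiplication operators. -/
def mulOp : R →ₐ[ℂ] Op d where
  toFun h := op d (multOp h)
  map_one' := by rw [multOp, HahnSeries.single_zero_one, op_one]
  map_mul' h g := by
    rw [← op_comp, multOp, multOp, multOp, comp_mult, HahnSeries.single_mul_single, zero_add]
  map_zero' := by simp [multOp]
  map_add' h g := by rw [← map_add, multOp, multOp, multOp, HahnSeries.single_add]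
  commutes' c := by
    rw [Algebra.algebraMap_eq_smul_one, Algebra.algebraMap_eq_smul_one, ← op_one, ← map_smul,
      multOp]
    congr 1
    ext e
    by_cases he : e = 0
    · subst he
      simp
    · simp [HahnSeries.coeff_one, he, HahnSeries.coeff_single_of_ne]

theorem op_multOp (h : R) : op d (multOp h) = mulOp d h := rfl

theorem op_multOp_mul (h : R) (P : PDO R) : op d (multOp h * P) = mulOp d h * op d P := by
  rw [← op_multOp, ← op_comp, multOp, comp_mult]

/-- `(σ D)^m`. -/
def sD (σ : ℤˣ) (m : ℤ) : Op d := op d (signedD R σ m)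

theorem op_signedD (σ : ℤˣ) (m : ℤ) : op d (signedD R σ m) = sD d σ m := rfl

theorem signedD_zero (σ : ℤˣ) : signedD R σ 0 = 1 := by
  rw [signedD, zpow_zero, sgn_one, neg_zero, HahnSeries.single_zero_one]

theorem sD_zero (σ : ℤˣ) : sD d σ 0 = 1 := by
  rw [sD, signedD_zero, op_one]

theorem signedD_eq (σ : ℤˣ) (m : ℤ) :
    signedD R σ m = sgn ℂ (σ ^ m) • HahnSeries.single (-m) 1 := by
  rcases Int.units_eq_one_or (σ ^ m) with h | h
  · rw [signedD, h, sgn_one, sgn_one, one_smul]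
  · rw [signedD, h, sgn_neg, sgn_neg, sgn_one, sgn_one, neg_smul, one_smul, HahnSeries.single_neg]

/-- Powers of D have constant coefficients, so as right factors they multiply the symbol without
correction terms. -/
theorem comp_signedD (P : PDO R) (σ : ℤˣ) (m : ℤ) :
    comp d P (signedD R σ m) = P * signedD R σ m := by
  have := comp_mul_single d P 1 (-m)
  rw [one_mul, comp_one] at this
  rw [signedD_eq, comp_smul, this, smul_eq_single_mul, smul_eq_single_mul, mul_left_comm]

theorem sD_mul (σ : ℤˣ) (m l : ℤ) : sD d σ m * sD d σ l = sD d σ (m + l) := by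
  rw [sD, sD, sD, ← op_comp, comp_signedD, signedD, signedD, signedD, HahnSeries.single_mul_single,
    zpow_add, sgn_mul, neg_add]

theorem sD_neg_mul (σ : ℤˣ) (m : ℤ) : sD d σ (-m) * sD d σ m = 1 := by
  rw [sD_mul, neg_add_cancel, sD_zero]

theorem sD_mul_neg (σ : ℤˣ) (m : ℤ) : sD d σ m * sD d σ (-m) = 1 := by
  rw [sD_mul, add_neg_cancel, sD_zero]

theorem sD_pow (σ : ℤˣ) (m : ℤ) (i : ℕ) : sD d σ m ^ i = sD d σ (i * m) := by
  induction i with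
  | zero => rw [pow_zero, Nat.cast_zero, zero_mul, sD_zero]
  | succ i ih => rw [pow_succ, ih, sD_mul]; congr 1; push_cast; ring

theorem sD_one_pow (σ : ℤˣ) (i : ℕ) : sD d σ 1 ^ i = sD d σ i := by
  rw [sD_pow, mul_one]

theorem sD_neg (σ : ℤˣ) : sD d (-σ) 1 = - sD d σ 1 := by
  rw [sD, sD, ← map_neg, signedD, signedD, ← HahnSeries.single_neg]
  simp only [zpow_one, zpow_neg_one, Int.units_inv_eq_self, sgn_neg]

theorem sD_mul_mulOp (σ : ℤˣ) (h : R) :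
    sD d σ 1 * mulOp d h = mulOp d h * sD d σ 1 + sgn ℂ σ • mulOp d (d h) := by
  have h1 : sD d 1 1 * mulOp d h = mulOp d h * sD d 1 1 + mulOp d (d h) := by
    rw [← op_multOp, ← op_multOp, sD, ← op_comp, ← op_comp, ← map_add]
    congr 1
    simp only [signedD, one_zpow, sgn_one]
    rw [comp_D, multOp, multOp, mapD_single, comp_mult, mul_comm, pow_one, Derivation.coeFn_coe]
  rcases Int.units_eq_one_or σ with rfl | rfl
  · rw [h1, sgn_one, one_smul]
  · rw [sD_neg, neg_mul, h1]
    simp only [mul_neg, sgn_neg, sgn_one, neg_smul, one_smul]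
    abel

/-! ### The adjoint -/

/-- `h D^j ↦ h (-D)^j`. -/
def flipD (P : PDO R) : PDO R := coeffwise (fun e => (((-1 : ℤˣ) ^ e : ℤˣ) : R)) P

theorem flipD_add (P Q : PDO R) : flipD (P + Q) = flipD P + flipD Q := by
  ext e
  simp [flipD, coeffwise_coeff, mul_add]

theorem Vanish.flipD {N : ℤ} {P : PDO R} (h : Vanish N P) : Vanish N (flipD P) := fun e he => by
  rw [KVec.flipD, coeffwise_coeff, h e he, mul_zero]

theorem adj_coeff_sum {P : PDO R} {N : ℤ} (hP : Vanish N P) {e : ℤ} {K : ℕ} (hK : e < N + K) :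
    (adj d P).coeff e = ∑ k ∈ Finset.range K, (hasse k (mapD d k (flipD P))).coeff e := by
  change ∑ᶠ k : ℕ, (hasse k (mapD d k (flipD P))).coeff e = _
  refine finsum_eq_sum_of_support_subset _ fun k hk => ?_
  by_contra h
  refine hk ?_
  have h' : K ≤ k := by simpa using h
  exact (hP.flipD.mapD d k).hasse k e (by omega)

theorem Vanish.adj {P : PDO R} {N : ℤ} (hP : Vanish N P) : Vanish N (adj d P) := fun e he => by
  rw [adj_coeff_sum d hP (K := 0) (by simpa using he), Finset.sum_range_zero]

theorem adj_add (P Q : PDO R) : adj d (P + Q) = adj d P + adj d Q := by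
  obtain ⟨N, hP, hP'⟩ := exists_vanish₂ P Q
  ext e
  have hK : e < N + (e - N + 1).toNat := by omega
  rw [HahnSeries.coeff_add, adj_coeff_sum d (hP.add hP') hK, adj_coeff_sum d hP hK,
    adj_coeff_sum d hP' hK, ← Finset.sum_add_distrib]
  simp [hasse_add, mapD_add, flipD_add]

theorem adj_single (e : ℤ) (h : R) :
    adj d (HahnSeries.single e h) = comp d (signedD R (-1) (-e)) (multOp h) := by
  have hs : Vanish e (HahnSeries.single e h) := vanish_single h le_rfl
  ext l
  obtain ⟨K, hK⟩ : ∃ K : ℕ, l < e + K := ⟨(l - e + 1).toNat, by omega⟩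
  have hf : flipD (HahnSeries.single e h) =
      HahnSeries.single e (sgn R ((-1) ^ e) * h) := by
    ext i
    rw [flipD, coeffwise_coeff]
    by_cases hi : i = e
    · subst hi; simp
    · simp [HahnSeries.coeff_single_of_ne hi]
  rw [adj_coeff_sum d hs hK, signedD, multOp, neg_neg, comp_coeff_sum d (vanish_single _ le_rfl)
    (vanish_single h le_rfl) (K := K) (N := e) (M := 0) (by omega)]
  refine Finset.sum_congr rfl fun k _ => ?_
  rw [hf, mapD_single, mapD_single, hasse_single, hasse_single,
    HahnSeries.single_mul_single, add_zero]
  congr 2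
  rw [mul_assoc]
  congr 1
  rw [show ((-1 : ℤˣ) ^ (-e)) = (-1) ^ e by rw [zpow_neg, Int.units_inv_eq_self]]
  rcases Int.units_eq_one_or ((-1) ^ e) with h | h <;> simp [h]

/-- The adjoint as a map of the ring of operators. -/
def adjOp : Op d →+ Op d :=
  AddMonoidHom.mk' (fun P => op d (adj d ((op d).symm P))) (adj_add d)

theorem op_adj (P : PDO R) : op d (adj d P) = adjOp d (op d P) := rfl

theorem op_single (e : ℤ) (h : R) : op d (HahnSeries.single e h) = mulOp d h * sD d 1 (-e) := by
  rw [← op_multOp, sD, ← op_comp, signedD, multOp, comp_mult, HahnSeries.single_mul_single, one_zpow, sgn_one,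
    mul_one, neg_neg, zero_add]

theorem adjOp_mulOp_sD (h : R) (m : ℤ) :
    adjOp d (mulOp d h * sD d 1 m) = sD d (-1) m * mulOp d h := by
  have := op_single d (-m) h
  rw [neg_neg] at this
  rw [← this, ← op_adj, adj_single, op_comp, neg_neg]
  rfl

theorem adjOp_mulOp (h : R) : adjOp d (mulOp d h) = mulOp d h := by
  simpa [sD_zero] using adjOp_mulOp_sD d h 0

theorem adjOp_one : adjOp d 1 = 1 := by
  simpa using adjOp_mulOp d 1

theorem adjOp_sD (σ : ℤˣ) (m : ℤ) : adjOp d (sD d σ m) = sD d (-σ) m := by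
  have h1 := adjOp_mulOp_sD d 1 m
  rw [map_one, one_mul, mul_one] at h1
  rcases Int.units_eq_one_or σ with rfl | rfl
  · exact h1
  · rw [neg_neg]
    -- (-D)^m is ±D^m according to the parity of m, so the formula for D implies the one for -D.
    rcases Int.even_or_odd m with hm | hm
    · have : sD d (-1) m = sD d 1 m := by simp only [sD, signedD, hm.neg_one_zpow, one_zpow]
      rw [this, h1, this]
    · have : sD d (-1) m = - sD d 1 m := by
        rw [sD, sD, ← map_neg, signedD, signedD, ← HahnSeries.single_neg]
        simp only [hm.neg_one_zpow, one_zpow, sgn_neg]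
      rw [this, map_neg, h1, this, neg_neg]

/-- An additive identity between operators which respects the filtration can be checked on `h D^m`. -/
theorem op_induction {R' : Type*} [CommRing R'] [Algebra ℂ R'] {d' : Derivation ℂ R' R'}
    (F G : Op d →+ Op d')
    (cF : ∃ c, ∀ N P, Vanish N P → Vanish (N + c) ((op d').symm (F (op d P))))
    (cG : ∃ c, ∀ N P, Vanish N P → Vanish (N + c) ((op d').symm (G (op d P))))
    (h : ∀ r m, F (mulOp d r * sD d 1 m) = G (mulOp d r * sD d 1 m)) : F = G := by
  ext P
  refine eq_of_eq_single (fun P => (op d').symm (F (op d P))) (fun P => (op d').symm (G (op d P)))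
    (fun P Q => by simp) (fun P Q => by simp) cF cG (fun e r => ?_) ((op d).symm P)
  rw [op_single, h]

theorem adjOp_mulOp_mul (h : R) (Q : Op d) :
    adjOp d (mulOp d h * Q) = adjOp d Q * mulOp d h := by
  refine DFunLike.congr_fun (op_induction d ((adjOp d).comp (AddMonoidHom.mulLeft (mulOp d h)))
    ((AddMonoidHom.mulRight (mulOp d h)).comp (adjOp d)) ⟨0, fun N P hP => ?_⟩
    ⟨0, fun N P hP => ?_⟩ fun r m => ?_) Q
  · have := ((vanish_single h le_rfl : Vanish 0 (multOp h)).comp d hP).adj d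
    exact this.mono (by omega)
  · exact (hP.adj d).comp d (vanish_single h le_rfl : Vanish 0 (multOp h))
  · simp only [AddMonoidHom.comp_apply, AddMonoidHom.coe_mulLeft, AddMonoidHom.coe_mulRight]
    rw [← mul_assoc, ← map_mul, adjOp_mulOp_sD, adjOp_mulOp_sD, mul_assoc, ← map_mul, mul_comm h]

theorem adjOp_D_mul (Q : Op d) :
    adjOp d (sD d 1 1 * Q) = adjOp d Q * sD d (-1) 1 := by
  refine DFunLike.congr_fun (op_induction d ((adjOp d).comp (AddMonoidHom.mulLeft (sD d 1 1)))
    ((AddMonoidHom.mulRight (sD d (-1) 1)).comp (adjOp d)) ⟨-1, fun N P hP => ?_⟩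
    ⟨-1, fun N P hP => ?_⟩ fun r m => ?_) Q
  · have := ((vanish_single _ le_rfl : Vanish (-1) (signedD R 1 1)).comp d hP).adj d
    exact this.mono (by omega)
  · exact (hP.adj d).comp d (vanish_single _ le_rfl : Vanish (-1) (signedD R (-1) 1))
  · simp only [AddMonoidHom.comp_apply, AddMonoidHom.coe_mulLeft, AddMonoidHom.coe_mulRight]
    rw [← mul_assoc, sD_mul_mulOp, add_mul, mul_assoc, sD_mul, map_add, adjOp_mulOp_sD]
    rw [sgn_one, one_smul, adjOp_mulOp_sD, adjOp_mulOp_sD, add_comm 1 m, ← sD_mul, mul_assoc, mul_assoc, ← mul_add,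
      sD_mul_mulOp, sgn_neg, sgn_one, neg_smul, one_smul, neg_add_cancel_right]

theorem adjOp_Dpow_mul (m : ℤ) (Q : Op d) :
    adjOp d (sD d 1 m * Q) = adjOp d Q * sD d (-1) m := by
  induction m using Int.induction_on generalizing Q with
  | zero => simp [sD_zero]
  | succ i ih => rw [add_comm, ← sD_mul, ← sD_mul, mul_assoc, adjOp_D_mul, ih, mul_assoc, sD_mul,
      sD_mul, add_comm]
  | pred i ih =>
    -- For a negative exponent the rule for a single D is applied to D^(-i-1) Q, and the surplus
    -- factor -D is removed on the right.
    have h := adjOp_D_mul d (sD d 1 (-i - 1) * Q)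
    rw [← mul_assoc, sD_mul, show (1 : ℤ) + (-i - 1) = -i by ring, ih] at h
    have h2 := congrArg (· * sD d (-1) (-1)) h
    rw [mul_assoc, mul_assoc, sD_mul, sD_mul_neg, mul_one] at h2
    rw [← h2, sub_eq_add_neg]

/-- Both sides are additive in `P` and respect the filtration, so `P` = h D^m suffices; there the
rules for left multiplication by functions and by powers of D combine. -/
theorem adjOp_mul (P Q : Op d) : adjOp d (P * Q) = adjOp d Q * adjOp d P := by
  obtain ⟨M, hQ⟩ := exists_vanish ((op d).symm Q)
  refine DFunLike.congr_fun (op_induction d ((adjOp d).comp (AddMonoidHom.mulRight Q))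
    ((AddMonoidHom.mulLeft (adjOp d Q)).comp (adjOp d)) ⟨M, fun N P hP => ?_⟩
    ⟨M, fun N P hP => ?_⟩ fun r m => ?_) P
  · exact (hP.comp d hQ).adj d
  · exact ((hQ.adj d).comp d (hP.adj d)).mono (by omega)
  · simp only [AddMonoidHom.comp_apply, AddMonoidHom.coe_mulLeft, AddMonoidHom.coe_mulRight]
    rw [mul_assoc, adjOp_mulOp_mul, adjOp_Dpow_mul, adjOp_mulOp_sD, mul_assoc]

theorem adjOp_adjOp (P : Op d) : adjOp d (adjOp d P) = P := by
  refine DFunLike.congr_fun (op_induction d ((adjOp d).comp (adjOp d)) (AddMonoidHom.id _)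
    ⟨0, fun N P hP => ?_⟩ ⟨0, fun N P hP => ?_⟩ fun r m => ?_) P
  · exact ((hP.adj d).adj d).mono (by omega)
  · exact hP.mono (by omega)
  · simp only [AddMonoidHom.comp_apply, AddMonoidHom.id_apply]
    rw [adjOp_mulOp_sD, adjOp_mul, adjOp_mulOp, adjOp_sD, neg_neg]

theorem adjOp_smul (c : ℂ) (P : Op d) : adjOp d (c • P) = c • adjOp d P := by
  have h : ∀ X : Op d, c • X = mulOp d (algebraMap ℂ R c) * X := fun X => by
    rw [AlgHom.commutes, Algebra.smul_def]
  have h' : ∀ X : Op d, c • X = X * mulOp d (algebraMap ℂ R c) := fun X => by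
    rw [AlgHom.commutes, ← Algebra.commutes, Algebra.smul_def]
  rw [h, adjOp_mulOp_mul, h']

end OpRing

/-! ### Differential and negative parts, inverses, and derivations or changes of the coefficients -/

section Parts

variable {R : Type*} [CommRing R]

/-- Differential operators. -/
def IsDiff (P : PDO R) : Prop := ∀ e, 0 < e → P.coeff e = 0

theorem IsDiff.sub {P Q : PDO R} (hP : IsDiff P) (hQ : IsDiff Q) : IsDiff (P - Q) :=
  fun e he => by rw [HahnSeries.coeff_sub, hP e he, hQ e he, sub_zero]

theorem isDiff_single {e : ℤ} (h : R) (he : e ≤ 0) : IsDiff (HahnSeries.single e h : PDO R) :=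
  fun i hi => HahnSeries.coeff_single_of_ne (by omega)

theorem posPart_coeff (P : PDO R) (e : ℤ) :
    (posPart P).coeff e = if e ≤ 0 then P.coeff e else 0 := by
  rw [posPart, coeffwise_coeff]
  split_ifs <;> simp

theorem negPart_coeff (P : PDO R) (e : ℤ) :
    (negPart P).coeff e = if e ≤ 0 then 0 else P.coeff e := by
  rw [negPart, coeffwise_coeff]
  split_ifs <;> simp

theorem isDiff_posPart (P : PDO R) : IsDiff (posPart P) := fun e he => by
  rw [posPart_coeff, if_neg (by omega)]

theorem vanish_negPart (P : PDO R) : Vanish 1 (negPart P) := fun e he => by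
  rw [negPart_coeff, if_pos (by omega)]

theorem posPart_add_negPart (P : PDO R) : posPart P + negPart P = P := by
  ext e
  rw [HahnSeries.coeff_add, posPart_coeff, negPart_coeff]
  split_ifs <;> simp

theorem negPart_eq {P A B : PDO R} (hA : IsDiff A) (hB : Vanish 1 B) (h : P = A + B) :
    negPart P = B := by
  ext e
  rw [negPart_coeff, h, HahnSeries.coeff_add]
  split_ifs with he
  · rw [hB e (by omega)]
  · rw [hA e (by omega), zero_add]

theorem posPart_eq {P A B : PDO R} (hA : IsDiff A) (hB : Vanish 1 B) (h : P = A + B) :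
    posPart P = A := by
  ext e
  rw [posPart_coeff, h, HahnSeries.coeff_add]
  split_ifs with he
  · rw [hB e (by omega), add_zero]
  · rw [hA e (by omega)]

theorem negPart_add (P Q : PDO R) : negPart (P + Q) = negPart P + negPart Q := by
  ext e
  simp only [negPart_coeff, HahnSeries.coeff_add]
  split_ifs <;> simp

theorem negPart_sub (P Q : PDO R) : negPart (P - Q) = negPart P - negPart Q := by
  ext e
  simp only [negPart_coeff, HahnSeries.coeff_sub]
  split_ifs <;> simp

theorem negPart_sum {ι : Type*} (s : Finset ι) (P : ι → PDO R) :
    negPart (∑ i ∈ s, P i) = ∑ i ∈ s, negPart (P i) :=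
  map_sum (AddMonoidHom.mk' negPart negPart_add) P s

theorem IsDiff.negPart {P : PDO R} (h : IsDiff P) : negPart P = 0 :=
  negPart_eq h (fun _ _ => rfl) (add_zero P).symm

theorem IsDiff.mul {P Q : PDO R} (hP : IsDiff P) (hQ : IsDiff Q) : IsDiff (P * Q) := by
  intro e he
  rw [HahnSeries.coeff_mul]
  refine Finset.sum_eq_zero fun ij hij => ?_
  have h := (Finset.mem_antidiagonal.1 hij).2.2
  rcases lt_or_ge 0 ij.1 with h1 | h1
  · rw [hP _ h1, zero_mul]
  · rw [hQ _ (by omega), mul_zero]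

/-- For 0 < e ≤ k the binomial coefficient has the natural upper entry k - e < k and vanishes:
derivatives of a polynomial symbol are polynomial. -/
theorem IsDiff.hasse {P : PDO R} (h : IsDiff P) (k : ℕ) : IsDiff (hasse k P) := by
  intro e he
  rw [hasse_coeff]
  by_cases hk : 0 < e - k
  · rw [h _ hk, mul_zero]
  · obtain ⟨j, hj⟩ : ∃ j : ℕ, (k : ℤ) - e = j := ⟨(k - e).toNat, by omega⟩
    rw [hj, Ring.choose_natCast, Nat.choose_eq_zero_of_lt (by omega)]
    simp

variable [Algebra ℂ R] (d : Derivation ℂ R R)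

theorem IsDiff.mapD {P : PDO R} (h : IsDiff P) (k : ℕ) : IsDiff (mapD d k P) := fun e he => by
  rw [mapD_coeff, h e he, map_zero]

theorem IsDiff.comp {P Q : PDO R} (hP : IsDiff P) (hQ : IsDiff Q) : IsDiff (comp d P Q) := by
  intro e he
  rw [comp_coeff]
  exact finsum_eq_zero_of_forall_eq_zero fun k => (hP.hasse k).mul (hQ.mapD d k) e he

theorem IsDiff.adj {P : PDO R} (h : IsDiff P) : IsDiff (adj d P) := by
  intro e he
  refine finsum_eq_zero_of_forall_eq_zero fun k => ?_
  refine IsDiff.hasse (IsDiff.mapD d (P := flipD P) (fun e he => ?_) k) k e he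
  rw [flipD, coeffwise_coeff, h e he, mul_zero]

theorem adj_eq_add (P : PDO R) : adj d P = adj d (posPart P) + adj d (negPart P) := by
  rw [← adj_add, posPart_add_negPart]

theorem adj_posPart (P : PDO R) : adj d (posPart P) = posPart (adj d P) :=
  (posPart_eq ((isDiff_posPart P).adj d) ((vanish_negPart P).adj d) (adj_eq_add d P)).symm

theorem adj_negPart (P : PDO R) : adj d (negPart P) = negPart (adj d P) :=
  (negPart_eq ((isDiff_posPart P).adj d) ((vanish_negPart P).adj d) (adj_eq_add d P)).symm

theorem comp_multOp_coeff_zero (P : PDO R) (q : R) :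
    (comp d P (multOp q)).coeff 0 = applyPos d P q := by
  rw [comp_coeff, applyPos]
  refine finsum_congr fun k => ?_
  rw [multOp, mapD_single, HahnSeries.coeff_mul_single_zero, hasse_coeff, sub_zero,
    Ring.choose_natCast, Nat.choose_self, zero_sub, Module.End.pow_apply]
  simp

theorem applyPos_posPart (P : PDO R) (q : R) : applyPos d (posPart P) q = applyPos d P q := by
  refine finsum_congr fun k => ?_
  rw [posPart_coeff, if_pos (by omega)]

/-- The differential operator B ∘ q - B(q) has no constant term, so it stays differential after
multiplication by (σD)⁻¹ on the right; only B(q) (σD)⁻¹ q' is left in the negative part. -/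
theorem negPart_comp_left {B : PDO R} (hB : IsDiff B) (σ : ℤˣ) (q q' : R) :
    negPart (comp d B (comp d (comp d (multOp q) (signedD R σ (-1))) (multOp q'))) =
      comp d (comp d (multOp (applyPos d B q)) (signedD R σ (-1))) (multOp q') := by
  have hC : IsDiff (comp d (comp d (comp d B (multOp q) - multOp (applyPos d B q))
      (signedD R σ (-1))) (multOp q')) := by
    refine IsDiff.comp d (fun e he => ?_) (isDiff_single q' le_rfl)
    rw [comp_signedD, signedD, HahnSeries.coeff_mul_single, HahnSeries.coeff_sub]
    -- The factor (σD)⁻¹ shifts indices by one: index 1 is the constant term of B ∘ q - B(q), which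
    -- is zero, and larger indices do not occur in a differential operator.
    by_cases h1 : e = 1
    · subst h1
      rw [show (1 : ℤ) - (-(-1)) = 0 by norm_num, comp_multOp_coeff_zero, multOp,
        HahnSeries.coeff_single_same, sub_self, zero_mul]
    · rw [(hB.comp d (isDiff_single q le_rfl) : IsDiff (comp d B (multOp q))) _ (by omega), multOp,
        isDiff_single (applyPos d B q) le_rfl _ (by omega), sub_self, zero_mul]
  refine negPart_eq hC ?_ ?_
  · have h0 : ∀ r : R, Vanish 0 (multOp r) := fun r => vanish_single r le_rfl
    have h1 : Vanish 1 (signedD R σ (-1)) := vanish_single _ (by norm_num)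
    exact (((h0 _).comp d h1).comp d (h0 _)).mono (by norm_num)
  · apply (op d).injective
    simp only [op_comp, map_add, map_sub]
    noncomm_ring

/-- Adjoint of `negPart_comp_left` for `B`^*; taking adjoints exchanges the two functions and the
sign of D. -/
theorem negPart_comp_right {B : PDO R} (hB : IsDiff B) (σ : ℤˣ) (q q' : R) :
    negPart (comp d (comp d (comp d (multOp q) (signedD R σ (-1))) (multOp q')) B) =
      comp d (comp d (multOp q) (signedD R σ (-1))) (multOp (applyPos d (adj d B) q')) := by
  have h := congrArg (adj d) (negPart_comp_left d (hB.adj d) (-σ) q' q)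
  rw [adj_negPart] at h
  have e1 : adj d (comp d (adj d B) (comp d (comp d (multOp q') (signedD R (-σ) (-1)))
      (multOp q))) = comp d (comp d (comp d (multOp q) (signedD R σ (-1))) (multOp q')) B := by
    apply (op d).injective
    simp only [op_comp, op_adj, adjOp_mul, adjOp_adjOp, op_multOp, op_signedD, adjOp_mulOp,
      adjOp_sD, neg_neg, mul_assoc]
  have e2 : ∀ r, adj d (comp d (comp d (multOp r) (signedD R (-σ) (-1)))
      (multOp q)) = comp d (comp d (multOp q) (signedD R σ (-1))) (multOp r) := by
    intro r
    apply (op d).injective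
    simp only [op_comp, op_adj, adjOp_mul, adjOp_adjOp, op_multOp, op_signedD, adjOp_mulOp,
      adjOp_sD, neg_neg, mul_assoc]
  rwa [e1, e2] at h

/-! ### Inverses -/

theorem Vanish.pow {N : PDO R} (hN : Vanish 1 N) (k : ℕ) :
    Vanish k ((op d).symm (op d N ^ k)) := by
  induction k with
  | zero =>
    rw [pow_zero]
    exact vanish_single (1 : R) le_rfl
  | succ k ih =>
    rw [pow_succ]
    exact (ih.comp d hN).mono (by push_cast; rfl)

/-- Geometric series in 1 - S, which has negative order, so that in every degree the partial sums
become stationary. -/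
theorem exists_inverse {S : PDO R} (hS : Vanish 1 (S - 1)) :
    ∃ T : PDO R, comp d S T = 1 ∧ comp d T S = 1 := by
  have hN : Vanish 1 (1 - S) := fun e he => by
    rw [← neg_sub, HahnSeries.coeff_neg, hS e he, neg_zero]
  set x : Op d := op d (1 - S) with hx
  have hSx : op d S = 1 - x := by rw [hx, map_sub, op_one]; abel
  set G : ℕ → Op d := fun K => ∑ k ∈ Finset.range K, x ^ k with hG
  have hx0 : ∀ (k : ℕ) (e : ℤ), e < k → ((op d).symm (x ^ k)).coeff e = 0 := fun k e he =>
    hN.pow d k e he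
  -- Powers beyond the e-th do not reach index e, so `e.toNat + 1` terms of the series determine
  -- this coefficient.
  let T : PDO R := HahnSeries.ofSuppBddBelow
    (fun e => ((op d).symm (G (e.toNat + 1))).coeff e) ⟨0, fun e he => not_lt.1 fun h => he (by
      change ((op d).symm (G (e.toNat + 1))).coeff e = 0
      rw [hG]
      simp only [map_sum, HahnSeries.coeff_sum]
      exact Finset.sum_eq_zero fun k _ => hx0 k e (by omega))⟩
  have hT : ∀ K : ℕ, Vanish K (T - (op d).symm (G K)) := by
    intro K e he
    rw [HahnSeries.coeff_sub]
    change ((op d).symm (G (e.toNat + 1))).coeff e - ((op d).symm (G K)).coeff e = 0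
    by_cases h0 : e < 0
    · simp only [hG, map_sum, HahnSeries.coeff_sum]
      rw [Finset.sum_eq_zero fun k _ => hx0 k e (by omega),
        Finset.sum_eq_zero fun k _ => hx0 k e (by omega), sub_zero]
    · simp only [hG, map_sum, HahnSeries.coeff_sum]
      rw [sub_eq_zero]
      refine Finset.sum_subset (fun k hk => ?_) fun k _ hk => ?_
      · rw [Finset.mem_range] at hk ⊢
        omega
      · rw [Finset.mem_range] at hk
        exact hx0 k e (by omega)
  have hS0 : Vanish 0 S := fun e he => by
    have := hS e (by omega)
    rwa [HahnSeries.coeff_sub, HahnSeries.coeff_one, if_neg (by omega), sub_zero] at this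
  refine ⟨T, ?_, ?_⟩
  · rw [← sub_eq_zero]
    refine eq_zero_of_vanish fun M => ?_
    have h1 := (hS0.comp d (hT M.toNat)).sub ((hN.pow d M.toNat).mono (by omega))
    have h2 : comp d S (T - (op d).symm (G M.toNat)) - (op d).symm (x ^ M.toNat) =
        comp d S T - 1 := by
      apply (op d).injective
      rw [map_sub, map_sub, op_comp, op_comp, map_sub, mul_sub, LinearEquiv.apply_symm_apply,
        LinearEquiv.apply_symm_apply, op_one, hSx, hG, mul_neg_geom_sum]
      abel
    rw [← h2]
    exact h1.mono (by omega)
  · rw [← sub_eq_zero]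
    refine eq_zero_of_vanish fun M => ?_
    have h1 := ((hT M.toNat).comp d hS0).sub ((hN.pow d M.toNat).mono (by omega))
    have h2 : comp d (T - (op d).symm (G M.toNat)) S - (op d).symm (x ^ M.toNat) =
        comp d T S - 1 := by
      apply (op d).injective
      rw [map_sub, map_sub, op_comp, op_comp, map_sub, sub_mul, LinearEquiv.apply_symm_apply,
        LinearEquiv.apply_symm_apply, op_one, hSx, hG, geom_sum_mul_neg]
      abel
    rw [← h2]
    exact h1.mono (by omega)

/-! ### Derivations of the coefficients -/

theorem mapD_one_mul (δ : Derivation ℂ R R) (P Q : PDO R) :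
    mapD δ 1 (P * Q) = mapD δ 1 P * Q + P * mapD δ 1 Q := by
  obtain ⟨M, hQ⟩ := exists_vanish Q
  refine eq_of_eq_single (fun P => mapD δ 1 (P * Q)) (fun P => mapD δ 1 P * Q + P * mapD δ 1 Q)
    (fun P P' => ?_) (fun P P' => ?_) ⟨M, fun N P hP => (hP.mul hQ).mapD δ 1⟩
    ⟨M, fun N P hP => ((hP.mapD δ 1).mul hQ).add (hP.mul (hQ.mapD δ 1))⟩ (fun e h => ?_) P
  · rw [add_mul, mapD_add]
  · rw [mapD_add, add_mul, add_mul]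
    abel
  · ext l
    rw [mapD_coeff, mapD_single, HahnSeries.coeff_add, HahnSeries.coeff_single_mul,
      HahnSeries.coeff_single_mul, HahnSeries.coeff_single_mul, mapD_coeff, pow_one,
      Derivation.coeFn_coe, Derivation.leibniz, smul_eq_mul, smul_eq_mul]
    ring

theorem mapD_one_coeff (δ : Derivation ℂ R R) (P : PDO R) (e : ℤ) :
    (mapD δ 1 P).coeff e = δ (P.coeff e) := by
  rw [mapD_coeff, pow_one, Derivation.coeFn_coe]

theorem mapD_one_hasse (δ : Derivation ℂ R R) (k : ℕ) (P : PDO R) :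
    mapD δ 1 (hasse k P) = hasse k (mapD δ 1 P) := by
  ext e
  rw [mapD_one_coeff, hasse_coeff, hasse_coeff, mapD_one_coeff, Derivation.leibniz,
    Derivation.map_intCast, smul_zero, add_zero, smul_eq_mul]

theorem mapD_one_mapD {δ : Derivation ℂ R R} (hδ : ∀ h, δ (d h) = d (δ h)) (k : ℕ) (P : PDO R) :
    mapD δ 1 (mapD d k P) = mapD d k (mapD δ 1 P) := by
  ext e
  rw [mapD_one_coeff, mapD_coeff, mapD_coeff, mapD_one_coeff]
  induction k with
  | zero => rfl
  | succ k ih => rw [pow_succ', Module.End.mul_apply, Module.End.mul_apply, ← ih]; exact hδ _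

/-- A derivation of the coefficients which commutes with `d` commutes with both kinds of derivatives
in the symbol calculus, so the Leibniz rule passes from products of symbols to compositions. It is
applied to ∂/∂t_i. -/
theorem mapD_one_comp {δ : Derivation ℂ R R} (hδ : ∀ h, δ (d h) = d (δ h)) (P Q : PDO R) :
    mapD δ 1 (comp d P Q) = comp d (mapD δ 1 P) Q + comp d P (mapD δ 1 Q) := by
  obtain ⟨N, hP⟩ := exists_vanish P
  obtain ⟨M, hQ⟩ := exists_vanish Q
  ext e
  have hK : e < N + M + (e - N - M + 1).toNat := by omega
  rw [HahnSeries.coeff_add, mapD_one_coeff, comp_coeff_sum d hP hQ hK,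
    comp_coeff_sum d (hP.mapD δ 1) hQ hK, comp_coeff_sum d hP (hQ.mapD δ 1) hK, map_sum,
    ← Finset.sum_add_distrib]
  refine Finset.sum_congr rfl fun k _ => ?_
  rw [← mapD_one_coeff, mapD_one_mul, mapD_one_hasse, mapD_one_mapD d hδ, HahnSeries.coeff_add]

theorem mapD_one_adj {δ : Derivation ℂ R R} (hδ : ∀ h, δ (d h) = d (δ h)) (P : PDO R) :
    mapD δ 1 (adj d P) = adj d (mapD δ 1 P) := by
  obtain ⟨N, hP⟩ := exists_vanish P
  ext e
  have hK : e < N + (e - N + 1).toNat := by omega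
  rw [mapD_one_coeff, adj_coeff_sum d hP hK, adj_coeff_sum d (hP.mapD δ 1) hK, map_sum]
  refine Finset.sum_congr rfl fun k _ => ?_
  rw [← mapD_one_coeff, mapD_one_hasse, mapD_one_mapD d hδ]
  congr 3
  ext l
  rw [mapD_one_coeff, flipD, flipD, coeffwise_coeff, coeffwise_coeff, mapD_one_coeff,
    Derivation.leibniz, Derivation.map_intCast, smul_zero, add_zero, smul_eq_mul]

theorem mapD_one_negPart (δ : Derivation ℂ R R) (P : PDO R) :
    mapD δ 1 (negPart P) = negPart (mapD δ 1 P) := by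
  ext e
  rw [mapD_one_coeff, negPart_coeff, negPart_coeff, mapD_one_coeff]
  split_ifs <;> simp

/-! ### Change of coefficients -/

variable {R' : Type*} [CommRing R'] [Algebra ℂ R'] {d' : Derivation ℂ R' R'} (f : R →ₐ[ℂ] R')

theorem map_hasse (k : ℕ) (P : PDO R) : (hasse k P).map f = hasse k (P.map f) := by
  ext e
  simp [hasse_coeff]

theorem map_mapD (hf : ∀ h, f (d h) = d' (f h)) (k : ℕ) (P : PDO R) :
    (mapD d k P).map f = mapD d' k (P.map f) := by
  ext e
  rw [HahnSeries.map_coeff, mapD_coeff, mapD_coeff, HahnSeries.map_coeff]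
  induction k with
  | zero => rfl
  | succ k ih => rw [pow_succ', pow_succ', Module.End.mul_apply, Module.End.mul_apply, ← ih]
                 exact hf _

theorem Vanish.map {N : ℤ} {P : PDO R} (h : Vanish N P) : Vanish N (P.map f : PDO R') :=
  fun e he => by rw [HahnSeries.map_coeff, h e he, map_zero]

theorem map_comp (hf : ∀ h, f (d h) = d' (f h)) (P Q : PDO R) :
    (comp d P Q).map f = comp d' (P.map f) (Q.map f) := by
  obtain ⟨N, hP⟩ := exists_vanish P
  obtain ⟨M, hQ⟩ := exists_vanish Q
  ext e
  have hK : e < N + M + (e - N - M + 1).toNat := by omega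
  rw [HahnSeries.map_coeff, comp_coeff_sum d hP hQ hK,
    comp_coeff_sum d' (hP.map f) (hQ.map f) hK, map_sum]
  refine Finset.sum_congr rfl fun k _ => ?_
  rw [← map_hasse, ← map_mapD d f hf]
  have := HahnSeries.map_mul (Γ := ℤ) ((f : R →+* R') : R →ₙ+* R') (x := hasse k P)
    (y := mapD d k Q)
  exact congrArg (fun X : PDO R' => X.coeff e) this

theorem map_adj (hf : ∀ h, f (d h) = d' (f h)) (P : PDO R) :
    (adj d P).map f = adj d' (P.map f) := by
  obtain ⟨N, hP⟩ := exists_vanish P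
  ext e
  have hK : e < N + (e - N + 1).toNat := by omega
  rw [HahnSeries.map_coeff, adj_coeff_sum d hP hK, adj_coeff_sum d' (hP.map f) hK, map_sum]
  refine Finset.sum_congr rfl fun k _ => ?_
  have : flipD (P.map f) = (flipD P).map f := by
    ext l
    simp [flipD, coeffwise_coeff]
  rw [this, ← map_mapD d f hf, ← map_hasse, HahnSeries.map_coeff]

end Parts

/-! ### Laurent series in `z⁻¹` -/

section FormalLaurent

@[simp]
theorem FLS.coeff_zero (e : ℤ) : (0 : FLS).coeff e = 0 := rfl

@[simp]
theorem FLS.coeff_sub (f g : FLS) (e : ℤ) : (f - g).coeff e = f.coeff e - g.coeff e := rfl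

/-- The coefficients as linear forms. -/
def FLS.coeffₗ (e : ℤ) : FLS →ₗ[ℂ] ℂ where
  toFun f := f.coeff e
  map_add' f g := FLS.coeff_add f g e
  map_smul' c f := FLS.coeff_smul c f e

theorem FLS.coeff_sum {ι : Type*} (s : Finset ι) (f : ι → FLS) (e : ℤ) :
    (∑ i ∈ s, f i).coeff e = ∑ i ∈ s, (f i).coeff e :=
  map_sum (FLS.coeffₗ e) f s

theorem FLS.coeff_monoF_mul (m : ℤ) (c : ℂ) (f : FLS) (e : ℤ) :
    (monoF m c * f).coeff e = c * f.coeff (e + m) := by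
  have := HahnSeries.coeff_single_mul (Γ' := ℤ) (R := ℂ) (r := c) (x := f) (a := e) (b := -m)
  rw [sub_neg_eq_add] at this
  exact this

theorem FLS.coeff_monoF (m : ℤ) (c : ℂ) (e : ℤ) :
    (monoF m c).coeff e = if e = -m then c else 0 := by
  split_ifs with h
  · subst h
    exact HahnSeries.coeff_single_same _ _
  · exact HahnSeries.coeff_single_of_ne h

theorem monoF_mul_monoF (m l : ℤ) (c c' : ℂ) :
    monoF m c * monoF l c' = monoF (m + l) (c * c') := by
  refine FLS.ext fun e => ?_
  rw [FLS.coeff_monoF_mul, FLS.coeff_monoF, FLS.coeff_monoF]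
  by_cases h : e + m = -l
  · rw [if_pos h, if_pos (by omega)]
  · rw [if_neg h, if_neg (by omega), mul_zero]

theorem monoF_zero_one : monoF 0 1 = 1 := rfl

theorem smul_eq_monoF_mul (c : ℂ) (f : FLS) : c • f = monoF 0 c * f := rfl

theorem smul_monoF (m : ℤ) (a c : ℂ) : a • monoF m c = monoF m (a * c) := by
  rw [smul_eq_monoF_mul, monoF_mul_monoF, zero_add]

theorem eulerF_coeff (f : FLS) (e : ℤ) : (eulerF f).coeff e = -(e : ℂ) * f.coeff e := rfl

theorem eulerF_monoF_mul (m : ℤ) (c : ℂ) (f : FLS) :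
    eulerF (monoF m c * f) = (m : ℂ) • (monoF m c * f) + monoF m c * eulerF f := by
  refine FLS.ext fun e => ?_
  simp only [FLS.coeff_add, FLS.coeff_smul, FLS.coeff_monoF_mul, eulerF_coeff]
  push_cast
  ring

/-- The constant term of the operator `A^σ`. -/
abbrev shiftA (p N : ℕ) (σ : ℤˣ) : ℂ := sgn ℂ σ * (N : ℂ) - ((p : ℂ) - 1) / 2

theorem formalA_apply (p N : ℕ) (σ : ℤˣ) (f : FLS) :
    formalA p N σ f = monoF 1 1 * f +
      monoF (-(p : ℤ)) (sgn ℂ σ / (p : ℂ)) * (eulerF f + shiftA p N σ • f) := rfl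

theorem formalA_coeff (p N : ℕ) (σ : ℤˣ) (f : FLS) (e : ℤ) :
    (formalA p N σ f).coeff e = f.coeff (e + 1) +
      sgn ℂ σ / (p : ℂ) * ((-((e - p : ℤ) : ℂ) + shiftA p N σ) * f.coeff (e - p)) := by
  rw [formalA_apply, FLS.coeff_add, FLS.coeff_monoF_mul, FLS.coeff_monoF_mul, FLS.coeff_add,
    FLS.coeff_smul, eulerF_coeff, ← sub_eq_add_neg]
  ring

/-- Multiplication by `z ^ p`. -/
def mulZ (p : ℕ) : Module.End ℂ FLS := LinearMap.mulLeft ℂ (monoF p 1)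

theorem mulZ_apply (p : ℕ) (f : FLS) : mulZ p f = monoF p 1 * f := rfl

/-- Only z d/dz fails to commute with z^p, and the factor σ/(p z^p) turns the commutator p z^p into
a constant. -/
theorem formalA_mul_mulZ {p : ℕ} (hp : p ≠ 0) (N : ℕ) (σ : ℤˣ) :
    formalA p N σ * mulZ p = mulZ p * formalA p N σ + sgn ℂ σ • 1 := by
  ext f
  refine FLS.ext fun e => ?_
  simp only [LinearMap.add_apply, Module.End.mul_apply, LinearMap.smul_apply, Module.End.one_apply,
    FLS.coeff_add, FLS.coeff_smul, mulZ_apply, formalA_coeff, FLS.coeff_monoF_mul]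
  rw [show e + 1 + (p : ℤ) = e + p + 1 by ring, show e - p + (p : ℤ) = e by ring,
    show e + p - (p : ℤ) = e by ring]
  have : (p : ℂ) ≠ 0 := by exact_mod_cast hp
  push_cast
  field_simp
  ring

end FormalLaurent

/-! ### Polynomials in an operator: constant commutators and intertwining maps -/

section Commutation

open Polynomial

variable {𝒜 : Type*} [Ring 𝒜] [Algebra ℂ 𝒜]

/-- If `[a, b] = s` then `[Q(a), b] = s Q'(a)`. -/
theorem aeval_mul_of_commutator {a b : 𝒜} {s : ℂ} (h : a * b = b * a + s • 1) (Q : ℂ[X]) :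
    aeval a Q * b = b * aeval a Q + s • aeval a (derivative Q) := by
  induction Q using Polynomial.induction_on' with
  | add P Q hP hQ =>
    simp only [map_add, add_mul, mul_add, hP, hQ, smul_add]
    abel
  | monomial i c =>
    have hi : a ^ i * b = b * a ^ i + (s * i) • a ^ (i - 1) := by
      induction i with
      | zero => simp
      | succ i ih =>
        rw [pow_succ', mul_assoc, ih, mul_add, ← mul_assoc, h, add_mul, smul_mul_assoc, one_mul,
          mul_smul_comm, mul_assoc, add_assoc, ← pow_succ', Nat.add_sub_cancel]
        congr 1
        rcases i with _ | i
        · simp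
        · rw [Nat.add_sub_cancel, ← pow_succ', ← add_smul]
          congr 1
          push_cast
          ring
    rw [derivative_monomial, aeval_monomial, aeval_monomial, ← Algebra.smul_def, ← Algebra.smul_def,
      smul_mul_assoc, hi, smul_add, mul_smul_comm, smul_smul, smul_smul]
    congr 2
    ring

/-- Linear maps which intertwine `a` and `b` intertwine `Q(a)` and `Q(b)`. -/
theorem aeval_intertwine {V V' : Type*} [AddCommGroup V] [Module ℂ V] [AddCommGroup V']
    [Module ℂ V'] (L : V →ₗ[ℂ] V') {a : Module.End ℂ V} {b : Module.End ℂ V'}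
    (h : ∀ v, L (a v) = b (L v)) (Q : ℂ[X]) (v : V) : L (aeval a Q v) = aeval b Q (L v) := by
  induction Q using Polynomial.induction_on' with
  | add P Q hP hQ => simp [hP, hQ]
  | monomial i c =>
    have hi : ∀ v, L ((a ^ i) v) = (b ^ i) (L v) := by
      induction i with
      | zero => simp
      | succ i ih =>
        intro v
        rw [pow_succ, pow_succ, Module.End.mul_apply, Module.End.mul_apply, ih, h]
    simp [aeval_monomial, Module.algebraMap_end_apply, hi]

end Commutation

/-! ### Leading terms under powers of A^σ -/

section Leading

/-- `f = c z ^ m + (lower powers of z)`. -/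
def Lead (m : ℤ) (c : ℂ) (f : FLS) : Prop := f.coeff (-m) = c ∧ ∀ e < -m, f.coeff e = 0

theorem Lead.add {m : ℤ} {c c' : ℂ} {f g : FLS} (hf : Lead m c f) (hg : Lead m c' g) :
    Lead m (c + c') (f + g) :=
  ⟨by rw [FLS.coeff_add, hf.1, hg.1], fun e he => by
    rw [FLS.coeff_add, hf.2 e he, hg.2 e he, add_zero]⟩

theorem Lead.smul {m : ℤ} {c : ℂ} {f : FLS} (hf : Lead m c f) (r : ℂ) :
    Lead m (r * c) (r • f) :=
  ⟨by rw [FLS.coeff_smul, hf.1], fun e he => by rw [FLS.coeff_smul, hf.2 e he, mul_zero]⟩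

theorem Lead.sub {m : ℤ} {c c' : ℂ} {f g : FLS} (hf : Lead m c f) (hg : Lead m c' g) :
    Lead m (c - c') (f - g) :=
  ⟨by rw [FLS.coeff_sub, hf.1, hg.1], fun e he => by
    rw [FLS.coeff_sub, hf.2 e he, hg.2 e he, sub_zero]⟩

theorem lead_zero (m : ℤ) : Lead m 0 0 := ⟨rfl, fun _ _ => rfl⟩

theorem Lead.of_lt {m m' : ℤ} {c : ℂ} {f : FLS} (hf : Lead m c f) (h : m < m') : Lead m' 0 f :=
  ⟨hf.2 _ (by omega), fun e he => hf.2 e (by omega)⟩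

theorem Lead.sum {ι : Type*} (s : Finset ι) {m : ℤ} {c : ι → ℂ} {f : ι → FLS}
    (h : ∀ i ∈ s, Lead m (c i) (f i)) : Lead m (∑ i ∈ s, c i) (∑ i ∈ s, f i) := by
  classical
  induction s using Finset.induction_on with
  | empty => simpa using lead_zero m
  | insert i s hi ih =>
    rw [Finset.sum_insert hi, Finset.sum_insert hi]
    exact (h i (Finset.mem_insert_self _ _)).add
      (ih fun j hj => h j (Finset.mem_insert_of_mem hj))

theorem Lead.monoF_mul {m : ℤ} {c : ℂ} {f : FLS} (hf : Lead m c f) (l : ℤ) (r : ℂ) :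
    Lead (m + l) (r * c) (monoF l r * f) :=
  ⟨by rw [FLS.coeff_monoF_mul, show -(m + l) + l = -m by ring, hf.1], fun e he => by
    rw [FLS.coeff_monoF_mul, hf.2 _ (by omega), mul_zero]⟩

theorem Lead.eulerF_add {m : ℤ} {c : ℂ} {f : FLS} (hf : Lead m c f) (r : ℂ) :
    Lead m ((m + r) * c) (eulerF f + r • f) :=
  ⟨by rw [FLS.coeff_add, FLS.coeff_smul, eulerF_coeff, hf.1]; push_cast; ring, fun e he => by
    rw [FLS.coeff_add, FLS.coeff_smul, eulerF_coeff, hf.2 e he]; ring⟩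

variable {p : ℕ} (hp : p ≠ 0) (N : ℕ) (σ : ℤˣ)
include hp

theorem Lead.formalA {m : ℤ} {c : ℂ} {f : FLS} (hf : Lead m c f) :
    Lead (m + 1) c (formalA p N σ f) := by
  have h1 := hf.monoF_mul 1 1
  have h2 := ((hf.eulerF_add (shiftA p N σ)).monoF_mul (-(p : ℤ)) (sgn ℂ σ / (p : ℂ))).of_lt
    (m' := m + 1) (by omega)
  simpa [formalA_apply] using h1.add h2

theorem Lead.formalA_pow {m : ℤ} {c : ℂ} {f : FLS} (hf : Lead m c f) (i : ℕ) :
    Lead (m + i) c ((KVec.formalA p N σ ^ i) f) := by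
  induction i with
  | zero => simpa using hf
  | succ i ih =>
    rw [pow_succ', Module.End.mul_apply]
    have := Lead.formalA hp N σ ih
    rwa [show m + ((i + 1 : ℕ) : ℤ) = m + i + 1 by push_cast; ring]

/-- From A^(i+1) f - z^(i+1) f = A (A^i f - z^i f) + (A - z) z^i f: each factor A contributes its
correction once, on a series z^l f of degree m + l, and products of two corrections have lower
degree. -/
theorem Lead.formalA_pow_sub {m : ℤ} {c : ℂ} {f : FLS} (hf : Lead m c f) (i : ℕ) :
    Lead (m + i - p - 1) (sgn ℂ σ / p * ((∑ l ∈ Finset.range i, ((m : ℂ) + l + shiftA p N σ)) * c))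
      ((KVec.formalA p N σ ^ i) f - monoF i 1 * f) := by
  induction i with
  | zero => simpa [monoF_zero_one] using lead_zero _
  | succ i ih =>
    have h1 := Lead.formalA hp N σ ih
    have h2 := ((hf.monoF_mul i 1).eulerF_add (shiftA p N σ)).monoF_mul (-(p : ℤ))
      (sgn ℂ σ / (p : ℂ))
    rw [show m + (i : ℤ) - p - 1 + 1 = m + ((i + 1 : ℕ) : ℤ) - p - 1 by push_cast; ring] at h1
    rw [show m + (i : ℤ) + -(p : ℤ) = m + ((i + 1 : ℕ) : ℤ) - p - 1 by push_cast; ring] at h2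
    convert h1.add h2 using 1
    · rw [Finset.sum_range_succ]
      push_cast
      ring
    · rw [map_sub, formalA_apply _ _ _ (monoF i 1 * f), pow_succ', Module.End.mul_apply,
        ← mul_assoc (monoF 1 1), monoF_mul_monoF, one_mul, add_comm (1 : ℤ)]
      push_cast
      ring

/-- Summing l over 0 ≤ l < p gives p(p-1)/2, which the constant -(p-1)/2 in A^σ is chosen to cancel.
-/
theorem Lead.formalA_pow_sub_mulZ {m : ℤ} {c : ℂ} {f : FLS} (hf : Lead m c f) :
    Lead (m - 1) ((sgn ℂ σ * m + N) * c) ((KVec.formalA p N σ ^ p) f - mulZ p f) := by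
  have h := Lead.formalA_pow_sub hp N σ hf p
  rw [show m + (p : ℤ) - p - 1 = m - 1 by ring] at h
  refine (?_ : (sgn ℂ σ * m + N) * c = _) ▸ h
  have hp' : (p : ℂ) ≠ 0 := by exact_mod_cast hp
  have hs : (∑ l ∈ Finset.range p, ((m : ℂ) + l + shiftA p N σ)) =
      p * (m + shiftA p N σ + (p - 1) / 2) := by
    have h1 : (∑ l ∈ Finset.range p, (l : ℂ)) = p * (p - 1) / 2 := by
      clear h hf hp hp'
      induction p with
      | zero => simp
      | succ p ih => rw [Finset.sum_range_succ, ih]; push_cast; ring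
    have h2 : (∑ l ∈ Finset.range p, ((m : ℂ) + l + shiftA p N σ)) =
        ∑ l ∈ Finset.range p, (l : ℂ) + p * (m + shiftA p N σ) := by
      have h3 : ∑ _l ∈ Finset.range p, ((m : ℂ) + shiftA p N σ) = p * (m + shiftA p N σ) := by
        rw [Finset.sum_const, Finset.card_range, nsmul_eq_mul]
      rw [← h3, ← Finset.sum_add_distrib]
      exact Finset.sum_congr rfl fun l _ => by ring
    rw [h2, h1]
    ring
  have hσ := sgn_mul_self ℂ σ
  rw [hs, shiftA]
  field_simp
  linear_combination (-(N : ℂ) * c * 2) * hσ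

open Polynomial in
theorem Lead.aeval_formalA {m : ℤ} {c : ℂ} {f : FLS} (hf : Lead m c f) {Q : ℂ[X]} {k : ℕ}
    (hQ : Q.natDegree ≤ k) :
    Lead (m + k) (Q.coeff k * c) (aeval (KVec.formalA p N σ) Q f) := by
  rw [aeval_eq_sum_range' (Nat.lt_succ_of_le hQ), LinearMap.sum_apply, Finset.sum_range_succ]
  have h1 : Lead (m + k) 0 (∑ i ∈ Finset.range k, (Q.coeff i • KVec.formalA p N σ ^ i) f) := by
    have := Lead.sum (Finset.range k) (m := m + k) (c := fun _ => 0)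
      (f := fun i => (Q.coeff i • KVec.formalA p N σ ^ i) f) fun i hi => by
        have := ((hf.formalA_pow hp N σ i).of_lt (m' := m + k)
          (by rw [Finset.mem_range] at hi; omega)).smul (Q.coeff i)
        rwa [mul_zero] at this
    simpa using this
  simpa using h1.add ((hf.formalA_pow hp N σ k).smul (Q.coeff k))

end Leading

/-! ### The formal differential equation and the subspace generated by its solution -/

section FormalODE

open Polynomial

variable {k : ℕ}

theorem applyPoly_eq_aeval {M : Type*} [AddCommGroup M] [Module ℂ M] (A : Module.End ℂ M)
    (Q : ℂ[X]) (f : M) : applyPoly A Q f = aeval A Q f := by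
  rw [applyPoly, aeval_eq_sum_range, LinearMap.sum_apply, Polynomial.sum_over_range _ (by simp)]
  exact Finset.sum_congr rfl fun i _ => by rw [LinearMap.smul_apply, Module.End.pow_apply]

/-- The operator `(A^p - Z) P_k(A) - σ P_k'(A) - ∑ nᵢ ∏_{j ≠ i} (A - wⱼ)`. -/
def odeEnd {M : Type*} [AddCommGroup M] [Module ℂ M] (p : ℕ) (w : Fin k → ℝ) (n : Fin k → ℕ)
    (σ : ℤˣ) (A Z : Module.End ℂ M) : Module.End ℂ M :=
  A ^ p * aeval A (polyP w) - Z * aeval A (polyP w) - sgn ℂ σ • aeval A (derivative (polyP w)) -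
    aeval A (polyR w n)

theorem odeOp_eq_odeEnd {M : Type*} [AddCommGroup M] [Module ℂ M] (p : ℕ) (w : Fin k → ℝ)
    (n : Fin k → ℕ) (σ : ℤˣ) (A Z : Module.End ℂ M) (f : M) :
    odeOp p w n σ A Z f = odeEnd p w n σ A Z f := by
  simp only [odeOp, odeEnd, applyPoly_eq_aeval, LinearMap.sub_apply, Module.End.mul_apply,
    LinearMap.smul_apply, Module.End.pow_apply]

theorem odeEnd_intertwine {V V' : Type*} [AddCommGroup V] [Module ℂ V] [AddCommGroup V']
    [Module ℂ V'] (L : V →ₗ[ℂ] V') {a z : Module.End ℂ V} {b z' : Module.End ℂ V'}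
    (h : ∀ v, L (a v) = b (L v)) (hz : ∀ v, L (z v) = z' (L v)) (p : ℕ) (w : Fin k → ℝ)
    (n : Fin k → ℕ) (σ : ℤˣ) (v : V) :
    L (odeEnd p w n σ a z v) = odeEnd p w n σ b z' (L v) := by
  have hp : ∀ v, L ((a ^ p) v) = (b ^ p) (L v) := fun v => by
    simpa using aeval_intertwine L h (X ^ p) v
  simp only [odeEnd, LinearMap.sub_apply, Module.End.mul_apply, LinearMap.smul_apply, map_sub,
    map_smul, hp, hz, aeval_intertwine L h]

theorem monic_polyP (w : Fin k → ℝ) : (polyP w).Monic :=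
  monic_prod_of_monic _ _ fun _ _ => monic_X_sub_C _

theorem natDegree_polyP (w : Fin k → ℝ) : (polyP w).natDegree = k := by
  rw [polyP, natDegree_prod_of_monic _ _ fun _ _ => monic_X_sub_C _]
  simp

theorem natDegree_prod_erase {k : ℕ} (w : Fin (k + 1) → ℝ) (i : Fin (k + 1)) :
    (∏ j ∈ Finset.univ.erase i, (X - C (w j : ℂ))).natDegree = k := by
  rw [natDegree_prod_of_monic _ _ fun _ _ => monic_X_sub_C _]
  simp

theorem polyR_natDegree_le {k : ℕ} (w : Fin (k + 1) → ℝ) (n : Fin (k + 1) → ℕ) :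
    (polyR w n).natDegree ≤ k := by
  refine natDegree_sum_le_of_forall_le _ _ fun i _ => ?_
  refine (natDegree_C_mul_le _ _).trans ?_
  rw [natDegree_prod_erase]

theorem polyR_coeff {k : ℕ} (w : Fin (k + 1) → ℝ) (n : Fin (k + 1) → ℕ) :
    (polyR w n).coeff k = ((∑ i, n i : ℕ) : ℂ) := by
  rw [polyR, finsetSum_coeff, Nat.cast_sum]
  refine Finset.sum_congr rfl fun i _ => ?_
  have h : (∏ j ∈ Finset.univ.erase i, (X - C (w j : ℂ))).Monic :=
    monic_prod_of_monic _ _ fun _ _ => monic_X_sub_C _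
  have h2 := h.coeff_natDegree
  rw [natDegree_prod_erase] at h2
  rw [coeff_C_mul, h2, mul_one]

variable {p : ℕ} (hp : p ≠ 0) (w : Fin k → ℝ) (n : Fin k → ℕ) (σ : ℤˣ)
include hp

/-- With N = ∑ nᵢ, the three parts of the operator contribute σ(m + k) + N, -σk and -N to the
coefficient of z^(m+k-1). Only σm remains, so a nonzero solution must have degree m = 0. -/
theorem Lead.odeEnd {m : ℤ} {c : ℂ} {f : FLS} (hf : Lead m c f) :
    Lead (m + k - 1) (sgn ℂ σ * m * c)
      (odeEnd p w n σ (KVec.formalA p (∑ i, n i) σ) (mulZ p) f) := by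
  have hP := hf.aeval_formalA hp (∑ i, n i) σ (natDegree_polyP w).le
  have h1 := hP.formalA_pow_sub_mulZ hp (∑ i, n i) σ
  have hc : (polyP w).coeff k = 1 := by
    have := (monic_polyP w).coeff_natDegree
    rwa [natDegree_polyP] at this
  rw [hc, one_mul] at h1
  simp only [KVec.odeEnd, LinearMap.sub_apply, Module.End.mul_apply, LinearMap.smul_apply]
  -- For k = 0 the last two terms are absent and N is an empty sum; the degree k - 1 used below
  -- would not be a natural number.
  rcases k with _ | k
  · have hd : derivative (polyP w) = 0 := by simp [polyP]
    have hR : polyR w n = 0 := by simp [polyR]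
    rw [hd, hR, map_zero, LinearMap.zero_apply, smul_zero, sub_zero, sub_zero]
    simpa using h1
  · have hd : (derivative (polyP w)).natDegree ≤ k := by
      refine (natDegree_derivative_le _).trans ?_
      rw [natDegree_polyP]
      rfl
    have h2 := (hf.aeval_formalA hp (∑ i, n i) σ hd).smul (sgn ℂ σ)
    have h3 := hf.aeval_formalA hp (∑ i, n i) σ (polyR_natDegree_le w n)
    rw [coeff_derivative, hc, one_mul] at h2
    rw [polyR_coeff] at h3
    rw [show m + ((k + 1 : ℕ) : ℤ) - 1 = m + k by push_cast; ring] at h1 ⊢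
    convert (h1.sub h2).sub h3 using 1
    push_cast
    ring

/-- A nonzero difference of two such solutions would begin with some z^(-j), j ≥ 1, and the equation
multiplies its leading coefficient by -σj ≠ 0. -/
theorem formal_solution_unique {f g : FLS} (hf : IsMonicOfDegree 0 f) (hg : IsMonicOfDegree 0 g)
    (hf' : odeEnd p w n σ (formalA p (∑ i, n i) σ) (mulZ p) f = 0)
    (hg' : odeEnd p w n σ (formalA p (∑ i, n i) σ) (mulZ p) g = 0) : f = g := by
  rw [← sub_eq_zero]
  set h := f - g with hh
  have h0 : ∀ e ≤ 0, h.coeff e = 0 := by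
    intro e he
    rcases lt_or_eq_of_le he with he | rfl
    · rw [hh, FLS.coeff_sub, hf.2 e (by simpa using he), hg.2 e (by simpa using he), sub_zero]
    · have h1 := hf.1
      have h2 := hg.1
      rw [neg_zero] at h1 h2
      rw [hh, FLS.coeff_sub, h1, h2, sub_self]
  have hode : odeEnd p w n σ (formalA p (∑ i, n i) σ) (mulZ p) h = 0 := by
    rw [hh, map_sub, hf', hg', sub_zero]
  have key : ∀ j : ℕ, ∀ e < (j : ℤ), h.coeff e = 0 := by
    intro j
    induction j with
    | zero => exact fun e he => h0 e (by simpa using he.le)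
    | succ j ih =>
      intro e he
      rcases lt_or_eq_of_le (show e ≤ j by push_cast at he; omega) with he | rfl
      · exact ih e he
      · rcases Nat.eq_zero_or_pos j with rfl | hj
        · exact h0 _ (by simp)
        · have hl : Lead (-(j : ℤ)) (h.coeff j) h := ⟨by rw [neg_neg], fun e he => ih e (by omega)⟩
          have h1 := (hl.odeEnd hp w n σ).1
          rw [hode, FLS.coeff_zero] at h1
          have hσ : sgn ℂ σ ≠ 0 := fun h => by
            have := sgn_mul_self ℂ σ
            rw [h, zero_mul] at this
            exact zero_ne_one this
          have hj' : ((-(j : ℤ) : ℤ) : ℂ) ≠ 0 := by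
            push_cast
            exact neg_ne_zero.2 (by exact_mod_cast hj.ne')
          have := mul_eq_zero.1 h1.symm
          rcases this with h2 | h2
          · exact absurd h2 (mul_ne_zero hσ hj')
          · exact h2
  exact FLS.ext fun e => key (e + 1).toNat e (by omega)

/-! ### The subspaces `𝒲^σ` -/

theorem isGrPoint_cyclicSpan (N : ℕ) {φ : FLS} (hφ : IsMonicOfDegree 0 φ) :
    IsGrPoint (cyclicSpan (formalA p N σ) φ) := by
  refine ⟨fun i => (formalA p N σ ^ i) φ, fun i => ?_, rfl⟩
  have := Lead.formalA_pow hp N σ (m := 0) (c := 1) hφ i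
  rwa [zero_add] at this

omit hp in
theorem mem_cyclicSpan_iff (A : Module.End ℂ FLS) (φ f : FLS) :
    f ∈ cyclicSpan A φ ↔ ∃ Q : ℂ[X], aeval A Q φ = f := by
  constructor
  · intro h
    refine Submodule.span_induction (fun x hx => ?_) ⟨0, by simp⟩ (fun x y _ _ hx hy => ?_)
      (fun c x _ hx => ?_) h
    · obtain ⟨i, rfl⟩ := hx
      exact ⟨X ^ i, by simp⟩
    · obtain ⟨Q, rfl⟩ := hx
      obtain ⟨Q', rfl⟩ := hy
      exact ⟨Q + Q', by simp⟩
    · obtain ⟨Q, rfl⟩ := hx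
      exact ⟨c • Q, by simp⟩
  · rintro ⟨Q, rfl⟩
    rw [aeval_eq_sum_range, LinearMap.sum_apply]
    refine Submodule.sum_mem _ fun i _ => ?_
    rw [LinearMap.smul_apply]
    exact Submodule.smul_mem _ _ (Submodule.subset_span ⟨i, rfl⟩)

/-- `Q ↦ Q(A) φ`. -/
def evalAt (A : Module.End ℂ FLS) (φ : FLS) : ℂ[X] →ₗ[ℂ] FLS :=
  (LinearMap.applyₗ φ) ∘ₗ (aeval A : ℂ[X] →ₐ[ℂ] Module.End ℂ FLS).toLinearMap

omit hp in
theorem evalAt_apply (A : Module.End ℂ FLS) (φ : FLS) (Q : ℂ[X]) :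
    evalAt A φ Q = aeval A Q φ := rfl

/-- Q(A)φ has degree deg Q in z and the same leading coefficient as Q. -/
theorem evalAt_injective (N : ℕ) {φ : FLS} (hφ : IsMonicOfDegree 0 φ) :
    Function.Injective (evalAt (formalA p N σ) φ) := by
  rw [← LinearMap.ker_eq_bot, LinearMap.ker_eq_bot']
  intro Q hQ
  have h := (Lead.aeval_formalA hp N σ (m := 0) (c := 1) hφ (le_refl Q.natDegree)).1
  rw [← evalAt_apply, hQ, FLS.coeff_zero, mul_one] at h
  exact leadingCoeff_eq_zero.1 h.symm

/-- Q ↦ Q(A)φ is an isomorphism of ℂ[X] onto the span which takes the ideal of P_k to the image of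
P_k(A). The quotient is thus ℂ[X]/(P_k), with deg P_k = k. -/
theorem rank_quotient_cyclicSpan (N : ℕ) {φ : FLS} (hφ : IsMonicOfDegree 0 φ) :
    Module.rank ℂ (cyclicSpan (formalA p N σ) φ ⧸ ((cyclicSpan (formalA p N σ) φ).map
      (aeval (formalA p N σ) (polyP w))).submoduleOf (cyclicSpan (formalA p N σ) φ)) = k := by
  set A := formalA p N σ
  have hr : LinearMap.range (evalAt A φ) = cyclicSpan A φ := by
    ext f
    rw [mem_cyclicSpan_iff]
    rfl
  let e : ℂ[X] ≃ₗ[ℂ] cyclicSpan A φ :=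
    (LinearEquiv.ofInjective _ (evalAt_injective hp σ N hφ)).trans (LinearEquiv.ofEq _ _ hr)
  have he : ∀ Q, ((e Q : cyclicSpan A φ) : FLS) = aeval A Q φ := fun Q => rfl
  have hmap : ((Ideal.span {polyP w}).restrictScalars ℂ).map (e : ℂ[X] →ₗ[ℂ] cyclicSpan A φ) =
      ((cyclicSpan A φ).map (aeval A (polyP w))).submoduleOf (cyclicSpan A φ) := by
    ext ⟨f, hf⟩
    rw [Submodule.submoduleOf, Submodule.mem_comap, Submodule.mem_map, Submodule.mem_map]
    constructor
    · rintro ⟨Q, hQ, hQf⟩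
      rw [Submodule.restrictScalars_mem, Ideal.mem_span_singleton] at hQ
      obtain ⟨Q', rfl⟩ := hQ
      refine ⟨aeval A Q' φ, (mem_cyclicSpan_iff _ _ _).2 ⟨Q', rfl⟩, ?_⟩
      rw [← Module.End.mul_apply, ← map_mul, ← he]
      exact congrArg Subtype.val hQf
    · rintro ⟨g, hg, hgf⟩
      obtain ⟨Q, rfl⟩ := (mem_cyclicSpan_iff _ _ _).1 hg
      refine ⟨polyP w * Q, ?_, Subtype.ext ?_⟩
      · rw [Submodule.restrictScalars_mem, Ideal.mem_span_singleton]
        exact dvd_mul_right _ _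
      · refine Eq.trans ?_ hgf
        rw [← Module.End.mul_apply, ← map_mul]
        exact he _
  have h1 := (Submodule.Quotient.equiv _ _ e hmap).rank_eq
  rw [← h1]
  have h2 := (AdjoinRoot.powerBasis' (monic_polyP w)).dim
  -- `AdjoinRoot` is by definition the quotient by this ideal, so its power basis has the required
  -- size.
  have h3 : Module.rank ℂ (AdjoinRoot (polyP w)) = k := by
    have := (AdjoinRoot.powerBasis' (monic_polyP w)).basis.mk_eq_rank''
    rw [← this, Cardinal.mk_fin, AdjoinRoot.powerBasis'_dim, natDegree_polyP]
  exact h3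

/-- Moving z^p past Q(A) costs only the term -σ Q'(A), and on P_k(A)φ the differential equation
rewrites z^p as a polynomial in A applied to φ. -/
theorem isVectorReducedVia_cyclicSpan {φ : FLS} (hφ : IsMonicOfDegree 0 φ)
    (hode : odeEnd p w n σ (formalA p (∑ i, n i) σ) (mulZ p) φ = 0) :
    IsVectorReducedVia k p (cyclicSpan (formalA p (∑ i, n i) σ) φ)
      ((cyclicSpan (formalA p (∑ i, n i) σ) φ).map
        (aeval (formalA p (∑ i, n i) σ) (polyP w))) := by
  set A := formalA p (∑ i, n i) σ with hA
  have hmem : ∀ Q : ℂ[X], aeval A Q φ ∈ cyclicSpan A φ := fun Q =>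
    (mem_cyclicSpan_iff _ _ _).2 ⟨Q, rfl⟩
  have hinv : ∀ (Q : ℂ[X]) (f : FLS), f ∈ cyclicSpan A φ → aeval A Q f ∈ cyclicSpan A φ := by
    intro Q f hf
    obtain ⟨Q', rfl⟩ := (mem_cyclicSpan_iff _ _ _).1 hf
    rw [← Module.End.mul_apply, ← map_mul]
    exact hmem _
  refine ⟨?_, rank_quotient_cyclicSpan hp w σ _ hφ, ?_⟩
  · rintro f ⟨g, hg, rfl⟩
    exact hinv _ _ hg
  · rintro f ⟨g, hg, rfl⟩
    obtain ⟨Q, rfl⟩ := (mem_cyclicSpan_iff _ _ _).1 hg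
    have hcomm := aeval_mul_of_commutator (formalA_mul_mulZ hp (∑ i, n i) σ) Q
    have h1 : mulZ p (aeval A Q (aeval A (polyP w) φ)) =
        aeval A Q (mulZ p (aeval A (polyP w) φ)) -
          sgn ℂ σ • aeval A (derivative Q) (aeval A (polyP w) φ) := by
      rw [eq_sub_iff_add_eq]
      exact (LinearMap.congr_fun hcomm (aeval A (polyP w) φ)).symm
    have h2 : mulZ p (aeval A (polyP w) φ) = aeval A (X ^ p * polyP w) φ -
        sgn ℂ σ • aeval A (derivative (polyP w)) φ - aeval A (polyR w n) φ := by
      have := hode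
      simp only [odeEnd, LinearMap.sub_apply, Module.End.mul_apply, LinearMap.smul_apply] at this
      rw [map_mul, map_pow, aeval_X, Module.End.mul_apply]
      rw [sub_sub, sub_sub, sub_eq_zero] at this
      rw [sub_sub, this]
      abel
    have h3 : monoF p 1 * aeval A (polyP w) (aeval A Q φ) =
        mulZ p (aeval A Q (aeval A (polyP w) φ)) := by
      rw [mulZ_apply, ← Module.End.mul_apply, ← Module.End.mul_apply, ← map_mul, ← map_mul,
        mul_comm Q]
    rw [h3, h1, h2]
    refine Submodule.sub_mem _ (hinv _ _ ?_) (Submodule.smul_mem _ _ (hinv _ _ (hmem _)))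
    exact Submodule.sub_mem _ (Submodule.sub_mem _ (hmem _) (Submodule.smul_mem _ _ (hmem _)))
      (hmem _)

theorem map_cyclicSpan_le (A : Module.End ℂ FLS) (φ : FLS) :
    (cyclicSpan A φ).map A ≤ cyclicSpan A φ := by
  rintro f ⟨g, hg, rfl⟩
  obtain ⟨Q, rfl⟩ := (mem_cyclicSpan_iff _ _ _).1 hg
  exact (mem_cyclicSpan_iff _ _ _).2 ⟨X * Q, by simp⟩

/-- Linear forms with prescribed values on `A^j φ`. -/
theorem exists_linearForm (N : ℕ) {φ : FLS} (hφ : IsMonicOfDegree 0 φ) (c x : ℂ) :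
    ∃ l : FLS →ₗ[ℂ] ℂ, ∀ j : ℕ, l ((formalA p N σ ^ j) φ) = c * x ^ j := by
  -- The form is a left inverse of Q ↦ Q(A)φ, defined on all Laurent series, followed by evaluation
  -- of polynomials at `x`.
  obtain ⟨g, hg⟩ := LinearMap.exists_leftInverse_of_injective _
    (LinearMap.ker_eq_bot.2 (evalAt_injective hp σ N hφ))
  refine ⟨c • (aeval x : ℂ[X] →ₐ[ℂ] ℂ).toLinearMap ∘ₗ g, fun j => ?_⟩
  have h1 : (formalA p N σ ^ j) φ = evalAt (formalA p N σ) φ (X ^ j) := by simp [evalAt_apply]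
  have h2 := LinearMap.congr_fun hg (X ^ j)
  rw [LinearMap.comp_apply, LinearMap.id_apply] at h2
  rw [h1]
  simp [h2]

end FormalODE

/-! ### Wave functions of operators with power series coefficients -/

section Wave

variable {τ : Type*}

/-- The symbol of an operator with `D^(-e)` replaced by `(σ z)^(-e)`. -/
def symb (σ : ℤˣ) (P : PDO (MvPowerSeries τ ℂ)) : MvPowerSeries τ FLS := fun α =>
  FLS.of (coeffwise (fun e => sgn ℂ (σ ^ e)) (P.map (MvPowerSeries.coeff (R := ℂ) α)))

theorem symb_coeff (σ : ℤˣ) (P : PDO (MvPowerSeries τ ℂ)) (α : τ →₀ ℕ) (e : ℤ) :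
    (MvPowerSeries.coeff α (symb σ P)).coeff e =
      sgn ℂ (σ ^ e) * MvPowerSeries.coeff α (P.coeff e) := rfl

theorem FLS.mv_ext {F G : MvPowerSeries τ FLS}
    (h : ∀ α e, (MvPowerSeries.coeff α F).coeff e = (MvPowerSeries.coeff α G).coeff e) : F = G :=
  MvPowerSeries.ext fun α => FLS.ext fun e => h α e

theorem FLS.coeff_algebraMap_mul (c : ℂ) (f : FLS) (e : ℤ) :
    (algebraMap ℂ FLS c * f).coeff e = c * f.coeff e := by
  rw [← Algebra.smul_def, FLS.coeff_smul]

theorem symb_add (σ : ℤˣ) (P Q : PDO (MvPowerSeries τ ℂ)) :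
    symb σ (P + Q) = symb σ P + symb σ Q :=
  FLS.mv_ext fun α e => by
    rw [map_add, FLS.coeff_add, symb_coeff, symb_coeff, symb_coeff, HahnSeries.coeff_add, map_add,
      mul_add]

theorem mv_coeff_smul_FLS (c : ℂ) (F : MvPowerSeries τ FLS) (α : τ →₀ ℕ) :
    MvPowerSeries.coeff α (c • F) = c • MvPowerSeries.coeff α F := rfl

theorem symb_smul (σ : ℤˣ) (c : ℂ) (P : PDO (MvPowerSeries τ ℂ)) :
    symb σ (c • P) = c • symb σ P :=
  FLS.mv_ext fun α e => by
    rw [mv_coeff_smul_FLS, FLS.coeff_smul, symb_coeff, symb_coeff, HahnSeries.coeff_smul,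
      MvPowerSeries.coeff_smul]
    ring

theorem symb_injective (σ : ℤˣ) {P Q : PDO (MvPowerSeries τ ℂ)} (h : symb σ P = symb σ Q) :
    P = Q := by
  ext e α
  have h1 := congrArg (fun F => (MvPowerSeries.coeff α F).coeff e) h
  simp only [symb_coeff] at h1
  have h2 : sgn ℂ (σ ^ e) ≠ 0 := fun h0 => by
    have := sgn_mul_self ℂ (σ ^ e)
    rw [h0, zero_mul] at this
    exact zero_ne_one this
  exact mul_left_cancel₀ h2 h1

/-- Power series over `ℂ` as power series over `FLS`. -/
abbrev toFLS : MvPowerSeries τ ℂ →+* MvPowerSeries τ FLS :=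
  MvPowerSeries.map (σ := τ) (algebraMap ℂ FLS)

theorem symb_multOp_mul (σ : ℤˣ) (h : MvPowerSeries τ ℂ) (P : PDO (MvPowerSeries τ ℂ)) :
    symb σ (multOp h * P) = toFLS h * symb σ P := by
  classical
  refine FLS.mv_ext fun α e => ?_
  rw [symb_coeff, multOp, HahnSeries.coeff_single_zero_mul, MvPowerSeries.coeff_mul,
    MvPowerSeries.coeff_mul, FLS.coeff_sum, Finset.mul_sum]
  refine Finset.sum_congr rfl fun x _ => ?_
  rw [MvPowerSeries.coeff_map, FLS.coeff_algebraMap_mul, symb_coeff]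
  ring

theorem mv_coeff_sgn_mul (α : τ →₀ ℕ) (s : ℤˣ) (f : MvPowerSeries τ ℂ) :
    MvPowerSeries.coeff α (f * sgn _ s) = sgn ℂ s * MvPowerSeries.coeff α f := by
  rcases Int.units_eq_one_or s with rfl | rfl
  · rw [sgn_one, sgn_one, mul_one, one_mul]
  · rw [sgn_neg, sgn_neg, sgn_one, sgn_one, mul_neg, mul_one, map_neg, neg_mul, one_mul]

theorem symb_mul_signedD (σ : ℤˣ) (P : PDO (MvPowerSeries τ ℂ)) (m : ℤ) :
    symb σ (P * signedD _ σ m) = MvPowerSeries.C (monoF m 1) * symb σ P := by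
  refine FLS.mv_ext fun α e => ?_
  rw [symb_coeff, signedD, HahnSeries.coeff_mul_single, mv_coeff_sgn_mul,
    MvPowerSeries.coeff_C_mul, FLS.coeff_monoF_mul, symb_coeff, sub_neg_eq_add, zpow_add, sgn_mul]
  ring

theorem mv_coeff_natCast_mul (f : FLS) (m : ℕ) (e : ℤ) :
    (f * ((m : FLS) + 1)).coeff e = f.coeff e * ((m : ℂ) + 1) := by
  have : ((m : FLS) + 1) = algebraMap ℂ FLS (m + 1) := by simp
  rw [this, mul_comm, FLS.coeff_algebraMap_mul, mul_comm]

theorem symb_mapD (σ : ℤˣ) (i : τ) (P : PDO (MvPowerSeries τ ℂ)) :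
    symb σ (mapD (MvPowerSeries.pderiv ℂ i) 1 P) = MvPowerSeries.pderiv FLS i (symb σ P) := by
  refine FLS.mv_ext fun α e => ?_
  rw [symb_coeff, mapD_one_coeff, MvPowerSeries.coeff_pderiv, MvPowerSeries.coeff_pderiv,
    mv_coeff_natCast_mul, symb_coeff, mul_assoc]

/-- `∂/∂xᵢ` as a linear map over `ℂ`. -/
def pdF (i : τ) : Module.End ℂ (MvPowerSeries τ FLS) where
  toFun F := MvPowerSeries.pderiv FLS i F
  map_add' F G := map_add _ F G
  map_smul' c F := by
    refine FLS.mv_ext fun α e => ?_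
    rw [RingHom.id_apply, MvPowerSeries.coeff_pderiv, mv_coeff_natCast_mul, mv_coeff_smul_FLS,
      mv_coeff_smul_FLS, FLS.coeff_smul, FLS.coeff_smul, MvPowerSeries.coeff_pderiv,
      mv_coeff_natCast_mul, mul_assoc]

theorem pdF_apply (i : τ) (F : MvPowerSeries τ FLS) : pdF i F = MvPowerSeries.pderiv FLS i F := rfl

/-- `P e^(σ x z + …)`, where `E` is the exponential factor. -/
def wave (d : Derivation ℂ (MvPowerSeries τ ℂ) (MvPowerSeries τ ℂ)) (σ : ℤˣ)
    (E : MvPowerSeries τ FLS) : Op d →ₗ[ℂ] MvPowerSeries τ FLS where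
  toFun P := E * symb σ ((op d).symm P)
  map_add' P Q := by rw [map_add, symb_add, mul_add]
  map_smul' c P := by rw [map_smul, symb_smul, mul_smul_comm, RingHom.id_apply]

variable {d : Derivation ℂ (MvPowerSeries τ ℂ) (MvPowerSeries τ ℂ)} {σ : ℤˣ}
  {E : MvPowerSeries τ FLS}

theorem wave_op (P : PDO (MvPowerSeries τ ℂ)) : wave d σ E (op d P) = E * symb σ P := rfl

theorem wave_mulOp_mul (h : MvPowerSeries τ ℂ) (P : Op d) :
    wave d σ E (mulOp d h * P) = toFLS h * wave d σ E P := by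
  obtain ⟨P, rfl⟩ := (op d).surjective P
  rw [← op_multOp_mul, wave_op, wave_op, symb_multOp_mul, mul_left_comm]

/-- As a right factor, (σD)^m meets only the exponential, where it is multiplication by z^m. -/
theorem wave_mul_sD (P : Op d) (m : ℤ) :
    wave d σ E (P * sD d σ m) = MvPowerSeries.C (monoF m 1) * wave d σ E P := by
  obtain ⟨P, rfl⟩ := (op d).surjective P
  rw [← op_signedD, ← op_comp, comp_signedD, wave_op, wave_op, symb_mul_signedD, mul_left_comm]

theorem smul_C_monoF (r c : ℂ) (m : ℤ) (F : MvPowerSeries τ FLS) :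
    r • (MvPowerSeries.C (monoF m c) * F) = MvPowerSeries.C (monoF m (r * c)) * F := by
  refine FLS.mv_ext fun α e => ?_
  rw [mv_coeff_smul_FLS, FLS.coeff_smul, MvPowerSeries.coeff_C_mul, MvPowerSeries.coeff_C_mul,
    FLS.coeff_monoF_mul, FLS.coeff_monoF_mul, mul_assoc]

theorem wave_dT {i : τ} {m : ℤ}
    (hE : MvPowerSeries.pderiv FLS i E = MvPowerSeries.C (monoF m (sgn ℂ σ)) * E)
    (P : PDO (MvPowerSeries τ ℂ)) :
    pdF i (wave d σ E (op d P)) = wave d σ E (op d (mapD (MvPowerSeries.pderiv ℂ i) 1 P)) +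
      sgn ℂ σ • (MvPowerSeries.C (monoF m 1) * wave d σ E (op d P)) := by
  rw [wave_op, wave_op, pdF_apply, Derivation.leibniz, symb_mapD, hE, smul_eq_mul, smul_eq_mul,
    smul_C_monoF, mul_one]
  ring

/-- D P = P D + P', where P' has the differentiated coefficients; on the wave the two terms are the
derivative of the exponential and the derivative of the amplitude. -/
theorem wave_D_mul {i : τ} (hd : d = MvPowerSeries.pderiv ℂ i)
    (hE : MvPowerSeries.pderiv FLS i E = MvPowerSeries.C (monoF 1 (sgn ℂ σ)) * E) (P : Op d) :
    wave d σ E (sD d σ 1 * P) = (sgn ℂ σ • pdF i) (wave d σ E P) := by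
  obtain ⟨P, rfl⟩ := (op d).surjective P
  have h1 : sD d σ 1 * op d P =
      op d P * sD d σ 1 + sgn ℂ σ • op d (mapD (MvPowerSeries.pderiv ℂ i) 1 P) := by
    have h2 : sD d 1 1 * op d P = op d P * sD d 1 1 +
        op d (mapD (MvPowerSeries.pderiv ℂ i) 1 P) := by
      rw [← op_signedD, ← op_comp, ← op_comp, comp_signedD, ← map_add, signedD, one_zpow, sgn_one,
        comp_D, mul_comm, hd]
    rcases Int.units_eq_one_or σ with rfl | rfl
    · rw [sgn_one, one_smul, h2]
    · rw [sD_neg, neg_mul, h2, sgn_neg, sgn_one, neg_smul, one_smul, mul_neg, neg_add]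
  rw [h1, map_add, map_smul, wave_mul_sD, LinearMap.smul_apply, wave_dT hE, smul_add, smul_smul,
    sgn_mul_self, one_smul, add_comm]

theorem wave_injective (hE : IsUnit E) : Function.Injective (wave d σ E) := by
  intro P Q h
  exact symb_injective σ (hE.mul_left_cancel h)

end Wave

/-! ### The exponential factor and its restriction to t = 0 -/

section ExpSeries

/-- `e^(σ (x z + ∑ tᵢ z^i))`. -/
def expXT (σ : ℤˣ) : MvPowerSeries ℕ FLS := fun α =>
  -- The variable of index 0 is x, which is paired with z just like t_1; hence the exponent `max i
  -- 1`.
  monoF ((α.sum fun i a => a * max i 1 : ℕ) : ℤ) (sgn ℂ σ ^ α.degree / α.prod fun _ a => (a.factorial : ℂ))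

theorem expXT_coeff (σ : ℤˣ) (α : ℕ →₀ ℕ) : MvPowerSeries.coeff α (expXT σ) =
    monoF ((α.sum fun i a => a * max i 1 : ℕ) : ℤ)
      (sgn ℂ σ ^ α.degree / α.prod fun _ a => (a.factorial : ℂ)) := rfl

theorem pderiv_expXT (σ : ℤˣ) (i : ℕ) : MvPowerSeries.pderiv FLS i (expXT σ) =
    MvPowerSeries.C (monoF (max i 1 : ℕ) (sgn ℂ σ)) * expXT σ := by
  refine FLS.mv_ext fun α e => ?_
  have h1 : (α + Finsupp.single i 1).sum (fun i a => a * max i 1) =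
      α.sum (fun i a => a * max i 1) + max i 1 := by
    rw [Finsupp.sum_add_index' (by simp) (by intros; ring), Finsupp.sum_single_index (by simp),
      one_mul]
  have h2 : (α + Finsupp.single i 1).prod (fun _ a => (a.factorial : ℂ)) =
      α.prod (fun _ a => (a.factorial : ℂ)) * (α i + 1) := by
    classical
    rw [← Finsupp.mul_prod_erase' (α + Finsupp.single i 1) i _ (by simp),
      ← Finsupp.mul_prod_erase' α i _ (by simp), Finsupp.erase_add, Finsupp.erase_single, add_zero,
      Finsupp.add_apply, Finsupp.single_eq_same, Nat.factorial_succ]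
    push_cast
    ring
  have h3 : (α.prod fun _ a => (a.factorial : ℂ)) ≠ 0 :=
    Finset.prod_ne_zero_iff.2 fun j _ => Nat.cast_ne_zero.2 (α j).factorial_ne_zero
  have h4 : ((α i : ℂ) + 1) ≠ 0 := by exact_mod_cast (α i).succ_ne_zero
  rw [MvPowerSeries.coeff_pderiv, mv_coeff_natCast_mul, MvPowerSeries.coeff_C_mul,
    FLS.coeff_monoF_mul, expXT_coeff, expXT_coeff, h1, h2, FLS.coeff_monoF, FLS.coeff_monoF,
    map_add, Finsupp.degree_single, pow_succ]
  push_cast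
  split_ifs with ha hb hb
  · field_simp
  · omega
  · omega
  · simp

theorem constantCoeff_expXT (σ : ℤˣ) : MvPowerSeries.constantCoeff (expXT σ) = 1 := by
  rw [← MvPowerSeries.coeff_zero_eq_constantCoeff_apply, expXT_coeff]
  simp [monoF_zero_one]

theorem isUnit_expXT (σ : ℤˣ) : IsUnit (expXT σ) := by
  rw [MvPowerSeries.isUnit_iff_constantCoeff, constantCoeff_expXT]
  exact isUnit_one

/-- `e^(σ x z)`. -/
def expX₀ (σ : ℤˣ) : PowerSeries FLS :=
  PowerSeries.mk (fun a => monoF a (sgn ℂ σ ^ a / (a.factorial : ℂ)))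

theorem derivative_expX₀ (σ : ℤˣ) : MvPowerSeries.pderiv FLS () (expX₀ σ) =
    MvPowerSeries.C (monoF 1 (sgn ℂ σ)) * expX₀ σ := by
  change PowerSeries.derivative FLS (expX₀ σ) = PowerSeries.C (monoF 1 (sgn ℂ σ)) * expX₀ σ
  refine PowerSeries.ext fun a => FLS.ext fun e => ?_
  rw [PowerSeries.coeff_derivative, mv_coeff_natCast_mul, PowerSeries.coeff_C_mul,
    FLS.coeff_monoF_mul, expX₀, PowerSeries.coeff_mk, PowerSeries.coeff_mk, FLS.coeff_monoF,
    FLS.coeff_monoF, pow_succ, Nat.factorial_succ]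
  have h3 : (a.factorial : ℂ) ≠ 0 := by exact_mod_cast a.factorial_ne_zero
  have h4 : ((a : ℂ) + 1) ≠ 0 := by exact_mod_cast a.succ_ne_zero
  push_cast
  split_ifs with ha hb hb
  · field_simp
  · omega
  · omega
  · simp

theorem isUnit_expX₀ (σ : ℤˣ) : IsUnit (expX₀ σ) := by
  rw [PowerSeries.isUnit_iff_constantCoeff, expX₀, ← PowerSeries.coeff_zero_eq_constantCoeff_apply,
    PowerSeries.coeff_mk]
  simp [monoF_zero_one]

theorem formalWave_eq (σ : ℤˣ) (K : PDO (PowerSeries ℂ)) :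
    formalWave σ K = expX₀ σ * symb (τ := Unit) σ K := by
  rw [formalWave, expX₀]
  congr 1
  refine PowerSeries.ext fun a => ?_
  rw [PowerSeries.coeff_mk]
  rfl

/-- Restriction of power series to `t = 0`. -/
def restrictX (K : Type*) [CommRing K] : MvPowerSeries ℕ K →+* PowerSeries K where
  toFun F := PowerSeries.mk fun a => MvPowerSeries.coeff (Finsupp.single 0 a) F
  map_one' := by
    classical
    refine PowerSeries.ext fun a => ?_
    rw [PowerSeries.coeff_mk, MvPowerSeries.coeff_one, PowerSeries.coeff_one]
    simp
  map_mul' F G := by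
    classical
    refine PowerSeries.ext fun a => ?_
    rw [PowerSeries.coeff_mk, MvPowerSeries.coeff_mul, PowerSeries.coeff_mul,
      Finsupp.antidiagonal_single, Finset.sum_map]
    simp
  map_zero' := by ext; simp
  map_add' F G := by ext; simp

theorem restrictX_coeff {K : Type*} [CommRing K] (F : MvPowerSeries ℕ K) (a : ℕ) :
    PowerSeries.coeff a (restrictX K F) = MvPowerSeries.coeff (Finsupp.single 0 a) F := by
  change PowerSeries.coeff a (PowerSeries.mk fun a => MvPowerSeries.coeff (Finsupp.single 0 a) F) = _
  rw [PowerSeries.coeff_mk]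

/-- Restriction to `t = 0`, as a homomorphism of algebras. -/
def atZeroHom : XT →ₐ[ℂ] PowerSeries ℂ :=
  { restrictX ℂ with
    commutes' := fun c => by
      change restrictX ℂ (MvPowerSeries.C c) = PowerSeries.C c
      refine PowerSeries.ext fun a => ?_
      classical
      rw [restrictX_coeff, MvPowerSeries.coeff_C, PowerSeries.coeff_C]
      simp }

theorem opAtZero_eq (P : PDO XT) : opAtZero P = P.map atZeroHom := rfl

theorem atZeroHom_dX (h : XT) : atZeroHom (dX h) = dX₀ (atZeroHom h) := by
  refine PowerSeries.ext fun a => ?_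
  change PowerSeries.coeff a (restrictX ℂ (MvPowerSeries.pderiv ℂ 0 h)) =
    PowerSeries.coeff a (PowerSeries.derivative ℂ (restrictX ℂ h))
  rw [restrictX_coeff, MvPowerSeries.coeff_pderiv, PowerSeries.coeff_derivative, restrictX_coeff,
    Finsupp.single_eq_same, ← Finsupp.single_add]

theorem formalWave_opAtZero (σ : ℤˣ) (P : PDO XT) :
    formalWave σ (opAtZero P) = restrictX FLS (wave dX σ (expXT σ) (op dX P)) := by
  rw [formalWave_eq, wave_op, map_mul]
  congr 1
  · refine PowerSeries.ext fun a => ?_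
    rw [restrictX_coeff, expX₀, PowerSeries.coeff_mk, expXT_coeff, Finsupp.degree_single,
      Finsupp.sum_single_index (by simp), Finsupp.prod_single_index (by simp)]
    simp

end ExpSeries

/-! ### Wave functions of the form e^(σxA) f -/

section ExpA

open Polynomial

/-- `d/dx` as a linear map over `ℂ`. -/
def derF : Module.End ℂ (PowerSeries FLS) := pdF (τ := Unit) ()

theorem derF_apply (F : PowerSeries FLS) : derF F = PowerSeries.derivative FLS F := rfl

theorem derF_coeff (F : PowerSeries FLS) (a : ℕ) :
    PowerSeries.coeff a (derF F) = ((a : ℂ) + 1) • PowerSeries.coeff (a + 1) F := by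
  rw [derF_apply, PowerSeries.coeff_derivative]
  refine FLS.ext fun e => ?_
  rw [mv_coeff_natCast_mul, FLS.coeff_smul, mul_comm]

theorem ps_coeff_smul (c : ℂ) (F : PowerSeries FLS) (a : ℕ) :
    PowerSeries.coeff a (c • F) = c • PowerSeries.coeff a F := rfl

/-- An operator on Laurent series acting on the coefficients of a power series. -/
def mapCoeff (A : Module.End ℂ FLS) : Module.End ℂ (PowerSeries FLS) where
  toFun F := PowerSeries.mk fun a => A (PowerSeries.coeff a F)
  map_add' F G := PowerSeries.ext fun a => by
    simp only [PowerSeries.coeff_mk, map_add]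
  map_smul' c F := PowerSeries.ext fun a => by
    simp only [PowerSeries.coeff_mk, ps_coeff_smul, map_smul, RingHom.id_apply]

theorem mapCoeff_coeff (A : Module.End ℂ FLS) (F : PowerSeries FLS) (a : ℕ) :
    PowerSeries.coeff a (mapCoeff A F) = A (PowerSeries.coeff a F) := by
  change PowerSeries.coeff a (PowerSeries.mk fun a => A (PowerSeries.coeff a F)) = _
  rw [PowerSeries.coeff_mk]

/-- `e^(σ x A) f`. -/
def expA (σ : ℤˣ) (A : Module.End ℂ FLS) : FLS →ₗ[ℂ] PowerSeries FLS where
  toFun f := PowerSeries.mk fun j => (sgn ℂ σ ^ j / (j.factorial : ℂ)) • (A ^ j) f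
  map_add' f g := PowerSeries.ext fun a => by
    simp only [PowerSeries.coeff_mk, map_add, smul_add]
  map_smul' c f := PowerSeries.ext fun a => by
    simp only [PowerSeries.coeff_mk, ps_coeff_smul, map_smul, RingHom.id_apply]
    rw [smul_comm]

theorem expA_coeff (σ : ℤˣ) (A : Module.End ℂ FLS) (f : FLS) (j : ℕ) :
    PowerSeries.coeff j (expA σ A f) = (sgn ℂ σ ^ j / (j.factorial : ℂ)) • (A ^ j) f := by
  change PowerSeries.coeff j (PowerSeries.mk fun j => (sgn ℂ σ ^ j / (j.factorial : ℂ)) • (A ^ j) f)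
    = _
  rw [PowerSeries.coeff_mk]

theorem constantCoeff_expA (σ : ℤˣ) (A : Module.End ℂ FLS) (f : FLS) :
    PowerSeries.constantCoeff (expA σ A f) = f := by
  rw [← PowerSeries.coeff_zero_eq_constantCoeff_apply, expA_coeff]
  simp

theorem expA_injective (σ : ℤˣ) (A : Module.End ℂ FLS) : Function.Injective (expA σ A) := by
  intro f g h
  rw [← constantCoeff_expA σ A f, h, constantCoeff_expA]

theorem derF_expA (σ : ℤˣ) (A : Module.End ℂ FLS) (f : FLS) :
    (sgn ℂ σ • derF) (expA σ A f) = expA σ A (A f) := by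
  refine PowerSeries.ext fun j => ?_
  rw [LinearMap.smul_apply, ps_coeff_smul, derF_coeff, expA_coeff, expA_coeff, smul_smul, smul_smul,
    ← Module.End.mul_apply, ← pow_succ, Nat.factorial_succ]
  congr 1
  have h3 : (j.factorial : ℂ) ≠ 0 := by exact_mod_cast j.factorial_ne_zero
  have h4 : ((j : ℂ) + 1) ≠ 0 := by exact_mod_cast j.succ_ne_zero
  have hσ := sgn_mul_self ℂ σ
  push_cast
  field_simp
  linear_combination (sgn ℂ σ ^ j) * hσ

theorem mapCoeff_expA (σ : ℤˣ) (A : Module.End ℂ FLS) (f : FLS) :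
    mapCoeff A (expA σ A f) = expA σ A (A f) := by
  refine PowerSeries.ext fun j => ?_
  rw [mapCoeff_coeff, expA_coeff, expA_coeff, map_smul, ← Module.End.mul_apply,
    ← Module.End.mul_apply, ← pow_succ, ← pow_succ']

/-- The solutions of `σ dY/dx = A Y`. -/
theorem eq_expA {σ : ℤˣ} {A : Module.End ℂ FLS} {Y : PowerSeries FLS}
    (h : (sgn ℂ σ • derF) Y = mapCoeff A Y) : Y = expA σ A (PowerSeries.constantCoeff Y) := by
  refine PowerSeries.ext fun j => ?_
  induction j with
  | zero => rw [PowerSeries.coeff_zero_eq_constantCoeff_apply,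
      PowerSeries.coeff_zero_eq_constantCoeff_apply, constantCoeff_expA]
  | succ j ih =>
    have h1 := congrArg (PowerSeries.coeff j) h
    rw [LinearMap.smul_apply, ps_coeff_smul, derF_coeff, mapCoeff_coeff, ih, expA_coeff, map_smul,
      ← Module.End.mul_apply, ← pow_succ'] at h1
    rw [expA_coeff, Nat.factorial_succ]
    have h3 : (j.factorial : ℂ) ≠ 0 := by exact_mod_cast j.factorial_ne_zero
    have h4 : ((j : ℂ) + 1) ≠ 0 := by exact_mod_cast j.succ_ne_zero
    have hσ := sgn_mul_self ℂ σ
    have h5 := congrArg (fun F => (sgn ℂ σ / ((j : ℂ) + 1)) • F) h1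
    simp only [smul_smul] at h5
    rw [show sgn ℂ σ / ((j : ℂ) + 1) * (sgn ℂ σ * ((j : ℂ) + 1)) = 1 by
      field_simp; linear_combination hσ, one_smul] at h5
    rw [h5]
    congr 1
    push_cast
    field_simp
    ring

/-- Multiplication by `x + z ^ p`. -/
def mulXZ (p : ℕ) : Module.End ℂ (PowerSeries FLS) :=
  LinearMap.mulLeft ℂ (PowerSeries.X + PowerSeries.C (monoF p 1) : PowerSeries FLS)

theorem mulXZ_apply (p : ℕ) (F : PowerSeries FLS) :
    mulXZ p F = PowerSeries.X * F + PowerSeries.C (monoF p 1) * F := by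
  rw [← add_mul]
  rfl

/-- From A^j z^p = z^p A^j + σ j A^(j-1): the last term shifts the exponential series by one and
produces the summand x. -/
theorem mulXZ_expA {p : ℕ} (hp : p ≠ 0) (N : ℕ) (σ : ℤˣ) (f : FLS) :
    mulXZ p (expA σ (formalA p N σ) f) = expA σ (formalA p N σ) (mulZ p f) := by
  have hc : ∀ j : ℕ, (formalA p N σ ^ j) (mulZ p f) = mulZ p ((formalA p N σ ^ j) f) +
      (sgn ℂ σ * j) • (formalA p N σ ^ (j - 1)) f := by
    intro j
    have := LinearMap.congr_fun (aeval_mul_of_commutator (formalA_mul_mulZ hp N σ) (X ^ j)) f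
    rw [derivative_X_pow, map_mul, aeval_C, ← Algebra.smul_def, smul_smul] at this
    rwa [map_pow, map_pow, aeval_X] at this
  refine PowerSeries.ext fun j => ?_
  rw [mulXZ_apply, map_add, PowerSeries.coeff_C_mul, expA_coeff, expA_coeff, hc, smul_add,
    ← mulZ_apply, map_smul, add_comm]
  congr 1
  rcases j with _ | j
  · simp
  · rw [PowerSeries.coeff_succ_X_mul, expA_coeff, Nat.add_sub_cancel, smul_smul, Nat.factorial_succ]
    congr 1
    have h3 : (j.factorial : ℂ) ≠ 0 := by exact_mod_cast j.factorial_ne_zero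
    have h4 : ((j : ℂ) + 1) ≠ 0 := by exact_mod_cast j.succ_ne_zero
    have hσ := sgn_mul_self ℂ σ
    push_cast
    field_simp
    linear_combination (-sgn ℂ σ ^ j) * hσ

/-- e^(σxA) intertwines A with σ d/dx and z^p with x + z^p, so the equation in z becomes an equation
in x. -/
theorem odeEnd_expA {k p : ℕ} (hp : p ≠ 0) (w : Fin k → ℝ) (n : Fin k → ℕ) (σ : ℤˣ) (N : ℕ)
    (f : FLS) : odeEnd p w n σ (sgn ℂ σ • derF) (mulXZ p) (expA σ (formalA p N σ) f) =
      expA σ (formalA p N σ) (odeEnd p w n σ (formalA p N σ) (mulZ p) f) :=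
  (odeEnd_intertwine (expA σ (formalA p N σ)) (fun f => (derF_expA σ _ f).symm)
    (fun f => (mulXZ_expA hp N σ f).symm) p w n σ f).symm

/-! ### Formal wave functions at `t = 0` -/

/-- The formal wave function at `t = 0`. -/
def wave₀ (σ : ℤˣ) : Op dX₀ →ₗ[ℂ] PowerSeries FLS := wave (τ := Unit) (d := dX₀) σ (expX₀ σ)

theorem wave₀_op (σ : ℤˣ) (K : PDO (PowerSeries ℂ)) : wave₀ σ (op dX₀ K) = formalWave σ K :=
  (formalWave_eq σ K).symm

theorem wave₀_injective (σ : ℤˣ) : Function.Injective (wave₀ σ) :=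
  wave_injective (isUnit_expX₀ σ)

theorem wave₀_D_mul (σ : ℤˣ) (P : Op dX₀) :
    wave₀ σ (sD dX₀ σ 1 * P) = (sgn ℂ σ • derF) (wave₀ σ P) :=
  wave_D_mul (τ := Unit) (i := ()) rfl (derivative_expX₀ σ) P

theorem wave₀_mulOp_mul (σ : ℤˣ) (h : PowerSeries ℂ) (P : Op dX₀) :
    wave₀ σ (mulOp dX₀ h * P) = PowerSeries.map (algebraMap ℂ FLS) h * wave₀ σ P :=
  wave_mulOp_mul (τ := Unit) h P

theorem wave₀_mul_sD (σ : ℤˣ) (P : Op dX₀) (m : ℤ) :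
    wave₀ σ (P * sD dX₀ σ m) = PowerSeries.C (monoF m 1) * wave₀ σ P :=
  wave_mul_sD (τ := Unit) P m

theorem smul_ps_C_monoF (r c : ℂ) (m : ℤ) (F : PowerSeries FLS) :
    r • (PowerSeries.C (monoF m c) * F) = PowerSeries.C (monoF m (r * c)) * F :=
  smul_C_monoF (τ := Unit) r c m F

theorem C_monoF_mul_C_monoF (m l : ℤ) (c c' : ℂ) (F : PowerSeries FLS) :
    PowerSeries.C (monoF m c) * (PowerSeries.C (monoF l c') * F) =
      PowerSeries.C (monoF (m + l) (c * c')) * F := by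
  rw [← mul_assoc, ← map_mul, monoF_mul_monoF]

/-- Leibniz rule together with z d/dz e^(σxz) = σ x z e^(σxz). -/
theorem mapCoeff_eulerF_expX₀_mul (σ : ℤˣ) (G : PowerSeries FLS) :
    mapCoeff eulerF (expX₀ σ * G) =
      expX₀ σ * (PowerSeries.X * (PowerSeries.C (monoF 1 (sgn ℂ σ)) * G) + mapCoeff eulerF G) := by
  have h1 : PowerSeries.X * (PowerSeries.C (monoF 1 (sgn ℂ σ)) * expX₀ σ) =
      PowerSeries.mk fun a => (a : ℂ) • PowerSeries.coeff a (expX₀ σ) := by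
    refine PowerSeries.ext fun a => ?_
    rw [PowerSeries.coeff_mk]
    rcases a with _ | a
    · simp
    · rw [PowerSeries.coeff_succ_X_mul, PowerSeries.coeff_C_mul, expX₀, PowerSeries.coeff_mk,
        PowerSeries.coeff_mk, monoF_mul_monoF, smul_monoF, Nat.factorial_succ]
      have h3 : (a.factorial : ℂ) ≠ 0 := by exact_mod_cast a.factorial_ne_zero
      have h4 : ((a : ℂ) + 1) ≠ 0 := by exact_mod_cast a.succ_ne_zero
      congr 1
      · push_cast; ring
      · push_cast
        field_simp
        ring
  have h2 : expX₀ σ * (PowerSeries.X * (PowerSeries.C (monoF 1 (sgn ℂ σ)) * G) + mapCoeff eulerF G) =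
      (PowerSeries.X * (PowerSeries.C (monoF 1 (sgn ℂ σ)) * expX₀ σ)) * G +
        expX₀ σ * mapCoeff eulerF G := by ring
  rw [h2, h1]
  refine PowerSeries.ext fun a => ?_
  rw [mapCoeff_coeff, map_add, PowerSeries.coeff_mul, PowerSeries.coeff_mul, PowerSeries.coeff_mul,
    map_sum, ← Finset.sum_add_distrib]
  refine Finset.sum_congr rfl fun x _ => ?_
  rw [PowerSeries.coeff_mk, mapCoeff_coeff, expX₀, PowerSeries.coeff_mk, eulerF_monoF_mul,
    smul_mul_assoc]
  rfl

theorem mapCoeff_formalA (p N : ℕ) (σ : ℤˣ) (F : PowerSeries FLS) :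
    mapCoeff (formalA p N σ) F = PowerSeries.C (monoF 1 1) * F +
      PowerSeries.C (monoF (-(p : ℤ)) (sgn ℂ σ / (p : ℂ))) *
        (mapCoeff eulerF F + shiftA p N σ • F) := by
  refine PowerSeries.ext fun a => ?_
  rw [mapCoeff_coeff, formalA_apply, map_add, PowerSeries.coeff_C_mul, PowerSeries.coeff_C_mul,
    map_add, mapCoeff_coeff, ps_coeff_smul]

/-- `A^σ`, conjugated by `e^(σ x z)`. -/
theorem mapCoeff_formalA_expX₀_mul (p N : ℕ) (σ : ℤˣ) (G : PowerSeries FLS) :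
    mapCoeff (formalA p N σ) (expX₀ σ * G) = expX₀ σ * (PowerSeries.C (monoF 1 1) * G +
      PowerSeries.C (monoF (-(p : ℤ)) (sgn ℂ σ / (p : ℂ))) *
        (PowerSeries.X * (PowerSeries.C (monoF 1 (sgn ℂ σ)) * G) + mapCoeff eulerF G +
          shiftA p N σ • G)) := by
  rw [mapCoeff_formalA, mapCoeff_eulerF_expX₀_mul, ← mul_smul_comm]
  ring

theorem derF_expX₀_mul (σ : ℤˣ) (G : PowerSeries FLS) :
    (sgn ℂ σ • derF) (expX₀ σ * G) =
      expX₀ σ * (PowerSeries.C (monoF 1 1) * G + (sgn ℂ σ • derF) G) := by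
  have h : PowerSeries.derivative FLS (expX₀ σ) = PowerSeries.C (monoF 1 (sgn ℂ σ)) * expX₀ σ :=
    derivative_expX₀ σ
  rw [LinearMap.smul_apply, LinearMap.smul_apply, derF_apply, derF_apply, Derivation.leibniz, h,
    smul_eq_mul, smul_eq_mul, smul_add, ← mul_smul_comm, mul_left_comm, ← mul_left_comm, mul_comm G,
    mul_assoc, smul_ps_C_monoF, sgn_mul_self]
  ring

/-- The operator `M` with `A Ψ = K M e^(σ x z)` for `Ψ = K e^(σ x z)`. -/
def opM (p N : ℕ) (σ : ℤˣ) : Op dX₀ :=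
  sD dX₀ σ 1 + (sgn ℂ σ / (p : ℂ)) • (sgn ℂ σ • (mulOp dX₀ PowerSeries.X * sD dX₀ σ (1 - p)) +
    shiftA p N σ • sD dX₀ σ (-p))

/-- Right multiplication by x adds ∂/∂D of the symbol to x times the symbol, since the second
derivative of x is zero. With D replaced by σz this derivative is σ d/dz, and the extra factor z
makes it the Euler operator. -/
theorem symb_comp_X (σ : ℤˣ) (K : PDO (PowerSeries ℂ)) :
    PowerSeries.C (monoF 1 1) * symb (τ := Unit) σ (comp dX₀ K (multOp PowerSeries.X)) =
      PowerSeries.X * (PowerSeries.C (monoF 1 1) * symb (τ := Unit) σ K) +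
        sgn ℂ σ • mapCoeff eulerF (symb (τ := Unit) σ K) := by
  have h1 : comp dX₀ K (multOp PowerSeries.X) = multOp PowerSeries.X * K + hasse 1 K := by
    obtain ⟨N, hN⟩ := exists_vanish K
    have h0 : ∀ k : ℕ, ((dX₀ : PowerSeries ℂ →ₗ[ℂ] PowerSeries ℂ) ^ (k + 2)) PowerSeries.X = 0 := by
      intro k
      rw [pow_add, Module.End.mul_apply, pow_two, Module.End.mul_apply, Derivation.coeFn_coe, dX₀,
        PowerSeries.derivative_X, Derivation.map_one_eq_zero, map_zero]
    ext1
    funext e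
    rw [multOp, comp_coeff_sum dX₀ hN (vanish_single PowerSeries.X le_rfl)
      (K := (e - N + 1).toNat + 2) (by push_cast; omega), Finset.sum_range_succ',
      Finset.sum_range_succ', Finset.sum_eq_zero]
    · rw [mapD_single, mapD_single, hasse_zero, zero_add, pow_one, pow_zero, zero_add,
        Module.End.one_apply, Derivation.coeFn_coe, dX₀, PowerSeries.derivative_X,
        HahnSeries.single_zero_one, mul_one, HahnSeries.coeff_add, mul_comm K, add_comm]
    · intro k _
      rw [mapD_single, h0, HahnSeries.single_eq_zero, mul_zero, HahnSeries.coeff_zero]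
  rw [h1, symb_add, mul_add]
  congr 1
  · rw [symb_multOp_mul]
    have : toFLS (τ := Unit) PowerSeries.X = (PowerSeries.X : PowerSeries FLS) :=
      PowerSeries.map_X _
    rw [this]
    ring
  · refine PowerSeries.ext fun a => FLS.ext fun e => ?_
    rw [PowerSeries.coeff_C_mul, FLS.coeff_monoF_mul, ps_coeff_smul, FLS.coeff_smul, mapCoeff_coeff,
      eulerF_coeff]
    have h2 : ∀ (P : PDO (PowerSeries ℂ)) (e : ℤ), (PowerSeries.coeff a (symb (τ := Unit) σ P)).coeff e =
      sgn ℂ (σ ^ e) * PowerSeries.coeff a (P.coeff e) := fun P e => rfl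
    rw [h2, h2, hasse_coeff, show ((1 : ℕ) : ℤ) - (e + 1) = -e by push_cast; ring,
      Ring.choose_one_right, show e + 1 - ((1 : ℕ) : ℤ) = e by push_cast; ring, zpow_add, sgn_mul,
      zpow_one]
    have h3 : (((-e : ℤ) : PowerSeries ℂ)) = PowerSeries.C ((-e : ℤ) : ℂ) := by simp
    rw [h3, PowerSeries.coeff_C_mul]
    push_cast
    ring

/-- M is the transcription of A under z ↔ σD, d/dz ↔ σx: operators in z acting on e^(σxz) become
operators in x, which stand to the right of K. -/
theorem wave₀_mul_opM (p N : ℕ) (σ : ℤˣ) (K : Op dX₀) :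
    wave₀ σ (K * opM p N σ) = mapCoeff (formalA p N σ) (wave₀ σ K) := by
  obtain ⟨K, rfl⟩ := (op dX₀).surjective K
  have h1 : wave₀ σ (op dX₀ K) = expX₀ σ * symb (τ := Unit) σ K := rfl
  have h2 : wave₀ σ (op dX₀ K * mulOp dX₀ PowerSeries.X) =
      expX₀ σ * symb (τ := Unit) σ (comp dX₀ K (multOp PowerSeries.X)) := rfl
  have h3 := symb_comp_X σ K
  rw [opM, mul_add, map_add, wave₀_mul_sD, mul_smul_comm, mul_add, mul_smul_comm, mul_smul_comm,
    map_smul, map_add, map_smul, map_smul, ← mul_assoc, wave₀_mul_sD, wave₀_mul_sD, h2, h1,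
    mapCoeff_formalA_expX₀_mul]
  have h4 : PowerSeries.C (monoF (1 - (p : ℤ)) 1) * (expX₀ σ * symb (τ := Unit) σ
      (comp dX₀ K (multOp PowerSeries.X))) = expX₀ σ * (PowerSeries.C (monoF (-(p : ℤ)) 1) *
      (PowerSeries.C (monoF 1 1) * symb (τ := Unit) σ (comp dX₀ K (multOp PowerSeries.X)))) := by
    rw [C_monoF_mul_C_monoF, one_mul, show -(p : ℤ) + 1 = 1 - p by ring]
    ring
  have h5 : (PowerSeries.C (monoF 1 (sgn ℂ σ)) : PowerSeries FLS) =
      sgn ℂ σ • PowerSeries.C (monoF 1 1) := by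
    have := smul_ps_C_monoF (sgn ℂ σ) 1 1 1
    rw [mul_one, mul_one, mul_one] at this
    exact this.symm
  have h6 : (PowerSeries.C (monoF (-(p : ℤ)) (sgn ℂ σ / (p : ℂ))) : PowerSeries FLS) =
      (sgn ℂ σ / (p : ℂ)) • PowerSeries.C (monoF (-(p : ℤ)) 1) := by
    have := smul_ps_C_monoF (sgn ℂ σ / (p : ℂ)) 1 (-(p : ℤ)) 1
    rw [mul_one, mul_one, mul_one] at this
    exact this.symm
  rw [h4, h3, h5, h6]
  have hσ := sgn_mul_self ℂ σ
  simp only [mul_add, smul_add, smul_mul_assoc, mul_smul_comm, smul_smul]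
  rw [hσ, mul_one, mul_comm (sgn ℂ σ) (sgn ℂ σ / (p : ℂ)), mul_comm (shiftA p N σ)]
  have h7 : PowerSeries.C (monoF 1 1) * (expX₀ σ * symb (τ := Unit) σ K) =
      expX₀ σ * (PowerSeries.C (monoF 1 1) * symb (τ := Unit) σ K) := by ring
  have h8 : PowerSeries.C (monoF (-(p : ℤ)) 1) * (expX₀ σ * symb (τ := Unit) σ K) =
      expX₀ σ * (PowerSeries.C (monoF (-(p : ℤ)) 1) * symb (τ := Unit) σ K) := by ring
  rw [h7, h8]

/-- `Ψ = K e^(σ x z)` satisfies `σ ∂Ψ/∂x = A Ψ` if and only if `σ D K = K M`. -/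
theorem wave₀_eq_expA_iff (p N : ℕ) (σ : ℤˣ) (K : Op dX₀) :
    wave₀ σ K = expA σ (formalA p N σ) (PowerSeries.constantCoeff (wave₀ σ K)) ↔
      sD dX₀ σ 1 * K = K * opM p N σ := by
  constructor
  · intro h
    apply wave₀_injective σ
    rw [wave₀_D_mul, wave₀_mul_opM, h, derF_expA, mapCoeff_expA]
  · intro h
    apply eq_expA
    rw [← wave₀_D_mul, ← wave₀_mul_opM, h]

theorem sD_mul_X (σ : ℤˣ) (m : ℤ) : sD dX₀ σ m * mulOp dX₀ PowerSeries.X =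
    mulOp dX₀ PowerSeries.X * sD dX₀ σ m + (sgn ℂ σ * m) • sD dX₀ σ (m - 1) := by
  have h1 : sD dX₀ σ 1 * mulOp dX₀ PowerSeries.X =
      mulOp dX₀ PowerSeries.X * sD dX₀ σ 1 + sgn ℂ σ • 1 := by
    rw [sD_mul_mulOp, dX₀, PowerSeries.derivative_X, map_one]
  induction m using Int.induction_on with
  | zero => simp [sD_zero]
  | succ i ih =>
    rw [← sD_mul, mul_assoc, h1, mul_add, ← mul_assoc, ih, mul_smul_comm, mul_one, add_mul,
      smul_mul_assoc, sD_mul, mul_assoc, add_assoc, sub_add_cancel, add_sub_cancel_right,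
      ← add_smul]
    congr 2
    push_cast
    ring
  | pred i ih =>
    have h2 : sD dX₀ σ (-1) * mulOp dX₀ PowerSeries.X =
        mulOp dX₀ PowerSeries.X * sD dX₀ σ (-1) - sgn ℂ σ • sD dX₀ σ (-2) := by
      have h3 := congrArg (fun F => sD dX₀ σ (-1) * F * sD dX₀ σ (-1)) h1
      simp only [mul_add, add_mul, ← mul_assoc] at h3
      rw [sD_neg_mul, one_mul, mul_assoc _ (sD dX₀ σ 1), sD_mul_neg, mul_one, mul_smul_comm,
        smul_mul_assoc, mul_one, sD_mul] at h3
      rw [h3]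
      norm_num
    rw [sub_eq_add_neg (-(i : ℤ)) 1, ← sD_mul, mul_assoc, h2, mul_sub, ← mul_assoc, ih,
      mul_smul_comm, add_mul, smul_mul_assoc, sD_mul, mul_assoc, sD_mul, sD_mul, add_sub_assoc]
    congr 1
    rw [show -(i : ℤ) - 1 + -1 = -i + -2 by ring, show -(i : ℤ) + -1 - 1 = -i + -2 by ring,
      ← sub_smul]
    congr 1
    push_cast
    ring

/-- Moving x back to the left of (-σD)^(1-p) produces a constant p - 1, which turns -(p-1)/2 into
(p-1)/2. This is what the opposite sign requires, because its whole bracket carries the factor -σ.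
-/
theorem adjOp_opM {p : ℕ} (hp : p ≠ 0) (N : ℕ) (σ : ℤˣ) :
    adjOp dX₀ (opM p N σ) = opM p N (-σ) := by
  rw [opM, opM, map_add, adjOp_smul, map_add, adjOp_smul, adjOp_smul, adjOp_mul, adjOp_sD, adjOp_sD,
    adjOp_sD, adjOp_mulOp, sD_mul_X, show (1 : ℤ) - p - 1 = -p by ring, sgn_neg]
  congr 1
  simp only [smul_add, smul_smul, add_assoc, ← add_smul]
  have hp' : (p : ℂ) ≠ 0 := by exact_mod_cast hp
  congr 2
  · ring
  · rw [shiftA, shiftA, sgn_neg]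
    have hσ := sgn_mul_self ℂ σ
    push_cast
    field_simp
    linear_combination (2 * p - 2 : ℂ) * hσ

end ExpA

/-! ### The nonlocal Lax operator at t = 0 and its spectral equation -/

section LaxAtZero

open Polynomial

theorem derivative_expX (a : ℂ) : dX₀ (expX a) = PowerSeries.C a * expX a := by
  refine PowerSeries.ext fun j => ?_
  rw [dX₀, PowerSeries.coeff_derivative, PowerSeries.coeff_C_mul, expX, PowerSeries.coeff_rescale,
    PowerSeries.coeff_rescale, PowerSeries.coeff_exp, PowerSeries.coeff_exp, Nat.factorial_succ]
  have h3 : (j.factorial : ℂ) ≠ 0 := by exact_mod_cast j.factorial_ne_zero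
  have h4 : ((j : ℂ) + 1) ≠ 0 := by exact_mod_cast j.succ_ne_zero
  simp only [map_div₀, map_one, map_natCast]
  push_cast
  field_simp
  ring

theorem expX_mul_expX_neg (a : ℂ) : expX a * expX (-a) = 1 := by
  rw [expX, expX, PowerSeries.exp_mul_exp_eq_exp_add, add_neg_cancel]
  simp

/-- `e^(σ x w) (σ D)⁻¹ e^(-σ x w)`, the inverse of `σ D - w`. -/
def resolvent (σ : ℤˣ) (w : ℂ) : Op dX₀ :=
  mulOp dX₀ (expX (sgn ℂ σ * w)) * sD dX₀ σ (-1) * mulOp dX₀ (expX (-sgn ℂ σ * w))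

theorem sD_mul_expX (σ : ℤˣ) (w : ℂ) :
    (sD dX₀ σ 1 - algebraMap ℂ _ w) * mulOp dX₀ (expX (sgn ℂ σ * w)) =
      mulOp dX₀ (expX (sgn ℂ σ * w)) * sD dX₀ σ 1 := by
  have hC : PowerSeries.C (sgn ℂ σ * w) = algebraMap ℂ (PowerSeries ℂ) (sgn ℂ σ * w) := rfl
  rw [sub_mul, sD_mul_mulOp, derivative_expX, hC, ← Algebra.smul_def, map_smul, smul_smul,
    ← mul_assoc, sgn_mul_self, one_mul, ← Algebra.smul_def, add_sub_cancel_right]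

theorem expX_mul_sD (σ : ℤˣ) (w : ℂ) :
    mulOp dX₀ (expX (-sgn ℂ σ * w)) * (sD dX₀ σ 1 - algebraMap ℂ _ w) =
      sD dX₀ σ 1 * mulOp dX₀ (expX (-sgn ℂ σ * w)) := by
  have hC : PowerSeries.C (-sgn ℂ σ * w) = algebraMap ℂ (PowerSeries ℂ) (-sgn ℂ σ * w) := rfl
  rw [mul_sub, sD_mul_mulOp, derivative_expX, hC, ← Algebra.smul_def, map_smul, smul_smul,
    ← mul_assoc, mul_neg, sgn_mul_self, ← Algebra.commutes, ← Algebra.smul_def]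
  simp only [neg_mul, one_mul, neg_smul, sub_eq_add_neg]

theorem sub_mul_resolvent (σ : ℤˣ) (w : ℂ) :
    (sD dX₀ σ 1 - algebraMap ℂ _ w) * resolvent σ w = 1 := by
  rw [resolvent, ← mul_assoc, ← mul_assoc, sD_mul_expX, mul_assoc (mulOp dX₀ _) (sD dX₀ σ 1),
    sD_mul_neg, mul_one, ← map_mul, neg_mul, expX_mul_expX_neg, map_one]

theorem resolvent_mul_sub (σ : ℤˣ) (w : ℂ) :
    resolvent σ w * (sD dX₀ σ 1 - algebraMap ℂ _ w) = 1 := by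
  rw [resolvent, mul_assoc, expX_mul_sD, ← mul_assoc, mul_assoc (mulOp dX₀ _) (sD dX₀ σ (-1)),
    sD_neg_mul, mul_one, ← map_mul, neg_mul, expX_mul_expX_neg, map_one]

theorem adjOp_resolvent (σ : ℤˣ) (w : ℂ) : adjOp dX₀ (resolvent σ w) = resolvent (-σ) w := by
  rw [resolvent, resolvent, adjOp_mul, adjOp_mul, adjOp_mulOp, adjOp_mulOp, adjOp_sD, sgn_neg,
    neg_neg, mul_assoc]

variable {k : ℕ} (p : ℕ) (w : Fin k → ℝ) (n : Fin k → ℕ) (σ : ℤˣ)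

theorem op_laxPower : op dX₀ (laxPower p w n σ) = sD dX₀ σ p - mulOp dX₀ PowerSeries.X -
    ∑ i, (n i : ℂ) • resolvent σ (w i) := by
  rw [laxPower, map_sub, map_sub, map_sum, op_signedD, op_multOp]
  congr 1
  refine Finset.sum_congr rfl fun i _ => ?_
  rw [op_multOp_mul]
  have hC : PowerSeries.C (n i : ℂ) = algebraMap ℂ (PowerSeries ℂ) (n i : ℂ) := rfl
  rw [hC, AlgHom.commutes, ← Algebra.smul_def]
  rfl

theorem adjOp_laxPower : adjOp dX₀ (op dX₀ (laxPower p w n σ)) =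
    op dX₀ (laxPower p w n (-σ)) := by
  rw [op_laxPower, op_laxPower, map_sub, map_sub, map_sum, adjOp_sD, adjOp_mulOp]
  simp only [adjOp_smul, adjOp_resolvent]

theorem aeval_sD_polyP_mul_resolvent (i : Fin k) :
    aeval (sD dX₀ σ 1) (polyP w) * resolvent σ (w i) =
      aeval (sD dX₀ σ 1) (∏ j ∈ Finset.univ.erase i, (X - C (w j : ℂ))) := by
  rw [polyP, ← Finset.prod_erase_mul _ _ (Finset.mem_univ i), map_mul, mul_assoc, map_sub, aeval_X,
    aeval_C, sub_mul_resolvent, mul_one]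

/-- Multiplication by P_k(σD) clears the resolvents (σD - wᵢ)⁻¹, and moving it past x creates the
term P_k'. The result is a differential operator with the shape of the equation in z. -/
theorem aeval_sD_polyP_mul_lax :
    aeval (sD dX₀ σ 1) (polyP w) * op dX₀ (laxPower p w n σ) =
      aeval (sD dX₀ σ 1) (polyP w) * sD dX₀ σ p -
      mulOp dX₀ PowerSeries.X * aeval (sD dX₀ σ 1) (polyP w) -
      sgn ℂ σ • aeval (sD dX₀ σ 1) (derivative (polyP w)) - aeval (sD dX₀ σ 1) (polyR w n) := by
  have h1 : sD dX₀ σ 1 * mulOp dX₀ PowerSeries.X =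
      mulOp dX₀ PowerSeries.X * sD dX₀ σ 1 + sgn ℂ σ • 1 := by
    rw [sD_mul_mulOp, dX₀, PowerSeries.derivative_X, map_one]
  rw [op_laxPower, mul_sub, mul_sub, aeval_mul_of_commutator h1, Finset.mul_sum, polyR, map_sum,
    ← sub_sub]
  congr 1
  refine Finset.sum_congr rfl fun i _ => ?_
  rw [mul_smul_comm, aeval_sD_polyP_mul_resolvent, map_mul, aeval_C, Algebra.smul_def]

/-- Each factor σD - wᵢ is inverted by its resolvent. -/
theorem eq_zero_of_aeval_sD_polyP_mul {Y : Op dX₀} (h : aeval (sD dX₀ σ 1) (polyP w) * Y = 0) :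
    Y = 0 := by
  have key : ∀ s : Finset (Fin k),
      aeval (sD dX₀ σ 1) (∏ j ∈ s, (X - C (w j : ℂ))) * Y = 0 → Y = 0 := by
    intro s
    induction s using Finset.induction_on with
    | empty => intro h; simpa using h
    | insert i s hi ih =>
      intro h
      rw [Finset.prod_insert hi, map_mul, map_sub, aeval_X, aeval_C, mul_assoc] at h
      have h2 := congrArg (resolvent σ (w i) * ·) h
      simp only [← mul_assoc] at h2
      rw [resolvent_mul_sub, one_mul, mul_zero] at h2
      exact ih h2
  exact key _ h

theorem wave₀_aeval_mul (Q : ℂ[X]) (K : Op dX₀) :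
    wave₀ σ (aeval (sD dX₀ σ 1) Q * K) = aeval (sgn ℂ σ • derF) Q (wave₀ σ K) := by
  have h := aeval_intertwine (wave₀ σ) (a := Algebra.lmul ℂ (Op dX₀) (sD dX₀ σ 1))
    (b := sgn ℂ σ • derF) (fun v => wave₀_D_mul σ v) Q K
  rw [aeval_algHom_apply] at h
  exact h

/-- K (σD)^p has the wave z^p Ψ, and this z^p joins the x of the Lax operator to form x + z^p. -/
theorem wave₀_lax (K : Op dX₀) :
    wave₀ σ (aeval (sD dX₀ σ 1) (polyP w) * (op dX₀ (laxPower p w n σ) * K - K * sD dX₀ σ p)) =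
      odeEnd p w n σ (sgn ℂ σ • derF) (mulXZ p) (wave₀ σ K) := by
  have h1 : aeval (sD dX₀ σ 1) (polyP w) * (op dX₀ (laxPower p w n σ) * K - K * sD dX₀ σ p) =
      aeval (sD dX₀ σ 1) (X ^ p * polyP w) * K -
      mulOp dX₀ PowerSeries.X * (aeval (sD dX₀ σ 1) (polyP w) * K) -
      sgn ℂ σ • (aeval (sD dX₀ σ 1) (derivative (polyP w)) * K) -
      aeval (sD dX₀ σ 1) (polyR w n) * K - aeval (sD dX₀ σ 1) (polyP w) * K * sD dX₀ σ p := by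
    rw [mul_sub, ← mul_assoc, aeval_sD_polyP_mul_lax, mul_comm (X ^ p), map_mul, map_pow, aeval_X,
      sD_one_pow, ← mul_assoc (aeval (sD dX₀ σ 1) (polyP w)) K, sub_mul, sub_mul, sub_mul,
      smul_mul_assoc, mul_assoc (mulOp dX₀ PowerSeries.X)]
  rw [h1, map_sub, map_sub, map_sub, map_sub, map_smul, wave₀_mul_sD, wave₀_mulOp_mul,
    wave₀_aeval_mul, wave₀_aeval_mul, wave₀_aeval_mul, wave₀_aeval_mul, map_mul, map_pow, aeval_X,
    PowerSeries.map_X]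
  simp only [odeEnd, LinearMap.sub_apply, Module.End.mul_apply, LinearMap.smul_apply, mulXZ_apply]
  abel

/-- The equation `ℒ K = K (σ D)^p` is equivalent to the differential equation in `z`. -/
theorem lax_mul_eq_iff (hp : p ≠ 0) {K : Op dX₀} {N : ℕ} {f : FLS}
    (hK : wave₀ σ K = expA σ (formalA p N σ) f) :
    op dX₀ (laxPower p w n σ) * K = K * sD dX₀ σ p ↔
      odeEnd p w n σ (formalA p N σ) (mulZ p) f = 0 := by
  have h := wave₀_lax p w n σ K
  rw [hK, odeEnd_expA hp] at h
  constructor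
  · intro h1
    rw [h1, sub_self, mul_zero, map_zero] at h
    refine expA_injective σ (formalA p N σ) ?_
    rw [← h, map_zero]
  · intro h1
    rw [h1, map_zero] at h
    have h2 : wave₀ σ _ = wave₀ σ 0 := h.trans (map_zero _).symm
    exact sub_eq_zero.1 (eq_zero_of_aeval_sD_polyP_mul w σ (wave₀_injective σ h2))

end LaxAtZero

/-! ### The coefficients of the formal wave function at t = 0 as polynomials in x -/

section WavePolynomials

open Polynomial

theorem exists_antiderivative (f : ℂ[X]) (c : ℂ) :
    ∃ q : ℂ[X], derivative q = f ∧ q.eval 0 = c := by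
  have h : ∃ q : ℂ[X], derivative q = f := by
    induction f using Polynomial.induction_on' with
    | add P Q hP hQ =>
      obtain ⟨q, rfl⟩ := hP
      obtain ⟨q', rfl⟩ := hQ
      exact ⟨q + q', derivative_add⟩
    | monomial i c =>
      refine ⟨monomial (i + 1) (c / (i + 1)), ?_⟩
      have h4 : ((i : ℂ) + 1) ≠ 0 := by exact_mod_cast i.succ_ne_zero
      rw [derivative_monomial, Nat.add_sub_cancel]
      congr 1
      push_cast
      field_simp
  obtain ⟨q, hq⟩ := h
  exact ⟨q + C (c - q.eval 0), by simp [hq], by simp⟩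

/-- A polynomial with given derivative and value at `0`. -/
def antideriv (f : ℂ[X]) (c : ℂ) : ℂ[X] := (exists_antiderivative f c).choose

theorem derivative_antideriv (f : ℂ[X]) (c : ℂ) : derivative (antideriv f c) = f :=
  (exists_antiderivative f c).choose_spec.1

theorem eval_antideriv (f : ℂ[X]) (c : ℂ) : (antideriv f c).eval 0 = c :=
  (exists_antiderivative f c).choose_spec.2

/-- The coefficients of the formal wave function at `t = 0`. -/
def wavePoly (p N : ℕ) (σ : ℤˣ) (a : ℕ → ℂ) (j : ℕ) : ℂ[X] :=
  -- Coefficient of z^(-j) in ∂G/∂x = (p z^p)⁻¹ (σ x z + z d/dz + μ) G, which is σ ∂Ψ/∂x = AΨ for Ψ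
  -- = e^(σxz) G. The guards record that both indices are natural numbers below j, where 2 ≤ p is
  -- needed for the first.
  antideriv (C (sgn ℂ σ / (p : ℂ)) * X *
      (if _h : 2 ≤ p ∧ p - 1 ≤ j then wavePoly p N σ a (j + 1 - p) else 0) +
    C ((-((j - p : ℤ) : ℂ) + shiftA p N σ) / (p : ℂ)) *
      (if _h : 2 ≤ p ∧ p ≤ j then wavePoly p N σ a (j - p) else 0)) (a j)
termination_by j
decreasing_by all_goals omega

variable {p : ℕ} (hp : 2 ≤ p) (N : ℕ) (σ : ℤˣ) (a : ℕ → ℂ)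

theorem eval_wavePoly (j : ℕ) : (wavePoly p N σ a j).eval 0 = a j := by
  rw [wavePoly, eval_antideriv]

/-- The polynomials of index `e ∈ ℤ`, zero for `e < 0`. -/
def wavePolyInt (p N : ℕ) (σ : ℤˣ) (a : ℕ → ℂ) (e : ℤ) : ℂ[X] :=
  if 0 ≤ e then wavePoly p N σ a e.toNat else 0

include hp in
theorem derivative_wavePolyInt (e : ℤ) : derivative (wavePolyInt p N σ a e) =
    C (sgn ℂ σ / (p : ℂ)) * X * wavePolyInt p N σ a (e + 1 - p) +
    C ((-((e - p : ℤ) : ℂ) + shiftA p N σ) / (p : ℂ)) * wavePolyInt p N σ a (e - p) := by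
  by_cases he : 0 ≤ e
  · obtain ⟨j, rfl⟩ := Int.eq_ofNat_of_zero_le he
    have h1 : wavePolyInt p N σ a (j + 1 - p) =
        if _h : 2 ≤ p ∧ p - 1 ≤ j then wavePoly p N σ a (j + 1 - p) else 0 := by
      rw [wavePolyInt]
      split_ifs with h h' h'
      · congr 1; omega
      · omega
      · omega
      · rfl
    have h2 : wavePolyInt p N σ a (j - p) =
        if _h : 2 ≤ p ∧ p ≤ j then wavePoly p N σ a (j - p) else 0 := by
      rw [wavePolyInt]
      split_ifs with h h' h'
      · congr 1; omega
      · omega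
      · omega
      · rfl
    rw [h1, h2, wavePolyInt, if_pos he, Int.toNat_natCast, wavePoly, derivative_antideriv]
  · have : ∀ e' ≤ e, wavePolyInt p N σ a e' = 0 := fun e' he' => by
      rw [wavePolyInt, if_neg (by omega)]
    rw [this e le_rfl, this (e + 1 - p) (by omega), this (e - p) (by omega)]
    simp

/-- The wave operator at `t = 0`. -/
def waveOp (p N : ℕ) (σ : ℤˣ) (a : ℕ → ℂ) : PDO (PowerSeries ℂ) :=
  HahnSeries.ofSuppBddBelow
    (fun e => sgn (PowerSeries ℂ) (σ ^ e) * (wavePolyInt p N σ a e : PowerSeries ℂ))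
    ⟨0, fun e he => not_lt.1 fun h => he (by
      simp only [wavePolyInt, if_neg (not_le.2 h), Polynomial.coe_zero, mul_zero])⟩

theorem waveOp_coeff (e : ℤ) : (waveOp p N σ a).coeff e =
    sgn (PowerSeries ℂ) (σ ^ e) * (wavePolyInt p N σ a e : PowerSeries ℂ) := rfl

theorem waveCoeff_waveOp (j : ℕ) :
    waveCoeff σ (waveOp p N σ a) j = (wavePoly p N σ a j : PowerSeries ℂ) := by
  rw [waveCoeff, waveOp_coeff, ← mul_assoc, sgn_mul_self, one_mul, wavePolyInt,
    if_pos (Int.natCast_nonneg j), Int.toNat_natCast]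

theorem symb_waveOp_coeff (b : ℕ) (e : ℤ) :
    (PowerSeries.coeff b (symb (τ := Unit) σ (waveOp p N σ a))).coeff e =
      (wavePolyInt p N σ a e).coeff b := by
  have : (PowerSeries.coeff b (symb (τ := Unit) σ (waveOp p N σ a))).coeff e =
      sgn ℂ (σ ^ e) * PowerSeries.coeff b ((waveOp p N σ a).coeff e) := rfl
  have h2 : PowerSeries.coeff b (sgn (PowerSeries ℂ) (σ ^ e) *
      (wavePolyInt p N σ a e : PowerSeries ℂ)) =
      sgn ℂ (σ ^ e) * (wavePolyInt p N σ a e).coeff b := by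
    rcases Int.units_eq_one_or (σ ^ e) with h | h <;> simp [h]
  rw [this, waveOp_coeff, h2, ← mul_assoc, sgn_mul_self, one_mul]

theorem seriesF_coeff (e : ℤ) : (seriesF a).coeff e = if 0 ≤ e then a e.toNat else 0 := by
  have h : (seriesF a).coeff e =
      ((PowerSeries.mk a : PowerSeries ℂ) : LaurentSeries ℂ).coeff e := rfl
  rw [h, PowerSeries.coeff_coe]
  split_ifs with h1 h2 h2
  · omega
  · rfl
  · rw [PowerSeries.coeff_mk]
    congr 1
    omega
  · omega

include hp in
-- Both sides solve σ dY/dx = A Y with the same value at x = 0; the recursion for the polynomials is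
-- this equation after division by e^(σxz).
theorem wave₀_waveOp :
    wave₀ σ (op dX₀ (waveOp p N σ a)) = expA σ (formalA p N σ) (seriesF a) := by
  have h0 : wave₀ σ (op dX₀ (waveOp p N σ a)) =
      expX₀ σ * symb (τ := Unit) σ (waveOp p N σ a) := rfl
  have h1 : PowerSeries.constantCoeff (wave₀ σ (op dX₀ (waveOp p N σ a))) = seriesF a := by
    have hE : PowerSeries.constantCoeff (expX₀ σ) = 1 := by
      rw [expX₀, ← PowerSeries.coeff_zero_eq_constantCoeff_apply, PowerSeries.coeff_mk]
      simp [monoF_zero_one]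
    rw [h0, map_mul, hE, one_mul]
    refine FLS.ext fun e => ?_
    rw [← PowerSeries.coeff_zero_eq_constantCoeff_apply, symb_waveOp_coeff, seriesF_coeff,
      wavePolyInt, coeff_zero_eq_eval_zero]
    split_ifs
    · rw [eval_wavePoly]
    · simp
  rw [← h1]
  refine eq_expA ?_
  rw [h0, derF_expX₀_mul, mapCoeff_formalA_expX₀_mul]
  congr 2
  refine PowerSeries.ext fun b => FLS.ext fun e => ?_
  rw [LinearMap.smul_apply, ps_coeff_smul, derF_coeff, FLS.coeff_smul, FLS.coeff_smul,
    symb_waveOp_coeff, PowerSeries.coeff_C_mul, FLS.coeff_monoF_mul, map_add, map_add,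
    FLS.coeff_add, FLS.coeff_add, mapCoeff_coeff, eulerF_coeff, ps_coeff_smul, FLS.coeff_smul,
    symb_waveOp_coeff]
  have h2 := congrArg (fun q => q.coeff b) (derivative_wavePolyInt hp N σ a e)
  simp only [coeff_derivative, coeff_add, mul_assoc, coeff_C_mul] at h2
  have h3 : (PowerSeries.coeff b (PowerSeries.X * (PowerSeries.C (monoF 1 (sgn ℂ σ)) *
      symb (τ := Unit) σ (waveOp p N σ a)))).coeff (e + -(p : ℤ)) =
      sgn ℂ σ * (X * wavePolyInt p N σ a (e + 1 - p)).coeff b := by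
    rcases b with _ | b
    · simp
    · rw [PowerSeries.coeff_succ_X_mul, PowerSeries.coeff_C_mul, FLS.coeff_monoF_mul,
        symb_waveOp_coeff, coeff_X_mul, show e + -(p : ℤ) + 1 = e + 1 - p by ring]
  rw [h3, mul_comm ((b : ℂ) + 1), h2, ← sub_eq_add_neg]
  have hp' : (p : ℂ) ≠ 0 := by
    have : p ≠ 0 := by omega
    exact_mod_cast this
  field_simp
  ring

include hp in
-- For j = 0 the recursion has no earlier terms, so the first polynomial is the constant a_0.
theorem vanish_waveOp_sub_one (ha : a 0 = 1) : Vanish 1 (waveOp p N σ a - 1) := by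
  intro e he
  rw [HahnSeries.coeff_sub, waveOp_coeff, HahnSeries.coeff_one, wavePolyInt]
  by_cases h0 : e = 0
  · subst h0
    have h1 : wavePoly p N σ a 0 = 1 := by
      have h2 := derivative_wavePolyInt hp N σ a 0
      have h3 : ∀ e' < 0, wavePolyInt p N σ a e' = 0 := fun e' he' => by
        rw [wavePolyInt, if_neg (by omega)]
      rw [h3 (0 + 1 - p) (by omega), h3 (0 - p) (by omega), mul_zero, mul_zero, add_zero, wavePolyInt,
        if_pos le_rfl, Int.toNat_zero] at h2
      have h4 := eq_C_of_derivative_eq_zero h2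
      rw [coeff_zero_eq_eval_zero, eval_wavePoly, ha] at h4
      rw [h4, map_one]
    simp [h1]
  · rw [if_neg (by omega), if_neg h0]
    simp

end WavePolynomials

/-! ### Inverses of operators 1 + (negative order) and adjoint intertwining relations -/

section Duality

variable {R : Type*} [CommRing R] [Algebra ℂ R] (d : Derivation ℂ R R)

/-- (S - 1) T = 1 - T improves the known order of T by one as long as T begins at a negative index.
This is repeated down to order 0 and used once more for T - 1. -/
theorem vanish_inverse_sub_one {S T : PDO R} (hS : Vanish 1 (S - 1)) (hST : comp d S T = 1) :
    Vanish 1 (T - 1) := by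
  have h1 : comp d (S - 1) T = 1 - T := by
    apply (op d).injective
    rw [op_comp, map_sub, map_sub, sub_mul, ← op_comp, hST, op_one, one_mul]
  have h0 : ∀ j : ℕ, ∀ N : ℤ, -(j : ℤ) ≤ N → Vanish N T → Vanish 0 T := by
    intro j
    induction j with
    | zero => exact fun N hN h => h.mono (by simpa using hN)
    | succ j ih =>
      intro N hN h
      by_cases hN0 : 0 ≤ N
      · exact h.mono hN0
      · refine ih (N + 1) (by push_cast at hN; omega) fun e he => ?_
        have h2 := hS.comp d h
        rw [h1] at h2
        have h3 := h2 e (by omega)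
        rwa [HahnSeries.coeff_sub, HahnSeries.coeff_one, if_neg (by omega), zero_sub,
          neg_eq_zero] at h3
  obtain ⟨N, hN⟩ := exists_vanish T
  have hT : Vanish 0 T := h0 N.natAbs N (by omega) hN
  intro e he
  have h2 := hS.comp d hT e (by omega)
  rw [h1] at h2
  rw [← neg_sub, HahnSeries.coeff_neg, h2, neg_zero]

/-- For a wave operator U this transports both the equation in x and the Lax equation to the adjoint
wave operator (U⁻¹)^*. -/
theorem adjOp_conj {U T A B : Op d} (h1 : U * T = 1) (h2 : T * U = 1) (h : A * U = U * B) :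
    adjOp d T * adjOp d B = adjOp d A * adjOp d T := by
  have h3 : B * T = T * A :=
    calc B * T = T * U * B * T := by rw [h2, one_mul]
      _ = T * (A * U) * T := by rw [h, mul_assoc T]
      _ = T * A := by rw [mul_assoc, mul_assoc, h1, mul_one]
  rw [← adjOp_mul, ← adjOp_mul, h3]

end Duality

/-! ### Identification of the adjoint wave function at t = 0 -/

section DualityAtZero

theorem isMonic_constantCoeff_wave₀ (σ : ℤˣ) {K : PDO (PowerSeries ℂ)} (hK : Vanish 1 (K - 1)) :
    IsMonicOfDegree 0 (PowerSeries.constantCoeff (wave₀ σ (op dX₀ K))) := by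
  have h0 : wave₀ σ (op dX₀ K) = expX₀ σ * symb (τ := Unit) σ K := rfl
  have hE : PowerSeries.constantCoeff (expX₀ σ) = 1 := by
    rw [expX₀, ← PowerSeries.coeff_zero_eq_constantCoeff_apply, PowerSeries.coeff_mk]
    simp [monoF_zero_one]
  have h1 : ∀ e, (PowerSeries.constantCoeff (wave₀ σ (op dX₀ K))).coeff e =
      sgn ℂ (σ ^ e) * PowerSeries.coeff 0 (K.coeff e) := by
    intro e
    rw [h0, map_mul, hE, one_mul, ← PowerSeries.coeff_zero_eq_constantCoeff_apply]
    rfl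
  have h2 : ∀ e < 1, K.coeff e = if e = 0 then 1 else 0 := fun e he => by
    have := hK e he
    rw [HahnSeries.coeff_sub, HahnSeries.coeff_one, sub_eq_zero] at this
    rw [this]
    congr
  constructor
  · rw [h1, neg_zero, h2 0 (by norm_num), if_pos rfl]
    simp
  · intro e he
    rw [h1, h2 e (by omega), if_neg (by omega)]
    simp

/-- The formal adjoint wave function at `t = 0`. -/
theorem wave₀_adj_inverse {k p : ℕ} (hp : 2 ≤ p) (w : Fin k → ℝ) (n : Fin k → ℕ) (σ : ℤˣ)
    {f g : FLS} (hg : IsMonicOfDegree 0 g)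
    (hf' : odeEnd p w n σ (formalA p (∑ i, n i) σ) (mulZ p) f = 0)
    (hg' : odeEnd p w n (-σ) (formalA p (∑ i, n i) (-σ)) (mulZ p) g = 0)
    {U T : PDO (PowerSeries ℂ)} (hU : Vanish 1 (U - 1)) (hUT : comp dX₀ U T = 1)
    (hTU : comp dX₀ T U = 1)
    (hwave : wave₀ σ (op dX₀ U) = expA σ (formalA p (∑ i, n i) σ) f) :
    wave₀ (-σ) (op dX₀ (adj dX₀ T)) = expA (-σ) (formalA p (∑ i, n i) (-σ)) g := by
  have hp0 : p ≠ 0 := by omega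
  have h1 : op dX₀ U * op dX₀ T = 1 := by rw [← op_comp, hUT, op_one]
  have h2 : op dX₀ T * op dX₀ U = 1 := by rw [← op_comp, hTU, op_one]
  have hM : sD dX₀ σ 1 * op dX₀ U = op dX₀ U * opM p (∑ i, n i) σ := by
    rw [← wave₀_eq_expA_iff, hwave, constantCoeff_expA]
  have hL := (lax_mul_eq_iff p w n σ hp0 hwave).2 hf'
  -- Since the adjoints of M and of the Lax operator are those of the sign -σ, the operator (U⁻¹)^*
  -- satisfies both equations of that sign.
  have hM' := adjOp_conj dX₀ h1 h2 hM
  have hL' := adjOp_conj dX₀ h1 h2 hL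
  rw [adjOp_opM hp0, adjOp_sD, ← op_adj] at hM'
  rw [adjOp_laxPower, adjOp_sD, ← op_adj] at hL'
  have hK := (wave₀_eq_expA_iff p (∑ i, n i) (-σ) (op dX₀ (adj dX₀ T))).2 hM'.symm
  have hode := (lax_mul_eq_iff p w n (-σ) hp0 hK).1 hL'.symm
  have hT : Vanish 1 (adj dX₀ T - 1) := by
    have h3 := (vanish_inverse_sub_one dX₀ hU hUT).adj dX₀
    have h4 : adj dX₀ (T - 1) = adj dX₀ T - 1 := by
      apply (op dX₀).injective
      rw [op_adj, map_sub, map_sub, map_sub, op_adj, op_one, adjOp_one]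
    rwa [h4] at h3
  -- The value of the wave at x = 0 is a normalised solution of the equation for -σ, hence equal to
  -- `g`.
  rw [hK, formal_solution_unique hp0 w n (-σ) (isMonic_constantCoeff_wave₀ (-σ) hT) hg hode hg']

end DualityAtZero

/-! ### Points of the big cell and power series with values in them -/

section Grassmannian

/-- The finitely many nonnegative powers of z are matched from the top downwards by multiples of z^m
+ …; an index e ≤ 0 stands for the power z^(-e). -/
theorem IsGrPoint.exists_approx {W : Submodule ℂ FLS} (hW : IsGrPoint W) (h : FLS) :
    ∃ f ∈ W, ∀ e ≤ 0, f.coeff e = h.coeff e := by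
  obtain ⟨φ, hφ, rfl⟩ := hW
  have key : ∀ m : ℕ, ∀ h : FLS, (∀ e < 1 - (m : ℤ), h.coeff e = 0) →
      ∃ f ∈ Submodule.span ℂ (Set.range φ), ∀ e ≤ 0, f.coeff e = h.coeff e := by
    intro m
    induction m with
    | zero => exact fun h hh => ⟨0, Submodule.zero_mem _, fun e he => by
        rw [hh e (by push_cast; omega), FLS.coeff_zero]⟩
    | succ m ih =>
      intro h hh
      obtain ⟨f, hf, hfe⟩ := ih (h - h.coeff (-(m : ℤ)) • φ m) (fun e he => by
        rw [FLS.coeff_sub, FLS.coeff_smul]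
        by_cases h1 : e = -(m : ℤ)
        · rw [h1, (hφ m).1, mul_one, sub_self]
        · rw [hh e (by push_cast; omega), (hφ m).2 e (by omega), mul_zero, sub_zero])
      refine ⟨f + h.coeff (-(m : ℤ)) • φ m, Submodule.add_mem _ hf (Submodule.smul_mem _ _
        (Submodule.subset_span ⟨m, rfl⟩)), fun e he => ?_⟩
      rw [FLS.coeff_add, hfe e he, FLS.coeff_sub, sub_add_cancel]
  obtain ⟨N, hN⟩ := exists_vanish (id h : LaurentSeries ℂ)
  exact key (1 - N).toNat h fun e he => hN e (by omega)

/-- In a linear combination of the basis the largest index m alone contributes the power z^m.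
Together with `IsGrPoint.exists_approx` this makes W isomorphic to ℂ[z] under projection. -/
theorem IsGrPoint.eq_zero {W : Submodule ℂ FLS} (hW : IsGrPoint W) {f : FLS} (hf : f ∈ W)
    (h : ∀ e ≤ 0, f.coeff e = 0) : f = 0 := by
  obtain ⟨φ, hφ, rfl⟩ := hW
  obtain ⟨c, rfl⟩ := Finsupp.mem_span_range_iff_exists_finsupp.1 hf
  by_cases hc : c.support.Nonempty
  · exfalso
    have h1 := Finset.max'_mem _ hc
    set m := c.support.max' hc with hm
    have h2 := h (-(m : ℤ)) (by omega)
    rw [Finsupp.sum, FLS.coeff_sum, Finset.sum_eq_single m] at h2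
    · rw [FLS.coeff_smul, (hφ m).1, mul_one] at h2
      exact Finsupp.mem_support_iff.1 h1 h2
    · intro i hi him
      have := Finset.le_max' _ i hi
      rw [FLS.coeff_smul, (hφ i).2 _ (by omega), mul_zero]
    · exact fun h3 => absurd h1 h3
  · rw [Finset.not_nonempty_iff_eq_empty] at hc
    rw [Finsupp.sum, hc, Finset.sum_empty]

variable {τ : Type*}

/-- All coefficients lie in `W`. -/
def ValuedIn (W : Submodule ℂ FLS) (F : MvPowerSeries τ FLS) : Prop :=
  ∀ α, MvPowerSeries.coeff α F ∈ W

variable {W : Submodule ℂ FLS}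

theorem ValuedIn.sub {F G : MvPowerSeries τ FLS} (hF : ValuedIn W F) (hG : ValuedIn W G) :
    ValuedIn W (F - G) := fun α => by
  rw [map_sub]
  exact W.sub_mem (hF α) (hG α)

theorem ValuedIn.pdF {F : MvPowerSeries τ FLS} (hF : ValuedIn W F) (i : τ) :
    ValuedIn W (pdF i F) := fun α => by
  have : MvPowerSeries.coeff α (KVec.pdF i F) =
      ((α i : ℂ) + 1) • MvPowerSeries.coeff (α + Finsupp.single i 1) F := by
    refine FLS.ext fun e => ?_
    rw [pdF_apply, MvPowerSeries.coeff_pderiv, mv_coeff_natCast_mul, FLS.coeff_smul, mul_comm]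
  rw [this]
  exact W.smul_mem _ (hF _)

theorem coeff_toFLS_mul [DecidableEq τ] (h : MvPowerSeries τ ℂ) (F : MvPowerSeries τ FLS)
    (α : τ →₀ ℕ) : MvPowerSeries.coeff α (toFLS h * F) = ∑ x ∈ Finset.HasAntidiagonal.antidiagonal α,
      MvPowerSeries.coeff x.1 h • MvPowerSeries.coeff x.2 F := by
  rw [MvPowerSeries.coeff_mul]
  refine Finset.sum_congr rfl fun x _ => ?_
  rw [MvPowerSeries.coeff_map, Algebra.smul_def]

theorem ValuedIn.toFLS_mul {F : MvPowerSeries τ FLS} (hF : ValuedIn W F) (h : MvPowerSeries τ ℂ) :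
    ValuedIn W (toFLS h * F) := fun α => by
  classical
  rw [coeff_toFLS_mul]
  exact W.sum_mem fun x _ => W.smul_mem _ (hF _)

theorem degree_lt_of_mem_antidiagonal [DecidableEq τ] {α : τ →₀ ℕ} {x : (τ →₀ ℕ) × (τ →₀ ℕ)}
    (hx : x ∈ Finset.HasAntidiagonal.antidiagonal α) (hne : x.2 ≠ α) : x.2.degree < α.degree := by
  rw [Finset.HasAntidiagonal.mem_antidiagonal] at hx
  rw [← hx, map_add]
  have : x.1.degree ≠ 0 := fun h0 => by
    rw [Finsupp.degree_eq_zero_iff] at h0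
    rw [h0, zero_add] at hx
    exact hne hx
  omega

/-- Separates the coefficient of full degree from those of lower degree, for inductions on the total
degree. -/
theorem coeff_mul_eq_sub [DecidableEq τ] {E' : MvPowerSeries τ FLS}
    (hE' : MvPowerSeries.constantCoeff E' = 1) (F : MvPowerSeries τ FLS) (α : τ →₀ ℕ) :
    MvPowerSeries.coeff α (E' * F) = MvPowerSeries.coeff α F +
      ∑ x ∈ Finset.HasAntidiagonal.antidiagonal α with x.2 ≠ α,
        MvPowerSeries.coeff x.1 E' * MvPowerSeries.coeff x.2 F := by
  rw [MvPowerSeries.coeff_mul, ← Finset.sum_filter_add_sum_filter_not _ (fun x => x.2 = α)]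
  congr 1
  rw [Finset.sum_eq_single (0, α)]
  · rw [MvPowerSeries.coeff_zero_eq_constantCoeff_apply, hE', one_mul]
  · rintro ⟨β, γ⟩ hx hne
    simp only [Finset.mem_filter, Finset.HasAntidiagonal.mem_antidiagonal] at hx
    obtain ⟨h1, rfl⟩ := hx
    rw [add_eq_right] at h1
    exact absurd (by rw [h1]) hne
  · intro h
    simp at h

/-- A `W`-valued series is determined by the nonnegative powers of `z` in `E' F`. -/
theorem ValuedIn.eq_zero (hW : IsGrPoint W) {E' F : MvPowerSeries τ FLS}
    (hE' : MvPowerSeries.constantCoeff E' = 1) (hF : ValuedIn W F)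
    (h : ∀ α, ∀ e ≤ 0, (MvPowerSeries.coeff α (E' * F)).coeff e = 0) : F = 0 := by
  classical
  have key : ∀ m : ℕ, ∀ α : τ →₀ ℕ, α.degree = m → MvPowerSeries.coeff α F = 0 := by
    intro m
    induction m using Nat.strong_induction_on with
    | _ m ih =>
      intro α hα
      refine hW.eq_zero (hF α) fun e he => ?_
      have h1 := h α e he
      rwa [coeff_mul_eq_sub hE', Finset.sum_eq_zero, add_zero] at h1
      intro x hx
      rw [Finset.mem_filter] at hx
      rw [ih _ (hα ▸ degree_lt_of_mem_antidiagonal hx.1 hx.2) _ rfl, mul_zero]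
  exact MvPowerSeries.ext fun α => by rw [key _ α rfl, map_zero]

open Classical in
/-- The `W`-valued series `F` such that `E' F = 1 + (negative powers of z)`. -/
def grSection (hW : IsGrPoint W) (E' : MvPowerSeries τ FLS) (α : τ →₀ ℕ) : FLS :=
  (hW.exists_approx ((if α = 0 then 1 else 0) -
    ∑ x ∈ (Finset.HasAntidiagonal.antidiagonal α).attach, if _h : x.1.2 ≠ α then
      MvPowerSeries.coeff x.1.1 E' * grSection hW E' x.1.2 else 0)).choose
termination_by α.degree
decreasing_by all_goals exact degree_lt_of_mem_antidiagonal x.2 _h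

open Classical in
theorem exists_valuedIn (hW : IsGrPoint W) {E' : MvPowerSeries τ FLS}
    (hE' : MvPowerSeries.constantCoeff E' = 1) :
    ∃ F : MvPowerSeries τ FLS, ValuedIn W F ∧ ∀ α, ∀ e ≤ 0,
      (MvPowerSeries.coeff α (E' * F)).coeff e = if α = 0 ∧ e = 0 then 1 else 0 := by
  let F : MvPowerSeries τ FLS := grSection hW E'
  have hF : ∀ α, MvPowerSeries.coeff α F = grSection hW E' α := fun α => rfl
  have hspec : ∀ α, grSection hW E' α ∈ W ∧ ∀ e ≤ 0, (grSection hW E' α).coeff e =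
      ((if α = 0 then 1 else 0) - ∑ x ∈ Finset.HasAntidiagonal.antidiagonal α with x.2 ≠ α,
        MvPowerSeries.coeff x.1 E' * grSection hW E' x.2 : FLS).coeff e := by
    intro α
    have h1 := (hW.exists_approx ((if α = 0 then 1 else 0) -
      ∑ x ∈ (Finset.HasAntidiagonal.antidiagonal α).attach, if _h : x.1.2 ≠ α then
        MvPowerSeries.coeff x.1.1 E' * grSection hW E' x.1.2 else 0)).choose_spec
    have h2 : (∑ x ∈ (Finset.HasAntidiagonal.antidiagonal α).attach, if _h : x.1.2 ≠ α then
        MvPowerSeries.coeff x.1.1 E' * grSection hW E' x.1.2 else 0) =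
        ∑ x ∈ Finset.HasAntidiagonal.antidiagonal α with x.2 ≠ α,
          MvPowerSeries.coeff x.1 E' * grSection hW E' x.2 := by
      rw [Finset.sum_filter, ← Finset.sum_attach (Finset.HasAntidiagonal.antidiagonal α)]
      refine Finset.sum_congr rfl fun x _ => ?_
      rw [dite_eq_ite]
    rw [← grSection, h2] at h1
    exact h1
  refine ⟨F, fun α => hF α ▸ (hspec α).1, fun α e he => ?_⟩
  rw [coeff_mul_eq_sub hE', FLS.coeff_add, hF, (hspec α).2 e he, FLS.coeff_sub]
  simp only [hF]
  rw [sub_add_cancel]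
  by_cases h0 : α = 0
  · rw [if_pos h0]
    by_cases h1 : e = 0
    · rw [if_pos ⟨h0, h1⟩, h1, ← monoF_zero_one, FLS.coeff_monoF]
      simp
    · rw [if_neg (fun h => h1 h.2), ← monoF_zero_one, FLS.coeff_monoF]
      simp [h1]
  · rw [if_neg h0, if_neg (fun h => h0 h.1), FLS.coeff_zero]

theorem symb_coeff_eq_zero {σ : ℤˣ} {P : PDO (MvPowerSeries τ ℂ)} (hP : Vanish 1 P)
    (α : τ →₀ ℕ) {e : ℤ} (he : e ≤ 0) : (MvPowerSeries.coeff α (symb σ P)).coeff e = 0 := by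
  rw [symb_coeff, hP e (by omega), map_zero, mul_zero]

/-- An operator of negative order whose wave is `W`-valued vanishes. -/
theorem eq_zero_of_valuedIn (hW : IsGrPoint W) {σ : ℤˣ} {E : MvPowerSeries τ FLS}
    (hE : MvPowerSeries.constantCoeff E = 1) {P : PDO (MvPowerSeries τ ℂ)} (hP : Vanish 1 P)
    (h : ValuedIn W (E * symb σ P)) : P = 0 := by
  have hu : IsUnit E := MvPowerSeries.isUnit_iff_constantCoeff.2 (by rw [hE]; exact isUnit_one)
  obtain ⟨E', hE'⟩ := hu.exists_left_inv
  have hc : MvPowerSeries.constantCoeff E' = 1 := by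
    have := congrArg MvPowerSeries.constantCoeff hE'
    rwa [map_mul, hE, mul_one, map_one] at this
  have h0 : E * symb σ P = 0 := h.eq_zero hW hc fun α e he => by
    rw [← mul_assoc, hE', one_mul, symb_coeff_eq_zero hP α he]
  refine symb_injective σ ?_
  have h1 : symb σ (0 : PDO (MvPowerSeries τ ℂ)) = 0 := by
    have := symb_add σ (0 : PDO (MvPowerSeries τ ℂ)) 0
    rwa [add_zero, left_eq_add] at this
  rw [h1]
  exact hu.mul_right_eq_zero.1 h0

open Classical in
/-- The operator with a given wave. -/
theorem exists_symb_eq {ψ : MvPowerSeries τ FLS} (h : ∀ α, ∀ e ≤ 0,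
      (MvPowerSeries.coeff α ψ).coeff e = if α = 0 ∧ e = 0 then 1 else 0) :
    ∃ S : PDO (MvPowerSeries τ ℂ), Vanish 1 (S - 1) ∧ symb 1 S = ψ := by
  let c : ℤ → MvPowerSeries τ ℂ := fun e α => (MvPowerSeries.coeff α ψ).coeff e
  have hc : ∀ e α, MvPowerSeries.coeff α (c e) = (MvPowerSeries.coeff α ψ).coeff e :=
    fun e α => rfl
  have hneg : ∀ e < 0, c e = 0 := fun e he => MvPowerSeries.ext fun α => by
    rw [hc, h α e he.le, if_neg (by omega), map_zero]
  have h0 : c 0 = 1 := MvPowerSeries.ext fun α => by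
    rw [hc, h α 0 le_rfl, MvPowerSeries.coeff_one]
    simp
  refine ⟨HahnSeries.ofSuppBddBelow c ⟨0, fun e he => not_lt.1 fun h => he (hneg e h)⟩,
    fun e he => ?_, FLS.mv_ext fun α e => ?_⟩
  · rw [HahnSeries.coeff_sub, HahnSeries.coeff_one]
    change c e - _ = 0
    split_ifs with h1
    · rw [h1, h0, sub_self]
    · rw [hneg e (by omega), sub_zero]
  · rw [symb_coeff, one_zpow, sgn_one, one_mul]
    exact hc e α

end Grassmannian

/-! ### Sato's construction of the wave operator -/

section KP

theorem IsDiff.op_eq_sum {R : Type*} [CommRing R] [Algebra ℂ R] (d : Derivation ℂ R R) {B : PDO R}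
    (hB : IsDiff B) : ∃ m : ℕ, (∀ j : ℕ, m ≤ j → B.coeff (-(j : ℤ)) = 0) ∧ op d B =
      ∑ j ∈ Finset.range m, mulOp d (B.coeff (-(j : ℤ))) * sD d 1 1 ^ j := by
  obtain ⟨N, hN⟩ := exists_vanish B
  refine ⟨(1 - N).toNat, fun j hj => hN _ (by omega), ?_⟩
  have h1 : ∀ j : ℕ, mulOp d (B.coeff (-(j : ℤ))) * sD d 1 1 ^ j =
      op d (HahnSeries.single (-(j : ℤ)) (B.coeff (-(j : ℤ)))) := fun j => by
    rw [op_single, sD_one_pow, neg_neg]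
  simp only [h1]
  rw [← map_sum]
  congr 1
  ext e
  rw [HahnSeries.coeff_sum]
  by_cases he : 0 < e
  · rw [hB e he, Finset.sum_eq_zero]
    exact fun j _ => HahnSeries.coeff_single_of_ne (by omega)
  · by_cases heN : e < N
    · rw [hN e heN, Finset.sum_eq_zero]
      intro j hj
      rw [Finset.mem_range] at hj
      exact HahnSeries.coeff_single_of_ne (by omega)
    · rw [Finset.sum_eq_single (-e).toNat]
      · rw [show -((-e).toNat : ℤ) = e by omega, HahnSeries.coeff_single_same]
      · exact fun j _ hj => HahnSeries.coeff_single_of_ne (by omega)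
      · intro hj
        exact absurd (Finset.mem_range.2 (by omega)) hj

variable {W : Submodule ℂ FLS}

theorem wave_sD_one_mul (σ : ℤˣ) (X : Op dX) :
    wave dX σ (expXT σ) (sD dX 1 1 * X) = pdF 0 (wave dX σ (expXT σ) X) := by
  have h1 : sD dX 1 1 * X = sgn ℂ σ • (sD dX σ 1 * X) := by
    rcases Int.units_eq_one_or σ with rfl | rfl
    · rw [sgn_one, one_smul]
    · rw [sD_neg, sgn_neg, sgn_one, neg_smul, one_smul, neg_mul, neg_neg]
  have hE : MvPowerSeries.pderiv FLS 0 (expXT σ) =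
      MvPowerSeries.C (monoF 1 (sgn ℂ σ)) * expXT σ := pderiv_expXT σ 0
  rw [h1, map_smul, wave_D_mul (d := dX) (i := 0) rfl hE, LinearMap.smul_apply, smul_smul,
    sgn_mul_self, one_smul]

/-- D acts on the wave as ∂/∂x, and both ∂/∂x and multiplication by scalar power series preserve
W-valued series. -/
theorem ValuedIn.wave_isDiff_mul {σ : ℤˣ} {B : PDO XT} (hB : IsDiff B) {X : Op dX}
    (hX : ValuedIn W (wave dX σ (expXT σ) X)) :
    ValuedIn W (wave dX σ (expXT σ) (op dX B * X)) := by
  obtain ⟨m, -, hm⟩ := hB.op_eq_sum dX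
  have hpow : ∀ j : ℕ, ValuedIn W (wave dX σ (expXT σ) (sD dX 1 1 ^ j * X)) := by
    intro j
    induction j with
    | zero => rwa [pow_zero, one_mul]
    | succ j ih =>
      rw [pow_succ', mul_assoc, wave_sD_one_mul]
      exact ih.pdF 0
  rw [hm, Finset.sum_mul, map_sum]
  intro α
  rw [map_sum]
  refine W.sum_mem fun j _ => ?_
  rw [mul_assoc, wave_mulOp_mul]
  exact (hpow j).toFLS_mul _ α

theorem pderiv_dX (i : ℕ) (h : XT) :
    MvPowerSeries.pderiv ℂ i (dX h) = dX (MvPowerSeries.pderiv ℂ i h) := by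
  refine MvPowerSeries.ext fun α => ?_
  rw [dX, MvPowerSeries.coeff_pderiv, MvPowerSeries.coeff_pderiv, MvPowerSeries.coeff_pderiv,
    MvPowerSeries.coeff_pderiv, add_right_comm]
  by_cases hi : i = 0
  · rw [hi]
  · simp [Finsupp.single_apply, hi, Ne.symm hi]
    ring

/-- The inverse of the dressing operator. -/
def undressing {R : Type*} [CommRing R] [Algebra ℂ R] (d : Derivation ℂ R R) (σ : ℤˣ)
    (S T : PDO R) : PDO R := if σ = 1 then T else adj d S

section Lax

variable {R : Type*} [CommRing R] [Algebra ℂ R] (d : Derivation ℂ R R) {S T : PDO R}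

theorem dressing_one : dressing d 1 S T = S := if_pos rfl

theorem dressing_neg_one : dressing d (-1) S T = adj d T := if_neg (by decide)

theorem undressing_one : undressing d 1 S T = T := if_pos rfl

theorem undressing_neg_one : undressing d (-1) S T = adj d S := if_neg (by decide)

theorem lax_one : lax d 1 S T = comp d (comp d S (signedD R 1 1)) T := if_pos rfl

theorem lax_neg_one : lax d (-1) S T =
    comp d (comp d (adj d T) (signedD R (-1) 1)) (adj d S) := if_neg (by decide)

theorem op_lax (σ : ℤˣ) : op d (lax d σ S T) =
    op d (dressing d σ S T) * sD d σ 1 * op d (undressing d σ S T) := by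
  rcases Int.units_eq_one_or σ with rfl | rfl
  · rw [lax_one, dressing_one, undressing_one, op_comp, op_comp, op_signedD]
  · rw [lax_neg_one, dressing_neg_one, undressing_neg_one, op_comp, op_comp, op_signedD]

variable (hST : comp d S T = 1) (hTS : comp d T S = 1)

include hST hTS in
theorem undressing_mul_dressing (σ : ℤˣ) :
    op d (undressing d σ S T) * op d (dressing d σ S T) = 1 := by
  rcases Int.units_eq_one_or σ with rfl | rfl
  · rw [dressing_one, undressing_one, ← op_comp, hTS, op_one]
  · rw [dressing_neg_one, undressing_neg_one, op_adj, op_adj, ← adjOp_mul, ← op_comp, hTS, op_one,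
      adjOp_one]

include hST hTS in
theorem op_compPow_lax (σ : ℤˣ) (i : ℕ) : op d (compPow d (lax d σ S T) i) =
    op d (dressing d σ S T) * sD d σ i * op d (undressing d σ S T) := by
  have h1 : op d (dressing d σ S T) * op d (undressing d σ S T) = 1 := by
    rcases Int.units_eq_one_or σ with rfl | rfl
    · rw [dressing_one, undressing_one, ← op_comp, hST, op_one]
    · rw [dressing_neg_one, undressing_neg_one, op_adj, op_adj, ← adjOp_mul, ← op_comp, hST, op_one,
        adjOp_one]
  rw [op_compPow, op_lax, ← sD_one_pow]
  induction i with
  | zero => rw [pow_zero, pow_zero, mul_one, h1]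
  | succ i ih =>
    rw [pow_succ, ih, pow_succ]
    simp only [mul_assoc]
    rw [← mul_assoc (op d (undressing d σ S T)) (op d (dressing d σ S T)),
      undressing_mul_dressing d hST hTS, one_mul]

include hST hTS in
-- The adjoint reverses the factors of S D S⁻¹ and replaces D by -D, which gives (S⁻¹)^* (-D) S^*.
theorem compPow_lax_neg (σ : ℤˣ) (i : ℕ) :
    compPow d (lax d (-σ) S T) i = adj d (compPow d (lax d σ S T) i) := by
  apply (op d).injective
  rw [op_adj, op_compPow_lax d hST hTS, op_compPow_lax d hST hTS, adjOp_mul, adjOp_mul, adjOp_sD]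
  rcases Int.units_eq_one_or σ with rfl | rfl
  · rw [dressing_one, dressing_neg_one, undressing_one, undressing_neg_one, op_adj, op_adj,
      mul_assoc]
  · rw [neg_neg, dressing_one, dressing_neg_one, undressing_one, undressing_neg_one, op_adj, op_adj,
      adjOp_adjOp, adjOp_adjOp, mul_assoc]

include hST hTS in
theorem op_compPow_lax_mul_dressing (σ : ℤˣ) (i : ℕ) :
    op d (compPow d (lax d σ S T) i) * op d (dressing d σ S T) =
      op d (dressing d σ S T) * sD d σ i := by
  rw [op_compPow_lax d hST hTS, mul_assoc, undressing_mul_dressing d hST hTS, mul_one]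

end Lax

theorem mapD_one_one {R : Type*} [CommRing R] [Algebra ℂ R] (δ : Derivation ℂ R R) :
    mapD δ 1 (1 : PDO R) = 0 := by
  ext e
  rw [mapD_one_coeff, HahnSeries.coeff_one]
  split_ifs <;> simp

theorem op_mapD_one_inverse {R : Type*} [CommRing R] [Algebra ℂ R] (d : Derivation ℂ R R)
    {δ : Derivation ℂ R R} (hδ : ∀ h, δ (d h) = d (δ h)) {S T : PDO R}
    (hST : comp d S T = 1) (hTS : comp d T S = 1) :
    op d (mapD δ 1 T) = - (op d T * op d (mapD δ 1 S) * op d T) := by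
  have h1 := congrArg (mapD δ 1) hTS
  rw [mapD_one_comp d hδ, mapD_one_one] at h1
  have h2 := congrArg (fun X => op d X * op d T) h1
  simp only [map_add, map_zero, zero_mul, op_comp, add_mul] at h2
  rw [mul_assoc, ← op_comp d S T, hST, op_one, mul_one] at h2
  exact eq_neg_of_add_eq_zero_left h2

/-- The equation for the adjoint wave function follows from the one for the wave function. -/
theorem isKPWaveOperator_of_one {S T : PDO XT} (hS : Vanish 1 (S - 1))
    (hST : comp dX S T = 1) (hTS : comp dX T S = 1)
    (h : ∀ i : ℕ, 1 ≤ i → op dX (dT i S) + op dX S * sD dX 1 i =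
      op dX (posPart (compPow dX (lax dX 1 S T) i)) * op dX S) : IsKPWaveOperator S T := by
  have hS' : ∀ e < 1, S.coeff e = (1 : PDO XT).coeff e := fun e he => by
    have := hS e he
    rwa [HahnSeries.coeff_sub, sub_eq_zero] at this
  refine ⟨⟨?_, fun e he => ?_⟩, hST, hTS, fun σ i hi => ?_⟩
  · rw [hS' 0 (by norm_num), HahnSeries.coeff_one, if_pos rfl]
  · rw [hS' e (by omega), HahnSeries.coeff_one, if_neg (by omega)]
  · apply (op dX).injective
    rw [map_add, op_sgn_mul, op_sgn_mul, op_comp, op_comp, op_signedD]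
    rcases Int.units_eq_one_or σ with rfl | rfl
    · rw [dressing_one, sgn_one, one_smul, one_smul]
      exact h i hi
    -- The equation for the sign - is the adjoint of the evolution of S⁻¹, which follows from that
    -- of S by differentiating S⁻¹ S = 1.
    · rw [dressing_neg_one, compPow_lax_neg dX hST hTS 1 i, ← adj_posPart, op_adj, op_adj, dT,
        mapD_one_adj dX (pderiv_dX i), op_adj, op_mapD_one_inverse dX (pderiv_dX i) hST hTS]
      have h1 : op dX (mapD (MvPowerSeries.pderiv ℂ i) 1 S) = _ - _ := eq_sub_of_add_eq (h i hi)
      have h2 : op dX S * op dX T = 1 := by rw [← op_comp, hST, op_one]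
      have h3 : op dX T * op dX S = 1 := by rw [← op_comp, hTS, op_one]
      have h4 : op dX T * op dX (mapD (MvPowerSeries.pderiv ℂ i) 1 S) * op dX T =
          op dX T * op dX (posPart (compPow dX (lax dX 1 S T) i)) - sD dX 1 i * op dX T := by
        rw [h1, mul_sub, sub_mul, ← mul_assoc, ← mul_assoc, h3, one_mul, mul_assoc _ (op dX S), h2,
          mul_one]
      rw [h4, map_neg, map_sub, adjOp_mul, adjOp_mul, adjOp_sD, sgn_neg, sgn_one, neg_smul,
        neg_smul, one_smul, one_smul]
      abel

/-- Sato's correspondence. -/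
theorem exists_waveOperator (hW : IsGrPoint W) : ∃ S T : PDO XT, IsKPWaveOperator S T ∧
    Vanish 1 (S - 1) ∧ ValuedIn W (wave dX 1 (expXT 1) (op dX S)) := by
  obtain ⟨E', hE'⟩ := (isUnit_expXT 1).exists_right_inv
  have hc : MvPowerSeries.constantCoeff E' = 1 := by
    have := congrArg MvPowerSeries.constantCoeff hE'
    rwa [map_mul, constantCoeff_expXT, one_mul, map_one] at this
  -- `E'` is the inverse of the exponential: F is the W-valued series with e^(-xz-…) F = 1 + O(1/z),
  -- and S is read off from this quotient.
  obtain ⟨F, hF, hF'⟩ := exists_valuedIn hW hc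
  obtain ⟨S, hS, hS'⟩ := exists_symb_eq hF'
  obtain ⟨T, hST, hTS⟩ := exists_inverse dX hS
  have hwave : wave dX 1 (expXT 1) (op dX S) = F := by
    rw [wave_op, hS', ← mul_assoc, hE', one_mul]
  have hWS : ValuedIn W (wave dX 1 (expXT 1) (op dX S)) := hwave ▸ hF
  refine ⟨S, T, isKPWaveOperator_of_one hS hST hTS fun i hi => ?_, hS, hWS⟩
  set L := compPow dX (lax dX 1 S T) i with hL
  have hLS : op dX L * op dX S = op dX S * sD dX 1 i := by
    have := op_compPow_lax_mul_dressing dX hST hTS 1 i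
    rwa [dressing_one] at this
  have hpos : op dX (posPart L) = op dX L - op dX (negPart L) := by
    rw [eq_sub_iff_add_eq, ← map_add, posPart_add_negPart]
  have hVS : Vanish 0 S := fun e he => by
    have := hS e (by omega)
    rwa [HahnSeries.coeff_sub, HahnSeries.coeff_one, if_neg (by omega), sub_zero] at this
  -- The defect of the KP equation, rewritten as ∂S/∂t_i + (L^i)_- S. It has negative order because
  -- the leading coefficient of S is the constant 1.
  have hV : Vanish 1 (dT i S + comp dX (negPart L) S) := by
    refine Vanish.add ?_ (((vanish_negPart L).comp dX hVS).mono (by omega))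
    have h1 : dT i S = dT i (S - 1) := by
      have h2 := mapD_add (MvPowerSeries.pderiv ℂ i) 1 (S - 1) 1
      rw [sub_add_cancel, mapD_one_one, add_zero] at h2
      exact h2
    rw [h1]
    exact hS.mapD _ 1
  have hY : op dX (dT i S + comp dX (negPart L) S) =
      op dX (dT i S) + op dX S * sD dX 1 i - op dX (posPart L) * op dX S := by
    rw [hpos, sub_mul, hLS, map_add, op_comp]
    abel
  have hE : MvPowerSeries.pderiv FLS i (expXT 1) =
      MvPowerSeries.C (monoF i (sgn ℂ 1)) * expXT 1 := by
    have := pderiv_expXT 1 i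
    rwa [max_eq_left hi] at this
  -- The wave of the defect is ∂Ψ/∂t_i - (L^i)_+ Ψ, and both terms are W-valued.
  have hval : ValuedIn W (wave dX 1 (expXT 1) (op dX (dT i S + comp dX (negPart L) S))) := by
    rw [hY, map_sub]
    refine ValuedIn.sub ?_ (hWS.wave_isDiff_mul (isDiff_posPart L))
    have := wave_dT (d := dX) hE S
    rw [sgn_one, one_smul] at this
    rw [map_add, wave_mul_sD, dT, ← this]
    exact hWS.pdF i
  rw [wave_op] at hval
  have h0 := eq_zero_of_valuedIn hW (constantCoeff_expXT 1) hV hval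
  rw [h0, map_zero] at hY
  exact sub_eq_zero.1 hY.symm

end KP

/-! ### Restriction of operators and waves to t = 0 -/

section RestrictionToZero

variable {W : Submodule ℂ FLS}

theorem ValuedIn.restrictX {F : MvPowerSeries ℕ FLS} (hF : ValuedIn W F) :
    ValuedIn (τ := Unit) W (restrictX FLS F) := fun α => by
  have h : MvPowerSeries.coeff α (KVec.restrictX FLS F) =
      PowerSeries.coeff (α ()) (KVec.restrictX FLS F) := by
    rw [PowerSeries.coeff_def rfl]
  rw [h, restrictX_coeff]
  exact hF _

theorem valuedIn_expA (σ : ℤˣ) (A : Module.End ℂ FLS) (f : FLS) :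
    ValuedIn (τ := Unit) (cyclicSpan A f) (expA σ A f) := fun α => by
  have h : MvPowerSeries.coeff α (expA σ A f) = PowerSeries.coeff (α ()) (expA σ A f) := by
    rw [PowerSeries.coeff_def rfl]
  rw [h, expA_coeff]
  exact Submodule.smul_mem _ _ (Submodule.subset_span ⟨α (), rfl⟩)

theorem map_one_hahn {R R' : Type*} [CommRing R] [CommRing R'] [Algebra ℂ R] [Algebra ℂ R']
    (f : R →ₐ[ℂ] R') : ((1 : PDO R).map f : PDO R') = 1 := by
  ext e
  rw [HahnSeries.map_coeff, HahnSeries.coeff_one, HahnSeries.coeff_one]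
  split_ifs <;> simp

theorem map_sgn {R R' : Type*} [CommRing R] [CommRing R'] [Algebra ℂ R] [Algebra ℂ R']
    (f : R →ₐ[ℂ] R') (σ : ℤˣ) : f (sgn R σ) = sgn R' σ := by simp

theorem map_signedD {R R' : Type*} [CommRing R] [CommRing R'] [Algebra ℂ R] [Algebra ℂ R']
    (f : R →ₐ[ℂ] R') (σ : ℤˣ) (m : ℤ) : ((signedD R σ m).map f : PDO R') = signedD R' σ m := by
  ext e
  rw [HahnSeries.map_coeff, signedD, signedD]
  by_cases h : e = -m
  · rw [h, HahnSeries.coeff_single_same, HahnSeries.coeff_single_same]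
    exact map_sgn f _
  · rw [HahnSeries.coeff_single_of_ne h, HahnSeries.coeff_single_of_ne h, map_zero]

theorem opAtZero_comp (P Q : PDO XT) :
    opAtZero (comp dX P Q) = comp dX₀ (opAtZero P) (opAtZero Q) :=
  map_comp (d := dX) (d' := dX₀) atZeroHom atZeroHom_dX P Q

theorem opAtZero_adj (P : PDO XT) : opAtZero (adj dX P) = adj dX₀ (opAtZero P) :=
  map_adj (d := dX) (d' := dX₀) atZeroHom atZeroHom_dX P

theorem opAtZero_one : opAtZero 1 = 1 := map_one_hahn atZeroHom

theorem opAtZero_signedD (σ : ℤˣ) (m : ℤ) :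
    opAtZero (signedD XT σ m) = signedD (PowerSeries ℂ) σ m := map_signedD atZeroHom σ m

theorem opAtZero_sub (P Q : PDO XT) : opAtZero (P - Q) = opAtZero P - opAtZero Q := by
  ext e
  simp only [opAtZero_eq, HahnSeries.map_coeff, HahnSeries.coeff_sub, map_sub]

theorem opAtZero_dressing (σ : ℤˣ) (S T : PDO XT) :
    opAtZero (dressing dX σ S T) = dressing dX₀ σ (opAtZero S) (opAtZero T) := by
  rcases Int.units_eq_one_or σ with rfl | rfl
  · rw [dressing_one, dressing_one]
  · rw [dressing_neg_one, dressing_neg_one, opAtZero_adj]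

theorem opAtZero_lax (σ : ℤˣ) (S T : PDO XT) :
    opAtZero (lax dX σ S T) = lax dX₀ σ (opAtZero S) (opAtZero T) := by
  rcases Int.units_eq_one_or σ with rfl | rfl
  · rw [lax_one, lax_one, opAtZero_comp, opAtZero_comp, opAtZero_signedD]
  · rw [lax_neg_one, lax_neg_one, opAtZero_comp, opAtZero_comp, opAtZero_signedD, opAtZero_adj,
      opAtZero_adj]

theorem opAtZero_compPow (P : PDO XT) (i : ℕ) :
    opAtZero (compPow dX P i) = compPow dX₀ (opAtZero P) i := by
  induction i with
  | zero => exact opAtZero_one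
  | succ i ih => rw [compPow, compPow, opAtZero_comp, ih]

/-- The i-th derivative of e^(σxA) f at x = 0 is σ^i A^i f, and signs do not change the span. -/
theorem waveSpace_expA (σ : ℤˣ) (A : Module.End ℂ FLS) (f : FLS) :
    waveSpace (expA σ A f) = cyclicSpan A f := by
  have h1 : ∀ i : ℕ, ∀ f : FLS, PowerSeries.constantCoeff
      ((PowerSeries.derivative FLS)^[i] (expA σ A f)) = sgn ℂ σ ^ i • (A ^ i) f := by
    intro i
    induction i with
    | zero => intro f; simp [constantCoeff_expA]
    | succ i ih =>
      intro f
      have h2 : PowerSeries.derivative FLS (expA σ A f) = expA σ A (sgn ℂ σ • A f) := by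
        rw [map_smul, ← derF_expA, LinearMap.smul_apply, smul_smul, sgn_mul_self, one_smul,
          derF_apply]
      rw [Function.iterate_succ_apply, h2, ih, map_smul, smul_smul, ← pow_succ,
        ← Module.End.mul_apply, ← pow_succ]
  refine le_antisymm (Submodule.span_le.2 ?_) (Submodule.span_le.2 ?_)
  · rintro _ ⟨i, rfl⟩
    simp only [h1]
    exact Submodule.smul_mem _ _ (Submodule.subset_span ⟨i, rfl⟩)
  · rintro _ ⟨i, rfl⟩
    have h2 : (A ^ i) f = sgn ℂ σ ^ i • (sgn ℂ σ ^ i • (A ^ i) f) := by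
      rw [smul_smul, ← mul_pow, sgn_mul_self, one_pow, one_smul]
    simp only
    rw [h2, ← h1]
    exact Submodule.smul_mem _ _ (Submodule.subset_span ⟨i, rfl⟩)

end RestrictionToZero

/-! ### The KP solution determined by the two expansions -/

section Solution

variable {k p : ℕ} (hp : 2 ≤ p) (w : Fin k → ℝ) (n : Fin k → ℕ) {a : ℤˣ → ℕ → ℂ}
  (ha : ∀ σ, a σ 0 = 1)
  (hode : ∀ σ, odeEnd p w n σ (formalA p (∑ i, n i) σ) (mulZ p) (seriesF (a σ)) = 0)

theorem isMonic_seriesF {a : ℕ → ℂ} (ha : a 0 = 1) : IsMonicOfDegree 0 (seriesF a) := by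
  refine ⟨by simp [seriesF_coeff, ha], fun e he => ?_⟩
  rw [seriesF_coeff, if_neg (by omega)]

include hp ha hode in
/-- The KP solution of the subspace generated by `seriesF (a 1)`, at `t = 0`. -/
theorem exists_solution : ∃ S T : PDO XT, IsKPWaveOperator S T ∧ Vanish 1 (S - 1) ∧
    ∀ σ, opAtZero (dressing dX σ S T) = waveOp p (∑ i, n i) σ (a σ) := by
  have hp0 : p ≠ 0 := by omega
  obtain ⟨S, T, hKP, hS, hval⟩ := exists_waveOperator
    (isGrPoint_cyclicSpan hp0 1 (∑ i, n i) (isMonic_seriesF (ha 1)))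
  have hS0 : opAtZero S = waveOp p (∑ i, n i) 1 (a 1) := by
    rw [← sub_eq_zero]
    -- Both operators begin with 1 and have W-valued waves at t = 0, so their difference has
    -- negative order and a W-valued wave.
    refine eq_zero_of_valuedIn (τ := Unit) (σ := 1) (E := expX₀ 1)
      (isGrPoint_cyclicSpan hp0 1 (∑ i, n i) (isMonic_seriesF (ha 1))) ?_ ?_ ?_
    · change PowerSeries.constantCoeff (expX₀ 1) = 1
      rw [expX₀, ← PowerSeries.coeff_zero_eq_constantCoeff_apply, PowerSeries.coeff_mk]
      simp [monoF_zero_one]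
    · have h1 : opAtZero S - waveOp p (∑ i, n i) 1 (a 1) =
          (S - 1).map atZeroHom - (waveOp p (∑ i, n i) 1 (a 1) - 1) := by
        rw [← opAtZero_eq, opAtZero_sub, opAtZero_one]
        abel
      rw [h1]
      exact (hS.map atZeroHom).sub (vanish_waveOp_sub_one hp _ _ _ (ha 1))
    · have h2 := hval.restrictX
      rw [← formalWave_opAtZero, ← wave₀_op] at h2
      have h3 := valuedIn_expA 1 (formalA p (∑ i, n i) 1) (seriesF (a 1))
      rw [← wave₀_waveOp hp] at h3
      have h4 := h2.sub h3
      have h5 : wave₀ 1 (op dX₀ (opAtZero S)) - wave₀ 1 (op dX₀ (waveOp p (∑ i, n i) 1 (a 1))) =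
        wave₀ 1 (op dX₀ (opAtZero S - waveOp p (∑ i, n i) 1 (a 1))) := by
        rw [map_sub, map_sub]
      rw [h5] at h4
      exact h4
  refine ⟨S, T, hKP, hS, fun σ => ?_⟩
  rw [opAtZero_dressing]
  rcases Int.units_eq_one_or σ with rfl | rfl
  · rw [dressing_one, hS0]
  · rw [dressing_neg_one]
    apply (op dX₀).injective
    apply wave₀_injective (-1)
    rw [wave₀_waveOp hp]
    have hUT : comp dX₀ (opAtZero S) (opAtZero T) = 1 := by
      rw [← opAtZero_comp, hKP.2.1, opAtZero_one]
    have hTU : comp dX₀ (opAtZero T) (opAtZero S) = 1 := by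
      rw [← opAtZero_comp, hKP.2.2.1, opAtZero_one]
    refine wave₀_adj_inverse hp w n 1 (isMonic_seriesF (ha (-1))) (hode 1) (hode (-1)) ?_ hUT hTU
      (by rw [hS0, wave₀_waveOp hp])
    rw [hS0]
    exact vanish_waveOp_sub_one hp _ _ _ (ha 1)

variable {w n} {S T : PDO XT} (hKP : IsKPWaveOperator S T)
  (h0 : ∀ σ, opAtZero (dressing dX σ S T) = waveOp p (∑ i, n i) σ (a σ))

include hp h0 in
theorem formalWave_dressing (σ : ℤˣ) : formalWave σ (opAtZero (dressing dX σ S T)) =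
    expA σ (formalA p (∑ i, n i) σ) (seriesF (a σ)) := by
  rw [h0, ← wave₀_op, wave₀_waveOp hp]

include hp hode h0 in
theorem laxPower_mul_dressing (σ : ℤˣ) :
    op dX₀ (laxPower p w n σ) * op dX₀ (opAtZero (dressing dX σ S T)) =
      op dX₀ (opAtZero (dressing dX σ S T)) * sD dX₀ σ p := by
  rw [lax_mul_eq_iff p w n σ (by omega) (N := ∑ i, n i) (f := seriesF (a σ))]
  · exact hode σ
  · rw [wave₀_op, formalWave_dressing hp h0]

include hp hode h0 in
theorem formalWave_laxPower (σ : ℤˣ) :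
    formalWave σ (comp dX₀ (laxPower p w n σ) (opAtZero (dressing dX σ S T))) =
      PowerSeries.C (monoF p 1) * formalWave σ (opAtZero (dressing dX σ S T)) := by
  rw [← wave₀_op, ← wave₀_op, op_comp, laxPower_mul_dressing hp hode h0, wave₀_mul_sD]

include hp hode h0 hKP in
-- At t = 0 the left side is K (σD)^p K⁻¹ for the dressing operator K, and `laxPower_mul_dressing`
-- replaces K (σD)^p.
theorem opAtZero_lax_pow (σ : ℤˣ) : opAtZero (compPow dX (lax dX σ S T) p) = laxPower p w n σ := by
  have hST : comp dX₀ (opAtZero S) (opAtZero T) = 1 := by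
    rw [← opAtZero_comp, hKP.2.1, opAtZero_one]
  have hTS : comp dX₀ (opAtZero T) (opAtZero S) = 1 := by
    rw [← opAtZero_comp, hKP.2.2.1, opAtZero_one]
  have h1 := laxPower_mul_dressing hp hode h0 σ
  rw [opAtZero_dressing] at h1
  apply (op dX₀).injective
  rw [opAtZero_compPow, opAtZero_lax, op_compPow_lax dX₀ hST hTS, ← h1, mul_assoc]
  have h2 : op dX₀ (dressing dX₀ σ (opAtZero S) (opAtZero T)) *
      op dX₀ (undressing dX₀ σ (opAtZero S) (opAtZero T)) = 1 := by
    have := op_compPow_lax dX₀ hST hTS σ 0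
    rwa [Nat.cast_zero, sD_zero, mul_one, compPow, op_one, eq_comm] at this
  rw [h2, mul_one]

end Solution

/-! ### Eigenfunctions obtained from linear forms on Laurent series -/

section Eigenfunctions

/-- A linear form applied to the coefficients. -/
def mapForm (l : FLS →ₗ[ℂ] ℂ) : MvPowerSeries ℕ FLS →ₗ[ℂ] XT where
  toFun F := fun α => l (MvPowerSeries.coeff α F)
  map_add' F G := MvPowerSeries.ext fun α =>
    map_add l (MvPowerSeries.coeff α F) (MvPowerSeries.coeff α G)
  map_smul' c F := MvPowerSeries.ext fun α => map_smul l c (MvPowerSeries.coeff α F)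

theorem mapForm_coeff (l : FLS →ₗ[ℂ] ℂ) (F : MvPowerSeries ℕ FLS) (α : ℕ →₀ ℕ) :
    MvPowerSeries.coeff α (mapForm l F) = l (MvPowerSeries.coeff α F) := rfl

theorem mapForm_toFLS_mul (l : FLS →ₗ[ℂ] ℂ) (h : XT) (F : MvPowerSeries ℕ FLS) :
    mapForm l (toFLS h * F) = h * mapForm l F := by
  classical
  refine MvPowerSeries.ext fun α => ?_
  rw [mapForm_coeff, coeff_toFLS_mul, map_sum, MvPowerSeries.coeff_mul]
  refine Finset.sum_congr rfl fun x _ => ?_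
  rw [map_smul, smul_eq_mul, mapForm_coeff]

theorem mapForm_pdF (l : FLS →ₗ[ℂ] ℂ) (i : ℕ) (F : MvPowerSeries ℕ FLS) :
    mapForm l (pdF i F) = MvPowerSeries.pderiv ℂ i (mapForm l F) := by
  refine MvPowerSeries.ext fun α => ?_
  have : MvPowerSeries.coeff α (KVec.pdF i F) =
      ((α i : ℂ) + 1) • MvPowerSeries.coeff (α + Finsupp.single i 1) F := by
    refine FLS.ext fun e => ?_
    rw [pdF_apply, MvPowerSeries.coeff_pderiv, mv_coeff_natCast_mul, FLS.coeff_smul, mul_comm]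
  rw [mapForm_coeff, this, map_smul, smul_eq_mul, MvPowerSeries.coeff_pderiv, mapForm_coeff,
    mul_comm]

/-- A linear form in z commutes with ∂/∂x and with multiplication by power series in x and t, hence
with differential operators. -/
theorem mapForm_wave_isDiff_mul (l : FLS →ₗ[ℂ] ℂ) {σ : ℤˣ} {B : PDO XT} (hB : IsDiff B)
    (X : Op dX) : mapForm l (wave dX σ (expXT σ) (op dX B * X)) =
      applyPos dX B (mapForm l (wave dX σ (expXT σ) X)) := by
  obtain ⟨m, hm0, hm⟩ := hB.op_eq_sum dX
  have hpow : ∀ j : ℕ, mapForm l (wave dX σ (expXT σ) (sD dX 1 1 ^ j * X)) =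
      (dX : XT → XT)^[j] (mapForm l (wave dX σ (expXT σ) X)) := by
    intro j
    induction j with
    | zero => rw [pow_zero, one_mul, Function.iterate_zero, id]
    | succ j ih =>
      rw [pow_succ', mul_assoc, wave_sD_one_mul, mapForm_pdF, ih, Function.iterate_succ_apply', dX]
  rw [hm, Finset.sum_mul, map_sum, map_sum, applyPos,
    finsum_eq_sum_of_support_subset (s := Finset.range m)]
  · refine Finset.sum_congr rfl fun j _ => ?_
    rw [mul_assoc, wave_mulOp_mul, mapForm_toFLS_mul, hpow]
  · intro j hj
    by_contra h
    rw [Finset.coe_range, Set.mem_Iio, not_lt] at h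
    exact hj (by simp only [hm0 j h, zero_mul])

/-- The evolution equations of the wave function are linear and do not involve z, so they survive
the application of any linear form in z. -/
theorem pderiv_mapForm_wave (l : FLS →ₗ[ℂ] ℂ) {S T : PDO XT} (hKP : IsKPWaveOperator S T)
    (σ : ℤˣ) {m : ℕ} (hm : 1 ≤ m) :
    MvPowerSeries.pderiv ℂ m (mapForm l (wave dX σ (expXT σ) (op dX (dressing dX σ S T)))) =
      sgn XT σ * applyPos dX (compPow dX (lax dX σ S T) m)
        (mapForm l (wave dX σ (expXT σ) (op dX (dressing dX σ S T)))) := by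
  have hE : MvPowerSeries.pderiv FLS m (expXT σ) =
      MvPowerSeries.C (monoF m (sgn ℂ σ)) * expXT σ := by
    have := pderiv_expXT σ m
    rwa [max_eq_left hm] at this
  have h1 := congrArg (op dX) (hKP.2.2.2 σ m hm)
  rw [map_add, op_sgn_mul, op_sgn_mul, op_comp, op_comp, op_signedD] at h1
  rw [← mapForm_pdF, wave_dT (d := dX) hE, ← wave_mul_sD, ← map_smul, ← map_add]
  change mapForm l (wave dX σ (expXT σ) (op dX (dT m (dressing dX σ S T)) + _)) = _
  rw [h1, map_smul, map_smul, mapForm_wave_isDiff_mul l (isDiff_posPart _), applyPos_posPart]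
  rcases Int.units_eq_one_or σ with rfl | rfl
  · rw [sgn_one, sgn_one, one_smul, one_mul]
  · rw [sgn_neg, sgn_neg, sgn_one, sgn_one, neg_smul, one_smul, neg_mul, one_mul]

/-- The Taylor coefficients of e^(σxA) f are σ^j A^j f / j!, on which the form produces an
exponential series. -/
theorem atZero_mapForm {σ : ℤˣ} {A : Module.End ℂ FLS} {f : FLS} {K : PDO XT}
    (hK : formalWave σ (opAtZero K) = expA σ A f) {l : FLS →ₗ[ℂ] ℂ} {c x : ℂ}
    (hl : ∀ j : ℕ, l ((A ^ j) f) = c * x ^ j) :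
    atZero (mapForm l (wave dX σ (expXT σ) (op dX K))) =
      PowerSeries.C c * expX (sgn ℂ σ * x) := by
  refine PowerSeries.ext fun j => ?_
  have h1 : PowerSeries.coeff j (atZero (mapForm l (wave dX σ (expXT σ) (op dX K)))) =
      l (PowerSeries.coeff j (restrictX FLS (wave dX σ (expXT σ) (op dX K)))) := by
    rw [restrictX_coeff]
    exact PowerSeries.coeff_mk j fun a => MvPowerSeries.coeff (Finsupp.single 0 a)
      (mapForm l (wave dX σ (expXT σ) (op dX K)))
  rw [h1, ← formalWave_opAtZero, hK, expA_coeff, map_smul, hl, PowerSeries.coeff_C_mul, expX,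
    PowerSeries.coeff_rescale, PowerSeries.coeff_exp, mul_pow, smul_eq_mul]
  simp
  ring

end Eigenfunctions

/-! ### The negative part of the Lax operator for all times -/

section NegativePart

/-- Operators with coefficients in an ideal. -/
theorem comp_coeff_mem {R : Type*} [CommRing R] [Algebra ℂ R] {d : Derivation ℂ R R} {I : Ideal R}
    (hI : ∀ h ∈ I, d h ∈ I) {P Q : PDO R} (h : (∀ e, P.coeff e ∈ I) ∨ ∀ e, Q.coeff e ∈ I) (e : ℤ) :
    (comp d P Q).coeff e ∈ I := by
  obtain ⟨N, hP⟩ := exists_vanish P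
  obtain ⟨M, hQ⟩ := exists_vanish Q
  rw [comp_coeff_sum d hP hQ (K := (e - N - M + 1).toNat) (by omega)]
  refine I.sum_mem fun k _ => ?_
  rw [HahnSeries.coeff_mul]
  refine I.sum_mem fun x _ => ?_
  rcases h with h | h
  · refine I.mul_mem_right _ ?_
    rw [hasse_coeff]
    exact I.mul_mem_left _ (h _)
  · refine I.mul_mem_left _ ?_
    rw [mapD_coeff]
    have h1 : ∀ k : ℕ, ((d : R →ₗ[ℂ] R) ^ k) (Q.coeff x.2) ∈ I := by
      intro k
      induction k with
      | zero => exact h _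
      | succ k ih =>
        rw [pow_succ', Module.End.mul_apply]
        exact hI _ ih
    exact h1 k

/-- The series of order at least `N` in the times. -/
def timeIdeal (N : ℕ) : Ideal XT where
  carrier := {h | ∀ α : ℕ →₀ ℕ, (α.erase 0).degree < N → MvPowerSeries.coeff α h = 0}
  zero_mem' := fun α _ => map_zero _
  add_mem' := fun {f g} hf hg α hα => by rw [map_add, hf α hα, hg α hα, add_zero]
  smul_mem' := fun c f hf α hα => by
    classical
    rw [smul_eq_mul, MvPowerSeries.coeff_mul]
    refine Finset.sum_eq_zero fun x hx => ?_
    rw [Finset.HasAntidiagonal.mem_antidiagonal] at hx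
    rw [← hx, Finsupp.erase_add, map_add] at hα
    rw [hf x.2 (by omega), mul_zero]

theorem dX_mem_timeIdeal (N : ℕ) : ∀ h ∈ timeIdeal N, dX h ∈ timeIdeal N := fun h hh α hα => by
  rw [dX, MvPowerSeries.coeff_pderiv, hh _ (by
    rwa [Finsupp.erase_add, Finsupp.erase_single, add_zero]), zero_mul]

/-- A coefficient at a monomial containing some t_m is, up to a nonzero factor, a coefficient of
∂h/∂t_m at a monomial with one time variable fewer; the monomials in x alone are seen at t = 0. -/
theorem mem_timeIdeal_succ {N : ℕ} {h : XT} (h0 : atZero h = 0)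
    (hd : ∀ m : ℕ, 1 ≤ m → MvPowerSeries.pderiv ℂ m h ∈ timeIdeal N) : h ∈ timeIdeal (N + 1) := by
  intro α hα
  by_cases hz : α.erase 0 = 0
  · have h1 : α = Finsupp.single 0 (α 0) := by
      rw [← Finsupp.single_add_erase 0 α, hz, add_zero]
      simp
    rw [h1]
    have h2 : PowerSeries.coeff (α 0) (atZero h) = MvPowerSeries.coeff (Finsupp.single 0 (α 0)) h :=
      PowerSeries.coeff_mk (α 0) fun a => MvPowerSeries.coeff (Finsupp.single 0 a) h
    rw [← h2, h0]
    rfl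
  · obtain ⟨m, hm⟩ := Finsupp.ne_iff.1 hz
    have hm0 : m ≠ 0 := fun h => by simp [h] at hm
    rw [Finsupp.erase_ne hm0, Finsupp.zero_apply] at hm
    have h1 : α = α - Finsupp.single m 1 + Finsupp.single m 1 := by
      rw [tsub_add_cancel_of_le]
      rw [Finsupp.single_le_iff]
      omega
    set β := α - Finsupp.single m 1
    rw [h1, Finsupp.erase_add, map_add, Finsupp.erase_single_ne (Ne.symm hm0),
      Finsupp.degree_single] at hα
    have h2 := hd m (by omega) β (by omega)
    rw [MvPowerSeries.coeff_pderiv, ← h1] at h2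
    exact (mul_eq_zero.1 h2).resolve_right (by exact_mod_cast (β m).succ_ne_zero)

theorem eq_zero_of_forall_mem_timeIdeal {h : XT} (hh : ∀ N, h ∈ timeIdeal N) : h = 0 :=
  MvPowerSeries.ext fun α => by rw [hh _ α (Nat.lt_succ_self _), map_zero]

/-- An operator which evolves linearly in the times is determined by its value at `t = 0`. -/
theorem eq_zero_of_evolution {Y : PDO XT} (h0 : opAtZero Y = 0) (B : ℕ → PDO XT)
    (hd : ∀ m : ℕ, 1 ≤ m → dT m Y = negPart (comp dX (B m) Y - comp dX Y (B m))) : Y = 0 := by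
  -- If the coefficients of Y have order N in the times, so does the right side, which is linear in
  -- Y, because the ideals are stable under ∂/∂x; integration then raises the order to N + 1.
  have key : ∀ N : ℕ, ∀ e, Y.coeff e ∈ timeIdeal N := by
    intro N
    induction N with
    | zero => exact fun e α hα => absurd hα (by omega)
    | succ N ih =>
      intro e
      refine mem_timeIdeal_succ ?_ fun m hm => ?_
      · have := congrArg (fun P => HahnSeries.coeff P e) h0
        exact this
      · have h1 := congrArg (fun P => HahnSeries.coeff P e) (hd m hm)
        simp only [dT, mapD_one_coeff, negPart_coeff, HahnSeries.coeff_sub] at h1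
        rw [h1]
        split_ifs
        · exact Ideal.zero_mem _
        · exact Ideal.sub_mem _ (comp_coeff_mem (dX_mem_timeIdeal N) (Or.inr ih) e)
            (comp_coeff_mem (dX_mem_timeIdeal N) (Or.inl ih) e)
  ext e : 2
  exact eq_zero_of_forall_mem_timeIdeal fun N => key N e

/-- The Lax equation. -/
theorem dT_lax_pow {S T : PDO XT} (hKP : IsKPWaveOperator S T) (p : ℕ) {m : ℕ} (hm : 1 ≤ m) :
    dT m (compPow dX (lax dX 1 S T) p) =
      comp dX (posPart (compPow dX (lax dX 1 S T) m)) (compPow dX (lax dX 1 S T) p) -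
      comp dX (compPow dX (lax dX 1 S T) p) (posPart (compPow dX (lax dX 1 S T) m)) := by
  have hST := hKP.2.1
  have hTS := hKP.2.2.1
  have h1 := congrArg (op dX) (hKP.2.2.2 1 m hm)
  rw [map_add, op_sgn_mul, op_sgn_mul, op_comp, op_comp, op_signedD, dressing_one, sgn_one,
    one_smul, one_smul] at h1
  have h1' : op dX (mapD (MvPowerSeries.pderiv ℂ m) 1 S) = _ - _ := eq_sub_of_add_eq h1
  set B := posPart (compPow dX (lax dX 1 S T) m)
  have hL := op_compPow_lax dX hST hTS 1 p
  rw [dressing_one, undressing_one] at hL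
  have hL' : compPow dX (lax dX 1 S T) p = comp dX (comp dX S (signedD XT 1 p)) T :=
    (op dX).injective hL
  have hD : mapD (MvPowerSeries.pderiv ℂ m) 1 (signedD XT 1 p) = 0 := by
    ext e : 2
    rw [mapD_one_coeff, signedD, one_zpow, sgn_one]
    by_cases h : e = -(p : ℤ)
    · rw [h, HahnSeries.coeff_single_same]
      simp
    · rw [HahnSeries.coeff_single_of_ne h]
      simp
  have hcancel : op dX T * op dX S = 1 := by rw [← op_comp, hTS, op_one]
  apply (op dX).injective
  rw [map_sub, op_comp, op_comp, hL, hL', dT, mapD_one_comp dX (pderiv_dX m),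
    mapD_one_comp dX (pderiv_dX m), hD, map_add, op_comp, op_comp, map_add, op_comp, op_comp,
    map_zero, mul_zero, add_zero, op_comp, op_mapD_one_inverse dX (pderiv_dX m) hST hTS, h1',
    op_signedD]
  have hcomm : sD dX 1 m * sD dX 1 p = sD dX 1 p * sD dX 1 m := by
    rw [sD_mul, sD_mul, add_comm]
  -- The terms with S D^(m+p) S⁻¹ cancel because powers of D commute.
  calc _ = op dX B * (op dX S * sD dX 1 p * op dX T) - op dX S * (sD dX 1 m * sD dX 1 p) * op dX T -
        op dX S * sD dX 1 p * op dX T * op dX B * (op dX S * op dX T) +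
        op dX S * sD dX 1 p * (op dX T * op dX S) * sD dX 1 m * op dX T := by noncomm_ring
    _ = _ := by
      rw [hcancel, hcomm, ← op_comp dX S T, hST, op_one, mul_one, mul_one]
      noncomm_ring

theorem opAtZero_negPart (P : PDO XT) : opAtZero (negPart P) = negPart (opAtZero P) := by
  ext e : 2
  rw [negPart_coeff, opAtZero_eq, opAtZero_eq, HahnSeries.map_coeff, HahnSeries.map_coeff,
    negPart_coeff]
  split_ifs <;> simp

theorem opAtZero_sum {ι : Type*} (s : Finset ι) (P : ι → PDO XT) :
    opAtZero (∑ i ∈ s, P i) = ∑ i ∈ s, opAtZero (P i) :=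
  map_sum (AddMonoidHom.mk' opAtZero fun P Q => by
    ext e
    simp only [opAtZero_eq, HahnSeries.map_coeff, HahnSeries.coeff_add, map_add]) P s

theorem opAtZero_multOp (h : XT) : opAtZero (multOp h) = multOp (atZero h) := by
  ext e : 2
  rw [opAtZero, HahnSeries.map_coeff, multOp, multOp]
  by_cases h : e = 0
  · rw [h, HahnSeries.coeff_single_same, HahnSeries.coeff_single_same]
  · rw [HahnSeries.coeff_single_of_ne h, HahnSeries.coeff_single_of_ne h, map_zero]

theorem vanish_mult_signedD_mult {R : Type*} [CommRing R] [Algebra ℂ R] (d : Derivation ℂ R R)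
    (σ : ℤˣ) (q q' : R) :
    Vanish 1 (comp d (comp d (multOp q) (signedD R σ (-1))) (multOp q')) :=
  ((((vanish_single q le_rfl).comp d (vanish_single _ le_rfl)).comp d
    (vanish_single q' le_rfl)).mono (by norm_num))

theorem negPart_laxPower {k : ℕ} (p : ℕ) (w : Fin k → ℝ) (n : Fin k → ℕ) (σ : ℤˣ) :
    negPart (laxPower p w n σ) = -∑ i, multOp (PowerSeries.C (n i : ℂ)) *
        comp dX₀ (comp dX₀ (multOp (expX (sgn ℂ σ * (w i : ℂ)))) (signedD (PowerSeries ℂ) σ (-1)))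
          (multOp (expX (-sgn ℂ σ * (w i : ℂ)))) := by
  refine negPart_eq (A := signedD (PowerSeries ℂ) σ p - multOp PowerSeries.X)
    (IsDiff.sub (isDiff_single _ (by omega)) (isDiff_single _ le_rfl)) ?_
    (sub_eq_add_neg _ _)
  intro e he
  rw [HahnSeries.coeff_neg, HahnSeries.coeff_sum, Finset.sum_eq_zero, neg_zero]
  intro i _
  rw [multOp, HahnSeries.coeff_single_zero_mul, vanish_mult_signedD_mult dX₀ σ _ _ e he, mul_zero]

theorem dT_mult_signedD_mult (m : ℕ) (σ : ℤˣ) (q q' : XT) :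
    dT m (comp dX (comp dX (multOp q) (signedD XT σ (-1))) (multOp q')) =
      comp dX (comp dX (multOp (MvPowerSeries.pderiv ℂ m q)) (signedD XT σ (-1))) (multOp q') +
      comp dX (comp dX (multOp q) (signedD XT σ (-1))) (multOp (MvPowerSeries.pderiv ℂ m q')) := by
  have h1 : ∀ q : XT, mapD (MvPowerSeries.pderiv ℂ m) 1 (multOp q) =
      multOp (MvPowerSeries.pderiv ℂ m q) := fun q => by
    rw [multOp, mapD_single, pow_one]
    rfl
  have h2 : mapD (MvPowerSeries.pderiv ℂ m) 1 (signedD XT σ (-1)) = 0 := by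
    have := h1 (sgn XT (σ ^ (-1 : ℤ)))
    rw [signedD, mapD_single, pow_one, Derivation.coeFn_coe]
    rw [Derivation.map_intCast, HahnSeries.single_eq_zero]
  rw [dT, mapD_one_comp dX (pderiv_dX m), mapD_one_comp dX (pderiv_dX m), h1, h1, h2,
    comp_zero_right, add_zero]

theorem multOp_neg {R : Type*} [CommRing R] (q : R) : multOp (-q) = -multOp q := by
  rw [multOp, multOp, HahnSeries.single_neg]

theorem comp_sub_right {R : Type*} [CommRing R] [Algebra ℂ R] (d : Derivation ℂ R R)
    (P Q Q' : PDO R) : comp d P (Q - Q') = comp d P Q - comp d P Q' := by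
  apply (op d).injective
  rw [op_comp, map_sub, map_sub, mul_sub, op_comp, op_comp]

theorem comp_sub_left {R : Type*} [CommRing R] [Algebra ℂ R] (d : Derivation ℂ R R)
    (P P' Q : PDO R) : comp d (P - P') Q = comp d P Q - comp d P' Q := by
  apply (op d).injective
  rw [op_comp, map_sub, map_sub, sub_mul, op_comp, op_comp]

theorem comp_sum_right {R : Type*} [CommRing R] [Algebra ℂ R] (d : Derivation ℂ R R) {ι : Type*}
    (s : Finset ι) (P : PDO R) (Q : ι → PDO R) :
    comp d P (∑ i ∈ s, Q i) = ∑ i ∈ s, comp d P (Q i) :=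
  map_sum (AddMonoidHom.mk' (comp d P) (comp_add_right d P)) Q s

theorem comp_sum_left {R : Type*} [CommRing R] [Algebra ℂ R] (d : Derivation ℂ R R) {ι : Type*}
    (s : Finset ι) (P : ι → PDO R) (Q : PDO R) :
    comp d (∑ i ∈ s, P i) Q = ∑ i ∈ s, comp d (P i) Q :=
  map_sum (AddMonoidHom.mk' (fun P => comp d P Q) fun P P' => comp_add_left d P P' Q) P s

theorem mapD_one_sub {R : Type*} [CommRing R] [Algebra ℂ R] (δ : Derivation ℂ R R) (P Q : PDO R) :
    mapD δ 1 (P - Q) = mapD δ 1 P - mapD δ 1 Q := by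
  ext e
  simp only [mapD_one_coeff, HahnSeries.coeff_sub, map_sub]

theorem mapD_one_sum {R : Type*} [CommRing R] [Algebra ℂ R] (δ : Derivation ℂ R R) {ι : Type*}
    (s : Finset ι) (P : ι → PDO R) : mapD δ 1 (∑ i ∈ s, P i) = ∑ i ∈ s, mapD δ 1 (P i) :=
  map_sum (AddMonoidHom.mk' (mapD δ 1) (mapD_add δ 1)) P s

/-- `k` pairs of eigenfunctions give the negative part of the Lax operator for all times. -/
theorem negPart_lax_pow_one {k : ℕ} {S T : PDO XT} (hKP : IsKPWaveOperator S T) (p : ℕ)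
    (q : ℤˣ → Fin k → XT)
    (hq : ∀ σ i, ∀ m : ℕ, 1 ≤ m → MvPowerSeries.pderiv ℂ m (q σ i) =
      sgn XT σ * applyPos dX (compPow dX (lax dX σ S T) m) (q σ i))
    (h0 : negPart (opAtZero (compPow dX (lax dX 1 S T) p)) =
      ∑ i, comp dX₀ (comp dX₀ (multOp (atZero (q 1 i))) (signedD (PowerSeries ℂ) 1 (-1)))
        (multOp (atZero (q (-1) i)))) :
    negPart (compPow dX (lax dX 1 S T) p) =
      ∑ i, comp dX (comp dX (multOp (q 1 i)) (signedD XT 1 (-1))) (multOp (q (-1) i)) := by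
  rw [← sub_eq_zero]
  refine eq_zero_of_evolution ?_ (fun m => posPart (compPow dX (lax dX 1 S T) m)) fun m hm => ?_
  · rw [opAtZero_sub, opAtZero_negPart, h0, opAtZero_sum, sub_eq_zero]
    simp only [opAtZero_comp, opAtZero_multOp, opAtZero_signedD]
  · set L := compPow dX (lax dX 1 S T) p with hL
    set B := posPart (compPow dX (lax dX 1 S T) m) with hB
    have hBd : IsDiff B := isDiff_posPart _
    -- The evolution of q⁺ᵢ by B gives the negative part of B ∘ q⁺ᵢ D⁻¹ q⁻ᵢ, and that of q⁻ᵢ by -B^*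
    -- gives the one with B on the right.
    have h1 : ∀ i, dT m (comp dX (comp dX (multOp (q 1 i)) (signedD XT 1 (-1)))
        (multOp (q (-1) i))) =
        negPart (comp dX B (comp dX (comp dX (multOp (q 1 i)) (signedD XT 1 (-1)))
          (multOp (q (-1) i)))) -
        negPart (comp dX (comp dX (comp dX (multOp (q 1 i)) (signedD XT 1 (-1)))
          (multOp (q (-1) i))) B) := by
      intro i
      rw [negPart_comp_left dX hBd, negPart_comp_right dX hBd, dT_mult_signedD_mult, hq 1 i m hm,
        hq (-1) i m hm, hB, adj_posPart, applyPos_posPart, applyPos_posPart, sgn_one, one_mul,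
        sgn_neg, sgn_one, neg_mul, one_mul, multOp_neg, sub_eq_add_neg,
        ← compPow_lax_neg dX hKP.2.1 hKP.2.2.1]
      congr 1
      apply (op dX).injective
      rw [op_comp, map_neg, map_neg, mul_neg, ← op_comp]
    -- The commutator of B with the differential part of L is differential, so the Lax equation
    -- closes on the negative part.
    have h2 : negPart (comp dX B L - comp dX L B) =
        negPart (comp dX B (negPart L)) - negPart (comp dX (negPart L) B) := by
      have h3 : comp dX B L - comp dX L B = (comp dX B (posPart L) - comp dX (posPart L) B) +
          (comp dX B (negPart L) - comp dX (negPart L) B) := by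
        conv_lhs => rw [← posPart_add_negPart L]
        rw [comp_add_left, comp_add_right]
        abel
      rw [h3, negPart_add, IsDiff.negPart (IsDiff.sub (hBd.comp dX (isDiff_posPart L))
        ((isDiff_posPart L).comp dX hBd)), zero_add, negPart_sub]
    rw [dT, mapD_one_sub, mapD_one_sum, mapD_one_negPart]
    change negPart (dT m L) - ∑ i, dT m _ = _
    rw [hL, dT_lax_pow hKP p hm, ← hL, ← hB, h2]
    simp only [h1]
    rw [comp_sub_right, comp_sub_left, comp_sum_right, comp_sum_left, negPart_sub, negPart_sub,
      negPart_sub, negPart_sum, negPart_sum, Finset.sum_sub_distrib]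
    abel

theorem adj_mult_signedD_mult {R : Type*} [CommRing R] [Algebra ℂ R] (d : Derivation ℂ R R)
    (σ : ℤˣ) (q q' : R) :
    adj d (comp d (comp d (multOp q) (signedD R σ (-1))) (multOp q')) =
      comp d (comp d (multOp q') (signedD R (-σ) (-1))) (multOp q) := by
  apply (op d).injective
  rw [op_adj, op_comp, op_comp, op_comp, op_comp, adjOp_mul, adjOp_mul, op_signedD, op_signedD,
    op_multOp, op_multOp, adjOp_mulOp, adjOp_mulOp, adjOp_sD, mul_assoc]

theorem adj_sum {R : Type*} [CommRing R] [Algebra ℂ R] (d : Derivation ℂ R R) {ι : Type*}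
    (s : Finset ι) (P : ι → PDO R) : adj d (∑ i ∈ s, P i) = ∑ i ∈ s, adj d (P i) :=
  map_sum (AddMonoidHom.mk' (adj d) (adj_add d)) P s

end NegativePart

/-! ### Eigenfunctions with the prescribed values at t = 0 -/

section Summary

variable {k p : ℕ} (hp : 2 ≤ p) (w : Fin k → ℝ) (n : Fin k → ℕ) {a : ℤˣ → ℕ → ℂ}
  (ha : ∀ σ, a σ 0 = 1)
  (hode : ∀ σ, odeEnd p w n σ (formalA p (∑ i, n i) σ) (mulZ p) (seriesF (a σ)) = 0)

include hp ha hode in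
-- Linear forms with values ∓√nᵢ wᵢ^j on the independent vectors A^j φ^± give exponentials at t = 0.
-- Their amplitudes for the two signs multiply to -nᵢ, as the Lax operator at t = 0 demands, and
-- `negPart_lax_pow_one` extends the formula to all times.
theorem exists_eigenfunctions {S T : PDO XT} (hKP : IsKPWaveOperator S T)
    (h0 : ∀ σ, opAtZero (dressing dX σ S T) = waveOp p (∑ i, n i) σ (a σ)) :
    ∃ q : ℤˣ → Fin k → XT,
      (∀ σ i, atZero (q σ i) =
        PowerSeries.C (-sgn ℂ σ * (Real.sqrt (n i) : ℂ)) * expX (sgn ℂ σ * (w i : ℂ))) ∧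
      (∀ σ, negPart (compPow dX (lax dX σ S T) p) =
        ∑ i, comp dX (comp dX (multOp (q σ i)) (signedD XT σ (-1))) (multOp (q (-σ) i))) ∧
      ∀ σ i, ∀ m : ℕ, 1 ≤ m →
        MvPowerSeries.pderiv ℂ m (q σ i) =
          sgn XT σ * applyPos dX (compPow dX (lax dX σ S T) m) (q σ i) := by
  have hp0 : p ≠ 0 := by omega
  choose l hl using fun (σ : ℤˣ) (i : Fin k) => exists_linearForm hp0 σ (∑ i, n i)
    (isMonic_seriesF (ha σ)) (-sgn ℂ σ * (Real.sqrt (n i) : ℂ)) (w i : ℂ)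
  let q : ℤˣ → Fin k → XT := fun σ i =>
    mapForm (l σ i) (wave dX σ (expXT σ) (op dX (dressing dX σ S T)))
  have hq0 : ∀ σ i, atZero (q σ i) =
      PowerSeries.C (-sgn ℂ σ * (Real.sqrt (n i) : ℂ)) * expX (sgn ℂ σ * (w i : ℂ)) := fun σ i =>
    atZero_mapForm (formalWave_dressing hp h0 σ) (hl σ i)
  have hq : ∀ σ i, ∀ m : ℕ, 1 ≤ m → MvPowerSeries.pderiv ℂ m (q σ i) =
      sgn XT σ * applyPos dX (compPow dX (lax dX σ S T) m) (q σ i) := fun σ i m hm =>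
    pderiv_mapForm_wave (l σ i) hKP σ hm
  have h1 : negPart (compPow dX (lax dX 1 S T) p) =
      ∑ i, comp dX (comp dX (multOp (q 1 i)) (signedD XT 1 (-1))) (multOp (q (-1) i)) := by
    refine negPart_lax_pow_one hKP p q hq ?_
    rw [opAtZero_lax_pow hp hode hKP h0, negPart_laxPower, ← Finset.sum_neg_distrib]
    refine Finset.sum_congr rfl fun i _ => ?_
    apply (op dX₀).injective
    have h2 : (PowerSeries.C (n i : ℂ) : PowerSeries ℂ) =
        PowerSeries.C ((Real.sqrt (n i) : ℂ)) * PowerSeries.C ((Real.sqrt (n i) : ℂ)) := by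
      rw [← map_mul, ← Complex.ofReal_mul, Real.mul_self_sqrt (Nat.cast_nonneg _),
        Complex.ofReal_natCast]
    have h3 : ∀ c : ℂ, mulOp dX₀ (PowerSeries.C c) = algebraMap ℂ (Op dX₀) c := fun c =>
      (mulOp dX₀).commutes c
    rw [hq0, hq0, map_neg, op_multOp_mul, op_comp, op_comp, op_comp, op_comp, op_multOp, op_multOp,
      op_multOp, op_multOp, h2, sgn_neg, sgn_one, one_mul, neg_mul, one_mul, neg_neg, neg_mul,
      one_mul, map_mul, map_mul, map_mul, map_neg, map_neg, h3, neg_mul,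
      neg_mul, neg_mul]
    simp only [mul_assoc, ← Algebra.smul_def, mul_smul_comm, smul_mul_assoc]
  refine ⟨q, hq0, fun σ => ?_, hq⟩
  rcases Int.units_eq_one_or σ with rfl | rfl
  · exact h1
  -- The sign - is the adjoint of the sign +, which interchanges the two families of eigenfunctions.
  · rw [compPow_lax_neg dX hKP.2.1 hKP.2.2.1, ← adj_negPart, h1, adj_sum, neg_neg]
    simp only [adj_mult_signedD_mult]

end Summary

section Analysis

open Filter Topology Asymptotics MeasureTheory

/-! ### Decay along the contours and amplitudes of exponential growth -/

section Curves

variable {p : ℕ} {σ : ℤˣ}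

/-- The decay of the exponential on a straight end. -/
theorem eventually_exponent_le (hp : 2 ≤ p) {b ζ : ℂ} (hζ : 0 < (sgn ℂ σ * ζ ^ (p + 1)).re)
    (R : ℝ) : ∀ᶠ s : ℝ in atTop,
      (-sgn ℂ σ * (b + s * ζ) ^ (p + 1) / ((p : ℂ) + 1)).re + R * ‖b + s * ζ‖ ≤ -s := by
  have h1 : Tendsto (fun s : ℝ => ((s : ℂ))⁻¹) atTop (𝓝 0) := by
    rw [tendsto_zero_iff_norm_tendsto_zero]
    have : (fun s : ℝ => ‖((s : ℂ))⁻¹‖) = fun s : ℝ => |s|⁻¹ := by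
      ext s; rw [norm_inv, Complex.norm_real, Real.norm_eq_abs]
    rw [this]
    exact tendsto_inv_atTop_zero.comp tendsto_abs_atTop_atTop
  have h2 : Tendsto (fun s : ℝ => b * (s : ℂ)⁻¹ + ζ) atTop (𝓝 ζ) := by
    simpa using (h1.const_mul b).add_const ζ
  have h3 : Tendsto (fun s : ℝ => (sgn ℂ σ * (b * (s : ℂ)⁻¹ + ζ) ^ (p + 1)).re) atTop
      (𝓝 (sgn ℂ σ * ζ ^ (p + 1)).re) :=
    (Complex.continuous_re.tendsto _).comp ((h2.pow (p + 1)).const_mul _)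
  -- After division by s^(p+1) the linear terms tend to 0, whereas the exponent itself tends to
  -- -Re(σ ζ^(p+1))/(p+1) < 0.
  have h4 : Tendsto (fun s : ℝ => (s⁻¹ ^ p) * (R * ‖b * (s : ℂ)⁻¹ + ζ‖ + 1)) atTop (𝓝 0) := by
    have := (tendsto_inv_atTop_zero (𝕜 := ℝ)).pow p
    rw [zero_pow (by omega)] at this
    simpa using this.mul ((h2.norm.const_mul R).add_const 1)
  have h5 := (h4.const_mul ((p : ℝ) + 1)).sub h3
  rw [mul_zero, zero_sub] at h5
  filter_upwards [h5.eventually (gt_mem_nhds (by linarith : -(sgn ℂ σ * ζ ^ (p + 1)).re < 0)),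
    eventually_gt_atTop 0] with s hs hs0
  have hsc : (s : ℂ) ≠ 0 := by exact_mod_cast hs0.ne'
  have hp1 : (0 : ℝ) < (p : ℝ) + 1 := by positivity
  have e1 : b + s * ζ = s * (b * (s : ℂ)⁻¹ + ζ) := by field_simp
  set η := b * (s : ℂ)⁻¹ + ζ
  have e2 : (-sgn ℂ σ * (b + s * ζ) ^ (p + 1) / ((p : ℂ) + 1)).re =
      -(s ^ (p + 1) * (sgn ℂ σ * η ^ (p + 1)).re) / ((p : ℝ) + 1) := by
    have : -sgn ℂ σ * (b + s * ζ) ^ (p + 1) / ((p : ℂ) + 1) =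
        ((-(s ^ (p + 1)) / ((p : ℝ) + 1) : ℝ) : ℂ) * (sgn ℂ σ * η ^ (p + 1)) := by
      rw [e1, mul_pow]
      push_cast
      ring
    rw [this, Complex.re_ofReal_mul]
    ring
  rw [e2, e1, norm_mul, Complex.norm_real, Real.norm_eq_abs, abs_of_pos hs0]
  have e3 : s⁻¹ ^ p * s ^ (p + 1) = s := by
    rw [pow_succ, ← mul_assoc, ← mul_pow, inv_mul_cancel₀ hs0.ne', one_pow, one_mul]
  have h6 : ((p : ℝ) + 1) * (s⁻¹ ^ p * (R * ‖η‖ + 1)) * s ^ (p + 1) -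
      (sgn ℂ σ * η ^ (p + 1)).re * s ^ (p + 1) < 0 := by
    rw [← sub_mul]
    exact mul_neg_of_neg_of_pos hs (by positivity)
  have h7 : ((p : ℝ) + 1) * (s⁻¹ ^ p * (R * ‖η‖ + 1)) * s ^ (p + 1) =
      ((p : ℝ) + 1) * (s * (R * ‖η‖ + 1)) := by
    calc _ = ((p : ℝ) + 1) * ((s⁻¹ ^ p * s ^ (p + 1)) * (R * ‖η‖ + 1)) := by ring
      _ = _ := by rw [e3]
  rw [h7] at h6
  have h8 : -(s ^ (p + 1) * (sgn ℂ σ * η ^ (p + 1)).re) / ((p : ℝ) + 1) ≤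
      -(s * (R * ‖η‖ + 1)) := by
    rw [div_le_iff₀ hp1]
    nlinarith
  nlinarith

/-- The modulus of the integrand, up to the growth of the amplitude. -/
def weight (p : ℕ) (σ : ℤˣ) (γ : ℝ → ℂ) (R s : ℝ) : ℝ :=
  Real.exp ((-sgn ℂ σ * γ s ^ (p + 1) / ((p : ℂ) + 1)).re + R * ‖γ s‖)

theorem IsDecayCurve.weight_le_atTop (hp : 2 ≤ p) {γ : ℝ → ℂ} (hγ : IsDecayCurve p σ γ) (R : ℝ) :
    ∀ᶠ s : ℝ in atTop, weight p σ γ R s ≤ Real.exp (-s) := by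
  obtain ⟨_, ⟨b, ζ, hζ, h⟩, _⟩ := hγ
  filter_upwards [h, eventually_exponent_le hp hζ R] with s hs h1
  rw [weight, hs]
  exact Real.exp_le_exp.2 h1

theorem IsDecayCurve.weight_le_atBot (hp : 2 ≤ p) {γ : ℝ → ℂ} (hγ : IsDecayCurve p σ γ) (R : ℝ) :
    ∀ᶠ s : ℝ in atBot, weight p σ γ R s ≤ Real.exp s := by
  obtain ⟨_, _, ⟨b, ζ, hζ, h⟩⟩ := hγ
  filter_upwards [h, tendsto_neg_atBot_atTop.eventually (eventually_exponent_le hp hζ R)]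
    with s hs h1
  have e : b - s * ζ = b + ((-s : ℝ) : ℂ) * ζ := by push_cast; ring
  rw [weight, hs, e]
  rw [neg_neg] at h1
  exact Real.exp_le_exp.2 h1

theorem IsDecayCurve.continuous {γ : ℝ → ℂ} (hγ : IsDecayCurve p σ γ) : Continuous γ :=
  hγ.1.continuous

theorem IsDecayCurve.hasDerivAt {γ : ℝ → ℂ} (hγ : IsDecayCurve p σ γ) (s : ℝ) :
    HasDerivAt γ (deriv γ s) s :=
  ((hγ.1.differentiable (by norm_num)) s).hasDerivAt

theorem IsDecayCurve.continuous_deriv {γ : ℝ → ℂ} (hγ : IsDecayCurve p σ γ) :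
    Continuous (deriv γ) := hγ.1.continuous_deriv le_rfl

theorem IsDecayCurve.exists_deriv_le {γ : ℝ → ℂ} (hγ : IsDecayCurve p σ γ) :
    ∃ C : ℝ, (∀ᶠ s in atTop, ‖deriv γ s‖ ≤ C) ∧ ∀ᶠ s in atBot, ‖deriv γ s‖ ≤ C := by
  obtain ⟨_, ⟨b, ζ, _, h⟩, ⟨b', ζ', _, h'⟩⟩ := hγ
  refine ⟨max ‖ζ‖ ‖ζ'‖, ?_, ?_⟩
  · obtain ⟨s₀, hs₀⟩ := eventually_atTop.1 h
    filter_upwards [eventually_gt_atTop s₀] with s hs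
    have h1 : γ =ᶠ[𝓝 s] fun s : ℝ => b + s * ζ := by
      filter_upwards [lt_mem_nhds hs] with t ht using hs₀ t ht.le
    have h2 : HasDerivAt (fun s : ℝ => b + s * ζ) ζ s := by
      simpa using ((Complex.ofRealCLM.hasDerivAt (x := s)).mul_const ζ).const_add b
    rw [h1.deriv_eq, h2.deriv]
    exact le_max_left _ _
  · obtain ⟨s₀, hs₀⟩ := eventually_atBot.1 h'
    filter_upwards [eventually_lt_atBot s₀] with s hs
    have h1 : γ =ᶠ[𝓝 s] fun s : ℝ => b' - s * ζ' := by
      filter_upwards [gt_mem_nhds hs] with t ht using hs₀ t ht.le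
    have h2 : HasDerivAt (fun s : ℝ => b' - s * ζ') (-ζ') s := by
      simpa using ((Complex.ofRealCLM.hasDerivAt (x := s)).mul_const ζ').const_sub b'
    rw [h1.deriv_eq, h2.deriv, norm_neg]
    exact le_max_right _ _

theorem IsDecayCurve.continuous_weight {γ : ℝ → ℂ} (hγ : IsDecayCurve p σ γ) (R : ℝ) :
    Continuous (weight p σ γ R) := by
  have := hγ.continuous
  unfold weight
  fun_prop

/-- On the straight ends γ' is constant and the weight is at most e^(-|s|); in between, continuity
suffices. -/
theorem IsDecayCurve.integrable_weight (hp : 2 ≤ p) {γ : ℝ → ℂ} (hγ : IsDecayCurve p σ γ)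
    (R : ℝ) : Integrable fun s => weight p σ γ R s * ‖deriv γ s‖ := by
  have hc : Continuous fun s => weight p σ γ R s * ‖deriv γ s‖ :=
    (hγ.continuous_weight R).mul hγ.continuous_deriv.norm
  have hw : ∀ s, 0 ≤ weight p σ γ R s := fun s => (Real.exp_pos _).le
  obtain ⟨C, hC, hC'⟩ := hγ.exists_deriv_le
  refine hc.locallyIntegrable.integrable_of_isBigO_atBot_atTop (g := fun s => Real.exp s)
    (g' := fun s => Real.exp (-s)) (IsBigO.of_bound C ?_)
    ⟨Set.Iic 0, Iic_mem_atBot 0, integrableOn_exp_Iic 0⟩ (IsBigO.of_bound C ?_)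
    ⟨Set.Ioi 0, Ioi_mem_atTop 0, integrableOn_exp_neg_Ioi 0⟩
  · filter_upwards [hγ.weight_le_atBot hp R, hC'] with s h1 h2
    rw [Real.norm_of_nonneg (mul_nonneg (hw s) (norm_nonneg _)),
      Real.norm_of_nonneg (Real.exp_pos _).le, mul_comm]
    exact mul_le_mul h2 h1 (hw s) ((norm_nonneg _).trans h2)
  · filter_upwards [hγ.weight_le_atTop hp R, hC] with s h1 h2
    rw [Real.norm_of_nonneg (mul_nonneg (hw s) (norm_nonneg _)),
      Real.norm_of_nonneg (Real.exp_pos _).le, mul_comm]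
    exact mul_le_mul h2 h1 (hw s) ((norm_nonneg _).trans h2)

/-- Amplitudes which are continuous along a curve and of at most exponential growth. -/
def Tame (γ : ℝ → ℂ) (g : ℂ → ℂ) : Prop :=
  (Continuous fun s => g (γ s)) ∧ ∃ C R : ℝ, ∀ s, ‖g (γ s)‖ ≤ C * Real.exp (R * ‖γ s‖)

variable {γ : ℝ → ℂ}

theorem Tame.mul {g h : ℂ → ℂ} (hg : Tame γ g) (hh : Tame γ h) : Tame γ fun y => g y * h y := by
  obtain ⟨h1, C, R, h2⟩ := hg
  obtain ⟨h3, C', R', h4⟩ := hh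
  refine ⟨h1.mul h3, C * C', R + R', fun s => ?_⟩
  rw [norm_mul, add_mul, Real.exp_add, mul_mul_mul_comm]
  exact mul_le_mul (h2 s) (h4 s) (norm_nonneg _) ((norm_nonneg _).trans (h2 s))

theorem Tame.add {g h : ℂ → ℂ} (hg : Tame γ g) (hh : Tame γ h) : Tame γ fun y => g y + h y := by
  obtain ⟨h1, C, R, h2⟩ := hg
  obtain ⟨h3, C', R', h4⟩ := hh
  refine ⟨h1.add h3, |C| + |C'|, max R R', fun s => ?_⟩
  have e1 : Real.exp (R * ‖γ s‖) ≤ Real.exp (max R R' * ‖γ s‖) :=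
    Real.exp_le_exp.2 (mul_le_mul_of_nonneg_right (le_max_left _ _) (norm_nonneg _))
  have e2 : Real.exp (R' * ‖γ s‖) ≤ Real.exp (max R R' * ‖γ s‖) :=
    Real.exp_le_exp.2 (mul_le_mul_of_nonneg_right (le_max_right _ _) (norm_nonneg _))
  refine (norm_add_le _ _).trans ?_
  rw [add_mul]
  refine add_le_add ((h2 s).trans ?_) ((h4 s).trans ?_)
  · exact mul_le_mul (le_abs_self C) e1 (Real.exp_pos _).le (abs_nonneg _)
  · exact mul_le_mul (le_abs_self C') e2 (Real.exp_pos _).le (abs_nonneg _)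

theorem tame_const (c : ℂ) : Tame γ fun _ => c :=
  ⟨continuous_const, ‖c‖, 0, fun s => by simp⟩

theorem tame_id (hγ : Continuous γ) : Tame γ fun y => y :=
  ⟨hγ, 1, 1, fun s => by
    rw [one_mul, one_mul]
    exact (Real.add_one_le_exp ‖γ s‖).trans' (by linarith)⟩

theorem Tame.pow {g : ℂ → ℂ} (hg : Tame γ g) (m : ℕ) : Tame γ fun y => g y ^ m := by
  induction m with
  | zero => simpa using tame_const (γ := γ) 1
  | succ m ih =>
    simp only [pow_succ]
    exact ih.mul hg

theorem Tame.prod {ι : Type*} (s : Finset ι) {g : ι → ℂ → ℂ} (hg : ∀ i ∈ s, Tame γ (g i)) :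
    Tame γ fun y => ∏ i ∈ s, g i y := by
  classical
  induction s using Finset.induction_on with
  | empty => simpa using tame_const (γ := γ) 1
  | insert i s hi ih =>
    simp only [Finset.prod_insert hi]
    exact (hg i (Finset.mem_insert_self i s)).mul
      (ih fun j hj => hg j (Finset.mem_insert_of_mem hj))

theorem Tame.sum {ι : Type*} (s : Finset ι) {g : ι → ℂ → ℂ} (hg : ∀ i ∈ s, Tame γ (g i)) :
    Tame γ fun y => ∑ i ∈ s, g i y := by
  classical
  induction s using Finset.induction_on with
  | empty => simpa using tame_const (γ := γ) 0
  | insert i s hi ih =>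
    simp only [Finset.sum_insert hi]
    exact (hg i (Finset.mem_insert_self i s)).add
      (ih fun j hj => hg j (Finset.mem_insert_of_mem hj))

theorem tame_eval (hγ : Continuous γ) (Q : Polynomial ℂ) : Tame γ fun y => Q.eval y := by
  simp only [Polynomial.eval_eq_sum_range]
  exact Tame.sum _ fun i _ => (tame_const _).mul ((tame_id hγ).pow i)

theorem IsDecayCurve.tendsto_norm_sub (hγ : IsDecayCurve p σ γ) (w : ℂ) :
    Tendsto (fun s => ‖γ s - w‖) atTop atTop ∧ Tendsto (fun s => ‖γ s - w‖) atBot atTop := by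
  have key : ∀ b ζ : ℂ, 0 < (sgn ℂ σ * ζ ^ (p + 1)).re →
      Tendsto (fun s : ℝ => ‖b + s * ζ - w‖) atTop atTop := by
    intro b ζ hζ
    have hζ0 : 0 < ‖ζ‖ := norm_pos_iff.2 fun h => by
      rw [h, zero_pow (by omega), mul_zero, Complex.zero_re] at hζ
      exact lt_irrefl _ hζ
    have h1 : Tendsto (fun s : ℝ => s * ‖ζ‖ - ‖b - w‖) atTop atTop :=
      tendsto_atTop_add_const_right _ _ (tendsto_id.atTop_mul_const hζ0)
    refine tendsto_atTop_mono (fun s => ?_) h1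
    have h2 := norm_sub_norm_le (s * ζ) (-(b - w))
    rw [norm_neg, norm_mul, Complex.norm_real, Real.norm_eq_abs] at h2
    have h3 : s * ‖ζ‖ ≤ |s| * ‖ζ‖ := mul_le_mul_of_nonneg_right (le_abs_self s) (norm_nonneg _)
    have h4 : (s : ℂ) * ζ - -(b - w) = b + s * ζ - w := by ring
    rw [h4] at h2
    linarith
  obtain ⟨_, ⟨b, ζ, hζ, h⟩, ⟨b', ζ', hζ', h'⟩⟩ := hγ
  constructor
  · refine (key b ζ hζ).congr' ?_
    filter_upwards [h] with s hs
    rw [hs]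
  · refine ((key b' ζ' hζ').comp tendsto_neg_atBot_atTop).congr' ?_
    filter_upwards [h'] with s hs
    rw [hs, Function.comp]
    congr 1
    push_cast
    ring

/-- Far out on both ends the curve has distance at least 1 from `w`, and the rest of it is compact.
-/
theorem IsDecayCurve.tame_inv_sub (hγ : IsDecayCurve p σ γ) {w : ℂ} (hw : ∀ s, γ s ≠ w) :
    Tame γ fun y => (y - w)⁻¹ := by
  have hc : Continuous fun s => (γ s - w)⁻¹ :=
    (hγ.continuous.sub continuous_const).inv₀ fun s => sub_ne_zero.2 (hw s)
  obtain ⟨h1, h2⟩ := hγ.tendsto_norm_sub w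
  obtain ⟨t, ht⟩ := eventually_atTop.1 (h1.eventually_ge_atTop 1)
  obtain ⟨b, hb⟩ := eventually_atBot.1 (h2.eventually_ge_atTop 1)
  obtain ⟨C, hC⟩ := (isCompact_Icc (a := b) (b := t)).exists_bound_of_continuousOn hc.continuousOn
  refine ⟨hc, max C 1, 0, fun s => ?_⟩
  rw [zero_mul, Real.exp_zero, mul_one]
  have h3 : 1 ≤ ‖γ s - w‖ → ‖(γ s - w)⁻¹‖ ≤ max C 1 := fun h => by
    rw [norm_inv]
    exact (inv_le_one_of_one_le₀ h).trans (le_max_right _ _)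
  by_cases hs : s ≤ b
  · exact h3 (hb s hs)
  · by_cases hs' : t ≤ s
    · exact h3 (ht s hs')
    · exact (hC s ⟨(not_le.1 hs).le, (not_le.1 hs').le⟩).trans (le_max_left _ _)

theorem IsDecayCurve.tame_zpow (hγ : IsDecayCurve p σ γ) {w : ℂ} {m : ℤ}
    (h : 0 ≤ m ∨ ∀ s, γ s ≠ w) : Tame γ fun y => (y - w) ^ m := by
  have h1 : Tame γ fun y => y - w := by
    simpa [sub_eq_add_neg] using (tame_id hγ.continuous).add (tame_const (-w))
  obtain ⟨j, rfl | rfl⟩ := m.eq_nat_or_neg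
  · simpa using h1.pow j
  · by_cases hj : j = 0
    · simpa [hj] using tame_const (γ := γ) 1
    · have h2 := h.resolve_left (by omega)
      simpa using (hγ.tame_inv_sub h2).pow j

end Curves

/-! ### Contour integrals with the exponential phase -/

section ContourIntegrals

variable {p : ℕ} {σ : ℤˣ}

/-- `exp (-σ y^(p+1)/(p+1) + σ u y)`. -/
def phase (p : ℕ) (σ : ℤˣ) (u y : ℂ) : ℂ :=
  Complex.exp (-sgn ℂ σ * y ^ (p + 1) / ((p : ℂ) + 1) + sgn ℂ σ * u * y)

theorem norm_sgn (σ : ℤˣ) : ‖sgn ℂ σ‖ = 1 := by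
  rcases Int.units_eq_one_or σ with rfl | rfl <;> simp

theorem continuous_phase (u : ℂ) : Continuous (phase p σ u) := by
  unfold phase
  fun_prop

theorem norm_phase_le {γ : ℝ → ℂ} {u : ℂ} {R : ℝ} (hu : ‖u‖ ≤ R) (s : ℝ) :
    ‖phase p σ u (γ s)‖ ≤ weight p σ γ R s := by
  rw [phase, Complex.norm_exp, weight]
  refine Real.exp_le_exp.2 ?_
  rw [Complex.add_re]
  refine add_le_add le_rfl ((Complex.re_le_norm _).trans ?_)
  rw [norm_mul, norm_mul, norm_sgn, one_mul]
  exact mul_le_mul_of_nonneg_right hu (norm_nonneg _)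

theorem weight_mul_exp (γ : ℝ → ℂ) (R R' s : ℝ) :
    weight p σ γ R s * Real.exp (R' * ‖γ s‖) = weight p σ γ (R + R') s := by
  rw [weight, weight, ← Real.exp_add]
  congr 1
  ring

/-- A common bound for the integrands. -/
theorem Tame.exists_bound {γ : ℝ → ℂ} {g : ℂ → ℂ} (hg : Tame γ g) (R : ℝ) :
    ∃ C R' : ℝ, ∀ u : ℂ, ‖u‖ ≤ R → ∀ s, ‖phase p σ u (γ s) * g (γ s)‖ ≤ C * weight p σ γ R' s := by
  obtain ⟨_, C, R', h⟩ := hg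
  refine ⟨C, R + R', fun u hu s => ?_⟩
  rw [norm_mul, ← weight_mul_exp, mul_left_comm]
  exact mul_le_mul (norm_phase_le hu s) (h s) (norm_nonneg _) (Real.exp_pos _).le

theorem Tame.continuous_integrand {γ : ℝ → ℂ} {g : ℂ → ℂ} (hγ : IsDecayCurve p σ γ)
    (hg : Tame γ g) (u : ℂ) : Continuous fun s => phase p σ u (γ s) * g (γ s) * deriv γ s :=
  (((continuous_phase u).comp hγ.continuous).mul hg.1).mul hγ.continuous_deriv

theorem Tame.integrable {γ : ℝ → ℂ} {g : ℂ → ℂ} (hp : 2 ≤ p) (hγ : IsDecayCurve p σ γ)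
    (hg : Tame γ g) (u : ℂ) : Integrable fun s => phase p σ u (γ s) * g (γ s) * deriv γ s := by
  obtain ⟨C, R', h⟩ := hg.exists_bound (p := p) (σ := σ) ‖u‖
  refine ((hγ.integrable_weight hp R').const_mul C).mono'
    (hg.continuous_integrand hγ u).aestronglyMeasurable (Eventually.of_forall fun s => ?_)
  rw [norm_mul, ← mul_assoc]
  exact mul_le_mul_of_nonneg_right (h u le_rfl s) (norm_nonneg _)

/-- Differentiation under the integral sign: for all parameters at distance less than 1 from `u` one
weight dominates, since weights are integrable for every exponential rate. -/
theorem hasDerivAt_integral_phase {γ : ℝ → ℂ} {g : ℂ → ℂ} (hp : 2 ≤ p) (hγ : IsDecayCurve p σ γ)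
    (hg : Tame γ g) (u : ℂ) :
    HasDerivAt (fun u => ∫ s, phase p σ u (γ s) * g (γ s) * deriv γ s)
      (sgn ℂ σ * ∫ s, phase p σ u (γ s) * (γ s * g (γ s)) * deriv γ s) u := by
  have hg' : Tame γ fun y => sgn ℂ σ * (y * g y) :=
    (tame_const _).mul ((tame_id hγ.continuous).mul hg)
  obtain ⟨C, R', h⟩ := hg'.exists_bound (p := p) (σ := σ) (‖u‖ + 1)
  have := (hasDerivAt_integral_of_dominated_loc_of_deriv_le
    (F := fun u s => phase p σ u (γ s) * g (γ s) * deriv γ s)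
    (F' := fun u s => phase p σ u (γ s) * (sgn ℂ σ * (γ s * g (γ s))) * deriv γ s)
    (Metric.ball_mem_nhds u one_pos)
    (Eventually.of_forall fun u => (hg.continuous_integrand hγ u).aestronglyMeasurable)
    (hg.integrable hp hγ u) (hg'.continuous_integrand hγ u).aestronglyMeasurable
    (Eventually.of_forall fun s v hv => ?_)
    ((hγ.integrable_weight hp R').const_mul C) (Eventually.of_forall fun s v _ => ?_)).2
  · have e : sgn ℂ σ * ∫ s, phase p σ u (γ s) * (γ s * g (γ s)) * deriv γ s =
        ∫ s, phase p σ u (γ s) * (sgn ℂ σ * (γ s * g (γ s))) * deriv γ s := by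
      rw [← integral_const_mul]
      congr 1
      ext s
      ring
    rw [e]
    exact this
  · rw [norm_mul]
    refine (mul_le_mul_of_nonneg_right (h v ?_ s) (norm_nonneg (deriv γ s))).trans_eq
      (mul_assoc _ _ _)
    have h1 := norm_sub_norm_le v u
    rw [Metric.mem_ball, dist_eq_norm] at hv
    linarith
  · have h1 : HasDerivAt (fun v => -sgn ℂ σ * γ s ^ (p + 1) / ((p : ℂ) + 1) + sgn ℂ σ * v * γ s)
        (sgn ℂ σ * γ s) v := by
      simpa using (((hasDerivAt_id v).const_mul (sgn ℂ σ)).mul_const (γ s)).const_add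
        (-sgn ℂ σ * γ s ^ (p + 1) / ((p : ℂ) + 1))
    have h2 := (h1.cexp.mul_const (g (γ s))).mul_const (deriv γ s)
    refine h2.congr_deriv ?_
    rw [phase]
    ring

theorem hasDerivAt_phase (u y : ℂ) :
    HasDerivAt (phase p σ u) (phase p σ u y * (sgn ℂ σ * (u - y ^ p))) y := by
  have h1 : HasDerivAt (fun y => -sgn ℂ σ * y ^ (p + 1) / ((p : ℂ) + 1) + sgn ℂ σ * u * y)
      (sgn ℂ σ * (u - y ^ p)) y := by
    have hp1 : (p : ℂ) + 1 ≠ 0 := by exact_mod_cast p.succ_ne_zero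
    have := (((hasDerivAt_pow (p + 1) y).const_mul (-sgn ℂ σ)).div_const ((p : ℂ) + 1)).add
      ((hasDerivAt_id y).const_mul (sgn ℂ σ * u))
    refine this.congr_deriv ?_
    push_cast
    field_simp
    ring
  exact h1.cexp

/-- The integral of a total derivative vanishes. -/
theorem integral_phase_total {γ : ℝ → ℂ} {g g' : ℂ → ℂ} (hp : 2 ≤ p) (hγ : IsDecayCurve p σ γ)
    (hg : Tame γ g) (hg' : Tame γ g') (hd : ∀ s, HasDerivAt g (g' (γ s)) (γ s)) (u : ℂ) :
    ∫ s, phase p σ u (γ s) * (g' (γ s) + sgn ℂ σ * ((u - γ s ^ p) * g (γ s))) * deriv γ s = 0 := by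
  have ht : Tame γ fun y => g' y + sgn ℂ σ * ((u - y ^ p) * g y) := by
    refine hg'.add ((tame_const _).mul (Tame.mul ?_ hg))
    have := (tame_const (γ := γ) u).add ((tame_const (-1)).mul ((tame_id hγ.continuous).pow p))
    simpa [sub_eq_add_neg] using this
  obtain ⟨C, R', h⟩ := hg.exists_bound (p := p) (σ := σ) ‖u‖
  have hC : ∀ s, ‖phase p σ u (γ s) * g (γ s)‖ ≤ |C| * weight p σ γ R' s := fun s =>
    (h u le_rfl s).trans (mul_le_mul_of_nonneg_right (le_abs_self C) (Real.exp_pos _).le)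
  have := integral_of_hasDerivAt_of_tendsto (f := fun s => phase p σ u (γ s) * g (γ s))
    (f' := fun s => phase p σ u (γ s) * (g' (γ s) + sgn ℂ σ * ((u - γ s ^ p) * g (γ s))) *
      deriv γ s) (m := 0) (n := 0) (fun s => ?_) (ht.integrable hp hγ u) ?_ ?_
  · rw [this, sub_zero]
  · have h1 := ((hasDerivAt_phase (p := p) (σ := σ) u (γ s)).mul (hd s)).comp_of_eq s
      (hγ.hasDerivAt s) rfl
    refine h1.congr_deriv ?_
    ring
  · refine squeeze_zero_norm' (a := fun s => |C| * Real.exp s) ?_ ?_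
    · filter_upwards [hγ.weight_le_atBot hp R'] with s hs
      exact (hC s).trans (mul_le_mul_of_nonneg_left hs (abs_nonneg _))
    · simpa using Real.tendsto_exp_atBot.const_mul |C|
  · refine squeeze_zero_norm' (a := fun s => |C| * Real.exp (-s)) ?_ ?_
    · filter_upwards [hγ.weight_le_atTop hp R'] with s hs
      exact (hC s).trans (mul_le_mul_of_nonneg_left hs (abs_nonneg _))
    · simpa using (Real.tendsto_exp_atBot.comp tendsto_neg_atTop_atBot).const_mul |C|

/-- `∫_Γ exp (-σ y^(p+1)/(p+1) + σ u y) g(y) dy`. -/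
def phaseIntegral (p : ℕ) (σ : ℤˣ) (Γ : List (ℝ → ℂ)) (g : ℂ → ℂ) (u : ℂ) : ℂ :=
  contourIntegral Γ fun y => phase p σ u y * g y

variable {Γ : List (ℝ → ℂ)}

theorem phaseIntegral_nil (g : ℂ → ℂ) (u : ℂ) : phaseIntegral p σ [] g u = 0 := rfl

theorem phaseIntegral_cons (γ : ℝ → ℂ) (g : ℂ → ℂ) (u : ℂ) : phaseIntegral p σ (γ :: Γ) g u =
    (∫ s, phase p σ u (γ s) * g (γ s) * deriv γ s) + phaseIntegral p σ Γ g u := rfl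

theorem phaseIntegral_congr {g h : ℂ → ℂ} (H : ∀ γ ∈ Γ, ∀ s, g (γ s) = h (γ s)) (u : ℂ) :
    phaseIntegral p σ Γ g u = phaseIntegral p σ Γ h u := by
  induction Γ with
  | nil => rfl
  | cons γ Γ ih =>
    rw [phaseIntegral_cons, phaseIntegral_cons, ih fun γ' hγ' => H γ' (List.mem_cons_of_mem _ hγ')]
    simp only [H γ List.mem_cons_self]

theorem phaseIntegral_const_mul (c : ℂ) (g : ℂ → ℂ) (u : ℂ) :
    phaseIntegral p σ Γ (fun y => c * g y) u = c * phaseIntegral p σ Γ g u := by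
  induction Γ with
  | nil => simp [phaseIntegral_nil]
  | cons γ Γ ih =>
    rw [phaseIntegral_cons, phaseIntegral_cons, ih, mul_add, ← integral_const_mul]
    congr 2
    ext s
    ring

variable (hp : 2 ≤ p) (hΓ : ∀ γ ∈ Γ, IsDecayCurve p σ γ)

include hp hΓ in
theorem phaseIntegral_add {g h : ℂ → ℂ} (hg : ∀ γ ∈ Γ, Tame γ g) (hh : ∀ γ ∈ Γ, Tame γ h) (u : ℂ) :
    phaseIntegral p σ Γ (fun y => g y + h y) u =
      phaseIntegral p σ Γ g u + phaseIntegral p σ Γ h u := by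
  induction Γ with
  | nil => simp [phaseIntegral_nil]
  | cons γ Γ ih =>
    have hm : γ ∈ γ :: Γ := List.mem_cons_self
    have hm' : ∀ γ' ∈ Γ, γ' ∈ γ :: Γ := fun γ' h => List.mem_cons_of_mem _ h
    rw [phaseIntegral_cons, phaseIntegral_cons, phaseIntegral_cons,
      ih (fun γ' h => hΓ γ' (hm' γ' h)) (fun γ' h => hg γ' (hm' γ' h)) fun γ' h => hh γ' (hm' γ' h),
      add_add_add_comm, ← integral_add ((hg γ hm).integrable hp (hΓ γ hm) u)
        ((hh γ hm).integrable hp (hΓ γ hm) u)]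
    congr 2
    ext s
    ring

include hp hΓ in
theorem phaseIntegral_sum {ι : Type*} (S : Finset ι) {g : ι → ℂ → ℂ}
    (hg : ∀ i ∈ S, ∀ γ ∈ Γ, Tame γ (g i)) (u : ℂ) :
    phaseIntegral p σ Γ (fun y => ∑ i ∈ S, g i y) u = ∑ i ∈ S, phaseIntegral p σ Γ (g i) u := by
  classical
  induction S using Finset.induction_on with
  | empty =>
    have := phaseIntegral_const_mul (p := p) (σ := σ) (Γ := Γ) 0 (fun _ => 0) u
    simpa using this
  | insert i S hi ih =>
    simp only [Finset.sum_insert hi]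
    rw [phaseIntegral_add hp hΓ (hg i (Finset.mem_insert_self i S)) (fun γ hγ => Tame.sum S
      fun j hj => hg j (Finset.mem_insert_of_mem hj) γ hγ),
      ih fun j hj => hg j (Finset.mem_insert_of_mem hj)]

include hp hΓ in
theorem hasDerivAt_phaseIntegral {g : ℂ → ℂ} (hg : ∀ γ ∈ Γ, Tame γ g) (u : ℂ) :
    HasDerivAt (phaseIntegral p σ Γ g) (sgn ℂ σ * phaseIntegral p σ Γ (fun y => y * g y) u) u := by
  induction Γ with
  | nil =>
    rw [phaseIntegral_nil, mul_zero]
    exact hasDerivAt_const u 0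
  | cons γ Γ ih =>
    have hm : γ ∈ γ :: Γ := List.mem_cons_self
    have hm' : ∀ γ' ∈ Γ, γ' ∈ γ :: Γ := fun γ' h => List.mem_cons_of_mem _ h
    rw [phaseIntegral_cons, mul_add]
    exact (hasDerivAt_integral_phase hp (hΓ γ hm) (hg γ hm) u).add
      (ih (fun γ' h => hΓ γ' (hm' γ' h)) fun γ' h => hg γ' (hm' γ' h))

include hp hΓ in
theorem phaseIntegral_total {g g' : ℂ → ℂ} (hg : ∀ γ ∈ Γ, Tame γ g) (hg' : ∀ γ ∈ Γ, Tame γ g')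
    (hd : ∀ γ ∈ Γ, ∀ s, HasDerivAt g (g' (γ s)) (γ s)) (u : ℂ) :
    phaseIntegral p σ Γ (fun y => g' y + sgn ℂ σ * ((u - y ^ p) * g y)) u = 0 := by
  induction Γ with
  | nil => rfl
  | cons γ Γ ih =>
    have hm : γ ∈ γ :: Γ := List.mem_cons_self
    have hm' : ∀ γ' ∈ Γ, γ' ∈ γ :: Γ := fun γ' h => List.mem_cons_of_mem _ h
    rw [phaseIntegral_cons, ih (fun γ' h => hΓ γ' (hm' γ' h)) (fun γ' h => hg γ' (hm' γ' h))
      (fun γ' h => hg' γ' (hm' γ' h)) fun γ' h => hd γ' (hm' γ' h), add_zero]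
    exact integral_phase_total hp (hΓ γ hm) (hg γ hm) (hg' γ hm) (hd γ hm) u

end ContourIntegrals

/-! ### The amplitude ∏ (y - wᵢ)^(mᵢ) and its derivative -/

section Amplitude

variable {k : ℕ} (w : Fin k → ℝ)

/-- `∏ (y - wᵢ)^(mᵢ)`. -/
def amplitude (m : Fin k → ℤ) (y : ℂ) : ℂ := ∏ i, (y - (w i : ℂ)) ^ m i

theorem amplitude_update (m : Fin k → ℤ) (i : Fin k) (l : ℤ) (y : ℂ) :
    amplitude w (Function.update m i l) y =
      (∏ j ∈ Finset.univ.erase i, (y - (w j : ℂ)) ^ m j) * (y - (w i : ℂ)) ^ l := by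
  rw [amplitude, ← Finset.prod_erase_mul _ _ (Finset.mem_univ i), Function.update_self]
  congr 1
  refine Finset.prod_congr rfl fun j hj => ?_
  rw [Function.update_of_ne (Finset.ne_of_mem_erase hj)]

theorem hasDerivAt_amplitude {m : Fin k → ℤ} {y : ℂ} (h : ∀ i, y ≠ (w i : ℂ) ∨ 0 ≤ m i) :
    HasDerivAt (amplitude w m)
      (∑ i, (m i : ℂ) * amplitude w (Function.update m i (m i - 1)) y) y := by
  have h1 : ∀ i ∈ Finset.univ, HasDerivAt (fun y => (y - (w i : ℂ)) ^ m i)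
      ((m i : ℂ) * (y - (w i : ℂ)) ^ (m i - 1)) y := fun i _ => by
    have h2 := (hasDerivAt_zpow (m i) (y - (w i : ℂ))
      ((h i).imp_left sub_ne_zero.2)).comp y ((hasDerivAt_id y).sub_const (w i : ℂ))
    rw [mul_one] at h2
    exact h2
  have h3 := HasDerivAt.fun_finsetProd h1
  refine h3.congr_deriv (Finset.sum_congr rfl fun i _ => ?_)
  rw [amplitude_update, smul_eq_mul]
  ring

/-- At x = 0 the exponent m = 0 has to be excluded: there the left side is 0⁻¹ * 0 = 0, the right
side 1. -/
theorem zpow_sub_one_mul_self {x : ℂ} {m : ℤ} (h : x ≠ 0 ∨ 0 < m) : x ^ (m - 1) * x = x ^ m := by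
  by_cases hx : x = 0
  · have hm := h.resolve_left (not_not.2 hx)
    rw [hx, mul_zero, zero_zpow _ hm.ne']
  · rw [← zpow_add_one₀ hx, sub_add_cancel]

theorem amplitude_update_mul {m : Fin k → ℤ} {y : ℂ} {i : Fin k}
    (h : y ≠ (w i : ℂ) ∨ 0 < m i) :
    amplitude w (Function.update m i (m i - 1)) y * (y - (w i : ℂ)) = amplitude w m y := by
  rw [amplitude_update, mul_assoc, zpow_sub_one_mul_self (h.imp_left sub_ne_zero.2), amplitude,
    Finset.prod_erase_mul _ _ (Finset.mem_univ i)]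

/-- The logarithmic derivative of the amplitude, without denominators. -/
theorem polyP_mul_deriv_amplitude (n : Fin k → ℕ) (σ : ℤˣ) {y : ℂ}
    (h : ∀ i, n i = 0 ∨ y ≠ (w i : ℂ) ∨ 0 < (σ : ℤ) * (n i : ℤ)) :
    (polyP w).eval y * ∑ i, (((σ : ℤ) * (n i : ℤ) : ℤ) : ℂ) *
        amplitude w (Function.update (fun i => (σ : ℤ) * (n i : ℤ)) i ((σ : ℤ) * (n i : ℤ) - 1)) y =
      sgn ℂ σ * ((polyR w n).eval y * amplitude w (fun i => (σ : ℤ) * (n i : ℤ)) y) := by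
  have hP : ∀ i, (polyP w).eval y = (∏ j ∈ Finset.univ.erase i, (y - (w j : ℂ))) *
      (y - (w i : ℂ)) := fun i => by
    rw [polyP, Polynomial.eval_prod, ← Finset.prod_erase_mul _ _ (Finset.mem_univ i)]
    simp
  have hR : (polyR w n).eval y = ∑ i, (n i : ℂ) * ∏ j ∈ Finset.univ.erase i, (y - (w j : ℂ)) := by
    simp [polyR, Polynomial.eval_finsetSum, Polynomial.eval_prod]
  rw [hR, Finset.mul_sum, Finset.sum_mul, Finset.mul_sum]
  refine Finset.sum_congr rfl fun i _ => ?_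
  by_cases hn : n i = 0
  · simp [hn]
  · rw [hP i, ← amplitude_update_mul w (m := fun i => (σ : ℤ) * (n i : ℤ)) ((h i).resolve_left hn)]
    push_cast
    ring

end Amplitude

/-! ### Sectors, the branch of √z and the prefactor -/

section Sectors

variable {θ δ : ℝ}

theorem mem_slitPlane_of_mem_sector (hδ : δ ≤ Real.pi) {z : ℂ} (hz : z ∈ sector θ δ) :
    z * Complex.exp (-(θ * Complex.I)) ∈ Complex.slitPlane := by
  refine Complex.mem_slitPlane_iff_arg.2 ⟨fun h => ?_, mul_ne_zero hz.1 (Complex.exp_ne_zero _)⟩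
  have := hz.2
  rw [h, abs_of_pos Real.pi_pos] at this
  linarith

theorem isOpen_sector (hδ : δ ≤ Real.pi) : IsOpen (sector θ δ) := by
  have h1 : IsOpen (Complex.slitPlane ∩ {x | |x.arg| < δ}) :=
    ContinuousOn.isOpen_inter_preimage (f := fun x : ℂ => |x.arg|)
      (fun x hx => (Complex.continuousAt_arg hx).abs.continuousWithinAt) Complex.isOpen_slitPlane
      isOpen_Iio
  have h2 : sector θ δ = (fun z => z * Complex.exp (-(θ * Complex.I))) ⁻¹'
      (Complex.slitPlane ∩ {x | |x.arg| < δ}) := by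
    ext z
    refine ⟨fun hz => ⟨mem_slitPlane_of_mem_sector hδ hz, hz.2⟩, fun hz => ⟨fun h => ?_, hz.2⟩⟩
    have h3 := Complex.slitPlane_ne_zero hz.1
    simp only [h, zero_mul] at h3
    exact h3 rfl
  rw [h2]
  exact h1.preimage (continuous_id.mul continuous_const)

theorem sector_mono {δ' : ℝ} (h : δ' ≤ δ) : sector θ δ' ⊆ sector θ δ :=
  fun _ hz => ⟨hz.1, hz.2.trans_le h⟩

/-- Multiplication by a number close to `1` maps a closed subsector into a larger one. -/
theorem exists_mul_mem_sector {δ' : ℝ} (h : δ' < δ) (hδ : δ ≤ Real.pi) :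
    ∃ η > 0, η ≤ 1 / 2 ∧ ∀ z ∈ sector θ δ', ∀ q : ℂ, ‖q - 1‖ ≤ η → z * q ∈ sector θ δ := by
  have h1 : ∀ᶠ q : ℂ in 𝓝 1, |q.arg| < δ - δ' := by
    have h2 : ContinuousAt (fun q : ℂ => |q.arg|) 1 :=
      (Complex.continuousAt_arg Complex.one_mem_slitPlane).abs
    refine h2.eventually (gt_mem_nhds ?_)
    simp only [Complex.arg_one, abs_zero]
    linarith
  obtain ⟨ε, hε, h3⟩ := Metric.eventually_nhds_iff.1 h1
  refine ⟨min (ε / 2) (1 / 2), by positivity, min_le_right _ _, fun z hz q hq => ?_⟩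
  have hq1 : |q.arg| < δ - δ' := h3 (by
    rw [dist_eq_norm]
    exact (hq.trans (min_le_left _ _)).trans_lt (by linarith))
  have hq0 : q ≠ 0 := fun h0 => by
    rw [h0, zero_sub, norm_neg, norm_one] at hq
    have := hq.trans (min_le_right _ _)
    norm_num at this
  refine ⟨mul_ne_zero hz.1 hq0, ?_⟩
  have h4 : z * q * Complex.exp (-(θ * Complex.I)) = z * Complex.exp (-(θ * Complex.I)) * q := by
    ring
  -- The sum of the two arguments stays below δ ≤ π in modulus, so the argument of the product has
  -- no jump.
  have h5 : |(z * Complex.exp (-(θ * Complex.I))).arg + q.arg| < δ :=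
    (abs_add_le _ _).trans_lt (by linarith [hz.2])
  rw [h4, Complex.arg_mul (mul_ne_zero hz.1 (Complex.exp_ne_zero _)) hq0]
  · exact h5
  · rw [abs_lt] at h5
    exact ⟨by linarith [h5.1], by linarith [h5.2]⟩

theorem neBot_sector (hδ : 0 < δ) :
    (Bornology.cobounded ℂ ⊓ 𝓟 (sector θ δ)).NeBot := by
  have h1 : Tendsto (fun t : ℝ => (t : ℂ) * Complex.exp (θ * Complex.I)) atTop
      (Bornology.cobounded ℂ ⊓ 𝓟 (sector θ δ)) := by
    refine tendsto_inf.2 ⟨?_, tendsto_principal.2 ?_⟩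
    · rw [← tendsto_norm_atTop_iff_cobounded]
      refine (tendsto_abs_atTop_atTop).congr fun t => ?_
      rw [norm_mul, Complex.norm_exp_ofReal_mul_I, mul_one, Complex.norm_real, Real.norm_eq_abs]
    · filter_upwards [eventually_gt_atTop 0] with t ht
      refine ⟨mul_ne_zero (by exact_mod_cast ht.ne') (Complex.exp_ne_zero _), ?_⟩
      rw [mul_assoc, ← Complex.exp_add, add_neg_cancel, Complex.exp_zero, mul_one,
        Complex.arg_ofReal_of_nonneg ht.le, abs_zero]
      exact hδ
  exact h1.neBot

theorem sqrtBranch_ne_zero {z : ℂ} (hz : z ∈ sector θ δ) :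
    sqrtBranch θ z ≠ 0 := by
  refine mul_ne_zero (Complex.exp_ne_zero _) fun h => ?_
  rw [Complex.cpow_eq_zero_iff] at h
  exact mul_ne_zero hz.1 (Complex.exp_ne_zero _) h.1

theorem hasDerivAt_sqrtBranch (hδ : δ ≤ Real.pi) {z : ℂ} (hz : z ∈ sector θ δ) :
    HasDerivAt (sqrtBranch θ) (sqrtBranch θ z / (2 * z)) z := by
  have hs := mem_slitPlane_of_mem_sector hδ hz
  have h0 : z * Complex.exp (-(θ * Complex.I)) ≠ 0 := Complex.slitPlane_ne_zero hs
  have h1 : HasDerivAt (fun z : ℂ => z * Complex.exp (-(θ * Complex.I)))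
      (Complex.exp (-(θ * Complex.I))) z := by
    simpa using (hasDerivAt_id z).mul_const (Complex.exp (-(θ * Complex.I)))
  have h2 := (h1.cpow_const (c := 1 / 2) hs).const_mul (Complex.exp (θ / 2 * Complex.I))
  refine h2.congr_deriv ?_
  rw [sqrtBranch, Complex.cpow_sub _ _ h0, Complex.cpow_one]
  have := hz.1
  field_simp

/-- `z^(-σ n + (p-1)/2) exp (-σ p/(p+1) z^(p+1))`. -/
def prefactor (p N : ℕ) (σ : ℤˣ) (θ : ℝ) (z : ℂ) : ℂ :=
  z ^ (-(σ : ℤ) * (N : ℤ)) * sqrtBranch θ z ^ ((p : ℤ) - 1) *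
    Complex.exp (-sgn ℂ σ * ((p : ℂ) / ((p : ℂ) + 1)) * z ^ (p + 1))

/-- The exponent of z in the prefactor is -μ, the negative of the constant in A^σ; the exponential
adds -σ p z^p to the logarithmic derivative. -/
theorem hasDerivAt_prefactor (p N : ℕ) (σ : ℤˣ) (hδ : δ ≤ Real.pi) {z : ℂ}
    (hz : z ∈ sector θ δ) : HasDerivAt (prefactor p N σ θ)
      ((-shiftA p N σ / z - sgn ℂ σ * p * z ^ p) * prefactor p N σ θ z) z := by
  have h0 := hz.1
  have hs0 := sqrtBranch_ne_zero hz
  have h1 := hasDerivAt_zpow (-(σ : ℤ) * (N : ℤ)) z (Or.inl h0)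
  have h2 := (hasDerivAt_zpow ((p : ℤ) - 1) (sqrtBranch θ z) (Or.inl hs0)).comp z
    (hasDerivAt_sqrtBranch hδ hz)
  have h3 := ((hasDerivAt_pow (p + 1) z).const_mul
    (-sgn ℂ σ * ((p : ℂ) / ((p : ℂ) + 1)))).cexp
  have hp1 : (p : ℂ) + 1 ≠ 0 := by exact_mod_cast p.succ_ne_zero
  refine ((h1.mul h2).mul h3).congr_deriv ?_
  rw [zpow_sub_one₀ h0, zpow_sub_one₀ hs0 ((p : ℤ) - 1), shiftA, prefactor]
  simp only [Function.comp, Pi.mul_apply]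
  push_cast
  field_simp
  ring

end Sectors

/-! ### The action of ∂/∂x and A^σ on the wave functions -/

section WaveFunctions

variable {p : ℕ} {σ : ℤˣ}

/-- The wave function with amplitude `g`. -/
def psiAmp (p N : ℕ) (σ : ℤˣ) (Γ : List (ℝ → ℂ)) (c : ℂ) (θ : ℝ) (g : ℂ → ℂ) (x z : ℂ) : ℂ :=
  prefactor p N σ θ z * (c * phaseIntegral p σ Γ g (x + z ^ p))

theorem PsiFun_eq {k : ℕ} (w : Fin k → ℝ) (n : Fin k → ℕ) (Γ : List (ℝ → ℂ)) (c : ℂ) (θ : ℝ)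
    (x z : ℂ) : PsiFun p w n σ Γ c θ x z =
      psiAmp p (∑ i, n i) σ Γ c θ (amplitude w fun i => (σ : ℤ) * (n i : ℤ)) x z := rfl

variable (hp : 2 ≤ p) {Γ : List (ℝ → ℂ)} (hΓ : ∀ γ ∈ Γ, IsDecayCurve p σ γ) (N : ℕ) (c : ℂ)
  {θ δ : ℝ} (hδ : δ ≤ Real.pi)

include hp hΓ in
theorem hasDerivAt_psiAmp_left {g : ℂ → ℂ} (hg : ∀ γ ∈ Γ, Tame γ g) (x z : ℂ) :
    HasDerivAt (fun x => psiAmp p N σ Γ c θ g x z)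
      (sgn ℂ σ * psiAmp p N σ Γ c θ (fun y => y * g y) x z) x := by
  have h1 := (hasDerivAt_phaseIntegral hp hΓ hg (x + z ^ p)).comp_add_const x (z ^ p)
  refine ((h1.const_mul c).const_mul (prefactor p N σ θ z)).congr_deriv ?_
  rw [psiAmp]
  ring

include hp hΓ hδ in
theorem hasDerivAt_psiAmp_right {g : ℂ → ℂ} (hg : ∀ γ ∈ Γ, Tame γ g) (x : ℂ) {z : ℂ}
    (hz : z ∈ sector θ δ) : HasDerivAt (fun z => psiAmp p N σ Γ c θ g x z)
      ((-shiftA p N σ / z - sgn ℂ σ * p * z ^ p) * psiAmp p N σ Γ c θ g x z +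
        sgn ℂ σ * p * z ^ (p - 1) * psiAmp p N σ Γ c θ (fun y => y * g y) x z) z := by
  have h1 := (hasDerivAt_phaseIntegral hp hΓ hg (x + z ^ p)).comp z
    ((hasDerivAt_pow p z).const_add x)
  refine ((hasDerivAt_prefactor p N σ hδ hz).mul (h1.const_mul c)).congr_deriv ?_
  simp only [Function.comp, psiAmp]
  ring

include hp hΓ hδ in
-- The chain rule for u = x + z^p yields σ p z^(p-1) times the integral with an extra factor y,
-- which σ z/(p z^p) normalises to 1. The logarithmic derivative of the prefactor cancels the
-- summand z and the constant in A^σ.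
theorem funA_psiAmp {g : ℂ → ℂ} (hg : ∀ γ ∈ Γ, Tame γ g) (x : ℂ) {z : ℂ} (hz : z ∈ sector θ δ) :
    funA p N σ (fun z => psiAmp p N σ Γ c θ g x z) z =
      psiAmp p N σ Γ c θ (fun y => y * g y) x z := by
  have hz0 := hz.1
  have hp0 : (p : ℂ) ≠ 0 := by
    have : p ≠ 0 := by omega
    exact_mod_cast this
  have h1 : z * z ^ (p - 1) = z ^ p := by
    rw [← pow_succ', Nat.sub_add_cancel (by omega)]
  have h2 : z * deriv (fun z => psiAmp p N σ Γ c θ g x z) z =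
      (-shiftA p N σ - sgn ℂ σ * p * z ^ p * z) * psiAmp p N σ Γ c θ g x z +
        sgn ℂ σ * p * z ^ p * psiAmp p N σ Γ c θ (fun y => y * g y) x z := by
    rw [(hasDerivAt_psiAmp_right hp hΓ N c hδ hg x hz).deriv, ← h1]
    field_simp
  have hs := sgn_mul_self ℂ σ
  rw [funA, h2]
  change _ + _ * (_ + shiftA p N σ * _) = _
  have hzp : z ^ p ≠ 0 := pow_ne_zero p hz0
  rw [div_mul_eq_mul_div, ← eq_sub_iff_add_eq', div_eq_iff (mul_ne_zero hp0 hzp)]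
  linear_combination (-p * z ^ p * z * psiAmp p N σ Γ c θ g x z +
    p * z ^ p * psiAmp p N σ Γ c θ (fun y => y * g y) x z) * hs

theorem funA_congr {U : Set ℂ} (hU : IsOpen U) {f g : ℂ → ℂ} (h : Set.EqOn f g U) :
    Set.EqOn (funA p N σ f) (funA p N σ g) U := fun z hz => by
  have h1 : f =ᶠ[𝓝 z] g := by filter_upwards [hU.mem_nhds hz] with y hy using h hy
  rw [funA, funA, h hz, h1.deriv_eq]

include hp hΓ hδ in
theorem funA_iterate_psiAmp {g : ℂ → ℂ} (hg : ∀ γ ∈ Γ, Tame γ g) (x : ℂ) {f : ℂ → ℂ}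
    (hf : Set.EqOn f (fun z => psiAmp p N σ Γ c θ g x z) (sector θ δ)) (j : ℕ) :
    Set.EqOn ((funA p N σ)^[j] f) (fun z => psiAmp p N σ Γ c θ (fun y => y ^ j * g y) x z)
      (sector θ δ) := by
  induction j with
  | zero => simpa using hf
  | succ j ih =>
    intro z hz
    have ht : ∀ γ ∈ Γ, Tame γ fun y => y ^ j * g y := fun γ hγ =>
      ((tame_id (hΓ γ hγ).continuous).pow j).mul (hg γ hγ)
    rw [Function.iterate_succ_apply', funA_congr N (isOpen_sector hδ) ih hz,
      funA_psiAmp hp hΓ N c hδ ht x hz]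
    simp only [pow_succ', mul_assoc]

theorem psiAmp_const_mul (g : ℂ → ℂ) (r x z : ℂ) :
    psiAmp p N σ Γ c θ (fun y => r * g y) x z = r * psiAmp p N σ Γ c θ g x z := by
  rw [psiAmp, psiAmp, phaseIntegral_const_mul]
  ring

include hp hΓ in
theorem psiAmp_sum {ι : Type*} (S : Finset ι) {g : ι → ℂ → ℂ}
    (hg : ∀ i ∈ S, ∀ γ ∈ Γ, Tame γ (g i)) (x z : ℂ) :
    psiAmp p N σ Γ c θ (fun y => ∑ i ∈ S, g i y) x z =
      ∑ i ∈ S, psiAmp p N σ Γ c θ (g i) x z := by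
  rw [psiAmp, phaseIntegral_sum hp hΓ S hg, Finset.mul_sum, Finset.mul_sum]
  rfl

theorem applyPoly_apply (A : (ℂ → ℂ) → ℂ → ℂ) (Q : Polynomial ℂ) (f : ℂ → ℂ) (z : ℂ) :
    applyPoly A Q f z = ∑ i ∈ Q.support, Q.coeff i * A^[i] f z := by
  rw [applyPoly, Polynomial.sum_def, Finset.sum_apply]
  rfl

include hp hΓ hδ in
theorem applyPoly_psiAmp {g : ℂ → ℂ} (hg : ∀ γ ∈ Γ, Tame γ g) (x : ℂ) {f : ℂ → ℂ}
    (hf : Set.EqOn f (fun z => psiAmp p N σ Γ c θ g x z) (sector θ δ)) (Q : Polynomial ℂ) :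
    Set.EqOn (applyPoly (funA p N σ) Q f)
      (fun z => psiAmp p N σ Γ c θ (fun y => Q.eval y * g y) x z) (sector θ δ) := by
  intro z hz
  have h1 : (fun y => Q.eval y * g y) =
      fun y => ∑ i ∈ Q.support, Q.coeff i * (y ^ i * g y) := by
    ext y
    rw [Polynomial.eval_eq_sum, Polynomial.sum_def, Finset.sum_mul]
    exact Finset.sum_congr rfl fun i _ => by ring
  simp only
  rw [applyPoly_apply, h1, psiAmp_sum hp hΓ]
  · refine Finset.sum_congr rfl fun i _ => ?_
    rw [psiAmp_const_mul, funA_iterate_psiAmp hp hΓ N c hδ hg x hf i hz]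
  · exact fun i _ γ hγ => (tame_const _).mul
      (((tame_id (hΓ γ hγ).continuous).pow i).mul (hg γ hγ))

end WaveFunctions

/-! ### The differential equation in z and the spectral equation in x for the integrals -/

section Equations

variable {k p : ℕ} {σ : ℤˣ} {w : Fin k → ℝ} {n : Fin k → ℕ} {Γ : List (ℝ → ℂ)}

theorem IsAdmissible.isDecayCurve (hΓ : IsAdmissible p w n σ Γ) : ∀ γ ∈ Γ, IsDecayCurve p σ γ :=
  fun γ hγ => (hΓ γ hγ).1

/-- Tameness and differentiability of the amplitude are checked factor by factor on this trichotomy.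
-/
theorem IsAdmissible.ne_or_pos (hΓ : IsAdmissible p w n σ Γ) {γ : ℝ → ℂ} (hγ : γ ∈ Γ) (i : Fin k) :
    n i = 0 ∨ (∀ s, γ s ≠ (w i : ℂ)) ∨ 0 < (σ : ℤ) * (n i : ℤ) := by
  by_cases hn : n i = 0
  · exact Or.inl hn
  · refine Or.inr ?_
    rcases Int.units_eq_one_or σ with rfl | rfl
    · refine Or.inr ?_
      rw [Units.val_one, one_mul]
      omega
    · exact Or.inl ((hΓ γ hγ).2 rfl i hn)

theorem IsAdmissible.tame_amplitude (hΓ : IsAdmissible p w n σ Γ) :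
    ∀ γ ∈ Γ, Tame γ (amplitude w fun i => (σ : ℤ) * (n i : ℤ)) := fun γ hγ =>
  Tame.prod _ fun i _ => (hΓ γ hγ).1.tame_zpow (by
    rcases hΓ.ne_or_pos hγ i with h | h | h
    · exact Or.inl (by simp [h])
    · exact Or.inr h
    · exact Or.inl h.le)

theorem IsAdmissible.tame_amplitude_update (hΓ : IsAdmissible p w n σ Γ) {i : Fin k}
    (hn : n i ≠ 0) : ∀ γ ∈ Γ, Tame γ (amplitude w
      (Function.update (fun i => (σ : ℤ) * (n i : ℤ)) i ((σ : ℤ) * (n i : ℤ) - 1))) := by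
  refine fun γ hγ => Tame.prod _ fun j _ => (hΓ γ hγ).1.tame_zpow ?_
  by_cases hj : j = i
  · subst hj
    rw [Function.update_self]
    rcases (hΓ.ne_or_pos hγ j).resolve_left hn with h | h
    · exact Or.inr h
    · exact Or.inl (by omega)
  · rw [Function.update_of_ne hj]
    rcases hΓ.ne_or_pos hγ j with h | h | h
    · exact Or.inl (by simp [h])
    · exact Or.inr h
    · exact Or.inl h.le

theorem IsAdmissible.tame_deriv_amplitude (hΓ : IsAdmissible p w n σ Γ) (i : Fin k) :
    ∀ γ ∈ Γ, Tame γ fun y => (((σ : ℤ) * (n i : ℤ) : ℤ) : ℂ) * amplitude w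
      (Function.update (fun i => (σ : ℤ) * (n i : ℤ)) i ((σ : ℤ) * (n i : ℤ) - 1)) y := by
  intro γ hγ
  by_cases hn : n i = 0
  · simpa [hn] using tame_const (γ := γ) 0
  · exact (tame_const _).mul (hΓ.tame_amplitude_update hn γ hγ)

theorem IsAdmissible.hasDerivAt_amplitude (hΓ : IsAdmissible p w n σ Γ) {γ : ℝ → ℂ} (hγ : γ ∈ Γ)
    (s : ℝ) : HasDerivAt (amplitude w fun i => (σ : ℤ) * (n i : ℤ))
      (∑ i, (((σ : ℤ) * (n i : ℤ) : ℤ) : ℂ) * amplitude w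
        (Function.update (fun i => (σ : ℤ) * (n i : ℤ)) i ((σ : ℤ) * (n i : ℤ) - 1)) (γ s)) (γ s) :=
  KVec.hasDerivAt_amplitude w fun i => by
    rcases hΓ.ne_or_pos hγ i with h | h | h
    · exact Or.inr (by simp [h])
    · exact Or.inl (h s)
    · exact Or.inr h.le

variable (hp : 2 ≤ p) (hΓ : IsAdmissible p w n σ Γ) (c : ℂ) {θ δ : ℝ} (hδ : δ ≤ Real.pi)

theorem tame_pow_mul (hΓ : ∀ γ ∈ Γ, IsDecayCurve p σ γ) {g : ℂ → ℂ} (hg : ∀ γ ∈ Γ, Tame γ g)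
    (j : ℕ) : ∀ γ ∈ Γ, Tame γ fun y => y ^ j * g y := fun γ hγ =>
  ((tame_id (hΓ γ hγ).continuous).pow j).mul (hg γ hγ)

include hp hΓ in
-- The total derivative of phase · P_k · amplitude integrates to zero. The factor P_k clears the
-- denominators of the logarithmic derivative σ ∑ nᵢ/(y - wᵢ) of the amplitude.
theorem phaseIntegral_ode (u : ℂ) :
    phaseIntegral p σ Γ (fun y => y ^ p * ((polyP w).eval y *
        amplitude w (fun i => (σ : ℤ) * (n i : ℤ)) y)) u -
      u * phaseIntegral p σ Γ (fun y => (polyP w).eval y *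
        amplitude w (fun i => (σ : ℤ) * (n i : ℤ)) y) u -
      sgn ℂ σ * phaseIntegral p σ Γ (fun y => (polyP w).derivative.eval y *
        amplitude w (fun i => (σ : ℤ) * (n i : ℤ)) y) u -
      phaseIntegral p σ Γ (fun y => (polyR w n).eval y *
        amplitude w (fun i => (σ : ℤ) * (n i : ℤ)) y) u = 0 := by
  have hD := hΓ.isDecayCurve
  set g := amplitude w fun i => (σ : ℤ) * (n i : ℤ) with hg
  have ht : ∀ γ ∈ Γ, Tame γ g := hΓ.tame_amplitude
  have htQ : ∀ Q : Polynomial ℂ, ∀ γ ∈ Γ, Tame γ fun y => Q.eval y * g y := fun Q γ hγ =>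
    (tame_eval (hD γ hγ).continuous Q).mul (ht γ hγ)
  have hc : ∀ (r : ℂ) {f : ℂ → ℂ}, (∀ γ ∈ Γ, Tame γ f) → ∀ γ ∈ Γ, Tame γ fun y => r * f y :=
    fun r f hf γ hγ => (tame_const r).mul (hf γ hγ)
  have h1 := phaseIntegral_total hp hD (g := fun y => (polyP w).eval y * g y)
    (g' := fun y => (polyP w).derivative.eval y * g y + sgn ℂ σ * ((polyR w n).eval y * g y))
    (htQ _) (fun γ hγ => (htQ _ γ hγ).add (hc _ (htQ _) γ hγ)) (fun γ hγ s => by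
      refine ((Polynomial.hasDerivAt (polyP w) (γ s)).mul
        (hΓ.hasDerivAt_amplitude hγ s)).congr_deriv ?_
      rw [polyP_mul_deriv_amplitude w n σ fun i => (hΓ.ne_or_pos hγ i).imp_right
        (Or.imp_left fun h => h s)]) u
  have h2 : (fun y => (polyP w).derivative.eval y * g y + sgn ℂ σ * ((polyR w n).eval y * g y) +
      sgn ℂ σ * ((u - y ^ p) * ((polyP w).eval y * g y))) =
      fun y => ((polyP w).derivative.eval y * g y + sgn ℂ σ * ((polyR w n).eval y * g y)) +
        ((sgn ℂ σ * u) * ((polyP w).eval y * g y) +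
          (-sgn ℂ σ) * (y ^ p * ((polyP w).eval y * g y))) := by
    ext y
    ring
  rw [h2, phaseIntegral_add hp hD (fun γ hγ => (htQ _ γ hγ).add (hc _ (htQ _) γ hγ))
    (fun γ hγ => (hc _ (htQ _) γ hγ).add (hc _ (tame_pow_mul hD (htQ _) p) γ hγ)),
    phaseIntegral_add hp hD (htQ _) (hc _ (htQ _)),
    phaseIntegral_add hp hD (hc _ (htQ _)) (hc _ (tame_pow_mul hD (htQ _) p)),
    phaseIntegral_const_mul, phaseIntegral_const_mul, phaseIntegral_const_mul] at h1
  have hs := sgn_mul_self ℂ σ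
  set J1 := phaseIntegral p σ Γ (fun y => y ^ p * ((polyP w).eval y * g y)) u
  set J2 := phaseIntegral p σ Γ (fun y => (polyP w).eval y * g y) u
  set J3 := phaseIntegral p σ Γ (fun y => (polyP w).derivative.eval y * g y) u
  set J4 := phaseIntegral p σ Γ (fun y => (polyR w n).eval y * g y) u
  linear_combination (-sgn ℂ σ) * h1 + (J4 + u * J2 - J1) * hs

include hp hΓ hδ in
/-- The differential equation in `z`, for the functions. -/
theorem odeOp_PsiFun {z : ℂ} (hz : z ∈ sector θ δ) :
    odeOp p w n σ (funA p (∑ i, n i) σ) (fun f z => z ^ p * f z)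
      (fun z => PsiFun p w n σ Γ c θ 0 z) z = 0 := by
  have hD := hΓ.isDecayCurve
  have ht := hΓ.tame_amplitude
  have htQ : ∀ Q : Polynomial ℂ, ∀ γ ∈ Γ, Tame γ fun y => Q.eval y *
      amplitude w (fun i => (σ : ℤ) * (n i : ℤ)) y := fun Q γ hγ =>
    (tame_eval (hD γ hγ).continuous Q).mul (ht γ hγ)
  have h1 := applyPoly_psiAmp hp hD (∑ i, n i) c hδ ht 0
    (f := fun z => PsiFun p w n σ Γ c θ 0 z) (fun z _ => rfl)
  have h2 := funA_iterate_psiAmp hp hD (∑ i, n i) c hδ (htQ _) 0 (h1 (polyP w)) p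
  simp only [odeOp, Pi.sub_apply, Pi.smul_apply, smul_eq_mul]
  rw [h2 hz, h1 _ hz, h1 _ hz, h1 _ hz]
  have h3 := phaseIntegral_ode hp hΓ (0 + z ^ p)
  simp only [psiAmp]
  linear_combination prefactor p (∑ i, n i) σ θ z * c * h3

include hp hΓ in
theorem iteratedDeriv_psiAmp (N j : ℕ) (x z : ℂ) :
    iteratedDeriv j (fun x => psiAmp p N σ Γ c θ (amplitude w fun i => (σ : ℤ) * (n i : ℤ)) x z) x =
      sgn ℂ σ ^ j * psiAmp p N σ Γ c θ
        (fun y => y ^ j * amplitude w (fun i => (σ : ℤ) * (n i : ℤ)) y) x z := by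
  have hD := hΓ.isDecayCurve
  induction j generalizing x with
  | zero => simp
  | succ j ih =>
    have h1 : iteratedDeriv j (fun x => psiAmp p N σ Γ c θ
        (amplitude w fun i => (σ : ℤ) * (n i : ℤ)) x z) = fun x => sgn ℂ σ ^ j *
        psiAmp p N σ Γ c θ (fun y => y ^ j * amplitude w (fun i => (σ : ℤ) * (n i : ℤ)) y) x z :=
      funext ih
    rw [iteratedDeriv_succ, h1]
    have h2 := (hasDerivAt_psiAmp_left hp hD N c (θ := θ)
      (tame_pow_mul hD hΓ.tame_amplitude j) x z).const_mul (sgn ℂ σ ^ j)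
    rw [h2.deriv, ← mul_assoc, ← pow_succ]
    simp only [pow_succ', mul_assoc]

include hp hΓ in
-- The total derivative of phase · amplitude, without the factor P_k; differentiating the amplitude
-- lowers one exponent at a time.
theorem phaseIntegral_spectral (u : ℂ) :
    phaseIntegral p σ Γ (fun y => y ^ p * amplitude w (fun i => (σ : ℤ) * (n i : ℤ)) y) u -
      u * phaseIntegral p σ Γ (amplitude w fun i => (σ : ℤ) * (n i : ℤ)) u =
    ∑ i, (n i : ℂ) * phaseIntegral p σ Γ (amplitude w
      (Function.update (fun i => (σ : ℤ) * (n i : ℤ)) i ((σ : ℤ) * (n i : ℤ) - 1))) u := by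
  have hD := hΓ.isDecayCurve
  have ht := hΓ.tame_amplitude
  set g := amplitude w fun i => (σ : ℤ) * (n i : ℤ) with hg
  have hc : ∀ (r : ℂ) {f : ℂ → ℂ}, (∀ γ ∈ Γ, Tame γ f) → ∀ γ ∈ Γ, Tame γ fun y => r * f y :=
    fun r f hf γ hγ => (tame_const r).mul (hf γ hγ)
  have hS : ∀ γ ∈ Γ, Tame γ fun y => ∑ i, (((σ : ℤ) * (n i : ℤ) : ℤ) : ℂ) * amplitude w
      (Function.update (fun i => (σ : ℤ) * (n i : ℤ)) i ((σ : ℤ) * (n i : ℤ) - 1)) y := fun γ hγ =>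
    Tame.sum _ fun i _ => hΓ.tame_deriv_amplitude i γ hγ
  have h1 := phaseIntegral_total hp hD ht hS (fun γ hγ s => hΓ.hasDerivAt_amplitude hγ s) u
  have h2 : (fun y => (∑ i, (((σ : ℤ) * (n i : ℤ) : ℤ) : ℂ) * amplitude w
      (Function.update (fun i => (σ : ℤ) * (n i : ℤ)) i ((σ : ℤ) * (n i : ℤ) - 1)) y) +
      sgn ℂ σ * ((u - y ^ p) * g y)) =
      fun y => (∑ i, (((σ : ℤ) * (n i : ℤ) : ℤ) : ℂ) * amplitude w
      (Function.update (fun i => (σ : ℤ) * (n i : ℤ)) i ((σ : ℤ) * (n i : ℤ) - 1)) y) +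
      ((sgn ℂ σ * u) * g y + (-sgn ℂ σ) * (y ^ p * g y)) := by
    ext y
    ring
  rw [h2, phaseIntegral_add hp hD hS
    (fun γ hγ => (hc _ ht γ hγ).add (hc _ (tame_pow_mul hD ht p) γ hγ)),
    phaseIntegral_add hp hD (hc _ ht) (hc _ (tame_pow_mul hD ht p)),
    phaseIntegral_sum hp hD _ (fun i _ => hΓ.tame_deriv_amplitude i),
    phaseIntegral_const_mul, phaseIntegral_const_mul] at h1
  simp only [phaseIntegral_const_mul] at h1
  have h3 : ∀ i, (((σ : ℤ) * (n i : ℤ) : ℤ) : ℂ) = sgn ℂ σ * (n i : ℂ) := fun i => by push_cast; rfl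
  simp only [h3, mul_assoc] at h1
  rw [← Finset.mul_sum] at h1
  have hs := sgn_mul_self ℂ σ
  set J1 := phaseIntegral p σ Γ (fun y => y ^ p * g y) u
  set J2 := phaseIntegral p σ Γ g u
  set J3 := ∑ i, (n i : ℂ) * phaseIntegral p σ Γ (amplitude w
      (Function.update (fun i => (σ : ℤ) * (n i : ℤ)) i ((σ : ℤ) * (n i : ℤ) - 1))) u
  linear_combination (-sgn ℂ σ) * h1 + (J3 + u * J2 - J1) * hs

include hp hΓ in
/-- The spectral equation, for the functions. -/
theorem spectral_PsiFun (z : ℂ) : ∃ G : Fin k → ℂ → ℂ,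
    (∀ i x, HasDerivAt (fun x => Complex.exp (-sgn ℂ σ * x * (w i : ℂ)) * G i x)
      (sgn ℂ σ * (Complex.exp (-sgn ℂ σ * x * (w i : ℂ)) * PsiFun p w n σ Γ c θ x z)) x) ∧
    ∀ x, sgn ℂ σ ^ p * iteratedDeriv p (fun x => PsiFun p w n σ Γ c θ x z) x
        - x * PsiFun p w n σ Γ c θ x z - ∑ i, (n i : ℂ) * G i x =
      z ^ p * PsiFun p w n σ Γ c θ x z := by
  have hD := hΓ.isDecayCurve
  have ht := hΓ.tame_amplitude
  have hexp : ∀ (a x : ℂ), HasDerivAt (fun x => Complex.exp (-sgn ℂ σ * x * a))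
      (Complex.exp (-sgn ℂ σ * x * a) * (-sgn ℂ σ * a)) x := fun a x => by
    have h1 : HasDerivAt (fun x => -sgn ℂ σ * x * a) (-sgn ℂ σ * a) x := by
      simpa using ((hasDerivAt_id x).const_mul (-sgn ℂ σ)).mul_const a
    exact h1.cexp
  -- Used for nᵢ = 0 only, where the amplitude with lowered exponent may have a pole on the contour.
  -- As Gᵢ then enters with coefficient 0, any primitive of the entire integrand will do.
  have hprim : ∀ i, ∃ F : ℂ → ℂ, ∀ x, HasDerivAt F (sgn ℂ σ *
      (Complex.exp (-sgn ℂ σ * x * (w i : ℂ)) * PsiFun p w n σ Γ c θ x z)) x := fun i => by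
    have hd : Differentiable ℂ fun x => sgn ℂ σ *
        (Complex.exp (-sgn ℂ σ * x * (w i : ℂ)) * PsiFun p w n σ Γ c θ x z) := fun x =>
      (((hexp _ x).mul (hasDerivAt_psiAmp_left hp hD (∑ i, n i) c ht x z)).const_mul
        (sgn ℂ σ)).differentiableAt
    obtain ⟨F, hF⟩ := hd.isExactOn_univ
    exact ⟨F, fun x => hF x (Set.mem_univ x)⟩
  choose F hF using hprim
  refine ⟨fun i x => if n i = 0 then Complex.exp (sgn ℂ σ * x * (w i : ℂ)) * F i x else
    psiAmp p (∑ i, n i) σ Γ c θ (amplitude w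
      (Function.update (fun i => (σ : ℤ) * (n i : ℤ)) i ((σ : ℤ) * (n i : ℤ) - 1))) x z,
    fun i x => ?_, fun x => ?_⟩
  · by_cases hn : n i = 0
    · simp only [if_pos hn]
      have h1 : (fun x => Complex.exp (-sgn ℂ σ * x * (w i : ℂ)) *
          (Complex.exp (sgn ℂ σ * x * (w i : ℂ)) * F i x)) = F i := by
        ext x
        rw [← mul_assoc, ← Complex.exp_add]
        rw [show -sgn ℂ σ * x * (w i : ℂ) + sgn ℂ σ * x * (w i : ℂ) = 0 by ring, Complex.exp_zero,
          one_mul]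
      rw [h1]
      exact hF i x
    · simp only [if_neg hn]
      have ht' := hΓ.tame_amplitude_update hn
      refine ((hexp (w i) x).mul
        (hasDerivAt_psiAmp_left hp hD (∑ i, n i) c ht' x z)).congr_deriv ?_
      set g' := amplitude w
        (Function.update (fun i => (σ : ℤ) * (n i : ℤ)) i ((σ : ℤ) * (n i : ℤ) - 1))
      -- Multiplying the lowered amplitude by y - wᵢ restores the original one, which gives (σ d/dx
      -- - wᵢ) Gᵢ = Ψ.
      have h2 : phaseIntegral p σ Γ (amplitude w fun i => (σ : ℤ) * (n i : ℤ)) (x + z ^ p) =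
          phaseIntegral p σ Γ (fun y => y * g' y) (x + z ^ p) +
            (-(w i : ℂ)) * phaseIntegral p σ Γ g' (x + z ^ p) := by
        rw [← phaseIntegral_const_mul, ← phaseIntegral_add hp hD
          (fun γ hγ => (tame_id (hD γ hγ).continuous).mul (ht' γ hγ))
          (fun γ hγ => (tame_const _).mul (ht' γ hγ))]
        refine phaseIntegral_congr (fun γ hγ s => ?_) _
        rw [← amplitude_update_mul w (i := i) (((hΓ.ne_or_pos hγ i).resolve_left hn).imp_left
          fun h => h s)]
        ring
      rw [PsiFun_eq]
      simp only [psiAmp]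
      rw [h2]
      ring
  · have h3 : ∀ i, (n i : ℂ) * (if n i = 0 then Complex.exp (sgn ℂ σ * x * (w i : ℂ)) * F i x else
        psiAmp p (∑ i, n i) σ Γ c θ (amplitude w
          (Function.update (fun i => (σ : ℤ) * (n i : ℤ)) i ((σ : ℤ) * (n i : ℤ) - 1))) x z) =
        prefactor p (∑ i, n i) σ θ z * c * ((n i : ℂ) * phaseIntegral p σ Γ (amplitude w
          (Function.update (fun i => (σ : ℤ) * (n i : ℤ)) i ((σ : ℤ) * (n i : ℤ) - 1)))
            (x + z ^ p)) := fun i => by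
      by_cases hn : n i = 0
      · simp [hn]
      · rw [if_neg hn, psiAmp]
        ring
    simp only [h3]
    rw [← Finset.mul_sum, ← phaseIntegral_spectral hp hΓ]
    have h4 : iteratedDeriv p (fun x => PsiFun p w n σ Γ c θ x z) x = _ :=
      iteratedDeriv_psiAmp hp hΓ c (∑ i, n i) p x z
    rw [h4, ← mul_assoc, ← mul_pow, sgn_mul_self, one_pow, one_mul, PsiFun_eq]
    simp only [psiAmp]
    ring

end Equations

/-! ### Asymptotic Laurent expansions of holomorphic functions on sectors -/

section Asymptotics

variable {θ δ : ℝ}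

theorem eventually_cobounded_inf {S : Set ℂ} {P : ℂ → Prop} :
    (∀ᶠ z in Bornology.cobounded ℂ ⊓ 𝓟 S, P z) ↔ ∃ R : ℝ, ∀ z ∈ S, R ≤ ‖z‖ → P z := by
  rw [eventually_inf_principal, Filter.hasBasis_cobounded_norm.eventually_iff]
  constructor
  · rintro ⟨R, -, h⟩
    exact ⟨R, fun z hz hR => h hR hz⟩
  · rintro ⟨R, h⟩
    exact ⟨R, trivial, fun z hR hz => h z hz hR⟩

/-- The part of `F` of the powers `z ^ (-e)`, `M ≤ e < N`. -/
def truncF (F : FLS) (M N : ℤ) (z : ℂ) : ℂ := ∑ e ∈ Finset.Ico M N, F.coeff e * z ^ (-e)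

/-- The holomorphic function `h` has the asymptotic expansion `F` on a sector. -/
def AsympF (θ δ : ℝ) (h : ℂ → ℂ) (F : FLS) : Prop :=
  DifferentiableOn ℂ h (sector θ δ) ∧ ∃ M : ℤ, (∀ e < M, F.coeff e = 0) ∧
    -- Estimates are required only for large N, a condition which is stable under the shifts of N
    -- caused by multiplication with powers of z.
    ∀ δ', 0 < δ' → δ' < δ → ∀ᶠ N : ℤ in atTop,
      (fun z => h z - truncF F M N z) =O[Bornology.cobounded ℂ ⊓ 𝓟 (sector θ δ')]
        fun z => z ^ (-N)

theorem truncF_eq {F : FLS} {M M' : ℤ} (h : M' ≤ M) (hF : ∀ e < M, F.coeff e = 0) (N : ℤ) :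
    truncF F M' N = truncF F M N := by
  ext z
  refine (Finset.sum_subset (Finset.Ico_subset_Ico_left h) fun e he he' => ?_).symm
  rw [Finset.mem_Ico] at he he'
  rw [hF e (by omega), zero_mul]

theorem AsympF.of_le {h : ℂ → ℂ} {F : FLS} (hA : AsympF θ δ h F) : ∃ M : ℤ, ∀ M' ≤ M,
    (∀ e < M', F.coeff e = 0) ∧ ∀ δ', 0 < δ' → δ' < δ → ∀ᶠ N : ℤ in atTop,
      (fun z => h z - truncF F M' N z) =O[Bornology.cobounded ℂ ⊓ 𝓟 (sector θ δ')]
        fun z => z ^ (-N) := by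
  obtain ⟨-, M, hM, hA⟩ := hA
  refine ⟨M, fun M' hM' => ⟨fun e he => hM e (by omega), fun δ' h0 h1 => ?_⟩⟩
  simp only [truncF_eq hM' hM]
  exact hA δ' h0 h1

theorem AsympF.congr {h h' : ℂ → ℂ} {F : FLS} (hA : AsympF θ δ h F)
    (hh : Set.EqOn h' h (sector θ δ)) : AsympF θ δ h' F := by
  obtain ⟨hd, M, hM, hA⟩ := hA
  refine ⟨hd.congr hh, M, hM, fun δ' h0 h1 => ?_⟩
  filter_upwards [hA δ' h0 h1] with N hN
  refine hN.congr' ?_ EventuallyEq.rfl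
  refine eventually_inf_principal.2 (Eventually.of_forall fun z hz => ?_)
  simp only [hh (sector_mono h1.le hz)]

theorem AsympF.zero : AsympF θ δ (fun _ => 0) 0 := by
  have h0 : ∀ e, (0 : FLS).coeff e = 0 := fun e => rfl
  refine ⟨differentiableOn_const 0, 0, fun e _ => h0 e, fun δ' _ _ => Eventually.of_forall
    fun N => ?_⟩
  simp only [truncF, h0, zero_mul, Finset.sum_const_zero, sub_zero]
  exact isBigO_zero _ _

theorem AsympF.add {h g : ℂ → ℂ} {F G : FLS} (hF : AsympF θ δ h F) (hG : AsympF θ δ g G) :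
    AsympF θ δ (fun z => h z + g z) (F + G) := by
  obtain ⟨M, hM⟩ := hF.of_le
  obtain ⟨M', hM'⟩ := hG.of_le
  obtain ⟨h1, h2⟩ := hM (min M M') (min_le_left _ _)
  obtain ⟨h3, h4⟩ := hM' (min M M') (min_le_right _ _)
  refine ⟨hF.1.add hG.1, min M M', fun e he => ?_, fun δ' hδ hδ' => ?_⟩
  · rw [FLS.coeff_add, h1 e he, h3 e he, add_zero]
  · filter_upwards [h2 δ' hδ hδ', h4 δ' hδ hδ'] with N hN hN'
    refine (hN.add hN').congr_left fun z => ?_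
    simp only [truncF, FLS.coeff_add, add_mul, Finset.sum_add_distrib]
    ring

theorem AsympF.monomial_mul {h : ℂ → ℂ} {F : FLS} (hF : AsympF θ δ h F) (m : ℤ) (c : ℂ) :
    AsympF θ δ (fun z => c * z ^ m * h z) (monoF m c * F) := by
  obtain ⟨hd, M, hM, hA⟩ := hF
  refine ⟨?_, M - m, fun e he => ?_, fun δ' h0 h1 => ?_⟩
  · refine DifferentiableOn.mul (fun z hz => ?_) hd
    exact ((hasDerivAt_zpow m z (Or.inl hz.1)).const_mul c).differentiableAt.differentiableWithinAt
  · rw [FLS.coeff_monoF_mul, hM _ (by omega), mul_zero]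
  · filter_upwards [(tendsto_atTop_add_const_right atTop m tendsto_id).eventually (hA δ' h0 h1)]
      with N hN
    simp only [id] at hN
    have h2 : (fun z : ℂ => c * z ^ m) =O[Bornology.cobounded ℂ ⊓ 𝓟 (sector θ δ')]
        fun z => z ^ m := isBigO_const_mul_self c _ _
    refine (h2.mul hN).congr' ?_ ?_
    · refine eventually_inf_principal.2 (Eventually.of_forall fun z hz => ?_)
      simp only [mul_sub, truncF, FLS.coeff_monoF_mul]
      congr 1
      have h3 := Finset.sum_Ico_add' (fun e => c * F.coeff e * z ^ (m - e)) (M - m) N m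
      rw [sub_add_cancel] at h3
      rw [Finset.mul_sum]
      refine Eq.trans (Finset.sum_congr rfl fun e _ => ?_) (h3.symm.trans
        (Finset.sum_congr rfl fun e _ => ?_))
      · rw [sub_eq_add_neg, zpow_add₀ hz.1]
        ring
      · rw [show m - (e + m) = -e by ring]
    · refine eventually_inf_principal.2 (Eventually.of_forall fun z hz => ?_)
      simp only
      rw [← zpow_add₀ hz.1]
      congr 1
      ring

theorem AsympF.smul {h : ℂ → ℂ} {F : FLS} (hF : AsympF θ δ h F) (c : ℂ) :
    AsympF θ δ (fun z => c * h z) (c • F) := by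
  have h1 := hF.monomial_mul 0 c
  rw [← smul_eq_monoF_mul] at h1
  simpa using h1

theorem AsympF.sub {h g : ℂ → ℂ} {F G : FLS} (hF : AsympF θ δ h F) (hG : AsympF θ δ g G) :
    AsympF θ δ (fun z => h z - g z) (F - G) := by
  have h1 := hF.add (hG.smul (-1))
  have h2 : F + (-1 : ℂ) • G = F - G := FLS.ext fun e => by
    rw [FLS.coeff_add, FLS.coeff_smul, neg_one_mul, ← sub_eq_add_neg]
    rfl
  rw [h2] at h1
  exact h1.congr fun z _ => by simp only; ring

theorem AsympF.sum {ι : Type*} (S : Finset ι) {h : ι → ℂ → ℂ} {F : ι → FLS}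
    (hF : ∀ i ∈ S, AsympF θ δ (h i) (F i)) :
    AsympF θ δ (fun z => ∑ i ∈ S, h i z) (∑ i ∈ S, F i) := by
  classical
  induction S using Finset.induction_on with
  | empty => simpa using AsympF.zero
  | insert i S hi ih =>
    rw [Finset.sum_insert hi]
    refine ((hF i (Finset.mem_insert_self i S)).add
      (ih fun j hj => hF j (Finset.mem_insert_of_mem hj))).congr fun z _ => ?_
    simp only [Finset.sum_insert hi]

theorem hasDerivAt_truncF (F : FLS) (M N : ℤ) {z : ℂ} (hz : z ≠ 0) :
    HasDerivAt (truncF F M N) (z⁻¹ * truncF (eulerF F) M N z) z := by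
  have h1 : ∀ e ∈ Finset.Ico M N, HasDerivAt (fun z : ℂ => F.coeff e * z ^ (-e))
      (F.coeff e * (((-e : ℤ) : ℂ) * z ^ (-e - 1))) z := fun e _ =>
    (hasDerivAt_zpow (-e) z (Or.inl hz)).const_mul _
  refine (HasDerivAt.fun_sum h1).congr_deriv ?_
  rw [truncF, Finset.mul_sum]
  refine Finset.sum_congr rfl fun e _ => ?_
  rw [zpow_sub_one₀ hz, show (eulerF F).coeff e = -(e : ℂ) * F.coeff e from rfl]
  push_cast
  ring

/-- Asymptotic expansions of holomorphic functions can be differentiated. -/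
theorem AsympF.euler (hδ : δ ≤ Real.pi) {h : ℂ → ℂ} {F : FLS} (hF : AsympF θ δ h F) :
    AsympF θ δ (fun z => z * deriv h z) (eulerF F) := by
  obtain ⟨hd, M, hM, hA⟩ := hF
  refine ⟨differentiableOn_id.mul (hd.deriv (isOpen_sector hδ)), M, fun e he => ?_,
    fun δ' h0 h1 => ?_⟩
  · rw [show (eulerF F).coeff e = -(e : ℂ) * F.coeff e from rfl, hM e he, mul_zero]
  -- Discs of radius η|z| about points of the smaller sector stay in an intermediate sector where
  -- the remainder is controlled. Cauchy's estimate on them costs 1/(η|z|), and the factor z of z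
  -- d/dz makes up for |z|.
  obtain ⟨η, hη, hη2, hmem⟩ := exists_mul_mem_sector (θ := θ) (δ' := δ') (δ := (δ' + δ) / 2)
    (by linarith) (by linarith)
  filter_upwards [hA ((δ' + δ) / 2) (by linarith) (by linarith), eventually_ge_atTop 0]
    with N hN hN0
  obtain ⟨C, hC, hN⟩ := hN.exists_pos
  rw [isBigOWith_iff, eventually_cobounded_inf] at hN
  obtain ⟨R, hR⟩ := hN
  -- On these discs |y| ≥ |z|/2, whence the factor 2^N and the radius 2R.
  refine IsBigO.of_bound (C * 2 ^ N / η) ?_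
  rw [eventually_cobounded_inf]
  refine ⟨2 * R, fun z hz hzR => ?_⟩
  have hz0 : 0 < ‖z‖ := norm_pos_iff.2 hz.1
  have hball : ∀ y ∈ Metric.closedBall z (η * ‖z‖), y ∈ sector θ ((δ' + δ) / 2) ∧
      ‖z‖ / 2 ≤ ‖y‖ := fun y hy => by
    rw [Metric.mem_closedBall, dist_eq_norm] at hy
    refine ⟨?_, ?_⟩
    · have h2 := hmem z hz (y / z) (by
        rw [div_sub_one hz.1, norm_div, div_le_iff₀ hz0]
        exact hy)
      rwa [mul_div_cancel₀ _ hz.1] at h2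
    · have h2 := norm_sub_norm_le z (z - y)
      rw [sub_sub_cancel, norm_sub_rev] at h2
      nlinarith
  have hdiff : ∀ y ∈ sector θ ((δ' + δ) / 2),
      HasDerivAt (fun z => h z - truncF F M N z)
        (deriv h y - y⁻¹ * truncF (eulerF F) M N y) y := fun y hy => by
    have h2 : y ∈ sector θ δ := sector_mono (by linarith) hy
    exact (hd.differentiableAt ((isOpen_sector hδ).mem_nhds h2)).hasDerivAt.sub
      (hasDerivAt_truncF F M N hy.1)
  have h3 := Complex.norm_deriv_le_of_forall_mem_sphere_norm_le (f := fun z => h z - truncF F M N z)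
    (c := z) (R := η * ‖z‖) (C := C * (2 ^ N * ‖z‖ ^ (-N))) (by positivity)
    (DifferentiableOn.diffContOnCl_ball (U := Metric.closedBall z (η * ‖z‖)) (fun y hy =>
      (hdiff y (hball y hy).1).differentiableAt.differentiableWithinAt) le_rfl) fun y hy => by
    obtain ⟨h4, h5⟩ := hball y (Metric.sphere_subset_closedBall hy)
    refine (hR y h4 (by linarith)).trans ?_
    gcongr
    rw [norm_zpow]
    have h6 : (2 : ℝ) ^ N * ‖z‖ ^ (-N) = (‖z‖ / 2) ^ (-N) := by
      rw [div_zpow, zpow_neg 2, div_inv_eq_mul, mul_comm]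
    rw [h6, zpow_neg, zpow_neg]
    have h7 : 0 < ‖z‖ / 2 := by positivity
    exact inv_anti₀ (zpow_pos h7 N) (zpow_le_zpow_left₀ hN0 h7.le h5)
  rw [(hdiff z (hball z (Metric.mem_closedBall_self (by positivity))).1).deriv] at h3
  have h8 : z * deriv h z - truncF (eulerF F) M N z =
      z * (deriv h z - z⁻¹ * truncF (eulerF F) M N z) := by
    rw [mul_sub, ← mul_assoc, mul_inv_cancel₀ hz.1, one_mul]
  rw [h8, norm_mul, norm_zpow]
  calc _ ≤ ‖z‖ * (C * (2 ^ N * ‖z‖ ^ (-N)) / (η * ‖z‖)) := by gcongr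
    _ = _ := by field_simp

theorem AsympF.funA (hδ : δ ≤ Real.pi) {h : ℂ → ℂ} {F : FLS} (hF : AsympF θ δ h F) (p N : ℕ)
    (σ : ℤˣ) : AsympF θ δ (funA p N σ h) (formalA p N σ F) := by
  have h1 := (hF.monomial_mul 1 1).add (((hF.euler hδ).add (hF.smul
    (sgn ℂ σ * (N : ℂ) - ((p : ℂ) - 1) / 2))).monomial_mul (-(p : ℤ)) (sgn ℂ σ / (p : ℂ)))
  refine h1.congr fun z hz => ?_
  simp only [KVec.funA, zpow_one, one_mul, zpow_neg, zpow_natCast]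
  rw [div_mul_eq_div_div, div_eq_mul_inv (sgn ℂ σ / (p : ℂ))]

theorem AsympF.iterate (hδ : δ ≤ Real.pi) {h : ℂ → ℂ} {F : FLS} (hF : AsympF θ δ h F) (p N : ℕ)
    (σ : ℤˣ) (j : ℕ) : AsympF θ δ ((KVec.funA p N σ)^[j] h) ((formalA p N σ)^[j] F) := by
  induction j with
  | zero => exact hF
  | succ j ih =>
    rw [Function.iterate_succ_apply', Function.iterate_succ_apply']
    exact ih.funA hδ p N σ

theorem AsympF.applyPoly (hδ : δ ≤ Real.pi) {h : ℂ → ℂ} {F : FLS} (hF : AsympF θ δ h F) (p N : ℕ)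
    (σ : ℤˣ) (Q : Polynomial ℂ) :
    AsympF θ δ (applyPoly (KVec.funA p N σ) Q h) (applyPoly (formalA p N σ) Q F) := by
  have h1 := AsympF.sum Q.support fun i _ => (hF.iterate hδ p N σ i).smul (Q.coeff i)
  exact h1.congr fun z _ => applyPoly_apply _ _ _ _

theorem AsympF.odeOp {k : ℕ} (w : Fin k → ℝ) (n : Fin k → ℕ) (hδ : δ ≤ Real.pi) {h : ℂ → ℂ}
    {F : FLS} (hF : AsympF θ δ h F) (p N : ℕ) (σ : ℤˣ) :
    AsympF θ δ (odeOp p w n σ (KVec.funA p N σ) (fun f z => z ^ p * f z) h)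
      (odeOp p w n σ (formalA p N σ) (fun f => monoF p 1 * f) F) := by
  have h1 := hF.applyPoly hδ p N σ (polyP w)
  refine ((((h1.iterate hδ p N σ p).sub (h1.monomial_mul p 1)).sub
    ((hF.applyPoly hδ p N σ (polyP w).derivative).smul (sgn ℂ σ))).sub
    (hF.applyPoly hδ p N σ (polyR w n))).congr fun z _ => ?_
  simp only [KVec.odeOp, Pi.sub_apply, Pi.smul_apply, smul_eq_mul, one_mul, zpow_natCast]

/-- If z^(-m) were the first power occurring in F, then z^m times the function would tend to its
nonzero coefficient along the sector. -/
theorem AsympF.eq_zero (hδ : 0 < δ) {h : ℂ → ℂ} {F : FLS} (hF : AsympF θ δ h F)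
    (h0 : Set.EqOn h 0 (sector θ δ)) : F = 0 := by
  obtain ⟨-, M, hM, hA⟩ := hF
  by_contra hne
  have hex : ∃ e, F.coeff e ≠ 0 := by
    by_contra! hall
    exact hne (FLS.ext hall)
  obtain ⟨m, hm, hmin⟩ := Int.exists_least_of_bdd (P := fun e => F.coeff e ≠ 0)
    ⟨M, fun e he => not_lt.1 fun hlt => he (hM e hlt)⟩ hex
  have hbelow : ∀ e < m, F.coeff e = 0 := fun e he => by
    by_contra hc
    exact absurd (hmin e hc) (by omega)
  have hMm : M ≤ m := not_lt.1 fun hlt => hm (hM m hlt)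
  have := neBot_sector (θ := θ) (half_pos hδ)
  set l := Bornology.cobounded ℂ ⊓ 𝓟 (sector θ (δ / 2)) with hl
  obtain ⟨N, hN, hNm⟩ := ((hA (δ / 2) (by linarith) (by linarith)).and
    (eventually_gt_atTop m)).exists
  have hinv : ∀ e : ℤ, 0 < e → Tendsto (fun z : ℂ => z ^ (-e)) l (𝓝 0) := fun e he => by
    lift e to ℕ using he.le
    have h1 : Tendsto (fun z : ℂ => (z⁻¹) ^ e) (Bornology.cobounded ℂ) (𝓝 (0 ^ e)) :=
      (tendsto_inv₀_cobounded).pow e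
    rw [zero_pow (by omega)] at h1
    refine (h1.mono_left inf_le_left).congr fun z => ?_
    rw [zpow_neg, zpow_natCast, inv_pow]
  have hne0 : ∀ᶠ z in l, z ≠ 0 :=
    eventually_inf_principal.2 (Eventually.of_forall fun z hz => hz.1)
  have hsec : ∀ᶠ z in l, z ∈ sector θ (δ / 2) :=
    eventually_inf_principal.2 (Eventually.of_forall fun z hz => hz)
  have h2 : Tendsto (fun z : ℂ => z ^ m * truncF F M N z) l (𝓝 0) := by
    have h3 : (fun z : ℂ => z ^ m * truncF F M N z) =O[l] fun z => z ^ (-(N - m)) := by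
      refine ((isBigO_refl (fun z : ℂ => z ^ m) l).mul hN.neg_left).congr' ?_ ?_
      · filter_upwards [hsec] with z hz
        rw [h0 (sector_mono (by linarith) hz)]
        simp
      · filter_upwards [hne0] with z hz
        rw [← zpow_add₀ hz]
        congr 1
        ring
    exact h3.trans_tendsto (hinv _ (by omega))
  have h4 : Tendsto (fun z : ℂ => z ^ m * truncF F M N z) l
      (𝓝 (∑ e ∈ Finset.Ico M N, if e = m then F.coeff m else 0)) := by
    have h5 : Tendsto (fun z : ℂ => ∑ e ∈ Finset.Ico M N, F.coeff e * z ^ (-(e - m))) l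
        (𝓝 (∑ e ∈ Finset.Ico M N, if e = m then F.coeff m else 0)) := by
      refine tendsto_finsetSum _ fun e _ => ?_
      rcases lt_trichotomy e m with hlt | heq | hgt
      · simp [hbelow e hlt, hlt.ne, tendsto_const_nhds]
      · subst heq
        simp [tendsto_const_nhds]
      · simpa [hgt.ne'] using (hinv (e - m) (by omega)).const_mul (F.coeff e)
    refine h5.congr' ?_
    filter_upwards [hne0] with z hz
    rw [truncF, Finset.mul_sum]
    refine Finset.sum_congr rfl fun e _ => ?_
    rw [show -(e - m) = m + -e by ring, zpow_add₀ hz]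
    ring
  have h6 := tendsto_nhds_unique h4 h2
  rw [Finset.sum_ite_eq' , if_pos (Finset.mem_Ico.2 ⟨hMm, hNm⟩)] at h6
  exact hm h6

theorem HasAsympExpansion.asympF {h : ℂ → ℂ} {a : ℕ → ℂ} (hA : HasAsympExpansion θ δ h a)
    (hd : DifferentiableOn ℂ h (sector θ δ)) : AsympF θ δ h (seriesF a) := by
  refine ⟨hd, 0, fun e he => ?_, fun δ' h0 h1 => ?_⟩
  · rw [seriesF_coeff, if_neg (by omega)]
  · filter_upwards [eventually_ge_atTop 0] with N hN
    lift N to ℕ using hN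
    refine (hA δ' h0 h1 N).congr (fun z => ?_) fun z => ?_
    · congr 1
      rw [truncF]
      have h2 : Finset.Ico (0 : ℤ) N = (Finset.range N).map Nat.castEmbedding := by
        ext e
        simp only [Finset.mem_Ico, Finset.mem_map, Finset.mem_range, Nat.castEmbedding_apply]
        exact ⟨fun he => ⟨e.toNat, by omega, by omega⟩, fun ⟨j, hj, hje⟩ => by omega⟩
      rw [h2, Finset.sum_map]
      refine Finset.sum_congr rfl fun j _ => ?_
      simp [seriesF_coeff]
    · rw [zpow_neg, zpow_natCast, inv_pow]

end Asymptotics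

/-! ### Transfer of the differential equation to the expansion -/

section FormalEquation

variable {k p : ℕ} {σ : ℤˣ} {w : Fin k → ℝ} {n : Fin k → ℕ} {Γ : List (ℝ → ℂ)}

/-- The asymptotic expansion of `Ψ(0,0;z)` satisfies the differential equation. -/
theorem odeOp_seriesF (hp : 2 ≤ p) (hΓ : IsAdmissible p w n σ Γ) (c : ℂ) {θ δ : ℝ}
    (hδ : 0 < δ ∧ δ ≤ Real.pi) {a : ℕ → ℂ}
    (ha : HasAsympExpansion θ δ (fun z => PsiFun p w n σ Γ c θ 0 z) a) :
    odeOp p w n σ (formalA p (∑ i, n i) σ) (fun f => monoF p 1 * f) (seriesF a) = 0 := by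
  have h1 := ha.asympF fun z hz => (hasDerivAt_psiAmp_right hp hΓ.isDecayCurve (∑ i, n i) c hδ.2
    hΓ.tame_amplitude 0 hz).differentiableAt.differentiableWithinAt
  exact (h1.odeOp w n hδ.2 p (∑ i, n i) σ).eq_zero hδ.1 fun z hz => odeOp_PsiFun hp hΓ c hδ.2 hz

end FormalEquation

/-! ### A path with constant contour integral, and the truncated series along it -/

section Shift

/-- The path `Z` from `(z ^ p + x) ^ (1 / p)` to `z` with `Z ^ p + x s = z ^ p + x`. -/
theorem exists_path {p : ℕ} (hp : 2 ≤ p) {θ δ δ' : ℝ} (h : δ' < δ) (hδ : δ ≤ Real.pi) (x : ℂ) :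
    ∃ R : ℝ, ∀ z ∈ sector θ δ', R ≤ ‖z‖ → ∃ Z : ℝ → ℂ, Z 1 = z ∧ ∀ s ∈ Set.Icc (0 : ℝ) 1,
      Z s ∈ sector θ δ ∧ x * s + Z s ^ p = x + z ^ p ∧ ‖z‖ ≤ 2 * ‖Z s‖ ∧
      HasDerivAt Z (-(x / p) * (Z s / Z s ^ p)) s := by
  have hp0 : p ≠ 0 := by omega
  have hpC : (p : ℂ) ≠ 0 := by exact_mod_cast hp0
  obtain ⟨η, hη, hη2, hmem⟩ := exists_mul_mem_sector (θ := θ) h hδ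
  have h1 : ContinuousAt (fun u : ℂ => (1 + u) ^ ((p : ℂ)⁻¹)) 0 := by
    refine ContinuousAt.cpow (by fun_prop) continuousAt_const ?_
    simp
  -- For large z the path is z times the principal p-th root of a number near 1, so it does not
  -- leave the larger sector.
  obtain ⟨ε, hε, h2⟩ := Metric.continuousAt_iff.1 h1 η hη
  -- The bound 1 gives |z| ≤ |z|^p, so that control of |x|/|z| suffices for |x|/|z|^p.
  refine ⟨max 1 (‖x‖ / min (ε / 2) (1 / 2)), fun z hz hR => ?_⟩
  have hz1 : 1 ≤ ‖z‖ := (le_max_left _ _).trans hR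
  have hzx : ‖x‖ / min (ε / 2) (1 / 2) ≤ ‖z‖ := (le_max_right _ _).trans hR
  have hm : 0 < min (ε / 2) (1 / 2) := by positivity
  rw [div_le_iff₀ hm] at hzx
  have hz0 := hz.1
  have hzp : z ^ p ≠ 0 := pow_ne_zero p hz0
  set f : ℂ → ℂ := fun s => 1 + x * (1 - s) / z ^ p with hf
  have hfs : ∀ s ∈ Set.Icc (0 : ℝ) 1, ‖x * (1 - (s : ℂ)) / z ^ p‖ ≤ min (ε / 2) (1 / 2) := by
    intro s hs
    have h3 : ‖(1 - (s : ℂ))‖ ≤ 1 := by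
      rw [← Complex.ofReal_one, ← Complex.ofReal_sub, Complex.norm_real, Real.norm_eq_abs,
        abs_of_nonneg (by linarith [hs.2])]
      linarith [hs.1]
    rw [norm_div, norm_mul, norm_pow, div_le_iff₀ (by positivity)]
    calc ‖x‖ * ‖1 - (s : ℂ)‖ ≤ ‖x‖ * 1 := by gcongr
      _ ≤ min (ε / 2) (1 / 2) * ‖z‖ := by linarith
      _ ≤ min (ε / 2) (1 / 2) * ‖z‖ ^ p := by
        gcongr
        exact le_self_pow₀ hz1 hp0
  refine ⟨fun s => z * f s ^ ((p : ℂ)⁻¹), by simp [hf], fun s hs => ?_⟩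
  have hu := hfs s hs
  have hslit : f s ∈ Complex.slitPlane := by
    refine Complex.mem_slitPlane_of_norm_lt_one (hu.trans_lt ?_)
    exact (min_le_right _ _).trans_lt (by norm_num)
  have hq : ‖f s ^ ((p : ℂ)⁻¹) - 1‖ ≤ η := by
    have h3 := h2 (x := x * (1 - (s : ℂ)) / z ^ p) (by
      rw [dist_zero_right]
      exact hu.trans_lt ((min_le_left _ _).trans_lt (by linarith)))
    rw [add_zero, Complex.one_cpow, dist_eq_norm] at h3
    exact h3.le
  have hpow : (f s ^ ((p : ℂ)⁻¹)) ^ p = f s := Complex.cpow_nat_inv_pow _ hp0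
  have hf0 := Complex.slitPlane_ne_zero hslit
  have hZp : (z * f s ^ ((p : ℂ)⁻¹)) ^ p = z ^ p + x * (1 - s) := by
    rw [mul_pow, hpow, hf]
    field_simp
  refine ⟨hmem z hz _ hq, ?_, ?_, ?_⟩
  · simp only
    rw [hZp]
    ring
  · simp only
    rw [norm_mul]
    have h3 := norm_sub_norm_le (1 : ℂ) (1 - f s ^ ((p : ℂ)⁻¹))
    rw [sub_sub_cancel, norm_one, norm_sub_rev] at h3
    nlinarith [norm_nonneg z]
  · have h3 : HasDerivAt f (-x / z ^ p) (s : ℂ) := by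
      have h4 := ((((hasDerivAt_id (s : ℂ)).const_sub 1).const_mul x).div_const (z ^ p)).const_add 1
      refine h4.congr_deriv ?_
      ring
    have h5 := ((h3.cpow_const (c := (p : ℂ)⁻¹) hslit).const_mul z).comp_ofReal
    refine h5.congr_deriv ?_
    simp only
    rw [mul_pow, hpow, Complex.cpow_sub _ _ hf0, Complex.cpow_one]
    field_simp

/-- After the shift of the index by m the sums differ only in the top m powers, all divisible by
W^K. -/
theorem sum_shift (b : ℤ → ℂ) (hb : ∀ e < 0, b e = 0) (K m : ℕ) (W : ℂ) :
    ∑ j ∈ Finset.range K, b (j - m) * W ^ j - ∑ i ∈ Finset.range K, b i * W ^ (i + m) =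
      -∑ i ∈ Finset.range m, b (K + i - m) * W ^ (K + i) := by
  have h1 := Finset.sum_range_add (fun j : ℕ => b (j - m) * W ^ j) m K
  have h2 := Finset.sum_range_add (fun j : ℕ => b (j - m) * W ^ j) K m
  have h3 : ∑ j ∈ Finset.range m, b (j - m) * W ^ j = 0 := Finset.sum_eq_zero fun j hj => by
    rw [Finset.mem_range] at hj
    rw [hb _ (by omega), zero_mul]
  rw [add_comm K m, h1, h3, zero_add] at h2
  have h4 : ∀ i : ℕ, b ((m + i : ℕ) - m) * W ^ (m + i) = b i * W ^ (i + m) := fun i => by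
    rw [Nat.cast_add, add_sub_cancel_left, add_comm m i]
  simp only [h4] at h2
  rw [h2]
  push_cast
  ring

theorem norm_sum_shift_le (b : ℤ → ℂ) (hb : ∀ e < 0, b e = 0) (K m : ℕ) {W : ℂ} (hW : ‖W‖ ≤ 1) :
    ‖∑ j ∈ Finset.range K, b (j - m) * W ^ j - ∑ i ∈ Finset.range K, b i * W ^ (i + m)‖ ≤
      (∑ i ∈ Finset.range m, ‖b (K + i - m)‖) * ‖W‖ ^ K := by
  rw [sum_shift b hb, norm_neg, Finset.sum_mul]
  refine (norm_sum_le _ _).trans (Finset.sum_le_sum fun i _ => ?_)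
  rw [norm_mul, norm_pow, pow_add]
  gcongr
  exact mul_le_of_le_one_right (by positivity) (pow_le_one₀ (norm_nonneg _) hW)

variable {p : ℕ} (hp : 2 ≤ p) (N : ℕ) (σ : ℤˣ) (a : ℕ → ℂ) (x : ℂ)

/-- The logarithmic derivative of the wave function along the path, in terms of `W = Z⁻¹`. -/
def pathRate (p N : ℕ) (σ : ℤˣ) (x : ℂ) (s : ℝ) (W : ℂ) : ℂ :=
  sgn ℂ σ * x ^ 2 * s / p * W ^ (p - 1) + x * shiftA p N σ / p * W ^ p

/-- The partial sums of the formal wave function along the path. -/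
def pathSum (p N : ℕ) (σ : ℤˣ) (a : ℕ → ℂ) (x : ℂ) (K : ℕ) (s : ℝ) (W : ℂ) : ℂ :=
  ∑ j ∈ Finset.range K, (wavePoly p N σ a j).eval (x * s) * W ^ j

theorem wavePolyInt_natCast (j : ℕ) : wavePolyInt p N σ a j = wavePoly p N σ a j := by
  rw [wavePolyInt, if_pos (Int.natCast_nonneg j), Int.toNat_natCast]

include hp in
-- For the full formal series the recursion of the wave polynomials is exactly the linear equation
-- along the path. Truncation leaves the boundary terms of the index shifts by p - 1 and p. The
-- constant does not depend on the path, hence not on z.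
theorem exists_bound_pathSum (K : ℕ) : ∃ C : ℝ, 0 ≤ C ∧ ∀ W : ℝ → ℂ, ∀ s ∈ Set.Icc (0 : ℝ) 1,
    ‖W s‖ ≤ 1 → HasDerivAt W (x / p * W s ^ (p + 1)) s →
    ∃ V', HasDerivAt (fun s => pathSum p N σ a x K s (W s)) V' s ∧
      ‖V' - pathRate p N σ x s (W s) * pathSum p N σ a x K s (W s)‖ ≤ C * ‖W s‖ ^ K := by
  set v : ℤ → Polynomial ℂ := wavePolyInt p N σ a with hv
  set μ := shiftA p N σ with hμ
  have hpC : (p : ℂ) ≠ 0 := by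
    have : p ≠ 0 := by omega
    exact_mod_cast this
  have hv0 : ∀ e < 0, v e = 0 := fun e he => by rw [hv, wavePolyInt, if_neg (by omega)]
  -- Norms of the boundary coefficients at time s; continuity bounds them on [0, 1].
  set c : ℝ → ℝ := fun s => ‖sgn ℂ σ * x ^ 2 * s / p‖ *
      (∑ i ∈ Finset.range (p - 1), ‖(v (K + i - (p - 1 : ℕ))).eval (x * s)‖) +
    ‖x / p‖ * ∑ i ∈ Finset.range p, ‖(μ - ((K + i - p : ℤ) : ℂ)) * (v (K + i - p)).eval (x * s)‖
    with hc
  have hcc : Continuous c := by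
    have h1 : ∀ P : Polynomial ℂ, Continuous fun s : ℝ => P.eval (x * s) := fun P =>
      P.continuous.comp (by fun_prop)
    refine ((by fun_prop : Continuous fun s : ℝ => ‖sgn ℂ σ * x ^ 2 * s / p‖).mul
      (continuous_finsetSum _ fun i _ => (h1 _).norm)).add (continuous_const.mul
      (continuous_finsetSum _ fun i _ => (continuous_const.mul (h1 _)).norm))
  obtain ⟨C, hC⟩ := (isCompact_Icc (a := (0 : ℝ)) (b := 1)).bddAbove_image hcc.continuousOn
  refine ⟨max C 0, le_max_right _ _, fun W s hs hW hW' => ?_⟩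
  have hV : ∀ j ∈ Finset.range K, HasDerivAt
      (fun s : ℝ => (wavePoly p N σ a j).eval (x * s) * W s ^ j)
      (x * (v j).derivative.eval (x * s) * W s ^ j + (v j).eval (x * s) *
        (j * (x / p) * W s ^ (j + p))) s := fun j _ => by
    have h1 : HasDerivAt (fun s : ℝ => (v j).eval (x * s)) ((v j).derivative.eval (x * s) * x) s := by
      have h2 := ((v j).hasDerivAt (x * (s : ℂ))).comp (s : ℂ) ((hasDerivAt_id (s : ℂ)).const_mul x)
      simpa using h2.comp_ofReal
    rw [← wavePolyInt_natCast]
    refine (h1.mul (hW'.fun_pow j)).congr_deriv ?_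
    rcases j with _ | j
    · simp
      ring
    · simp only [Nat.add_sub_cancel]
      ring
  refine ⟨_, HasDerivAt.fun_sum hV, ?_⟩
  set U := W s with hU
  have hb1 : ∀ e < 0, (v e).eval (x * s) = 0 := fun e he => by rw [hv0 e he, Polynomial.eval_zero]
  have hb2 : ∀ e : ℤ, e < 0 → (μ - (e : ℂ)) * (v e).eval (x * s) = 0 := fun e he => by
    rw [hb1 e he, mul_zero]
  have h5 := norm_sum_shift_le (fun e => (v e).eval (x * s)) hb1 K (p - 1) hW
  have h6 := norm_sum_shift_le (fun e => (μ - (e : ℂ)) * (v e).eval (x * s)) hb2 K p hW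
  -- The factor j from the derivative of W^j changes the μ of the rate into μ - j, which matches the
  -- coefficient μ - (j - p) of the recursion after a shift by p.
  have h7 : ∑ j ∈ Finset.range K, (x * (v j).derivative.eval (x * s) * U ^ j +
        (v j).eval (x * s) * (j * (x / p) * U ^ (j + p))) -
      pathRate p N σ x s U * pathSum p N σ a x K s U =
      sgn ℂ σ * x ^ 2 * s / p * (∑ j ∈ Finset.range K, (v (j - (p - 1 : ℕ))).eval (x * s) * U ^ j -
        ∑ i ∈ Finset.range K, (v i).eval (x * s) * U ^ (i + (p - 1))) +
      x / p * (∑ j ∈ Finset.range K, (μ - ((j - p : ℤ) : ℂ)) * (v (j - p)).eval (x * s) * U ^ j -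
        ∑ i ∈ Finset.range K, (μ - ((i : ℤ) : ℂ)) * (v i).eval (x * s) * U ^ (i + p)) := by
    rw [pathSum, Finset.mul_sum, ← Finset.sum_sub_distrib, ← Finset.sum_sub_distrib,
      ← Finset.sum_sub_distrib, Finset.mul_sum, Finset.mul_sum, ← Finset.sum_add_distrib]
    refine Finset.sum_congr rfl fun j _ => ?_
    rw [← wavePolyInt_natCast, hv, derivative_wavePolyInt hp, ← hv, pathRate,
      show (j : ℤ) - (p - 1 : ℕ) = j + 1 - p by omega]
    simp only [Polynomial.eval_add, Polynomial.eval_mul, Polynomial.eval_C, Polynomial.eval_X]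
    push_cast
    field_simp
    ring
  have h8 : c s ≤ max C 0 := (hC ⟨s, hs, rfl⟩).trans (le_max_left _ _)
  have h9 : ‖sgn ℂ σ * x ^ 2 * s / p * (∑ j ∈ Finset.range K,
        (v (j - (p - 1 : ℕ))).eval (x * s) * U ^ j -
        ∑ i ∈ Finset.range K, (v i).eval (x * s) * U ^ (i + (p - 1))) +
      x / p * (∑ j ∈ Finset.range K, (μ - ((j - p : ℤ) : ℂ)) * (v (j - p)).eval (x * s) * U ^ j -
        ∑ i ∈ Finset.range K, (μ - ((i : ℤ) : ℂ)) * (v i).eval (x * s) * U ^ (i + p))‖ ≤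
      c s * ‖U‖ ^ K := by
    refine (norm_add_le _ _).trans ?_
    rw [norm_mul, norm_mul]
    refine (add_le_add (mul_le_mul_of_nonneg_left h5 (norm_nonneg _))
      (mul_le_mul_of_nonneg_left h6 (norm_nonneg _))).trans_eq ?_
    rw [hc]
    ring
  rw [h7]
  exact h9.trans (by gcongr)

end Shift

/-! ### The expansion of the wave function for all x -/

section WaveExpansion

variable {p : ℕ} (hp : 2 ≤ p) {N : ℕ} {σ : ℤˣ} {Γ : List (ℝ → ℂ)} {c : ℂ} {θ δ : ℝ}

include hp in
/-- The expansion of the wave function at `x = 0` determines the one at all `x`. -/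
theorem HasAsympExpansion.psiAmp (hδ : δ ≤ Real.pi) {g : ℂ → ℂ} {a : ℕ → ℂ}
    (ha : HasAsympExpansion θ δ (fun z => psiAmp p N σ Γ c θ g 0 z) a) (x : ℂ) :
    HasAsympExpansion θ δ (fun z => Complex.exp (-sgn ℂ σ * x * z) * psiAmp p N σ Γ c θ g x z)
      (fun j => (wavePoly p N σ a j).eval x) := by
  intro δ' h0 h1 K
  have hp0 : p ≠ 0 := by omega
  have hpC : (p : ℂ) ≠ 0 := by exact_mod_cast hp0
  obtain ⟨R₁, hpath⟩ := exists_path (θ := θ) hp (δ' := δ') (δ := (δ' + δ) / 2)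
    (by linarith) (by linarith) x
  obtain ⟨C, hC, hV⟩ := exists_bound_pathSum hp N σ a x K
  obtain ⟨C₀, hC₀, hexp⟩ := (ha ((δ' + δ) / 2) (by linarith) (by linarith) K).exists_pos
  rw [isBigOWith_iff, eventually_cobounded_inf] at hexp
  obtain ⟨R₀, hexp⟩ := hexp
  -- A bound for the rate when |W| ≤ 1; the summand 1 keeps it nonzero, as the closed form of the
  -- Gronwall bound requires.
  set L : ℝ := ‖x ^ 2 / p‖ + ‖x * shiftA p N σ / p‖ + 1 with hL
  have hL1 : 1 ≤ L := by
    rw [hL]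
    linarith [norm_nonneg (x ^ 2 / (p : ℂ)), norm_nonneg (x * shiftA p N σ / p)]
  -- The Gronwall bound at s = 1 with |z|^(-K) taken out; 2^K comes from |z| ≤ 2|Z|.
  refine IsBigO.of_bound (C₀ * 2 ^ K * Real.exp L + C * 2 ^ K / L * (Real.exp L - 1)) ?_
  rw [eventually_cobounded_inf]
  refine ⟨max R₁ (max (2 * R₀) 2), fun z hz hR => ?_⟩
  obtain ⟨Z, hZ1, hZ⟩ := hpath z hz ((le_max_left _ _).trans hR)
  have hR0 : 2 * R₀ ≤ ‖z‖ := ((le_max_left _ _).trans (le_max_right _ _)).trans hR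
  have hR2 : 2 ≤ ‖z‖ := ((le_max_right _ _).trans (le_max_right _ _)).trans hR
  have hz0 : 0 < ‖z‖ := by linarith
  -- As x s + Z^p is constant on the path, the integral enters only through this constant and H is
  -- elementary.
  set κ : ℂ := c * phaseIntegral p σ Γ g (x + z ^ p) with hκ
  set H : ℝ → ℂ := fun s => Complex.exp (-sgn ℂ σ * x * s * Z s) * prefactor p N σ θ (Z s) * κ
    with hH
  set V : ℝ → ℂ := fun s => pathSum p N σ a x K s (Z s)⁻¹ with hVdef
  have hW : ∀ s ∈ Set.Icc (0 : ℝ) 1, ‖(Z s)⁻¹‖ ≤ 2 * ‖z‖⁻¹ := fun s hs => by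
    obtain ⟨h2, -, h3, -⟩ := hZ s hs
    have h4 : 0 < ‖Z s‖ := norm_pos_iff.2 h2.1
    rw [norm_inv, ← div_eq_mul_inv, le_div_iff₀ hz0, inv_mul_le_iff₀ h4, mul_comm]
    exact h3
  have hz2 : 2 * ‖z‖⁻¹ ≤ 1 := by
    rw [← div_eq_mul_inv, div_le_one hz0]
    exact hR2
  have hW1 : ∀ s ∈ Set.Icc (0 : ℝ) 1, ‖(Z s)⁻¹‖ ≤ 1 := fun s hs => (hW s hs).trans hz2
  have hWd : ∀ s ∈ Set.Icc (0 : ℝ) 1,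
      HasDerivAt (fun s => (Z s)⁻¹) (x / p * (Z s)⁻¹ ^ (p + 1)) s := fun s hs => by
    obtain ⟨h2, -, -, h3⟩ := hZ s hs
    have h4 := (hasDerivAt_inv h2.1).scomp s h3
    refine h4.congr_deriv ?_
    have := h2.1
    rw [smul_eq_mul, inv_pow]
    field_simp
    ring
  -- The growing term -σxZ from the exponential cancels against the one from the prefactor; negative
  -- powers of Z remain.
  have hHd : ∀ s ∈ Set.Icc (0 : ℝ) 1, HasDerivAt H (pathRate p N σ x s (Z s)⁻¹ * H s) s := by
    intro s hs
    obtain ⟨h2, -, -, h3⟩ := hZ s hs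
    have hZ0 := h2.1
    have h4 : HasDerivAt (fun s : ℝ => -sgn ℂ σ * x * s * Z s)
        (-sgn ℂ σ * x * Z s + -sgn ℂ σ * x * s * (-(x / p) * (Z s / Z s ^ p))) s := by
      have h5 : HasDerivAt (fun s : ℝ => -sgn ℂ σ * x * (s : ℂ)) (-sgn ℂ σ * x) s := by
        simpa using ((hasDerivAt_id (s : ℂ)).const_mul (-sgn ℂ σ * x)).comp_ofReal
      exact h5.mul h3
    have h6 := (hasDerivAt_prefactor p N σ (δ := (δ' + δ) / 2) (by linarith) h2).scomp s h3
    refine ((h4.cexp.mul h6).mul_const κ).congr_deriv ?_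
    simp only [Function.comp, smul_eq_mul, hH, pathRate]
    have h7 : (Z s)⁻¹ ^ (p - 1) = Z s * (Z s)⁻¹ ^ p := by
      obtain ⟨m, rfl⟩ : ∃ m, p = m + 1 := ⟨p - 1, by omega⟩
      rw [Nat.add_sub_cancel, pow_succ', ← mul_assoc, mul_inv_cancel₀ hZ0, one_mul]
    rw [h7, inv_pow]
    field_simp
    ring
  choose! V' hV'd hV'b using fun s hs => hV (fun s => (Z s)⁻¹) s hs (hW1 s hs) (hWd s hs)
  have hrate : ∀ s ∈ Set.Icc (0 : ℝ) 1, ‖pathRate p N σ x s (Z s)⁻¹‖ ≤ L := fun s hs => by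
    have h2 : ∀ j : ℕ, ‖(Z s)⁻¹ ^ j‖ ≤ 1 := fun j => by
      rw [norm_pow]
      exact pow_le_one₀ (norm_nonneg _) (hW1 s hs)
    have h3 : ‖sgn ℂ σ * x ^ 2 * s / p‖ ≤ ‖x ^ 2 / p‖ := by
      have h4 : ‖sgn ℂ σ‖ = 1 := by
        rcases Int.units_eq_one_or σ with rfl | rfl <;> simp [sgn]
      have h5 : ‖(s : ℂ)‖ ≤ 1 := by
        rw [Complex.norm_real, Real.norm_eq_abs, abs_of_nonneg hs.1]
        exact hs.2
      rw [norm_div, norm_div, norm_mul, norm_mul, h4, one_mul]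
      gcongr
      exact mul_le_of_le_one_right (norm_nonneg _) h5
    have h6 := norm_add_le (sgn ℂ σ * x ^ 2 * s / p * (Z s)⁻¹ ^ (p - 1))
      (x * shiftA p N σ / p * (Z s)⁻¹ ^ p)
    rw [norm_mul, norm_mul (x * shiftA p N σ / p)] at h6
    have h7 := mul_le_of_le_one_right (norm_nonneg (sgn ℂ σ * x ^ 2 * s / p)) (h2 (p - 1))
    have h8 := mul_le_of_le_one_right (norm_nonneg (x * shiftA p N σ / p)) (h2 p)
    rw [pathRate]
    linarith
  have hgd : ∀ s ∈ Set.Icc (0 : ℝ) 1, HasDerivAt (fun s => H s - V s)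
      (pathRate p N σ x s (Z s)⁻¹ * H s - V' s) s := fun s hs => (hHd s hs).sub (hV'd s hs)
  -- At s = 0 the parameter is x = 0, so the given expansion applies at the point Z(0) of the
  -- intermediate sector.
  have hstart : ‖H 0 - V 0‖ ≤ C₀ * (2 ^ K * ‖z‖⁻¹ ^ K) := by
    have hs0 : (0 : ℝ) ∈ Set.Icc (0 : ℝ) 1 := by simp
    obtain ⟨h2, h3, h4, -⟩ := hZ 0 hs0
    have h5 := hexp (Z 0) h2 (by linarith)
    rw [Complex.ofReal_zero, mul_zero, zero_add] at h3
    have h6 : H 0 - V 0 = KVec.psiAmp p N σ Γ c θ g 0 (Z 0) -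
        ∑ j ∈ Finset.range K, a j * (Z 0)⁻¹ ^ j := by
      simp only [hH, hVdef, pathSum, Complex.ofReal_zero, mul_zero, zero_mul, Complex.exp_zero,
        one_mul, eval_wavePoly, KVec.psiAmp, zero_add, h3, hκ]
    rw [h6]
    refine h5.trans ?_
    rw [norm_pow, ← mul_pow]
    gcongr
    exact hW 0 hs0
  -- H solves the linear equation exactly and V up to O(|z|^(-K)); at s = 1 the difference is the
  -- remainder at (x, z).
  have hgron := norm_le_gronwallBound_of_norm_deriv_right_le (f := fun s => H s - V s)
    (f' := fun s => pathRate p N σ x s (Z s)⁻¹ * H s - V' s) (δ := C₀ * (2 ^ K * ‖z‖⁻¹ ^ K))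
    (K := L) (ε := C * (2 ^ K * ‖z‖⁻¹ ^ K)) (a := 0) (b := 1)
    (fun s hs => (hgd s hs).continuousAt.continuousWithinAt)
    (fun s hs => (hgd s (Set.Ico_subset_Icc_self hs)).hasDerivWithinAt) hstart
    (fun s hs => by
      have hs' := Set.Ico_subset_Icc_self hs
      have h2 : pathRate p N σ x s (Z s)⁻¹ * H s - V' s =
          pathRate p N σ x s (Z s)⁻¹ * (H s - V s) -
            (V' s - pathRate p N σ x s (Z s)⁻¹ * V s) := by ring
      rw [h2]
      refine (norm_sub_le _ _).trans (add_le_add ?_ ((hV'b s hs').trans ?_))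
      · rw [norm_mul]
        gcongr
        exact hrate s hs'
      · rw [← mul_pow]
        gcongr
        exact hW s hs') 1 (by simp)
  rw [gronwallBound_of_K_ne_0 (by linarith)] at hgron
  have hend : H 1 - V 1 = Complex.exp (-sgn ℂ σ * x * z) * KVec.psiAmp p N σ Γ c θ g x z -
      ∑ j ∈ Finset.range K, (wavePoly p N σ a j).eval x * z⁻¹ ^ j := by
    simp only [hH, hVdef, pathSum, hZ1, Complex.ofReal_one, mul_one, KVec.psiAmp, hκ]
    ring
  simp only [sub_zero, mul_one] at hgron
  rw [hend] at hgron
  refine hgron.trans (le_of_eq ?_)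
  rw [norm_pow, norm_inv]
  ring

end WaveExpansion

end Analysis

end

end KVec

theorem theorem2p9 {k : ℕ} (p : ℕ) (hp : 2 ≤ p) (w : Fin k → ℝ) (n : Fin k → ℕ)
    -- contours, square roots of `± p / (2 π)`, sectors
    (Γ : ℤˣ → List (ℝ → ℂ)) (hΓ : ∀ σ, IsAdmissible p w n σ (Γ σ))
    (c : ℤˣ → ℂ) (hc : ∀ σ, c σ ^ 2 = sgn ℂ σ * (p : ℂ) / (2 * (Real.pi : ℂ)))
    (θ δ : ℤˣ → ℝ) (hδ : ∀ σ, 0 < δ σ ∧ δ σ ≤ Real.pi)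
    -- the contours are chosen such that `Ψ^±(0,0;z)` expands as `1 + ∑_{j ≥ 1} a_j z^(-j)`
    (a : ℤˣ → ℕ → ℂ) (ha : ∀ σ, a σ 0 = 1)
    (hasymp : ∀ σ, HasAsympExpansion (θ σ) (δ σ)
      (fun z => PsiFun p w n σ (Γ σ) (c σ) (θ σ) 0 z) (a σ))
    -- the subspaces `𝒲^±`
    (W : ℤˣ → Submodule ℂ FLS)
    (hW : ∀ σ, W σ = cyclicSpan (formalA p (∑ i, n i) σ) (seriesF (a σ))) :
    -- the differential equation, for the functions
    (∀ σ, ∀ z ∈ sector (θ σ) (δ σ),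
      odeOp p w n σ (funA p (∑ i, n i) σ) (fun f z => z ^ p * f z)
        (fun z => PsiFun p w n σ (Γ σ) (c σ) (θ σ) 0 z) z = 0) ∧
    -- their expansions are the unique solutions of the form `1 + O(1/z)`
    (∀ σ, ∀ f : FLS,
      (IsMonicOfDegree 0 f ∧
        odeOp p w n σ (formalA p (∑ i, n i) σ) (fun f => monoF p 1 * f) f = 0) ↔
      f = seriesF (a σ)) ∧
    -- `𝒲^±` are points of the Grassmannian, invariant under `A^±`, and `k`-vector `p`-reduced
    (∀ σ, IsGrPoint (W σ) ∧
      (W σ).map (formalA p (∑ i, n i) σ) ≤ W σ ∧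
      IsVectorReducedVia k p (W σ)
        ((W σ).map (Polynomial.aeval (formalA p (∑ i, n i) σ) (polyP w)))) ∧
    -- the KP solution
    (∃ S T : PDO XT, IsKPWaveOperator S T ∧
      -- it corresponds to `𝒲^±`
      (∀ σ, waveSpace (formalWave σ (opAtZero (dressing dX σ S T))) = W σ) ∧
      -- `Ψ^±(x,0;z)` are its wave and adjoint wave function at `t = 0`
      (∃ v : ℤˣ → ℕ → Polynomial ℂ,
        (∀ σ, ∀ j : ℕ, waveCoeff σ (opAtZero (dressing dX σ S T)) j = (v σ j : PowerSeries ℂ)) ∧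
        ∀ σ, ∀ x : ℂ, HasAsympExpansion (θ σ) (δ σ)
          (fun z => Complex.exp (-sgn ℂ σ * x * z) * PsiFun p w n σ (Γ σ) (c σ) (θ σ) x z)
          (fun j => (v σ j).eval x)) ∧
      -- the `p`-th power of the Lax operator at `t = 0`
      (∀ σ, opAtZero (compPow dX (lax dX σ S T) p) = laxPower p w n σ) ∧
      (∀ σ, formalWave σ (comp dX₀ (laxPower p w n σ) (opAtZero (dressing dX σ S T))) =
        PowerSeries.C (monoF p 1) * formalWave σ (opAtZero (dressing dX σ S T))) ∧
      -- its negative part, for all times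
      (∃ q : ℤˣ → Fin k → XT,
        (∀ σ i, atZero (q σ i) =
          PowerSeries.C (-sgn ℂ σ * (Real.sqrt (n i) : ℂ)) * expX (sgn ℂ σ * (w i : ℂ))) ∧
        (∀ σ, negPart (compPow dX (lax dX σ S T) p) =
          ∑ i, comp dX (comp dX (multOp (q σ i)) (signedD XT σ (-1))) (multOp (q (-σ) i))) ∧
        ∀ σ i, ∀ m : ℕ, 1 ≤ m →
          MvPowerSeries.pderiv ℂ m (q σ i) =
            sgn XT σ * applyPos dX (compPow dX (lax dX σ S T) m) (q σ i))) ∧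
    -- the spectral equation for the functions `Ψ^±(x,0;z)`
    (∀ σ, ∀ z ∈ sector (θ σ) (δ σ), ∃ G : Fin k → ℂ → ℂ,
      (∀ i x, HasDerivAt (fun x => Complex.exp (-sgn ℂ σ * x * (w i : ℂ)) * G i x)
        (sgn ℂ σ * (Complex.exp (-sgn ℂ σ * x * (w i : ℂ)) *
          PsiFun p w n σ (Γ σ) (c σ) (θ σ) x z)) x) ∧
      ∀ x, sgn ℂ σ ^ p * iteratedDeriv p (fun x => PsiFun p w n σ (Γ σ) (c σ) (θ σ) x z) x
          - x * PsiFun p w n σ (Γ σ) (c σ) (θ σ) x z - ∑ i, (n i : ℂ) * G i x =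
        z ^ p * PsiFun p w n σ (Γ σ) (c σ) (θ σ) x z) := by
  have hp0 : p ≠ 0 := by omega
  -- All purely formal assertions follow from this equation together with a_0 = 1.
  have hode := fun σ => odeOp_seriesF hp (hΓ σ) (c σ) (hδ σ) (hasymp σ)
  have hode' : ∀ σ, odeEnd p w n σ (formalA p (∑ i, n i) σ) (mulZ p) (seriesF (a σ)) = 0 :=
    fun σ => by
      rw [← odeOp_eq_odeEnd]
      exact hode σ
  obtain ⟨S, T, hKP, -, h0⟩ := exists_solution hp w n ha hode'
  refine ⟨fun σ z hz => odeOp_PsiFun hp (hΓ σ) (c σ) (hδ σ).2 hz, fun σ f => ⟨fun hf => ?_, ?_⟩,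
    fun σ => ?_, ⟨S, T, hKP, fun σ => ?_, ⟨fun σ j => wavePoly p (∑ i, n i) σ (a σ) j,
      fun σ j => ?_, fun σ x => (hasymp σ).psiAmp hp (hδ σ).2 x⟩,
      opAtZero_lax_pow hp hode' hKP h0, formalWave_laxPower hp hode' h0,
      exists_eigenfunctions hp w n ha hode' hKP h0⟩,
    fun σ z _ => spectral_PsiFun hp (hΓ σ) (c σ) z⟩
  · refine formal_solution_unique hp0 w n σ hf.1 (isMonic_seriesF (ha σ)) ?_ (hode' σ)
    rw [← odeOp_eq_odeEnd]
    exact hf.2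
  · rintro rfl
    exact ⟨isMonic_seriesF (ha σ), hode σ⟩
  · rw [hW σ]
    exact ⟨isGrPoint_cyclicSpan hp0 σ _ (isMonic_seriesF (ha σ)), map_cyclicSpan_le hp0 _ _,
      isVectorReducedVia_cyclicSpan hp0 w n σ (isMonic_seriesF (ha σ)) (hode' σ)⟩
  · rw [formalWave_dressing hp h0, waveSpace_expA, hW σ]
  · rw [h0, waveCoeff_waveOp]
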